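/- **Model.** Fix $\theta\in\mathbb R\setminus\{0\}$, $\Omega\in[0,1)$, a mass $m\in\mathbb R$ (with $m\neq0$ if $\Omega=0$), a scale ratio $M>1$, and $2\times2$ complex matrices $\gamma^0,\gamma^1$ with $\gamma^\mu\gamma^\nu+\gamma^\nu\gamma^\mu=-2\delta^{\mu\nu}$. Put $\Theta=\begin{pmatrix}0&-\theta\\ \theta&0\end{pmatrix}$, $x\wedge y=2x\Theta^{-1}y$, $\tilde x=2x\Theta^{-1}$ for positions, $\tilde p=\frac12\Theta p$ for momenta, $\tilde\Omega=2\Omega/\theta$, $\not\! x=\gamma^\mu x_\mu$. The sliced propagator is $C^i(x,y)=\int C(t;x,y)\,dt$ over $t\in(M^{-2i},M^{-2(i-1)}]$ if $i\ge1$ and over $t>1$ if $i=0$, where $$C(t;x,y)=-\frac{\Omega}{\theta\pi}\frac{e^{-tm^2}}{\sinh(2\tilde\Omega t)}\,e^{-\frac{\tilde\Omega}2\coth(2\tilde\Omega t)(x-y)^2+i\Omega x\wedge y}\,\bigl\{i\tilde\Omega\coth(2\tilde\Omega t)(\not\! x-\not\! y)+\Omega(\not\!\tilde x-\not\!\tilde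 y)-m\bigr\}\,e^{-2i\Omega t\,\gamma\Theta^{-1}\gamma}$$ (limit values at $\Omega=0$). **Graphs.** $G$ is a connected orientable graph with $n$ quartic vertices, each with four cyclically ordered positions carrying two fields $\psi$ and two fields $\bar\psi$, the positions at a vertex being paired by equality of their spin indices. The positions carry signs that alternate around each vertex; every line $l$ joins a $+$ position $x_{l+}$ to a $-$ position $x_{l-}$, and a $\psi$ to a $\bar\psi$. There are $N\ge1$ external positions; one of them, of sign $+$, is the root $x_1$. Write $\eta(e)$ for the sign of the external position $x_e$. Choose any spanning tree $\mathcal T$; $\mathcal L$ is the set of the other (loop) lines. Number all positions in the order in which they are met when turning around the tree from the root, the two ends of a tree line being met consecutively when one first goes along it. For lines $l=(i,j)$, $l'=(p,q)$ with $i<j$, $p<q$: $l\subset l'$ means $p<i<j<q$, and $l\ltimes l'$ means $i<p<j<q$. Set $\varepsilon(l)=+1$ (resp. $-1$) if the first end of $l$ is a $-$ (resp. $+$) position, and $\epsilon(l)=+1$ (resp. $-1$) if it carries $\psi$ (resp. $\bar\psi$). Let $u_l=x_{l+}-x_{l-}$ be the short variables, and let the long variables $x_{l+}+x_{l-}$ be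 called $v_l$ for $l\in\mathcal T$ and $w_\ell$ for $\ell\in\mathcal L$. For $l\in\mathcal T$ the branch $b(l)$ is the set of vertices joined to the root through $l$; a tree line $l'\ne l$ is below $l$ if it lies on the tree path from $l$ to the root. **Amplitude.** For a scale attribution $\mu=(i_l)_{l}$, $i_l\in\mathbb N$, Schwartz functions $f_1,\dots,f_N$ on $\mathbb R^2$ and fixed external spins, the amputated amplitude is, omitting powers of $2\pi$, Jacobians and coupling constants, $$A_G^\mu=\int\prod_{e=1}^N dx_e\,f_e(x_e)\,\delta_G\prod_{l\in\mathcal T}du_l\,dv_l\,dp_l\prod_{\ell\in\mathcal L}du_\ell\,dw_\ell\ \Bigl[\prod_l C^{i_l}_l\Bigr]\exp i\Bigl(\sum_\nu\varphi_\nu+\sum_{l\in\mathcal T}p_l\cdot\sum_{\nu\in b(l)}\sum_{j=1}^4\pm x_{\nu_j}\Bigr),$$ where $\delta_G=\delta\bigl(\sum_e\eta(e)x_e+\sum_lu_l\bigr)$, $\varphi_\nu=\sum_{i<j}(-1)^{i+j+1}x_{\nu_i}\wedge x_{\nu_j}$, $\pm$ is the sign of the position, $[\,\cdot\,]$ is the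 product of the propagators (evaluated at the $\psi$ and $\bar\psi$ ends of the lines) summed over the internal spins, and the conditionally convergent integral over the long variables and momenta is the limit $r\to0^+$ of the absolutely convergent integrals with the cut-off $e^{-r(\sum v_l^2+\sum w_\ell^2+\sum p_l^2)}$. **New long variables.** Define $\mathcal V_l$ ($l\in\mathcal T$) and $\mathcal W_\ell$ ($\ell\in\mathcal L$) by (all $\ell'$ being loop lines) $$\varepsilon(l)\mathcal V_l=\tfrac12(1+\epsilon(l)\Omega)\varepsilon(l)v_l+\sum_{\ell'\supset l}\varepsilon(\ell')w_{\ell'}-\tfrac12\tilde p_l-\sum_{l'\in\mathcal T\text{ below }l}\tilde p_{l'},$$ $$\varepsilon(\ell)\mathcal W_\ell=\tfrac12(1+\epsilon(\ell)\Omega)\varepsilon(\ell)w_\ell+\sum_{\ell'\supset\ell}\varepsilon(\ell')w_{\ell'}+\sum_{\ell'\ltimes\ell}\varepsilon(\ell')w_{\ell'}.$$ For a Schwartz function $h$ on $\mathbb R^2$ put $\|h\|_k=\max_{j\le k}\sup_x|x|^j|h(x)|$, and define $\|h^{(p)}\|_k$ in the same way with the $p$-th derivative. **Lemma.** Let the model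 and an integer $k\ge3$ be given. There are $K\in\mathbb R$, a nonnegative Schwartz function $\Xi$, and for every Schwartz function $f$ a nonnegative Schwartz function $g=g[f]$ with $\|g\|_k\le\sup_{0\le p\le2}\|f^{(p)}\|_k$, such that for every $n$ and every graph $G$ with $n$ vertices as above (with its root and tree) the following holds. (i) $G$ has $2n-N/2$ lines. The linear part of the change of variables $(\varepsilon v,\varepsilon w)\to(\varepsilon\mathcal V,\varepsilon\mathcal W)$ is given by a matrix (indexed by the lines) that is triangular when the lines are totally ordered by their first ends, with determinant $2^{-(2n-N/2)}\prod_{l}(1+\epsilon(l)\Omega)\neq0$. For fixed momenta, $(v,w)\mapsto(\mathcal V,\mathcal W)$ is a bijection. (ii) For all $\mu$, $f_1,\dots,f_N$ and external spins, the limit that defines $A_G^\mu$ exists, and with $g_e=g[f_e]$ $$\begin{aligned}|A_G^\mu|\le K^n\int&dx_1\,g_1\Bigl(x_1+\sum_l\varepsilon(l)a_l\Bigr)\,\delta_G\prod_{e=2}^Ndx_e\,g_e(x_e)\prod_{l}da_l\,M^{2i_l}\,\Xi(M^{i_l}a_l)\\ &\prod_{l\in\mathcal T}du_l\,d\mathcal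 V_l\,dp_l\,M^{i_l}e^{-M^{2i_l}(u_l-\varepsilon(l)a_l)^2}\prod_{\mu=0}^1\frac1{1+M^{-2i_l}\mathcal V_{l,\mu}^2}\,\frac1{1+M^{2i_l}p_{l,\mu}^2}\\ &\prod_{\ell\in\mathcal L}du_\ell\,d\mathcal W_\ell\,M^{i_\ell}e^{-M^{2i_\ell}(u_\ell-\varepsilon(\ell)a_\ell)^2}\prod_{\mu=0}^1\frac1{1+M^{-2i_\ell}\mathcal W_{\ell,\mu}^2},\end{aligned}$$ the integral on the right being convergent. -/

import Mathlib

open MeasureTheory Filter Topology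
open scoped SchwartzMap

noncomputable section

namespace MoyalGN

/-- The plane `ℝ²` with its Euclidean norm. -/
abbrev Plane : Type := EuclideanSpace ℝ (Fin 2)

/-- Lebesgue measure (a shortcut for instance search). -/
instance : MeasureSpace Plane := measureSpaceOfInnerProductSpace

/-! ### The model: Moyal structure and propagator -/

/-- Parameters: deformation `θ`, harmonic frequency `Ω`, mass `m`, scale ratio `M`, and the
matrices `γ⁰, γ¹`. -/
structure Model where
  θ : ℝ
  Ω : ℝ
  m : ℝ
  M : ℝ
  γ : Fin 2 → Matrix (Fin 2) (Fin 2) ℂ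

namespace Model

variable (P : Model)

/-- `{γ^μ, γ^ν} = -2 δ^{μν}`. -/
def Clifford : Prop :=
  ∀ μ ν, P.γ μ * P.γ ν + P.γ ν * P.γ μ = if μ = ν then (-2 : ℂ) • 1 else 0

/-- The skew-symmetric matrix `Θ`. -/
def Theta : Matrix (Fin 2) (Fin 2) ℝ := !![0, -P.θ; P.θ, 0]

/-- `x ∧ y = 2 x Θ⁻¹ y`. -/
def wedge (x y : Plane) : ℝ := 2 * (x.ofLp ⬝ᵥ (P.Theta⁻¹).mulVec y.ofLp)

/-- `x̃ = 2 x Θ⁻¹`, so that `x ∧ y = x̃ · y`. -/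
def tilde (x : Plane) : Plane := WithLp.toLp 2 ((2 : ℝ) • Matrix.vecMul x.ofLp P.Theta⁻¹)

/-- `p̃ = ½ Θ p`, for the momenta. -/
def tildeMom (p : Plane) : Plane := WithLp.toLp 2 ((1 / 2 : ℝ) • P.Theta.mulVec p.ofLp)

/-- Feynman slash `γ^μ x_μ`. -/
def slash (x : Plane) : Matrix (Fin 2) (Fin 2) ℂ := ∑ μ, ((x μ : ℝ) : ℂ) • P.γ μ

/-- `γ Θ⁻¹ γ = γ^μ (Θ⁻¹)_{μν} γ^ν`. -/
def gammaThetaGamma : Matrix (Fin 2) (Fin 2) ℂ :=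
  ∑ μ, ∑ ν, ((P.Theta⁻¹ μ ν : ℝ) : ℂ) • (P.γ μ * P.γ ν)

/-- `Ω̃ = 2 Ω / θ`. -/
def Om : ℝ := 2 * P.Ω / P.θ

/-- `sinh (2 Ω̃ t) / (2 Ω̃)`, with its limit value `t` at `Ω = 0`. -/
def sinhOver (t : ℝ) : ℝ :=
  if P.Ω = 0 then t else Real.sinh (2 * P.Om * t) / (2 * P.Om)

/-- `Ω̃ coth (2 Ω̃ t)`, with its limit value `1 / (2 t)` at `Ω = 0`. -/
def omCoth (t : ℝ) : ℝ := Real.cosh (2 * P.Om * t) / (2 * P.sinhOver t)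

/-- `exp (-2 i Ω t γ Θ⁻¹ γ) = cosh (2 Ω̃ t) 1 - i (θ/2) sinh (2 Ω̃ t) γ Θ⁻¹ γ`. -/
def spinFactor (t : ℝ) : Matrix (Fin 2) (Fin 2) ℂ :=
  ((Real.cosh (2 * P.Om * t) : ℝ) : ℂ) • 1
    - (Complex.I * ((P.θ / 2 * Real.sinh (2 * P.Om * t) : ℝ) : ℂ)) • P.gammaThetaGamma

/-- The kernel `C(t; x, y)`; the propagator `(-i∂̸ + Ω x̸̃ + m)⁻¹(x, y)` is its integral over
`t > 0`. The scalar prefactor `Ω / (θ π sinh (2 Ω̃ t))` is `1 / (4 π sinhOver t)`. -/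
def kernel (t : ℝ) (x y : Plane) : Matrix (Fin 2) (Fin 2) ℂ :=
  (-((Real.exp (-t * P.m ^ 2) / (4 * Real.pi * P.sinhOver t) : ℝ) : ℂ)
    * Complex.exp (((-(P.omCoth t / 2) * ‖x - y‖ ^ 2 : ℝ) : ℂ)
        + Complex.I * ((P.Ω * P.wedge x y : ℝ) : ℂ))) •
  (((Complex.I * ((P.omCoth t : ℝ) : ℂ)) • P.slash (x - y)
      + ((P.Ω : ℝ) : ℂ) • P.slash (P.tilde (x - y)) - ((P.m : ℝ) : ℂ) • 1) * P.spinFactor t)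

/-- The range of the parameter `t` in the slice of scale `i`. -/
def slice (i : ℕ) : Set ℝ :=
  if i = 0 then Set.Ioi 1 else Set.Ioc (P.M ^ (-2 * (i : ℤ))) (P.M ^ (-2 * ((i : ℤ) - 1)))

/-- The sliced propagator `C^i(x, y)`; rows are indexed by the spin at the `ψ` end `x`, columns by
the spin at the `ψ̄` end `y`. -/
def prop (i : ℕ) (x y : Plane) : Matrix (Fin 2) (Fin 2) ℂ :=
  Matrix.of fun a b => ∫ t in P.slice i, P.kernel t x y a b

/-- The oscillation of one Moyal vertex, `φ = ∑_{i<j} (-1)^{i+j+1} x_i ∧ x_j`. -/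
def vertexPhase (x : Fin 4 → Plane) : ℝ :=
  ∑ i : Fin 4, ∑ j : Fin 4,
    if i < j then (-1 : ℝ) ^ ((i : ℕ) + (j : ℕ) + 1) * P.wedge (x i) (x j) else 0

end Model

/-! ### Orientable graphs -/

/-- The four positions (in cyclic order) at each of the `n` vertices. -/
abbrev Pos (n : ℕ) : Type := Fin n × Fin 4

/-- A graph with `n` quartic Moyal vertices. `contr` sends a position to the one it is contracted
with; its fixed points are the external positions. Each position carries a field `ψ` (`true`) or
`ψ̄` (`false`), and each vertex carries a pairing of its positions: paired positions have the same
spin index. (The six possible cyclic types of vertices are the six quartic interactions.) -/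
structure FeynmanGraph (n : ℕ) where
  contr : Pos n → Pos n
  contr_contr : ∀ h, contr (contr h) = h
  isPsi : Pos n → Bool
  isPsi_contr : ∀ h, contr h ≠ h → isPsi (contr h) = !isPsi h
  two_psi : ∀ v, (Finset.univ.filter fun j => isPsi (v, j) = true).card = 2
  partner : Fin n → Fin 4 → Fin 4
  partner_partner : ∀ v j, partner v (partner v j) = j
  partner_ne : ∀ v j, partner v j ≠ j

/-- An orientable graph with its orientation: signs alternate around each vertex, and each line
joins a `+` position to a `-` position. -/
structure OrientedGraph (n : ℕ) extends FeynmanGraph n where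
  sign : Pos n → ℤ
  sign_eq : ∀ h, sign h = 1 ∨ sign h = -1
  sign_succ : ∀ v j, sign (v, j + 1) = -sign (v, j)
  sign_contr : ∀ h, contr h ≠ h → sign (contr h) = -sign h

namespace OrientedGraph

variable {n : ℕ} (G : OrientedGraph n)

/-- Internal lines, each represented by its `+` end. -/
abbrev Line : Type := {h : Pos n // G.contr h ≠ h ∧ G.sign h = 1}

/-- External positions. -/
abbrev External : Type := {h : Pos n // G.contr h = h}

/-- The incoming end `l+` of a line. -/
def plus (l : G.Line) : Pos n := l.1

/-- The outcoming end `l-` of a line. -/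
def minus (l : G.Line) : Pos n := G.contr l.1

theorem minus_end {h : Pos n} (hx : ¬G.contr h = h) (hs : ¬G.sign h = 1) :
    G.contr (G.contr h) ≠ G.contr h ∧ G.sign (G.contr h) = 1 := by
  refine ⟨fun e => hx ?_, ?_⟩
  · rw [G.contr_contr] at e
    exact e.symm
  · rw [G.sign_contr h hx]
    rcases G.sign_eq h with h1 | h1
    · exact absurd h1 hs
    · simp [h1]

/-- The graph on the vertices whose edges are the lines in `T`. -/
def lineGraph (T : Finset G.Line) : SimpleGraph (Fin n) :=
  SimpleGraph.fromRel fun v w => ∃ l ∈ T, (G.plus l).1 = v ∧ (G.minus l).1 = w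

/-- The positions in terms of the external variables `x`, the short variables `u_l = x_{l+} - x_{l-}`
and the long variables `v_l = x_{l+} + x_{l-}`. -/
def position (x : G.External → Plane) (u v : G.Line → Plane) (h : Pos n) : Plane :=
  if hx : G.contr h = h then x ⟨h, hx⟩
  else if hs : G.sign h = 1 then (1 / 2 : ℝ) • (v ⟨h, hx, hs⟩ + u ⟨h, hx, hs⟩)
  else (1 / 2 : ℝ) • (v ⟨G.contr h, G.minus_end hx hs⟩ - u ⟨G.contr h, G.minus_end hx hs⟩)

end OrientedGraph

/-- A connected orientable graph with a root position (an external position of sign `+`) and a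
spanning tree. -/
structure RootedGraph (n : ℕ) extends OrientedGraph n where
  root : toOrientedGraph.External
  root_sign : sign root.1 = 1
  tree : Finset toOrientedGraph.Line
  tree_connected : (toOrientedGraph.lineGraph tree).Connected
  tree_card : tree.card + 1 = n

namespace RootedGraph

variable {n : ℕ} (G : RootedGraph n)

/-- `h` is an end of a tree line. -/
def IsTreeEnd (h : Pos n) : Prop := ∃ l ∈ G.tree, h = G.plus l ∨ h = G.minus l

open Classical in
/-- One step of the walk around the tree: cross the line at `h` if it is a tree line, then go to the
next position in cyclic order. -/
def step (h : Pos n) : Pos n :=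
  let h' := if G.IsTreeEnd h then G.contr h else h
  (h'.1, h'.2 + 1)

/-- The time at which the walk around the tree, started at the root position, leaves `h`. -/
def time (h : Pos n) : ℕ := sInf {k | G.step^[k] G.root.1 = h}

open Classical in
/-- The numbers that order the positions as they are met when turning around the tree from the root
position: the two ends of a tree line are met one after the other, when the walk first
goes along this line. (Only the order of these numbers matters.) -/
def num (h : Pos n) : ℕ :=
  if G.IsTreeEnd h ∧ G.time (G.contr h) < G.time h then 2 * G.time (G.contr h) + 1
  else 2 * G.time h

/-- The end of `l` that is met first. -/
def firstEnd (l : G.Line) : Pos n :=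
  if G.num (G.minus l) < G.num (G.plus l) then G.minus l else G.plus l

/-- The number `i` of the first end of `l = (i, j)`, `i < j`. -/
def fst (l : G.Line) : ℕ := min (G.num (G.plus l)) (G.num (G.minus l))

/-- The number `j` of the last end of `l = (i, j)`, `i < j`. -/
def lst (l : G.Line) : ℕ := max (G.num (G.plus l)) (G.num (G.minus l))

/-- `l ⊂ l'`: for `l = (i, j)` and `l' = (p, q)`, `p < i < j < q`. -/
def Below (l l' : G.Line) : Prop := G.fst l' < G.fst l ∧ G.lst l < G.lst l'

/-- `l ⋉ l'`: for `l = (i, j)` and `l' = (p, q)`, `i < p < j < q`. -/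
def Crosses (l l' : G.Line) : Prop :=
  G.fst l < G.fst l' ∧ G.fst l' < G.lst l ∧ G.lst l < G.lst l'

/-- The sign `ε(l)`: `+1` if the first end of `l` is a `-` position, `-1` if it is a `+` one. -/
def veps (l : G.Line) : ℝ := if G.num (G.minus l) < G.num (G.plus l) then 1 else -1

/-- The sign `ϵ(l)`: `+1` if the first end of `l` carries `ψ`, `-1` if it carries `ψ̄`. -/
def eps (l : G.Line) : ℝ := if G.isPsi (G.firstEnd l) = true then 1 else -1

open Classical in
/-- The branch `b(l)` of a tree line: the vertices joined to the root through `l`. -/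
def branch (l : G.Line) : Finset (Fin n) :=
  Finset.univ.filter fun v => ¬(G.lineGraph (G.tree.erase l)).Reachable G.root.1.1 v

/-- The set `𝒫_ν` of tree lines joining the vertex `ν` to the root. -/
def path (v : Fin n) : Finset G.Line := G.tree.filter fun l => v ∈ G.branch l

/-- The vertex `ν_l` just above the tree line `l`. -/
def upper (l : G.Line) : Fin n :=
  if (G.plus l).1 ∈ G.branch l then (G.plus l).1 else (G.minus l).1

/-- External positions other than the root position. -/
abbrev Ext' : Type := {e : G.External // e ≠ G.root}

/-- Integration variables of the amplitude: the external positions other than the root one, the short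
variables `u`, the long variables (`v_l` for tree lines, `w_ℓ` for loop lines), and the branch
momenta `p_l`, `l` in the tree. -/
abbrev Vars : Type :=
  (G.Ext' → Plane) × (G.Line → Plane) × (G.Line → Plane) × ({l // l ∈ G.tree} → Plane)

/-- The external positions: the root one is given by the root delta function
`δ_G (∑_e η(e) x_e + ∑_l u_l)`. -/
def ext (x : G.Ext' → Plane) (u : G.Line → Plane) (e : G.External) : Plane :=
  if he : e = G.root then -(∑ e', (G.sign e'.1.1 : ℝ) • x e' + ∑ l, u l) else x ⟨e, he⟩

/-- The argument `∑_{ν ∈ b(l)} ∑_i ± x_{ν_i}` of the branch delta function. -/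
def branchSum (y : Pos n → Plane) (l : G.Line) : Plane :=
  ∑ v ∈ G.branch l, ∑ j : Fin 4, (G.sign (v, j) : ℝ) • y (v, j)

/-- Spin assignments that respect the vertex pairings and the external spins `s`. -/
def spins (s : G.External → Fin 2) : Finset (Pos n → Fin 2) :=
  Finset.univ.filter fun σ =>
    (∀ v j, σ (v, G.partner v j) = σ (v, j)) ∧ ∀ e : G.External, σ e.1 = s e

/-- The `ψ` end of a line. -/
def psiEnd (l : G.Line) : Pos n := if G.isPsi (G.plus l) = true then G.plus l else G.minus l

variable (P : Model)

/-- The integrand of the amputed amplitude, the branch delta functions being written as integrals over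
`p_l` of `exp (i p_l · …)`. -/
def integrand (i : G.Line → ℕ) (f : G.External → 𝓢(Plane, ℂ)) (s : G.External → Fin 2)
    (z : G.Vars) : ℂ :=
  let x := G.ext z.1 z.2.1
  let y := G.position x z.2.1 z.2.2.1
  (∏ e, f e (x e))
    * (∑ σ ∈ G.spins s, ∏ l, P.prop (i l) (y (G.psiEnd l)) (y (G.contr (G.psiEnd l)))
        (σ (G.psiEnd l)) (σ (G.contr (G.psiEnd l))))
    * Complex.exp (Complex.I * ((∑ v, P.vertexPhase (fun j => y (v, j))
        + ∑ l, inner ℝ (z.2.2.2 l) (G.branchSum y l.1) : ℝ) : ℂ))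

/-- The integrand with a Gaussian cut-off in the long variables and in the momenta. -/
def regIntegrand (i : G.Line → ℕ) (f : G.External → 𝓢(Plane, ℂ)) (s : G.External → Fin 2)
    (r : ℝ) (z : G.Vars) : ℂ :=
  ((Real.exp (-r * (∑ l, ‖z.2.2.1 l‖ ^ 2 + ∑ l, ‖z.2.2.2 l‖ ^ 2)) : ℝ) : ℂ)
    * G.integrand P i f s z

/-- `A` is the value of the amplitude: the integral over the long variables and momenta is only
conditionally convergent, and is the limit of the integrals with a cut-off. -/
def IsAmplitude (i : G.Line → ℕ) (f : G.External → 𝓢(Plane, ℂ)) (s : G.External → Fin 2)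
    (A : ℂ) : Prop :=
  Tendsto (fun r : ℝ => ∫ z : G.Vars, G.regIntegrand P i f s r z) (𝓝[>] 0) (𝓝 A)

/-! ### The new long variables -/

open Classical in
/-- The new long variables: `𝒱_l` for a tree line `l`, given by
`ε(l) 𝒱_l = ½ (1 + ϵ(l) Ω) ε(l) v_l + ∑_{ℓ' ⊃ l} ε(ℓ') w_ℓ' - ½ p̃_l - ∑ p̃_l'`, the last sum being
over the tree lines strictly below `l`, and `𝒲_ℓ` for a loop line `ℓ`, given by
`ε(ℓ) 𝒲_ℓ = ½ (1 + ϵ(ℓ) Ω) ε(ℓ) w_ℓ + ∑_{ℓ' ⊃ ℓ} ε(ℓ') w_ℓ' + ∑_{ℓ' ⋉ ℓ} ε(ℓ') w_ℓ'`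
(sums over loop lines `ℓ'`). -/
def newLong (v : G.Line → Plane) (p : {l // l ∈ G.tree} → Plane) (l : G.Line) : Plane :=
  G.veps l •
    ((1 / 2 * (1 + G.eps l * P.Ω) * G.veps l) • v l
      + ∑ l' ∈ Finset.univ.filter (fun l' => l' ∉ G.tree ∧ G.Below l l'), G.veps l' • v l'
      + if hl : l ∈ G.tree then
          -((1 / 2 : ℝ) • P.tildeMom (p ⟨l, hl⟩))
            - ∑ l' : {l' // l' ∈ G.tree},
                if l'.1 ≠ l ∧ l'.1 ∈ G.path (G.upper l) then P.tildeMom (p l') else 0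
        else
          ∑ l' ∈ Finset.univ.filter (fun l' => l' ∉ G.tree ∧ G.Crosses l' l), G.veps l' • v l')

open Classical in
/-- The matrix of the change of variables `(ε v, ε w) → (ε 𝒱, ε 𝒲)`. -/
def changeMatrix : Matrix G.Line G.Line ℝ :=
  Matrix.of fun l l' =>
    if l' = l then 1 / 2 * (1 + G.eps l * P.Ω)
    else if l' ∉ G.tree ∧ (G.Below l l' ∨ (l ∉ G.tree ∧ G.Crosses l' l)) then 1 else 0

/-! ### The bounding integral -/

/-- Variables of the bounding integral: the auxiliary variables `a_l` and those of the amplitude. -/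
abbrev BoundVars : Type := (G.Line → Plane) × G.Vars

/-- The integrand of the bound, in the variables `(a, x, u, v, p)`. The factor `(det)²` is the
Jacobian of `v ↦ (𝒱, 𝒲)` on `(ℝ²)^{lines}`, i.e. `(det)² dv dw = d𝒱 d𝒲`. -/
def boundIntegrand (i : G.Line → ℕ) (Ξ : 𝓢(Plane, ℝ)) (g : G.External → 𝓢(Plane, ℝ))
    (z : G.BoundVars) : ℝ :=
  let a := z.1
  let x := G.ext z.2.1 z.2.2.1
  let u := z.2.2.1
  let v := z.2.2.2.1
  let p := z.2.2.2.2
  g G.root (x G.root + ∑ l, G.veps l • a l)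
    * (∏ e : G.Ext', g e.1 (x e.1))
    * (∏ l, P.M ^ (2 * i l) * Ξ (P.M ^ i l • a l))
    * (∏ l, P.M ^ i l * Real.exp (-P.M ^ (2 * i l) * ‖u l - G.veps l • a l‖ ^ 2)
        * ∏ μ : Fin 2, 1 / (1 + (P.M ^ (2 * i l))⁻¹ * (G.newLong P v p l μ) ^ 2))
    * (∏ l : {l // l ∈ G.tree}, ∏ μ : Fin 2, 1 / (1 + P.M ^ (2 * i l.1) * (p l μ) ^ 2))
    * (G.changeMatrix P).det ^ 2

/-- The bounding integral. -/
def boundIntegral (i : G.Line → ℕ) (Ξ : 𝓢(Plane, ℝ)) (g : G.External → 𝓢(Plane, ℝ)) : ℝ :=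
  ∫ z : G.BoundVars, G.boundIntegrand P i Ξ g z

end RootedGraph

/-- The norm `sup_{j ≤ k, q ≤ p} sup_x |x|^j ‖D^q f(x)‖`. -/
def weightedNorm {F : Type*} [NormedAddCommGroup F] [NormedSpace ℝ F] (k p : ℕ)
    (f : 𝓢(Plane, F)) : ℝ :=
  (Finset.Iic (k, p)).sup (schwartzSeminormFamily ℝ Plane F) f

end MoyalGN

end

open MeasureTheory Filter Topology
open scoped SchwartzMap

noncomputable section

namespace MoyalGN

/-! ### Merging of cycles -/

section Merge

variable {α : Type*} [Finite α] [DecidableEq α] {f : Equiv.Perm α} {a b : α}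

/-! The long variables are not integrated by parts. Both sides of the bound are evaluated up to
constants to the power n, and both turn out to be the same integral over the external positions
times $M^{-i_l}$ for each tree line and $M^{i_l}$ for each loop line.

Left side. With $\alpha=\tilde\Omega\coth(2\tilde\Omega t)$, half of the Gaussian of each propagator
is kept, with width $\beta=\alpha/2$, and the other half, with the matrix factor, is written as an
absolutely convergent superposition of plane waves in $u_l$. For the root function $f(y-\sum u_l)$,
the translate of f is multiplied by the cut-off $1/(4\cosh\cosh)$ and expanded in Fourier modes. The
inverse of the cut-off is a sum of four real exponentials of $\sum u_l$. These factor over the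
lines, and each propagator absorbs its own by a shift of its weight (`prop_mul_exp`). What is left
in $(u,v,p)$ is an oscillating Gaussian integral with diagonal widths and an antisymmetric phase
matrix S. It is computed exactly: its modulus is at most $(2\pi)^d/|\det(\beta+S)|$, where β
vanishes on v and p, and the determinant only increases with the cut-off, so dominated convergence
gives the limit (`exists_oscillating_limit`).

The core is the lower bound of this determinant (`le_abs_det_phase`). The momenta act as Lagrange
multipliers: they eliminate the $v_l$ of the tree and make the signed positions at each vertex sum
to zero. On such configurations the vertex oscillations add up to the form of a single rosette, in
which positions are ordered by the walk around the tree (`vertexForm_eq_orderMatrix`); the tree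
lines and the root then drop out. For the loop lines, the coupling between short variables and last
ends is triangular with diagonal $-(1+\epsilon\Omega)$, by the same ordering that makes the change
of variables to $\mathcal W$ triangular. Determinants of matrices with positive semidefinite
symmetric part do the rest and give $\beta/4$ for a tree line and a constant times
$\beta/(\beta+2/|\theta|)$ for a loop line. In the slice of scale i the weight of a propagator has
total mass of order $M^i$, and $\beta^{-1}$ gains $M^{-2i}$ on tree lines
(`exists_lineWeight_bound`).

Right side. All factors are nonnegative. After the shift $u_l\to u_l+\varepsilon(l)a_l$ the integral
nearly separates: only the root function still sees $\sum u_l$, and it varies slowly, so it is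
bounded below by its value at $u=0$ times an exponential that the Gaussians in u absorb
(`le_boundIntegral`). For this reason g is a mollified envelope of f and its first two derivatives
(`exists_schwartz_envelope`). Two derivatives are enough because $(1+|q|^2)^{-1}$ is square
integrable in the plane, which bounds the $L^1$ norm of the Fourier modes of the root function.

The combinatorics rests on one fact: the walk around the spanning tree is a single cycle, in which
every branch occupies consecutive numbers. -/

theorem sameCycle_mul_swap (h : ¬f.SameCycle a b) : (f * Equiv.swap a b).SameCycle a b := by
  set g := f * Equiv.swap a b with hg
  have hgb : g b = f a := by simp [hg]
  have hex : ∃ k : ℕ, (f ^ k) (f a) = a := by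
    have h1 : f.SameCycle (f a) a := Equiv.Perm.sameCycle_apply_left.2 (Equiv.Perm.SameCycle.refl f a)
    exact h1.exists_nat_pow_eq
  classical
  -- From `b` the new permutation goes to `f a` and then follows `f`. It feels the swap only at `a`
  -- and `b`: `a` is met only at the end of the cycle, and `b` never, since it lies in another
  -- cycle.
  have key : ∀ j ≤ Nat.find hex, g.SameCycle (f a) ((f ^ j) (f a)) := by
    intro j
    induction j with
    | zero => intro _; exact Equiv.Perm.SameCycle.refl _ _
    | succ j ih =>
      intro hj
      have h1 := ih (by omega)
      have h2 : (f ^ j) (f a) ≠ a := Nat.find_min hex (by omega)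
      have h3 : (f ^ j) (f a) ≠ b := by
        intro h3
        apply h
        rw [← h3]
        exact Equiv.Perm.sameCycle_pow_right.2
          (Equiv.Perm.sameCycle_apply_right.2 (Equiv.Perm.SameCycle.refl f a))
      have h4 : (f ^ (j + 1)) (f a) = g ((f ^ j) (f a)) := by
        rw [pow_succ', Equiv.Perm.mul_apply, hg, Equiv.Perm.mul_apply,
          Equiv.swap_apply_of_ne_of_ne h2 h3]
      rw [h4]
      exact Equiv.Perm.sameCycle_apply_right.2 h1
  have h1 := key _ le_rfl
  rw [Nat.find_spec hex, ← hgb] at h1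
  exact (Equiv.Perm.sameCycle_apply_left.1 h1).symm

/-- The swap merges the two cycles and changes nothing else, so no connection is lost: the step from
`x` to `f x` survives, at `a` and `b` by a detour through the other old cycle. -/
theorem SameCycle.mul_swap (h : ¬f.SameCycle a b) {x y : α} (hxy : f.SameCycle x y) :
    (f * Equiv.swap a b).SameCycle x y := by
  set g := f * Equiv.swap a b with hg
  have hab : g.SameCycle a b := sameCycle_mul_swap h
  have hgb : g b = f a := by simp [hg]
  have hga : g a = f b := by simp [hg]
  have step : ∀ x, g.SameCycle x (f x) := by
    intro x
    by_cases h1 : x = a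
    · subst h1
      rw [← hgb]
      exact Equiv.Perm.sameCycle_apply_right.2 hab
    by_cases h2 : x = b
    · subst h2
      rw [← hga]
      exact Equiv.Perm.sameCycle_apply_right.2 hab.symm
    have : f x = g x := by rw [hg, Equiv.Perm.mul_apply, Equiv.swap_apply_of_ne_of_ne h1 h2]
    rw [this]
    exact Equiv.Perm.sameCycle_apply_right.2 (Equiv.Perm.SameCycle.refl _ _)
  obtain ⟨k, rfl⟩ := hxy.exists_nat_pow_eq
  clear hxy
  induction k with
  | zero => exact Equiv.Perm.SameCycle.refl _ _
  | succ k ih =>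
    rw [pow_succ', Equiv.Perm.mul_apply]
    exact ih.trans (step _)

end Merge

/-! ### Walks around sets of lines -/

namespace OrientedGraph

variable {n : ℕ} (G : OrientedGraph n)

theorem contr_plus (l : G.Line) : G.contr (G.plus l) = G.minus l := rfl

theorem contr_minus (l : G.Line) : G.contr (G.minus l) = G.plus l := G.contr_contr _

theorem sign_plus (l : G.Line) : G.sign (G.plus l) = 1 := l.2.2

theorem sign_minus (l : G.Line) : G.sign (G.minus l) = -1 := by
  rw [← l.2.2]; exact G.sign_contr _ l.2.1

theorem plus_injective : Function.Injective G.plus := Subtype.val_injective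

theorem minus_injective : Function.Injective G.minus := fun a b h => by
  apply G.plus_injective
  rw [← G.contr_minus, ← G.contr_minus, h]

theorem plus_ne_minus (l l' : G.Line) : G.plus l ≠ G.minus l' := fun h => by
  have := G.sign_plus l
  rw [h, G.sign_minus] at this
  omega

theorem contr_plus_ne (l : G.Line) : G.contr (G.plus l) ≠ G.plus l := l.2.1

theorem contr_minus_ne (l : G.Line) : G.contr (G.minus l) ≠ G.minus l := by
  rw [contr_minus]; exact G.plus_ne_minus _ _

theorem exists_line {h : Pos n} (hh : G.contr h ≠ h) : ∃ l : G.Line, h = G.plus l ∨ h = G.minus l := by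
  by_cases hs : G.sign h = 1
  · exact ⟨⟨h, hh, hs⟩, Or.inl rfl⟩
  · exact ⟨⟨G.contr h, G.minus_end hh hs⟩, Or.inr (G.contr_contr h).symm⟩

/-- `h` is an end of a line in `F`. -/
def IsEnd (F : Finset G.Line) (h : Pos n) : Prop := ∃ l ∈ F, h = G.plus l ∨ h = G.minus l

theorem isEnd_plus {F : Finset G.Line} {l : G.Line} : G.IsEnd F (G.plus l) ↔ l ∈ F := by
  refine ⟨?_, fun h => ⟨l, h, Or.inl rfl⟩⟩
  rintro ⟨l', h, h1 | h1⟩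
  · rwa [G.plus_injective h1]
  · exact absurd h1 (G.plus_ne_minus _ _)

theorem isEnd_minus {F : Finset G.Line} {l : G.Line} : G.IsEnd F (G.minus l) ↔ l ∈ F := by
  refine ⟨?_, fun h => ⟨l, h, Or.inr rfl⟩⟩
  rintro ⟨l', h, h1 | h1⟩
  · exact absurd h1.symm (G.plus_ne_minus _ _)
  · rwa [G.minus_injective h1]

theorem isEnd_contr {F : Finset G.Line} {h : Pos n} : G.IsEnd F (G.contr h) ↔ G.IsEnd F h := by
  have key : ∀ h, G.IsEnd F h → G.IsEnd F (G.contr h) := by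
    rintro h ⟨l, hl, rfl | rfl⟩
    · exact ⟨l, hl, Or.inr rfl⟩
    · exact ⟨l, hl, Or.inl (G.contr_minus l)⟩
  refine ⟨fun h1 => ?_, key h⟩
  have := key _ h1
  rwa [G.contr_contr] at this

open Classical in
/-- Cross the line at `h` if it belongs to `F`. -/
def cross (F : Finset G.Line) : Equiv.Perm (Pos n) :=
  Function.Involutive.toPerm (fun h => if G.IsEnd F h then G.contr h else h) (by
    intro h
    by_cases hh : G.IsEnd F h
    · simp [hh, G.isEnd_contr, G.contr_contr]
    · simp [hh])

theorem cross_of_isEnd {F : Finset G.Line} {h : Pos n} (hh : G.IsEnd F h) :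
    G.cross F h = G.contr h := if_pos hh

theorem cross_of_not_isEnd {F : Finset G.Line} {h : Pos n} (hh : ¬G.IsEnd F h) :
    G.cross F h = h := if_neg hh

/-- Next position in cyclic order. -/
def rot (n : ℕ) : Equiv.Perm (Pos n) := Equiv.prodCongr (Equiv.refl _) (Equiv.addRight 1)

/-- One step of the walk around the lines in `F`. -/
def walk (F : Finset G.Line) : Equiv.Perm (Pos n) := rot n * G.cross F

theorem walk_apply (F : Finset G.Line) (h : Pos n) :
    G.walk F h = ((G.cross F h).1, (G.cross F h).2 + 1) := rfl

open Classical in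
-- Adding a line composes the walk with one transposition of its ends, which reduces the induction
-- on a forest to the merging of two cycles.
theorem cross_insert {F : Finset G.Line} {l : G.Line} (hl : l ∉ F) :
    G.cross (insert l F) = G.cross F * Equiv.swap (G.plus l) (G.minus l) := by
  ext1 h
  rw [Equiv.Perm.mul_apply]
  by_cases h1 : h = G.plus l
  · subst h1
    rw [Equiv.swap_apply_left, G.cross_of_isEnd (G.isEnd_plus.2 (Finset.mem_insert_self _ _)),
      G.cross_of_not_isEnd (fun h => hl (G.isEnd_minus.1 h)), G.contr_plus]
  by_cases h2 : h = G.minus l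
  · subst h2
    rw [Equiv.swap_apply_right, G.cross_of_isEnd (G.isEnd_minus.2 (Finset.mem_insert_self _ _)),
      G.cross_of_not_isEnd (fun h => hl (G.isEnd_plus.1 h)), G.contr_minus]
  rw [Equiv.swap_apply_of_ne_of_ne h1 h2]
  have h3 : G.IsEnd (insert l F) h ↔ G.IsEnd F h := by
    constructor
    · rintro ⟨l', hl', h'⟩
      rcases Finset.mem_insert.1 hl' with rfl | hl'
      · tauto
      · exact ⟨l', hl', h'⟩
    · rintro ⟨l', hl', h'⟩
      exact ⟨l', Finset.mem_insert_of_mem hl', h'⟩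
  by_cases h4 : G.IsEnd F h
  · rw [G.cross_of_isEnd h4, G.cross_of_isEnd (h3.2 h4)]
  · rw [G.cross_of_not_isEnd h4, G.cross_of_not_isEnd (fun h => h4 (h3.1 h))]

/-! ### Reachability -/

theorem reachable_ends {F : Finset G.Line} {l : G.Line} (hl : l ∈ F) :
    (G.lineGraph F).Reachable (G.plus l).1 (G.minus l).1 := by
  by_cases h : (G.plus l).1 = (G.minus l).1
  · rw [h]
  · exact SimpleGraph.Adj.reachable
      ((SimpleGraph.fromRel_adj _ _ _).2 ⟨h, Or.inl ⟨l, hl, rfl, rfl⟩⟩)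

/-- Reachability is the smallest equivalence relation that identifies the two ends of each line. In
this form invariants are propagated along the tree without handling paths. -/
theorem reachable_rec {F : Finset G.Line} (R : Fin n → Fin n → Prop) (hR : Equivalence R)
    (h : ∀ l ∈ F, R (G.plus l).1 (G.minus l).1) {v w : Fin n}
    (hvw : (G.lineGraph F).Reachable v w) : R v w := by
  obtain ⟨p⟩ := hvw
  induction p with
  | nil => exact hR.refl _
  | cons hadj _ ih =>
    refine hR.trans ?_ ih
    obtain ⟨-, ⟨l, hl, rfl, rfl⟩ | ⟨l, hl, rfl, rfl⟩⟩ := (SimpleGraph.fromRel_adj _ _ _).1 hadj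
    · exact h l hl
    · exact hR.symm (h l hl)

theorem reachable_mono {F F' : Finset G.Line} (hF : F ⊆ F') {v w : Fin n}
    (h : (G.lineGraph F).Reachable v w) : (G.lineGraph F').Reachable v w :=
  G.reachable_rec _ (G.lineGraph F').reachable_is_equivalence
    (fun _ hl => G.reachable_ends (hF hl)) h

theorem reachable_of_sameCycle {F : Finset G.Line} {h h' : Pos n}
    (hc : (G.walk F).SameCycle h h') : (G.lineGraph F).Reachable h.1 h'.1 := by
  obtain ⟨k, rfl⟩ := hc.exists_nat_pow_eq
  clear hc
  induction k with
  | zero => exact SimpleGraph.Reachable.refl _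
  | succ k ih =>
    rw [pow_succ', Equiv.Perm.mul_apply]
    refine ih.trans ?_
    generalize (G.walk F ^ k) h = g
    rw [walk_apply]
    by_cases hg : G.IsEnd F g
    · rw [G.cross_of_isEnd hg]
      obtain ⟨l, hl, rfl | rfl⟩ := hg
      · exact G.reachable_ends hl
      · rw [G.contr_minus]
        exact (G.reachable_ends hl).symm
    · rw [G.cross_of_not_isEnd hg]

open Classical in
/-- The cycles of the walk around a forest are its connected components. -/
theorem sameCycle_walk (F : Finset G.Line)
    (hF : ∀ l ∈ F, ¬(G.lineGraph (F.erase l)).Reachable (G.plus l).1 (G.minus l).1)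
    {h h' : Pos n} (hr : (G.lineGraph F).Reachable h.1 h'.1) : (G.walk F).SameCycle h h' := by
  induction F using Finset.induction_on generalizing h h' with
  | empty =>
    have h1 : h.1 = h'.1 :=
      G.reachable_rec (fun v w => v = w) eq_equivalence (by simp) hr
    have h2 : ∀ g : Pos n, G.walk ∅ g = (g.1, g.2 + 1) := by
      intro g
      rw [walk_apply, G.cross_of_not_isEnd]
      rintro ⟨l, hl, -⟩
      simp at hl
    have h3 : ∀ (k : ℕ) (g : Pos n), (G.walk ∅ ^ k) g = (g.1, g.2 + k • (1 : Fin 4)) := by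
      intro k g
      induction k with
      | zero => simp
      | succ k ih =>
        rw [pow_succ', Equiv.Perm.mul_apply, ih, h2]
        rw [succ_nsmul, add_assoc]
    have h4 : ∀ a b : Fin 4, a + ((b - a : Fin 4) : ℕ) • (1 : Fin 4) = b := by decide
    refine ⟨((h'.2 - h.2 : Fin 4) : ℕ), ?_⟩
    rw [zpow_natCast, h3]
    exact Prod.ext h1 (h4 _ _)
  | insert l F hl ih =>
    have hF' : ∀ l' ∈ F, ¬(G.lineGraph (F.erase l')).Reachable (G.plus l').1 (G.minus l').1 :=
      fun l' hl' hh => hF l' (Finset.mem_insert_of_mem hl')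
        (G.reachable_mono (Finset.erase_subset_erase _ (Finset.subset_insert _ _)) hh)
    have hw : G.walk (insert l F) = G.walk F * Equiv.swap (G.plus l) (G.minus l) := by
      rw [walk, walk, G.cross_insert hl, mul_assoc]
    -- In a forest the two ends of the new line are in different components of the other lines,
    -- hence in different cycles of their walk: the swap merges cycles and never splits one.
    have hnc : ¬(G.walk F).SameCycle (G.plus l) (G.minus l) := by
      intro hc
      have := hF l (Finset.mem_insert_self _ _)
      rw [Finset.erase_insert hl] at this
      exact this (G.reachable_of_sameCycle hc)
    have h1 : ∀ {x y : Pos n}, (G.lineGraph F).Reachable x.1 y.1 →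
        (G.walk (insert l F)).SameCycle x y := by
      intro x y hxy
      rw [hw]
      exact SameCycle.mul_swap hnc (ih hF' hxy)
    have h2 : (G.walk (insert l F)).SameCycle (G.plus l) (G.minus l) := by
      rw [hw]; exact sameCycle_mul_swap hnc
    have h3 := G.reachable_rec
      (fun v w => ∀ i j, (G.walk (insert l F)).SameCycle (v, i) (w, j))
      ⟨fun v i j => h1 (SimpleGraph.Reachable.refl _), fun h i j => (h j i).symm,
        fun h k i j => (h i 0).trans (k 0 j)⟩ ?_ hr
    · exact h3 h.2 h'.2
    · intro l' hl' i j
      rcases Finset.mem_insert.1 hl' with rfl | hl'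
      · exact (h1 (x := ((G.plus l').1, i)) (y := G.plus l') (SimpleGraph.Reachable.refl _)).trans
          (h2.trans (h1 (x := G.minus l') (y := ((G.minus l').1, j))
            (SimpleGraph.Reachable.refl _)))
      · exact h1 (G.reachable_ends hl')

end OrientedGraph

/-! ### The walk around the spanning tree, branches, and the numbering -/

namespace RootedGraph

variable {n : ℕ} (G : RootedGraph n)

theorem walk_tree (h : Pos n) : G.walk G.tree h = G.step h := by
  rw [OrientedGraph.walk_apply, step]
  by_cases hh : G.IsTreeEnd h
  · rw [G.cross_of_isEnd hh]; simp [hh]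
  · rw [G.cross_of_not_isEnd hh]; simp [hh]

/-- The tree without the line `l`. -/
abbrev cut (l : G.Line) : SimpleGraph (Fin n) := by
  classical exact G.lineGraph (G.tree.erase l)

theorem card_le_of_connected {F : Finset G.Line} (h : (G.lineGraph F).Connected) :
    n ≤ F.card + 1 := by
  classical
  have h1 := h.card_vert_le_card_edgeSet_add_one
  have h2 : (G.lineGraph F).edgeSet ⊆ ((F.image fun l => s((G.plus l).1, (G.minus l).1) :
      Finset (Sym2 (Fin n))) : Set (Sym2 (Fin n))) := by
    intro e
    induction e using Sym2.ind with
    | _ v w =>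
      intro he
      obtain ⟨-, ⟨l, hl, rfl, rfl⟩ | ⟨l, hl, rfl, rfl⟩⟩ := (SimpleGraph.fromRel_adj _ _ _).1
        ((SimpleGraph.mem_edgeSet _).1 he)
      · exact Finset.mem_coe.2 (Finset.mem_image.2 ⟨l, hl, rfl⟩)
      · exact Finset.mem_coe.2 (Finset.mem_image.2 ⟨l, hl, Sym2.eq_swap⟩)
  have h3 := Set.ncard_le_ncard h2 (Finset.finite_toSet _)
  rw [Set.ncard_coe_finset] at h3
  have h4 : (F.image fun l => s((G.plus l).1, (G.minus l).1)).card ≤ F.card := Finset.card_image_le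
  rw [← Nat.card_coe_set_eq] at h3
  rw [Nat.card_fin] at h1
  omega

/-- Otherwise the tree without `l` would still connect the n vertices, with only n − 2 lines. -/
theorem not_reachable_cut {l : G.Line} (hl : l ∈ G.tree) :
    ¬(G.cut l).Reachable (G.plus l).1 (G.minus l).1 := by
  classical
  intro hr
  have hc : (G.lineGraph (G.tree.erase l)).Connected := by
    have : Nonempty (Fin n) := ⟨G.root.1.1⟩
    refine SimpleGraph.Connected.mk fun v w => ?_
    refine G.reachable_rec _ (G.cut l).reachable_is_equivalence (fun l' hl' => ?_)
      (G.tree_connected.preconnected v w)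
    by_cases h : l' = l
    · rw [h]; convert hr
    · exact G.reachable_ends (Finset.mem_erase.2 ⟨h, hl'⟩)
  have h1 := G.card_le_of_connected hc
  have h2 := Finset.card_erase_of_mem hl
  have h3 := G.tree_card
  have h4 := Finset.card_pos.2 ⟨l, hl⟩
  omega

/-- A tree is connected and each of its lines separates, so its walk is one cycle through all
positions. Hence `time` is an infimum over a nonempty set for every position. -/
theorem sameCycle (h h' : Pos n) : (G.walk G.tree).SameCycle h h' := by
  classical
  refine G.sameCycle_walk G.tree (fun l hl => ?_) (G.tree_connected.preconnected _ _)
  convert G.not_reachable_cut hl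

theorem exists_step (h : Pos n) : ∃ k, G.step^[k] G.root.1 = h := by
  obtain ⟨k, hk⟩ := (G.sameCycle G.root.1 h).exists_nat_pow_eq
  refine ⟨k, ?_⟩
  rw [← hk, Equiv.Perm.coe_pow]
  congr 1

theorem step_time (h : Pos n) : G.step^[G.time h] G.root.1 = h := Nat.sInf_mem (G.exists_step h)

theorem time_le {h : Pos n} {k : ℕ} (hk : G.step^[k] G.root.1 = h) : G.time h ≤ k := Nat.sInf_le hk

theorem time_injective : Function.Injective G.time := fun h h' e => by
  rw [← G.step_time h, ← G.step_time h', e]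

theorem time_root : G.time G.root.1 = 0 := Nat.le_zero.1 (G.time_le rfl)

/-- Up to the time of `g` the walk only visits new positions: a repetition would be a shortcut, by
which `g` would be reached earlier. -/
theorem time_iterate {g : Pos n} {k : ℕ} (hk : k ≤ G.time g) :
    G.time (G.step^[k] G.root.1) = k := by
  refine le_antisymm (G.time_le rfl) ?_
  by_contra! hlt
  have h1 := G.step_time (G.step^[k] G.root.1)
  have h2 : G.step^[G.time g - k + G.time (G.step^[k] G.root.1)] G.root.1 = g := by
    rw [Function.iterate_add_apply, h1, ← Function.iterate_add_apply, Nat.sub_add_cancel hk,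
      G.step_time]
  have := G.time_le h2
  omega

/-- Unless the walk is over, the next position is left one unit of time later. -/
theorem time_step (h : Pos n) : G.time (G.step h) = G.time h + 1 ∨ G.step h = G.root.1 := by
  by_cases hlt : G.time h < G.time (G.step h)
  · left
    have h1 : G.step^[G.time h + 1] G.root.1 = G.step h := by
      rw [Function.iterate_succ_apply', G.step_time]
    have := G.time_le h1
    omega
  · right
    by_contra hne
    have hpos : G.time (G.step h) ≠ 0 := by
      intro h0
      apply hne
      rw [← G.step_time (G.step h), h0]
      rfl
    obtain ⟨k, hk⟩ := Nat.exists_eq_succ_of_ne_zero hpos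
    have h1 := G.step_time (G.step h)
    rw [hk, Function.iterate_succ_apply'] at h1
    have h2 : G.step^[k] G.root.1 = h := by
      rw [← G.walk_tree, ← G.walk_tree] at h1
      exact (G.walk G.tree).injective h1
    have := G.time_le h2
    omega

/-! ### Branches -/

theorem mem_branch {l : G.Line} {v : Fin n} :
    v ∈ G.branch l ↔ ¬(G.cut l).Reachable G.root.1.1 v := by
  classical
  simp only [branch, Finset.mem_filter, Finset.mem_univ, true_and]

theorem root_not_mem_branch (l : G.Line) : G.root.1.1 ∉ G.branch l := fun h =>
  G.mem_branch.1 h (SimpleGraph.Reachable.refl _)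

theorem mem_branch_congr {l : G.Line} {v w : Fin n} (h : (G.cut l).Reachable v w) :
    v ∈ G.branch l ↔ w ∈ G.branch l := by
  rw [mem_branch, mem_branch, not_iff_not]
  exact ⟨fun h1 => h1.trans h, fun h1 => h1.trans h.symm⟩

theorem branch_ends_of_ne {l l' : G.Line} (hl' : l' ∈ G.tree) (h : l' ≠ l) :
    (G.plus l').1 ∈ G.branch l ↔ (G.minus l').1 ∈ G.branch l := by
  classical
  apply G.mem_branch_congr
  exact G.reachable_ends (Finset.mem_erase.2 ⟨h, hl'⟩)

/-- If both ends were in the branch, crossing any tree line would preserve membership and the root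
itself would be in the branch; if neither were, both ends would be connected to the root without
`l`. -/
theorem branch_ends {l : G.Line} (hl : l ∈ G.tree) :
    (G.plus l).1 ∈ G.branch l ↔ (G.minus l).1 ∉ G.branch l := by
  constructor
  · intro h1 h2
    have key : (G.plus l).1 ∉ G.branch l := by
      have := G.reachable_rec (F := G.tree)
        (fun v w => v ∈ G.branch l ↔ w ∈ G.branch l)
        ⟨fun _ => Iff.rfl, fun h => h.symm, fun h h' => h.trans h'⟩
        (fun l' hl' => by
          by_cases h : l' = l
          · rw [h]; exact iff_of_true h1 h2
          · exact G.branch_ends_of_ne hl' h)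
        (G.tree_connected.preconnected G.root.1.1 (G.plus l).1)
      rw [← this]
      exact G.root_not_mem_branch l
    exact key h1
  · intro h2
    by_contra h1
    rw [mem_branch, not_not] at h1 h2
    exact G.not_reachable_cut hl (h1.symm.trans h2)

/-- The end of the tree line `l` in the branch of `l`. -/
def inEnd (l : G.Line) : Pos n := if (G.plus l).1 ∈ G.branch l then G.plus l else G.minus l

/-- The end of the tree line `l` on the side of the root. -/
def outEnd (l : G.Line) : Pos n := if (G.plus l).1 ∈ G.branch l then G.minus l else G.plus l

variable {G}

theorem inEnd_mem {l : G.Line} (hl : l ∈ G.tree) : (G.inEnd l).1 ∈ G.branch l := by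
  rw [inEnd]
  split_ifs with h
  · exact h
  · by_contra h'
    exact h ((G.branch_ends hl).2 h')

theorem outEnd_not_mem {l : G.Line} (hl : l ∈ G.tree) : (G.outEnd l).1 ∉ G.branch l := by
  rw [outEnd]
  split_ifs with h
  · exact (G.branch_ends hl).1 h
  · exact h

theorem contr_inEnd (l : G.Line) : G.contr (G.inEnd l) = G.outEnd l := by
  rw [inEnd, outEnd]
  split_ifs
  · rfl
  · exact G.contr_minus l

theorem contr_outEnd (l : G.Line) : G.contr (G.outEnd l) = G.inEnd l := by
  rw [← contr_inEnd, G.contr_contr]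

theorem isTreeEnd_inEnd {l : G.Line} (hl : l ∈ G.tree) : G.IsTreeEnd (G.inEnd l) := by
  refine ⟨l, hl, ?_⟩
  rw [inEnd]
  split_ifs <;> simp

theorem isTreeEnd_outEnd {l : G.Line} (hl : l ∈ G.tree) : G.IsTreeEnd (G.outEnd l) := by
  refine ⟨l, hl, ?_⟩
  rw [outEnd]
  split_ifs <;> simp

theorem IsTreeEnd.exists {h : Pos n} (hh : G.IsTreeEnd h) :
    ∃ l ∈ G.tree, h = G.inEnd l ∨ h = G.outEnd l := by
  obtain ⟨l, hl, h1⟩ := hh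
  refine ⟨l, hl, ?_⟩
  rw [inEnd, outEnd]
  split_ifs <;> tauto

theorem step_of_isTreeEnd {h : Pos n} (hh : G.IsTreeEnd h) :
    G.step h = ((G.contr h).1, (G.contr h).2 + 1) := by
  simp [step, hh]

theorem step_of_not_isTreeEnd {h : Pos n} (hh : ¬G.IsTreeEnd h) : G.step h = (h.1, h.2 + 1) := by
  simp [step, hh]

theorem step_mem_branch {l : G.Line} {h : Pos n} (h1 : h ≠ G.inEnd l) (h2 : h ≠ G.outEnd l) :
    (G.step h).1 ∈ G.branch l ↔ h.1 ∈ G.branch l := by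
  by_cases hh : G.IsTreeEnd h
  · rw [step_of_isTreeEnd hh]
    obtain ⟨l', hl', h3⟩ := hh
    have hne : l' ≠ l := by
      rintro rfl
      rw [inEnd] at h1
      rw [outEnd] at h2
      split_ifs at h1 h2 <;> tauto
    rcases h3 with rfl | rfl
    · exact (G.branch_ends_of_ne hl' hne).symm
    · rw [G.contr_minus]; exact G.branch_ends_of_ne hl' hne
  · rw [step_of_not_isTreeEnd hh]

/-- The walk enters a branch once and leaves it once. -/
theorem iterate_mem_branch {l : G.Line} (hl : l ∈ G.tree) {g : Pos n} {k : ℕ} (hk : k ≤ G.time g) :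
    (G.step^[k] G.root.1).1 ∈ G.branch l ↔ G.time (G.outEnd l) < k ∧ k ≤ G.time (G.inEnd l) := by
  induction k using Nat.strong_induction_on with
  | _ k ih =>
  rcases Nat.eq_zero_or_pos k with rfl | hpos
  · simp [G.root_not_mem_branch l]
  obtain ⟨k, rfl⟩ := Nat.exists_eq_succ_of_ne_zero hpos.ne'
  have ht := G.time_iterate (show k ≤ G.time g by omega)
  rw [Nat.succ_eq_add_one, Function.iterate_succ_apply']
  have ihk := ih k (by omega) (by omega)
  generalize hx : G.step^[k] G.root.1 = x at ht ihk ⊢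
  -- Membership in the branch changes only when `l` is crossed. Leaving `outEnd` leads in, leaving
  -- `inEnd` leads out, and every other step stays on its side.
  by_cases h1 : x = G.outEnd l
  · subst h1
    have h2 : (G.step (G.outEnd l)).1 ∈ G.branch l := by
      rw [step_of_isTreeEnd (isTreeEnd_outEnd hl), contr_outEnd]
      exact inEnd_mem hl
    refine iff_of_true h2 ⟨by omega, ?_⟩
    by_contra hlt
    have h3 := ih (G.time (G.inEnd l)) (by omega) (by omega)
    rw [G.step_time] at h3
    have := (h3.1 (inEnd_mem hl)).1
    have h4 : G.time (G.inEnd l) ≠ G.time (G.outEnd l) := fun h => by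
      have h5 := inEnd_mem hl
      rw [G.time_injective h] at h5
      exact outEnd_not_mem hl h5
    omega
  by_cases h2 : x = G.inEnd l
  · subst h2
    refine iff_of_false ?_ (by omega)
    rw [step_of_isTreeEnd (isTreeEnd_inEnd hl), contr_inEnd]
    exact outEnd_not_mem hl
  rw [step_mem_branch h2 h1, ihk]
  have h3 : k ≠ G.time (G.outEnd l) := fun h => h1 (G.time_injective (ht.trans h))
  have h4 : k ≠ G.time (G.inEnd l) := fun h => h2 (G.time_injective (ht.trans h))
  omega

/-- A branch is an interval of times. It is open on the left, since the position left at that time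
is still outside, and closed on the right, since `inEnd` is the last position left from inside. -/
theorem mem_branch_iff {l : G.Line} (hl : l ∈ G.tree) (g : Pos n) :
    g.1 ∈ G.branch l ↔ G.time (G.outEnd l) < G.time g ∧ G.time g ≤ G.time (G.inEnd l) := by
  rw [← iterate_mem_branch hl le_rfl, G.step_time]

theorem time_outEnd_lt {l : G.Line} (hl : l ∈ G.tree) :
    G.time (G.outEnd l) < G.time (G.inEnd l) :=
  ((mem_branch_iff hl _).1 (inEnd_mem hl)).1

/-! ### Numbers of the positions -/

theorem num_inEnd {l : G.Line} (hl : l ∈ G.tree) :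
    G.num (G.inEnd l) = 2 * G.time (G.outEnd l) + 1 := by
  rw [num, if_pos ⟨isTreeEnd_inEnd hl, by rw [contr_inEnd]; exact time_outEnd_lt hl⟩, contr_inEnd]

theorem num_of_ne_inEnd {h : Pos n} (hh : ∀ l ∈ G.tree, h ≠ G.inEnd l) :
    G.num h = 2 * G.time h := by
  rw [num, if_neg]
  rintro ⟨h1, h2⟩
  obtain ⟨l, hl, rfl | rfl⟩ := h1.exists
  · exact hh l hl rfl
  · rw [contr_outEnd] at h2
    exact absurd h2 (time_outEnd_lt hl).not_gt

theorem outEnd_ne_inEnd {l l' : G.Line} (hl : l ∈ G.tree) (hl' : l' ∈ G.tree) :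
    G.outEnd l ≠ G.inEnd l' := by
  intro h
  have h1 := congrArg G.contr h
  rw [contr_outEnd, contr_inEnd] at h1
  have h2 := time_outEnd_lt hl
  have h3 := time_outEnd_lt hl'
  rw [h1, h] at h2
  omega

theorem num_outEnd {l : G.Line} (hl : l ∈ G.tree) :
    G.num (G.outEnd l) = 2 * G.time (G.outEnd l) :=
  num_of_ne_inEnd fun _ hl' => outEnd_ne_inEnd hl hl'

/-- Odd numbers belong to the inner ends of tree lines, even numbers to all other positions; within
each class the number determines a time. -/
theorem num_injective : Function.Injective G.num := by
  intro h h' e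
  by_cases h1 : ∃ l ∈ G.tree, h = G.inEnd l
  · obtain ⟨l, hl, rfl⟩ := h1
    by_cases h2 : ∃ l ∈ G.tree, h' = G.inEnd l
    · obtain ⟨l', hl', rfl⟩ := h2
      rw [num_inEnd hl, num_inEnd hl'] at e
      have := G.time_injective (show G.time (G.outEnd l) = G.time (G.outEnd l') by omega)
      rw [← contr_outEnd, ← contr_outEnd, this]
    · push Not at h2
      rw [num_inEnd hl, num_of_ne_inEnd h2] at e
      omega
  · push Not at h1
    by_cases h2 : ∃ l ∈ G.tree, h' = G.inEnd l
    · obtain ⟨l', hl', rfl⟩ := h2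
      rw [num_inEnd hl', num_of_ne_inEnd h1] at e
      omega
    · push Not at h2
      rw [num_of_ne_inEnd h1, num_of_ne_inEnd h2] at e
      exact G.time_injective (by omega)

theorem num_root : G.num G.root.1 = 0 := by
  rw [num_of_ne_inEnd, G.time_root]
  rintro l hl h
  have := inEnd_mem hl
  rw [← h] at this
  exact G.root_not_mem_branch l this

/-- The two ends of a tree line are consecutive. -/
theorem num_tree_consecutive {l : G.Line} (hl : l ∈ G.tree) {h : Pos n} (h1 : h ≠ G.plus l)
    (h2 : h ≠ G.minus l) : (G.num (G.plus l) < G.num h ↔ G.num (G.minus l) < G.num h) ∧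
      (G.num h < G.num (G.plus l) ↔ G.num h < G.num (G.minus l)) := by
  have h3 : G.num h ≠ G.num (G.plus l) := fun h => h1 (num_injective h)
  have h4 : G.num h ≠ G.num (G.minus l) := fun h => h2 (num_injective h)
  have h5 := num_inEnd hl
  have h6 := num_outEnd hl
  rw [inEnd] at h5
  rw [outEnd] at h5 h6
  split_ifs at h5 h6 <;> omega

/-- The positions of a branch are numbered consecutively. -/
theorem num_branch {l : G.Line} (hl : l ∈ G.tree) {g : Pos n} (hg : g.1 ∉ G.branch l) :
    (∀ h : Pos n, h.1 ∈ G.branch l → G.num g < G.num h) ∨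
      ∀ h : Pos n, h.1 ∈ G.branch l → G.num h < G.num g := by
  have hlt := time_outEnd_lt hl
  -- The outer end of `l` has number `2 * time (outEnd l)` and the inner end the next one. Inner
  -- ends of other lines of the branch are renumbered next to their outer ends, which are in the
  -- branch too, so no number leaves the range.
  have key : ∀ h : Pos n, h.1 ∈ G.branch l →
      2 * G.time (G.outEnd l) + 1 ≤ G.num h ∧ G.num h ≤ 2 * G.time (G.inEnd l) := by
    intro h hh
    have h0 := (mem_branch_iff hl h).1 hh
    by_cases h1 : ∃ l' ∈ G.tree, h = G.inEnd l'
    · obtain ⟨l', hl', rfl⟩ := h1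
      rw [num_inEnd hl']
      have h2 := time_outEnd_lt hl'
      refine ⟨?_, by omega⟩
      by_cases h3 : l' = l
      · rw [h3]
      · have h4 : (G.outEnd l').1 ∈ G.branch l := by
          have := G.branch_ends_of_ne hl' h3
          rw [inEnd] at hh
          rw [outEnd]
          split_ifs at hh ⊢ <;> tauto
        have := (mem_branch_iff hl _).1 h4
        omega
    · push Not at h1
      rw [num_of_ne_inEnd h1]
      omega
  have hg' := (not_congr (mem_branch_iff hl g)).1 hg
  suffices h : G.num g ≤ 2 * G.time (G.outEnd l) ∨ 2 * G.time (G.inEnd l) < G.num g by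
    rcases h with h | h
    · left; intro x hx; have := key x hx; omega
    · right; intro x hx; have := key x hx; omega
  by_cases h1 : ∃ l' ∈ G.tree, g = G.inEnd l'
  · obtain ⟨l', hl', rfl⟩ := h1
    rw [num_inEnd hl']
    have h2 := time_outEnd_lt hl'
    have h3 : l' ≠ l := by
      rintro rfl
      exact hg (inEnd_mem hl)
    have h4 : (G.outEnd l').1 ∉ G.branch l := by
      have := G.branch_ends_of_ne hl' h3
      rw [inEnd] at hg
      rw [outEnd]
      split_ifs at hg ⊢ <;> tauto
    have h5 := (not_congr (mem_branch_iff hl _)).1 h4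
    have h6 : G.time (G.outEnd l') ≠ G.time (G.outEnd l) := fun h => by
      have := G.time_injective h
      apply hg
      rw [← contr_outEnd, this, contr_outEnd]
      exact inEnd_mem hl
    omega
  · push Not at h1
    rw [num_of_ne_inEnd h1]
    omega

/-- A vertex is entered from the root side by one line only: each of two entries would lie in the
branch of the other, hence be no later than it, and their times would coincide. -/
theorem not_mem_of_two_entries {l : G.Line} {v : Fin n} {j j' : Fin 4} (hl : l ∈ G.tree)
    (h : (v, j) = G.inEnd l) {l' : G.Line} (hl' : l' ∈ G.tree) (h' : (v, j') = G.inEnd l') :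
    j = j' := by
  have h1 : v ∈ G.branch l := by have := inEnd_mem hl; rwa [← h] at this
  have h2 : v ∈ G.branch l' := by have := inEnd_mem hl'; rwa [← h'] at this
  have h3 := (mem_branch_iff hl (v, j')).1 h1
  have h4 := (mem_branch_iff hl' (v, j)).1 h2
  rw [← h] at h3
  rw [← h'] at h4
  have := G.time_injective (show G.time (v, j) = G.time (v, j') by omega)
  exact (Prod.ext_iff.1 this).2

/-- Up to a cyclic permutation, the positions of a vertex are met in cyclic order. -/
theorem num_vertex (v : Fin n) :
    ∃ e : Fin 4, ∀ j : Fin 4, j + 1 ≠ e → G.num (v, j) < G.num (v, j + 1) := by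
  -- Between two cyclically consecutive positions the walk either steps directly or makes an
  -- excursion around a branch, and in both cases it comes back later. The order can only break at
  -- the entry of the vertex, which is renumbered, and at the root, where the cycle starts.
  have key : ∀ j : Fin 4, (∀ l ∈ G.tree, (v, j + 1) ≠ G.inEnd l) → (v, j + 1) ≠ G.root.1 →
      G.num (v, j) < G.num (v, j + 1) := by
    intro j h1 h2
    rw [num_of_ne_inEnd h1]
    by_cases hj : G.IsTreeEnd (v, j)
    · obtain ⟨l, hl, h3 | h3⟩ := hj.exists
      · have h4 : G.step (G.outEnd l) = (v, j + 1) := by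
          rw [step_of_isTreeEnd (isTreeEnd_outEnd hl), contr_outEnd, ← h3]
        rw [h3, num_inEnd hl, ← h4, (G.time_step _).resolve_right (by rwa [h4])]
        omega
      · have h4 : G.step (G.inEnd l) = (v, j + 1) := by
          rw [step_of_isTreeEnd (isTreeEnd_inEnd hl), contr_inEnd, ← h3]
        rw [h3, num_outEnd hl, ← h4, (G.time_step _).resolve_right (by rwa [h4])]
        have := time_outEnd_lt hl
        omega
    · have h4 : G.step (v, j) = (v, j + 1) := step_of_not_isTreeEnd hj
      rw [← h4, (G.time_step _).resolve_right (by rwa [h4]), num_of_ne_inEnd]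
      · omega
      · rintro l hl h
        rw [h] at hj
        exact hj (isTreeEnd_inEnd hl)
  by_cases hv : ∃ l ∈ G.tree, ∃ j, (v, j) = G.inEnd l
  · obtain ⟨l, hl, e, he⟩ := hv
    refine ⟨e, fun j hj => key j (fun l' hl' h => hj ?_) (fun h => ?_)⟩
    · exact not_mem_of_two_entries hl' h hl he
    · have h1 := inEnd_mem hl
      rw [← he] at h1
      apply G.root_not_mem_branch l
      rw [← h]
      exact h1
  · push Not at hv
    -- Without an entry line the exceptional position is the root, if it is at this vertex;
    -- otherwise no position is exceptional and the value 0 is arbitrary.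
    refine ⟨if G.root.1.1 = v then G.root.1.2 else 0, fun j hj => key j (fun l hl => hv l hl _)
      (fun h => hj ?_)⟩
    rw [← h]
    simp

/-! ### Vertex sums -/

open Classical in
/-- A function on the vertices with vanishing branch sums and vanishing total sum is zero. -/
theorem eq_zero_of_branch_sums (D : Fin n → ℝ) (h0 : ∑ v, D v = 0)
    (hD : ∀ l ∈ G.tree, ∑ v ∈ G.branch l, D v = 0) : D = 0 := by
  let Φ : (Fin n → ℝ) →ₗ[ℝ] (ℝ × ({l // l ∈ G.tree} → ℝ)) :=
    LinearMap.prod (∑ v, LinearMap.proj v)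
      (LinearMap.pi fun l => ∑ v ∈ G.branch l.1, LinearMap.proj v)
  have hΦ : ∀ D : Fin n → ℝ, Φ D = (∑ v, D v, fun l => ∑ v ∈ G.branch l.1, D v) := by
    intro D
    refine Prod.ext ?_ ?_
    · simp [Φ]
    · ext l; simp [Φ]
  have hdim : Module.finrank ℝ (Fin n → ℝ) = Module.finrank ℝ (ℝ × ({l // l ∈ G.tree} → ℝ)) := by
    simp [Module.finrank_prod]
    have := G.tree_card
    omega
  -- The dimensions agree, so surjectivity is enough. The indicator of the root vertex has total sum
  -- one and no branch sum; the difference of the indicators of the two ends of a tree line has only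
  -- the branch sum of that line.
  have hsurj : Function.Surjective Φ := by
    rw [← LinearMap.range_eq_top, eq_top_iff]
    have hroot : Φ (Pi.single G.root.1.1 1) = (1, 0) := by
      rw [hΦ]
      refine Prod.ext ?_ ?_
      · simp
      · ext l
        simp [G.root_not_mem_branch]
    have hline : ∀ l : {l // l ∈ G.tree},
        Φ (Pi.single (G.inEnd l.1).1 1 - Pi.single (G.outEnd l.1).1 1) = (0, Pi.single l 1) := by
      intro l
      rw [hΦ]
      refine Prod.ext ?_ ?_
      · simp
      · ext l'
        simp only [Pi.sub_apply, Finset.sum_sub_distrib]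
        by_cases h : l' = l
        · subst h
          simp [inEnd_mem l'.2, outEnd_not_mem l'.2]
        · rw [Pi.single_eq_of_ne h]
          have h1 := G.branch_ends_of_ne (l := l'.1) l.2 (fun e => h (Subtype.ext e.symm))
          have h2 : (G.inEnd l.1).1 ∈ G.branch l'.1 ↔ (G.outEnd l.1).1 ∈ G.branch l'.1 := by
            rw [inEnd, outEnd]
            split_ifs <;> tauto
          by_cases h3 : (G.inEnd l.1).1 ∈ G.branch l'.1
          · simp [h3, h2.1 h3]
          · simp [h3, (not_congr h2).1 h3]
    rintro ⟨a, b⟩ -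
    have : (a, b) = a • ((1 : ℝ), (0 : {l // l ∈ G.tree} → ℝ))
        + ∑ l, b l • ((0 : ℝ), (Pi.single l 1 : {l // l ∈ G.tree} → ℝ)) := by
      refine Prod.ext ?_ ?_
      · simp [Prod.fst_sum]
      · ext l
        simp [Prod.snd_sum, Finset.sum_apply, Pi.single_apply]
    rw [this]
    refine Submodule.add_mem _ (Submodule.smul_mem _ _ ⟨_, hroot⟩)
      (Submodule.sum_mem _ fun l _ => Submodule.smul_mem _ _ ⟨_, hline l⟩)
  have hinj := (LinearMap.injective_iff_surjective_of_finrank_eq_finrank hdim).2 hsurj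
  apply hinj
  rw [hΦ, map_zero]
  refine Prod.ext h0 ?_
  ext l
  exact hD l.1 l.2

/-- If no branch separated the two vertices, the difference of their indicators would have vanishing
branch sums and total sum without being zero. -/
theorem exists_separating {v w : Fin n} (h : v ≠ w) :
    ∃ l ∈ G.tree, ¬(v ∈ G.branch l ↔ w ∈ G.branch l) := by
  classical
  by_contra! hc
  have := eq_zero_of_branch_sums (G := G) (Pi.single v 1 - Pi.single w 1) (by simp) (by
    intro l hl
    simp only [Pi.sub_apply, Finset.sum_sub_distrib]
    have := hc l hl
    by_cases h1 : v ∈ G.branch l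
    · simp [h1, this.1 h1]
    · simp [h1, (not_congr this).1 h1])
  have h1 := congrFun this v
  simp [h] at h1

end RootedGraph

theorem _root_.Matrix.det_of_injective {m : Type*} [Fintype m] [DecidableEq m] {A : Matrix m m ℝ}
    {b : m → ℕ} (hb : Function.Injective b) (hA : ∀ i j, b i < b j → A i j = 0) :
    A.det = ∏ i, A i i := by
  -- The matrix is lower triangular for the order of `b`, hence upper triangular for the dual order.
  let _ : LinearOrder m := LinearOrder.lift' (fun i => OrderDual.toDual (b i))
    (OrderDual.toDual.injective.comp hb)
  convert Matrix.det_of_isUpperTriangular (M := A) (fun i j h => hA i j h)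

/-! ### Counting positions -/

namespace OrientedGraph

variable {n : ℕ} (G : OrientedGraph n)

/-- The positions are the external ones, the `+` ends and the `-` ends of the lines. -/
def posEquiv : G.External ⊕ (G.Line ⊕ G.Line) ≃ Pos n :=
  Equiv.ofBijective (Sum.elim Subtype.val (Sum.elim G.plus G.minus)) (by
    constructor
    · rintro (e | l | l) (e' | l' | l') h
      · exact congrArg Sum.inl (Subtype.ext h)
      · exact absurd (show G.contr (G.plus l') = G.plus l' from
          (show e.1 = G.plus l' from h) ▸ e.2) (G.contr_plus_ne l')
      · exact absurd (show G.contr (G.minus l') = G.minus l' from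
          (show e.1 = G.minus l' from h) ▸ e.2) (G.contr_minus_ne l')
      · exact absurd (show G.contr (G.plus l) = G.plus l from
          (show G.plus l = e'.1 from h) ▸ e'.2) (G.contr_plus_ne l)
      · exact congrArg _ (congrArg _ (G.plus_injective h))
      · exact absurd h (G.plus_ne_minus _ _)
      · exact absurd (show G.contr (G.minus l) = G.minus l from
          (show G.minus l = e'.1 from h) ▸ e'.2) (G.contr_minus_ne l)
      · exact absurd h.symm (G.plus_ne_minus _ _)
      · exact congrArg _ (congrArg _ (G.minus_injective h))
    · intro h
      by_cases hh : G.contr h = h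
      · exact ⟨Sum.inl ⟨h, hh⟩, rfl⟩
      · obtain ⟨l, rfl | rfl⟩ := G.exists_line hh
        · exact ⟨Sum.inr (Sum.inl l), rfl⟩
        · exact ⟨Sum.inr (Sum.inr l), rfl⟩)

theorem sum_pos {M : Type*} [AddCommMonoid M] (F : Pos n → M) :
    ∑ h, F h = ∑ e : G.External, F e.1 + (∑ l, F (G.plus l) + ∑ l, F (G.minus l)) := by
  rw [← G.posEquiv.sum_comp, Fintype.sum_sum_type, Fintype.sum_sum_type]
  rfl

theorem two_mul_card_line :
    2 * Fintype.card G.Line + Fintype.card G.External = 4 * n := by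
  have := Fintype.card_congr G.posEquiv
  simp only [Fintype.card_sum, Fintype.card_prod, Fintype.card_fin] at this
  omega

end OrientedGraph

/-! ### The change of long variables -/

namespace RootedGraph

variable {n : ℕ} (G : RootedGraph n) (P : Model)

theorem fst_eq_num (l : G.Line) : G.fst l = G.num (G.firstEnd l) := by
  rw [fst, firstEnd]
  split_ifs with h
  · exact min_eq_right h.le
  · exact min_eq_left (not_lt.1 h)

theorem fst_injective : Function.Injective G.fst := by
  intro l l' h
  rw [fst_eq_num, fst_eq_num] at h
  have h1 := num_injective h
  rw [firstEnd, firstEnd] at h1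
  split_ifs at h1
  · exact G.minus_injective h1
  · exact absurd h1.symm (G.plus_ne_minus _ _)
  · exact absurd h1 (G.plus_ne_minus _ _)
  · exact G.plus_injective h1

/-- Only loop lines that start earlier contribute to a new variable: both $l\subset l'$ and
$l'\ltimes l$ force the first end of `l'` before that of `l`. -/
theorem changeMatrix_eq_zero {l l' : G.Line} (h : G.fst l < G.fst l') :
    G.changeMatrix P l l' = 0 := by
  rw [changeMatrix, Matrix.of_apply, if_neg (by rintro rfl; exact lt_irrefl _ h), if_neg]
  rintro ⟨-, h1 | ⟨-, h1⟩⟩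
  · exact h.not_gt h1.1
  · exact h.not_gt h1.1

theorem veps_mul_self (l : G.Line) : G.veps l * G.veps l = 1 := by
  rw [veps]; split_ifs <;> norm_num

theorem one_add_eps_pos (hΩ : P.Ω ∈ Set.Ico (0 : ℝ) 1) (l : G.Line) : 0 < 1 + G.eps l * P.Ω := by
  obtain ⟨h0, h1⟩ := hΩ
  rw [eps]; split_ifs <;> linarith

theorem det_changeMatrix : (G.changeMatrix P).det
    = (1 / 2 : ℝ) ^ Fintype.card G.Line * ∏ l, (1 + G.eps l * P.Ω) := by
  rw [Matrix.det_of_injective G.fst_injective fun l l' h => G.changeMatrix_eq_zero P h]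
  simp only [changeMatrix, Matrix.of_apply, if_true]
  rw [Finset.prod_mul_distrib, Finset.prod_const, Finset.card_univ]

theorem det_changeMatrix_ne_zero (hΩ : P.Ω ∈ Set.Ico (0 : ℝ) 1) : (G.changeMatrix P).det ≠ 0 := by
  rw [det_changeMatrix]
  have := Finset.prod_pos fun l (_ : l ∈ Finset.univ) => G.one_add_eps_pos P hΩ l
  positivity

open Classical in
-- Subtracting the value at `v = 0` removes the momenta, so this is the linear part.
theorem newLong_sub (v : G.Line → Plane) (p : {l // l ∈ G.tree} → Plane) (l : G.Line) :
    G.veps l • (G.newLong P v p l - G.newLong P 0 p l)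
      = ∑ l', G.changeMatrix P l l' • G.veps l' • v l' := by
  -- The relations $l\subset l'$ and $l'\ltimes l$ exclude each other by the order of the last ends,
  -- so the entry 1 for their disjunction splits into two separate sums.
  have h1 : ∀ l', G.changeMatrix P l l' • G.veps l' • v l'
      = (if l' = l then (1 / 2 * (1 + G.eps l * P.Ω) * G.veps l) • v l else 0)
        + (if l' ∉ G.tree ∧ G.Below l l' then G.veps l' • v l' else 0)
        + (if l ∉ G.tree then (if l' ∉ G.tree ∧ G.Crosses l' l then G.veps l' • v l' else 0)
            else 0) := by
    intro l'
    rw [changeMatrix, Matrix.of_apply]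
    by_cases h : l' = l
    · subst h
      have h2 : ¬G.Below l' l' := fun h => lt_irrefl _ h.1
      have h3 : ¬G.Crosses l' l' := fun h => lt_irrefl _ h.1
      simp [h2, h3, smul_smul]
    · by_cases hb : G.Below l l'
      · have h3 : ¬G.Crosses l' l := fun h => absurd h.2.2 hb.2.not_gt
        by_cases h4 : l' ∈ G.tree <;> simp [h, hb, h3, h4]
      · by_cases h4 : l' ∈ G.tree <;> by_cases h5 : l ∈ G.tree <;>
          by_cases h6 : G.Crosses l' l <;> simp [h, hb, h4, h5, h6]
  simp_rw [h1, Finset.sum_add_distrib]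
  rw [newLong, newLong, ← smul_sub, smul_smul, veps_mul_self, one_smul]
  simp only [Pi.zero_apply, smul_zero, Finset.sum_const_zero, Finset.sum_ite_eq', Finset.mem_univ,
    if_true]
  rw [Finset.sum_filter]
  by_cases hl : l ∈ G.tree
  · simp [hl]
  · simp only [hl, dif_neg, not_false_eq_true, if_true]
    rw [Finset.sum_filter]
    abel

theorem newLong_eq (v : G.Line → Plane) (p : {l // l ∈ G.tree} → Plane) (l : G.Line) :
    G.newLong P v p l = G.newLong P 0 p l
      + G.veps l • ∑ l', G.changeMatrix P l l' • G.veps l' • v l' := by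
  rw [← newLong_sub, smul_smul, veps_mul_self, one_smul]
  abel

theorem sum_smul_sum_smul {ι E : Type*} [Fintype ι] [DecidableEq ι] [AddCommGroup E] [Module ℝ E]
    {A B : Matrix ι ι ℝ} (h : A * B = 1) (x : ι → E) (i : ι) :
    ∑ j, A i j • ∑ k, B j k • x k = x i := by
  simp_rw [Finset.smul_sum, smul_smul]
  rw [Finset.sum_comm]
  simp_rw [← Finset.sum_smul]
  have : ∀ k, ∑ j, A i j * B j k = (1 : Matrix ι ι ℝ) i k := fun k => by
    rw [← h, Matrix.mul_apply]
  simp_rw [this, Matrix.one_apply]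
  simp

theorem newLong_bijective (hΩ : P.Ω ∈ Set.Ico (0 : ℝ) 1) (p : {l // l ∈ G.tree} → Plane) :
    Function.Bijective fun v => G.newLong P v p := by
  have hdet : IsUnit (G.changeMatrix P).det := (G.det_changeMatrix_ne_zero P hΩ).isUnit
  have hv : ∀ (l : G.Line) (x : Plane), G.veps l • G.veps l • x = x := fun l x => by
    rw [smul_smul, veps_mul_self, one_smul]
  refine Function.bijective_iff_has_inverse.2
    ⟨fun V l => G.veps l • ∑ l', (G.changeMatrix P)⁻¹ l l' • G.veps l' • (V l' - G.newLong P 0 p l'),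
      fun v => ?_, fun V => ?_⟩
  · ext1 l
    simp only [newLong_sub]
    rw [sum_smul_sum_smul (Matrix.nonsing_inv_mul _ hdet) (fun l => G.veps l • v l), hv]
  · ext1 l
    simp only
    rw [newLong_eq]
    simp only [hv]
    rw [sum_smul_sum_smul (Matrix.mul_nonsing_inv _ hdet)
      (fun l' => G.veps l' • (V l' - G.newLong P 0 p l')), hv]
    abel

end RootedGraph

/-! ### Determinants of accretive matrices -/

section Accretive

open Matrix

variable {m : Type*} [Fintype m]

/-- The symmetric part is positive semidefinite. -/
def Accretive (N : Matrix m m ℝ) : Prop := ∀ x, 0 ≤ x ⬝ᵥ N *ᵥ x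

theorem Accretive.add {N N' : Matrix m m ℝ} (h : Accretive N) (h' : Accretive N') :
    Accretive (N + N') := fun x => by
  rw [add_mulVec, dotProduct_add]; exact add_nonneg (h x) (h' x)

theorem accretive_of_transpose_eq_neg {N : Matrix m m ℝ} (h : Nᵀ = -N) : Accretive N := fun x => by
  have h1 : x ⬝ᵥ N *ᵥ x = -(x ⬝ᵥ N *ᵥ x) := by
    conv_lhs => rw [dotProduct_mulVec, ← mulVec_transpose, h, neg_mulVec, neg_dotProduct,
      dotProduct_comm]
  linarith

theorem accretive_diagonal [DecidableEq m] {d : m → ℝ} (hd : ∀ i, 0 ≤ d i) : Accretive (diagonal d) := fun x => by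
  rw [dotProduct]
  refine Finset.sum_nonneg fun i _ => ?_
  rw [mulVec_diagonal]
  have := mul_nonneg (hd i) (mul_self_nonneg (x i))
  linarith

theorem Accretive.conj {k : Type*} [Fintype k] {N : Matrix m m ℝ} (h : Accretive N)
    (C : Matrix m k ℝ) : Accretive (Cᵀ * N * C) := fun x => by
  have := h (C *ᵥ x)
  rwa [← mulVec_mulVec, ← mulVec_mulVec, mulVec_transpose, dotProduct_comm, ← dotProduct_mulVec,
    dotProduct_comm]

theorem Accretive.transpose {N : Matrix m m ℝ} (h : Accretive N) : Accretive Nᵀ := fun x => by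
  rw [mulVec_transpose, dotProduct_comm, ← dotProduct_mulVec]
  exact h x

/-- $N^{-1}=(N^{-1})^TN^TN^{-1}$ is congruent to $N^T$. -/
theorem Accretive.inv [DecidableEq m] {N : Matrix m m ℝ} (h : Accretive N) (hN : IsUnit N.det) :
    Accretive N⁻¹ := by
  have h1 := h.transpose.conj N⁻¹
  rwa [← transpose_mul, mul_nonsing_inv _ hN, transpose_one, one_mul] at h1

variable [DecidableEq m]

/-- $|(1+N)v|^2=|v|^2+2\,v\cdot Nv+|Nv|^2\ge|v|^2$, so all singular values of $1+N$ are at least 1.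
The later determinant bounds reduce to this one. -/
theorem one_le_abs_det_one_add {N : Matrix m m ℝ} (h : Accretive N) : 1 ≤ |(1 + N).det| := by
  have hC : ((1 + N)ᵀ * (1 + N)).IsHermitian := by
    rw [IsHermitian, conjTranspose_eq_transpose_of_trivial, transpose_mul, transpose_transpose]
  have h1 : ∀ i, 1 ≤ hC.eigenvalues i := by
    intro i
    set v : m → ℝ := ⇑(hC.eigenvectorBasis i) with hv
    have h2 : v ⬝ᵥ ((1 + N)ᵀ * (1 + N)) *ᵥ v = hC.eigenvalues i * (v ⬝ᵥ v) := by
      rw [hC.mulVec_eigenvectorBasis, dotProduct_smul, smul_eq_mul]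
    have h3 : v ⬝ᵥ v = 1 := by
      have := hC.eigenvectorBasis.orthonormal.1 i
      have h4 : ‖hC.eigenvectorBasis i‖ ^ 2 = 1 := by rw [this]; norm_num
      rw [EuclideanSpace.norm_sq_eq] at h4
      rw [dotProduct, ← h4]
      refine Finset.sum_congr rfl fun j _ => ?_
      rw [Real.norm_eq_abs, sq_abs, sq]
    rw [h3, mul_one] at h2
    rw [← h2, ← mulVec_mulVec, mulVec_transpose, dotProduct_comm, ← dotProduct_mulVec, add_mulVec,
      one_mulVec, add_dotProduct, dotProduct_add, dotProduct_add, h3]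
    have h5 := h v
    have h6 : 0 ≤ N *ᵥ v ⬝ᵥ N *ᵥ v := Finset.sum_nonneg fun j _ => mul_self_nonneg _
    have h7 : N *ᵥ v ⬝ᵥ v = v ⬝ᵥ N *ᵥ v := dotProduct_comm _ _
    linarith
  have h2 : (1 : ℝ) ≤ ((1 + N)ᵀ * (1 + N)).det := by
    rw [hC.det_eq_prod_eigenvalues]
    calc (1 : ℝ) = ∏ _i : m, 1 := by simp
      _ ≤ _ := Finset.prod_le_prod (fun _ _ => zero_le_one) fun i _ => h1 i
  rw [det_mul, det_transpose] at h2
  rw [← abs_one]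
  apply sq_le_sq.1
  linarith [sq ((1 + N).det)]

/-- Taking $\sqrt d$ out on both sides leaves $1$ plus an accretive matrix. -/
theorem prod_le_abs_det_diagonal_add {d : m → ℝ} (hd : ∀ i, 0 < d i) {N : Matrix m m ℝ}
    (h : Accretive N) : ∏ i, d i ≤ |(diagonal d + N).det| := by
  set s : m → ℝ := fun i => √(d i)
  have hs : ∀ i, s i ≠ 0 := fun i => (Real.sqrt_pos.2 (hd i)).ne'
  have h1 : diagonal d + N
      = diagonal s * (1 + (diagonal fun i => (s i)⁻¹)ᵀ * N * diagonal fun i => (s i)⁻¹)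
        * diagonal s := by
    have h2 : diagonal s * (diagonal fun i => (s i)⁻¹) = 1 := by
      rw [diagonal_mul_diagonal, ← diagonal_one]
      congr 1; ext i; exact mul_inv_cancel₀ (hs i)
    have h3 : (diagonal fun i => (s i)⁻¹) * diagonal s = 1 := by
      rw [diagonal_mul_diagonal, ← diagonal_one]
      congr 1; ext i; exact inv_mul_cancel₀ (hs i)
    have h4 : diagonal s * diagonal s = diagonal d := by
      rw [diagonal_mul_diagonal]
      congr 1; ext i; exact Real.mul_self_sqrt (hd i).le
    rw [diagonal_transpose, mul_add, add_mul, mul_one, h4]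
    congr 1
    calc N = 1 * N * 1 := by rw [one_mul, mul_one]
      _ = (diagonal s * diagonal fun i => (s i)⁻¹) * N * ((diagonal fun i => (s i)⁻¹) * diagonal s) := by
        rw [h2, h3]
      _ = _ := by simp only [Matrix.mul_assoc]
  rw [h1, det_mul, det_mul, abs_mul, abs_mul, det_diagonal, Finset.abs_prod]
  have h2 := one_le_abs_det_one_add (h.conj (diagonal fun i => (s i)⁻¹))
  have h3 : ∏ i, d i = (∏ i, |s i|) * (∏ i, |s i|) := by
    rw [← Finset.prod_mul_distrib]
    refine Finset.prod_congr rfl fun i _ => ?_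
    rw [abs_mul_abs_self]; exact (Real.mul_self_sqrt (hd i).le).symm
  have h4 : 0 ≤ ∏ i, |s i| := Finset.prod_nonneg fun i _ => abs_nonneg _
  rw [h3]
  nlinarith [mul_nonneg h4 h4]

theorem isUnit_det_diagonal_add {d : m → ℝ} (hd : ∀ i, 0 < d i) {N : Matrix m m ℝ}
    (h : Accretive N) : IsUnit (diagonal d + N).det := by
  have h1 := prod_le_abs_det_diagonal_add hd h
  have h2 : 0 < ∏ i, d i := Finset.prod_pos fun i _ => hd i
  exact (abs_pos.1 (h2.trans_le h1)).isUnit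

/-- With $e=F^2$, $\det(A+e)=\det A\,\det(1+FA^{-1}F)$, and $FA^{-1}F$ is accretive. This
monotonicity supplies the dominating function when the cut-off is removed. -/
theorem abs_det_le_abs_det_add_diagonal {A : Matrix m m ℝ} (hA : Accretive A) {e : m → ℝ}
    (he : ∀ i, 0 ≤ e i) : |A.det| ≤ |(A + diagonal e).det| := by
  by_cases hu : IsUnit A.det
  · set F : Matrix m m ℝ := diagonal fun i => √(e i)
    have h1 : F * F = diagonal e := by
      rw [diagonal_mul_diagonal]
      congr 1; ext i; exact Real.mul_self_sqrt (he i)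
    have h2 : A + diagonal e = A * (1 + A⁻¹ * F * F) := by
      rw [mul_add, mul_one, Matrix.mul_assoc, h1, ← Matrix.mul_assoc, mul_nonsing_inv _ hu, one_mul]
    rw [h2, det_mul, abs_mul, det_one_add_mul_comm]
    have h3 := one_le_abs_det_one_add ((hA.inv hu).conj F)
    rw [show Fᵀ = F from diagonal_transpose _, Matrix.mul_assoc] at h3
    exact le_mul_of_one_le_right (abs_nonneg _) h3
  · rw [isUnit_iff_ne_zero, not_not] at hu
    rw [hu, abs_zero]
    exact abs_nonneg _

/-- With off-diagonal blocks $B$ and $-B^T$, the Schur complement is $d+S+BA^{-1}B^T$: the coupling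
only adds an accretive term. It lets the short variables of the tree be split off from the loop
variables, whatever their coupling. -/
theorem prod_mul_le_abs_det_fromBlocks {k : Type*} [Fintype k] [DecidableEq k] {d : m → ℝ}
    (hd : ∀ i, 0 < d i) {S : Matrix m m ℝ} (hS : Accretive S) (B : Matrix m k ℝ)
    {A : Matrix k k ℝ} (hA : Accretive A) :
    (∏ i, d i) * |A.det| ≤ |(fromBlocks (diagonal d + S) B (-Bᵀ) A).det| := by
  by_cases hu : IsUnit A.det
  · have : Invertible A := invertibleOfIsUnitDet A hu
    rw [det_fromBlocks₂₂, abs_mul, mul_comm]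
    refine mul_le_mul_of_nonneg_left ?_ (abs_nonneg _)
    rw [Matrix.mul_neg, sub_neg_eq_add, add_assoc]
    refine prod_le_abs_det_diagonal_add hd (hS.add ?_)
    have := (hA.inv hu).conj Bᵀ
    rwa [transpose_transpose, ← invOf_eq_nonsing_inv] at this
  · rw [isUnit_iff_ne_zero, not_not] at hu
    rw [hu, abs_zero, mul_zero]
    exact abs_nonneg _

/-- Write $B=\beta+J$. The Schur complement $K+A^TB^{-1}A$ equals $A^TB^{-1}(B^T+BK'B^T)B^{-T}A$
with $K'=A^{-T}KA^{-1}$ antisymmetric, and $B^T=\beta-J$. The middle factor is therefore β plus an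
antisymmetric matrix, and K, about which nothing else is known, disappears from the bound. The two
inverses of B leave one factor $\det B$ to be bounded from above. -/
theorem le_abs_det_fromBlocks {β : m → ℝ} (hβ : ∀ i, 0 < β i) {J A K : Matrix m m ℝ}
    (hJ : Jᵀ = -J) (hK : Kᵀ = -K) (hA : IsUnit A.det) :
    A.det ^ 2 * ∏ i, β i
      ≤ |(fromBlocks (diagonal β + J) A (-Aᵀ) K).det| * |(diagonal β + J).det| := by
  set B := diagonal β + J with hB
  have hBu : IsUnit B.det := isUnit_det_diagonal_add hβ (accretive_of_transpose_eq_neg hJ)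
  have : Invertible B := invertibleOfIsUnitDet B hBu
  rw [det_fromBlocks₁₁]
  set K' := (A⁻¹)ᵀ * K * A⁻¹ with hK'
  have hK't : K'ᵀ = -K' := by
    rw [hK', transpose_mul, transpose_mul, transpose_transpose, hK, Matrix.mul_assoc, Matrix.neg_mul,
      Matrix.mul_neg]
  have h1 : K - -Aᵀ * ⅟B * A = Aᵀ * (B⁻¹ * (diagonal β + (-J + B * K' * Bᵀ)) * (B⁻¹)ᵀ) * A := by
    have h2 : diagonal β + -J = Bᵀ := by
      rw [hB, transpose_add, hJ, diagonal_transpose]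
    have h3 : B⁻¹ * B = 1 := nonsing_inv_mul _ hBu
    have h4 : Bᵀ * (B⁻¹)ᵀ = 1 := by rw [← transpose_mul, h3, transpose_one]
    have h5 : A⁻¹ * A = 1 := nonsing_inv_mul _ hA
    have h6 : Aᵀ * (A⁻¹)ᵀ = 1 := by rw [← transpose_mul, h5, transpose_one]
    rw [← add_assoc, h2, mul_add, add_mul, Matrix.mul_assoc B⁻¹, h4, mul_one, mul_add, add_mul,
      invOf_eq_nonsing_inv]
    have h7 : B⁻¹ * (B * K' * Bᵀ) * (B⁻¹)ᵀ = K' := by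
      calc B⁻¹ * (B * K' * Bᵀ) * (B⁻¹)ᵀ = (B⁻¹ * B) * K' * (Bᵀ * (B⁻¹)ᵀ) := by
            simp only [Matrix.mul_assoc]
        _ = K' := by rw [h3, h4, one_mul, mul_one]
    have h8 : Aᵀ * K' * A = K := by
      calc Aᵀ * K' * A = (Aᵀ * (A⁻¹)ᵀ) * K * (A⁻¹ * A) := by rw [hK']; simp only [Matrix.mul_assoc]
        _ = K := by rw [h5, h6, one_mul, mul_one]
    rw [h7, h8, Matrix.neg_mul, Matrix.neg_mul, sub_neg_eq_add, add_comm]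
  rw [h1, det_mul, det_mul, det_mul, det_mul, det_transpose, det_transpose, det_nonsing_inv,
    Ring.inverse_eq_inv']
  have h2 : ∏ i, β i ≤ |(diagonal β + (-J + B * K' * Bᵀ)).det| := by
    refine prod_le_abs_det_diagonal_add hβ (accretive_of_transpose_eq_neg ?_)
    rw [transpose_add, transpose_neg, hJ, transpose_mul, transpose_mul, transpose_transpose, hK't,
      Matrix.neg_mul, Matrix.mul_neg, ← Matrix.mul_assoc, neg_add]
  have hB0 : |B.det| ≠ 0 := abs_ne_zero.2 hBu.ne_zero
  simp only [abs_mul, abs_inv]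
  have h3 : |B.det| * (|A.det| * (|B.det|⁻¹ * |(diagonal β + (-J + B * K' * Bᵀ)).det| * |B.det|⁻¹)
      * |A.det|) * |B.det| = A.det ^ 2 * |(diagonal β + (-J + B * K' * Bᵀ)).det| := by
    rw [← sq_abs A.det]
    field_simp
  rw [h3]
  exact mul_le_mul_of_nonneg_left h2 (sq_nonneg _)

/-- The sign matrix of the order given by `b`. -/
def orderMatrix {ι : Type*} (b : ι → ℕ) : Matrix ι ι ℝ :=
  Matrix.of fun i j => if b i < b j then -1 else if b j < b i then 1 else 0

theorem orderMatrix_transpose {ι : Type*} (b : ι → ℕ) : (orderMatrix b)ᵀ = -orderMatrix b := by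
  ext i j
  simp only [orderMatrix, transpose_apply, of_apply, Matrix.neg_apply]
  split_ifs <;> first | omega | norm_num

/-- Adding or subtracting c times the matrix of ones makes the matrix triangular, with diagonal
$\beta\pm c$. The determinant is affine along this rank-one direction, so it is the mean of the two
products. The result is a product over the lines, which a constant to the power n can absorb. -/
theorem abs_det_diagonal_add_orderMatrix_le {b : m → ℕ} (hb : Function.Injective b) {β : m → ℝ}
    (hβ : ∀ i, 0 < β i) (c : ℝ) :
    |(diagonal β + c • orderMatrix b).det| ≤ ∏ i, (β i + |c|) := by
  set X := diagonal β + c • orderMatrix b with hX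
  have hu : IsUnit X.det := isUnit_det_diagonal_add hβ (accretive_of_transpose_eq_neg (by
    rw [transpose_smul, orderMatrix_transpose, smul_neg]))
  -- The matrix determinant lemma: affine dependence on the coefficient of the rank-one update.
  have hrank : ∀ t : ℝ, (X + vecMulVec (fun _ => t) (fun _ => 1)).det
      = X.det * (1 + t * ((fun _ => (1 : ℝ)) ⬝ᵥ X⁻¹ *ᵥ fun _ => 1)) := by
    intro t
    rw [vecMulVec_eq Unit, det_add_replicateCol_mul_replicateRow hu]
    congr 2
    rw [← smul_eq_mul t, ← dotProduct_smul, ← mulVec_smul]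
    rw [det_unique]
    simp only [Matrix.add_apply, one_apply_eq, Matrix.mul_apply, replicateRow_apply, replicateCol_apply,
      dotProduct, mulVec, Pi.smul_apply, smul_eq_mul, one_mul, mul_one, Finset.sum_mul]
    rw [Finset.sum_comm]
  have h1 : (X + vecMulVec (fun _ => c) (fun _ => 1)).det = ∏ i, (β i + c) := by
    rw [det_of_injective hb]
    · refine Finset.prod_congr rfl fun i _ => ?_
      simp [hX, orderMatrix, vecMulVec_apply]
    · intro i j hij
      have hne : i ≠ j := by rintro rfl; exact lt_irrefl _ hij
      simp [hX, orderMatrix, vecMulVec_apply, hne, hij]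
  have h2 : (X + vecMulVec (fun _ => -c) (fun _ => 1)).det = ∏ i, (β i - c) := by
    rw [← det_transpose, det_of_injective hb]
    · refine Finset.prod_congr rfl fun i _ => ?_
      simp [hX, orderMatrix, vecMulVec_apply, sub_eq_add_neg]
    · intro i j hij
      have hne : j ≠ i := by rintro rfl; exact lt_irrefl _ hij
      simp [hX, orderMatrix, vecMulVec_apply, hne, hij, hij.not_gt]
  rw [hrank] at h1 h2
  have h3 : X.det = (∏ i, (β i + c) + ∏ i, (β i - c)) / 2 := by
    rw [← h1, ← h2]; ring
  have h4 : ∀ t : ℝ, |t| ≤ |c| → |∏ i, (β i + t)| ≤ ∏ i, (β i + |c|) := by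
    intro t ht
    rw [Finset.abs_prod]
    refine Finset.prod_le_prod (fun i _ => abs_nonneg _) fun i _ => ?_
    exact (abs_add_le _ _).trans (by rw [abs_of_pos (hβ i)]; linarith)
  have h5 := h4 c le_rfl
  have h6 := h4 (-c) (by rw [abs_neg])
  simp only [← sub_eq_add_neg] at h6
  rw [h3, abs_div, abs_two]
  have := abs_add_le (∏ i, (β i + c)) (∏ i, (β i - c))
  linarith

/-- The last group of variables (the momenta) enters only linearly, paired with the eliminated ones
by the diagonal κ. Integrating it out imposes a linear constraint, with solution `R`, and leaves the
form restricted to the constraint; the two copies of κ give the squared product. -/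
theorem abs_det_fromBlocks_constraint {k : Type*} [Fintype k] [DecidableEq k]
    (A : Matrix m m ℝ) (B : Matrix m k ℝ) (Y : Matrix m k ℝ) (C : Matrix k m ℝ) (E : Matrix k k ℝ)
    {κ : k → ℝ} (hκ : ∀ l, κ l ≠ 0) (R : Matrix k m ℝ) (hR : diagonal κ * R = -Yᵀ) :
    |(fromBlocks A (fromCols B Y) (fromRows C (-Yᵀ))
        (fromBlocks E (diagonal κ) (-diagonal κ) 0)).det|
      = (∏ l, κ l) ^ 2 * |(A + B * R + Rᵀ * C + Rᵀ * E * R).det| := by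
  set κi : Matrix k k ℝ := diagonal fun l => (κ l)⁻¹ with hκi
  have hl : diagonal κ * κi = 1 := by
    rw [diagonal_mul_diagonal, ← diagonal_one]
    congr 1; ext i; exact mul_inv_cancel₀ (hκ i)
  have hr : κi * diagonal κ = 1 := by
    rw [diagonal_mul_diagonal, ← diagonal_one]
    congr 1; ext i; exact inv_mul_cancel₀ (hκ i)
  set D := fromBlocks E (diagonal κ) (-diagonal κ) 0 with hD
  set D' := fromBlocks 0 (-κi) κi (κi * E * κi) with hD'
  have hDD : D * D' = 1 := by
    rw [hD, hD', fromBlocks_multiply, ← fromBlocks_one]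
    congr 1
    · rw [hl]; simp
    · rw [Matrix.mul_neg, ← Matrix.mul_assoc, ← Matrix.mul_assoc, hl, one_mul]; simp
    · simp
    · rw [Matrix.neg_mul, Matrix.mul_neg, hl]; simp
  have : Invertible D := invertibleOfRightInverse D D' hDD
  have hinv : ⅟D = D' := invOf_eq_right_inv hDD
  have hR' : R = -(κi * Yᵀ) := by
    rw [← Matrix.mul_neg, ← hR, ← Matrix.mul_assoc, hr, Matrix.one_mul]
  have hRt : Rᵀ = -(Y * κi) := by
    rw [hR', transpose_neg, transpose_mul, transpose_transpose, hκi, diagonal_transpose]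
  rw [det_fromBlocks₂₂, hinv, abs_mul]
  congr 1
  · have h1 : D * fromBlocks 0 (-1) 1 0 = fromBlocks (diagonal κ) (-E) 0 (diagonal κ) := by
      rw [hD, fromBlocks_multiply]; simp
    have h2 := congrArg Matrix.det h1
    rw [det_mul, det_fromBlocks_zero₂₁, det_diagonal] at h2
    have h3 := J_det_mul_J_det k ℝ
    have h4 : |(J k ℝ).det| = 1 := by
      rw [← sq_eq_sq₀ (abs_nonneg _) zero_le_one, sq_abs, sq, h3, one_pow]
    have h5 := congrArg abs h2
    rw [abs_mul, show (fromBlocks 0 (-1) 1 0 : Matrix (k ⊕ k) (k ⊕ k) ℝ) = J k ℝ from rfl, h4,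
      mul_one] at h5
    rw [h5, ← sq, abs_of_nonneg (sq_nonneg _)]
  · congr 2
    rw [hD', fromCols_mul_fromBlocks, fromCols_mul_fromRows, hRt, hR']
    simp only [Matrix.mul_neg, Matrix.neg_mul, Matrix.mul_zero, zero_add, Matrix.add_mul, neg_neg,
      Matrix.mul_assoc]
    abel

end Accretive

namespace RootedGraph

open Matrix

variable {n : ℕ} (G : RootedGraph n) (P : Model)

/-! ### The form of the vertices and the form of the rosette -/

/-- The form `-∑_{i<j} x_i ∧ x_j` of the vertices, in terms of signed positions. -/
def vertexForm (n : ℕ) : Matrix (Pos n) (Pos n) ℝ :=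
  Matrix.of fun h h' =>
    if h.1 = h'.1 then if h.2 < h'.2 then -1 else if h'.2 < h.2 then 1 else 0 else 0

/-- The form of the oscillations of the propagators, in terms of signed positions. -/
def lineForm : Matrix (Pos n) (Pos n) ℝ :=
  Matrix.of fun h h' =>
    if h' = G.contr h ∧ G.contr h ≠ h then if G.isPsi h = true then 1 else -1 else 0

theorem vertexForm_transpose : (vertexForm n)ᵀ = -vertexForm n := by
  ext h h'
  simp only [vertexForm, transpose_apply, of_apply, Matrix.neg_apply]
  by_cases h1 : h.1 = h'.1
  · rw [if_pos h1, if_pos h1.symm]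
    rcases lt_trichotomy h.2 h'.2 with h2 | h2 | h2 <;> simp [h2, h2.not_gt]
  · rw [if_neg h1, if_neg (Ne.symm h1), neg_zero]

theorem lineForm_transpose : G.lineFormᵀ = -G.lineForm := by
  ext h h'
  simp only [lineForm, transpose_apply, of_apply, Matrix.neg_apply]
  by_cases h1 : h' = G.contr h ∧ G.contr h ≠ h
  · obtain ⟨rfl, h2⟩ := h1
    have h3 := G.isPsi_contr h h2
    cases hb : G.isPsi h <;> simp [G.contr_contr, h2, h2.symm, h3, hb]
  · rw [if_neg h1, if_neg, neg_zero]
    rintro ⟨rfl, h2⟩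
    exact h1 ⟨(G.contr_contr h').symm, by rw [G.contr_contr]; exact h2.symm⟩

/-- Moving the first position of a cyclic order to the end changes the form by multiples of the two
sums, which vanish. So the form depends on the cyclic order only, and any numbers that increase from
a starting point `e` give the same value. -/
theorem sum_cyclic_order {X Y : Fin 4 → ℝ} {a : Fin 4 → ℕ} (hX : ∑ j, X j = 0)
    (hY : ∑ j, Y j = 0) {e : Fin 4} (he : ∀ j, j + 1 ≠ e → a j < a (j + 1)) :
    (∑ i, ∑ j, X i * (vertexForm 1 (0, i) (0, j) * Y j))
      = ∑ i, ∑ j, X i * (orderMatrix a i j * Y j) := by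
  have hX' : X 3 = -(X 0 + X 1 + X 2) := by
    rw [Fin.sum_univ_four] at hX; linarith
  have hY' : Y 3 = -(Y 0 + Y 1 + Y 2) := by
    rw [Fin.sum_univ_four] at hY; linarith
  have h0 := he 0
  have h1 := he 1
  have h2 := he 2
  have h3 := he 3
  simp only [show (0 : Fin 4) + 1 = 1 from rfl, show (1 : Fin 4) + 1 = 2 from rfl,
    show (2 : Fin 4) + 1 = 3 from rfl, show (3 : Fin 4) + 1 = 0 from rfl] at h0 h1 h2 h3
  have hlt : ∀ {p q : ℕ}, p < q → (p < q) = True ∧ (q < p) = False := fun h =>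
    ⟨eq_true h, eq_false h.not_gt⟩
  simp only [vertexForm, orderMatrix, of_apply, if_true, Fin.sum_univ_four]
  rw [hX', hY']
  fin_cases e
  · have k0 := h0 (by decide); have k1 := h1 (by decide); have k2 := h2 (by decide)
    simp [hlt k0, hlt k1, hlt k2, hlt (k0.trans k1), hlt (k1.trans k2),
      hlt ((k0.trans k1).trans k2)]
  · have k0 := h1 (by decide); have k1 := h2 (by decide); have k2 := h3 (by decide)
    simp [hlt k0, hlt k1, hlt k2, hlt (k0.trans k1), hlt (k1.trans k2),
      hlt ((k0.trans k1).trans k2)]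
    ring
  · have k0 := h2 (by decide); have k1 := h3 (by decide); have k2 := h0 (by decide)
    simp [hlt k0, hlt k1, hlt k2, hlt (k0.trans k1), hlt (k1.trans k2),
      hlt ((k0.trans k1).trans k2)]
    ring
  · have k0 := h3 (by decide); have k1 := h0 (by decide); have k2 := h1 (by decide)
    simp [hlt k0, hlt k1, hlt k2, hlt (k0.trans k1), hlt (k1.trans k2),
      hlt ((k0.trans k1).trans k2)]
    ring

/-- The reduction to a rosette. Inside a vertex the numbering is a cyclic shift of the given order.
Two distinct vertices are separated by a branch, whose numbers are consecutive: all positions of one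
vertex are on the same side of any position of the other, and the sum over that vertex vanishes. So
the terms added by the global order contribute nothing. -/
theorem vertexForm_eq_orderMatrix {X Y : Pos n → ℝ} (hX : ∀ v, ∑ j, X (v, j) = 0)
    (hY : ∀ v, ∑ j, Y (v, j) = 0) :
    X ⬝ᵥ vertexForm n *ᵥ Y = X ⬝ᵥ orderMatrix G.num *ᵥ Y := by
  have hexp : ∀ M : Matrix (Pos n) (Pos n) ℝ, X ⬝ᵥ M *ᵥ Y
      = ∑ v, ∑ v', ∑ i, ∑ j, X (v, i) * (M (v, i) (v', j) * Y (v', j)) := by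
    intro M
    simp only [dotProduct, mulVec, Fintype.sum_prod_type, Finset.mul_sum]
    exact Finset.sum_congr rfl fun v _ => Finset.sum_comm
  rw [hexp, hexp]
  refine Finset.sum_congr rfl fun v _ => Finset.sum_congr rfl fun v' _ => ?_
  by_cases hv : v = v'
  · subst hv
    obtain ⟨e, he⟩ := num_vertex (G := G) v
    convert sum_cyclic_order (X := fun j => X (v, j)) (Y := fun j => Y (v, j))
      (a := fun j => G.num (v, j)) (hX v) (hY v) he using 5 <;>
      simp [vertexForm, orderMatrix]
  · have hsgn : ∀ l ∈ G.tree, ∀ w w' : Fin n, w ∉ G.branch l → w' ∈ G.branch l → ∀ i : Fin 4,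
        ∃ c : ℝ, ∀ j, orderMatrix G.num (w, i) (w', j) = c ∧ orderMatrix G.num (w', j) (w, i) = -c := by
      intro l hl w w' hw hw' i
      rcases num_branch hl (g := (w, i)) hw with h | h
      · refine ⟨-1, fun j => ?_⟩
        have := h (w', j) hw'
        simp [orderMatrix, this, this.not_gt]
      · refine ⟨1, fun j => ?_⟩
        have := h (w', j) hw'
        simp [orderMatrix, this, this.not_gt]
    obtain ⟨l, hl, h⟩ := exists_separating (G := G) hv
    have hl0 : ∑ i, ∑ j, X (v, i) * (vertexForm n (v, i) (v', j) * Y (v', j)) = 0 := by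
      simp [vertexForm, hv]
    rw [hl0]
    by_cases h1 : v ∈ G.branch l
    · have h2 : v' ∉ G.branch l := fun h' => h (iff_of_true h1 h')
      rw [Finset.sum_comm]
      refine (Finset.sum_eq_zero fun j _ => ?_).symm
      obtain ⟨c, hc⟩ := hsgn l hl v' v h2 h1 j
      simp only [fun i => (hc i).2]
      rw [← Finset.sum_mul, hX, zero_mul]
    · have h2 : v' ∈ G.branch l := by by_contra h'; exact h (iff_of_false h1 h')
      refine (Finset.sum_eq_zero fun i _ => ?_).symm
      obtain ⟨c, hc⟩ := hsgn l hl v v' h1 h2 i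
      simp only [fun j => (hc j).1]
      rw [← Finset.mul_sum, ← Finset.mul_sum, hY, mul_zero, mul_zero]

end RootedGraph

namespace RootedGraph

open Matrix

variable {n : ℕ} (G : RootedGraph n) (P : Model)

/-! ### The quadratic form of the phase -/

/-- Indices of the variables `u`, `v`, `p`. -/
abbrev Idx : Type := G.Line ⊕ (G.Line ⊕ {l // l ∈ G.tree})

/-- The signed positions as linear functions of `(u, v, p)`. -/
def posMatrix : Matrix (Pos n) G.Idx ℝ :=
  Matrix.of fun h => Sum.elim
    (fun e => Sum.elim (fun _ => if e = G.root then -1 else 0) 0)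
    (Sum.elim (fun l => Sum.elim (Pi.single l (1 / 2)) (Sum.elim (Pi.single l (1 / 2)) 0))
      (fun l => Sum.elim (Pi.single l (1 / 2)) (Sum.elim (Pi.single l (-(1 / 2))) 0)))
    (G.posEquiv.symm h)

/-- Incidence of positions and branches. -/
def inBranch : Matrix (Pos n) {l // l ∈ G.tree} ℝ :=
  Matrix.of fun h l => if h.1 ∈ G.branch l.1 then 1 else 0

/-- Incidence of positions and branches, as columns for the momenta. -/
def branchMatrix : Matrix (Pos n) G.Idx ℝ :=
  Matrix.of fun h => Sum.elim 0 (Sum.elim 0 (G.inBranch h))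

/-- The form of the phases of vertices and propagators, in terms of signed positions. -/
def posForm : Matrix (Pos n) (Pos n) ℝ := vertexForm n - P.Ω • G.lineForm

/-- The form of the total phase. -/
def phaseMatrix : Matrix G.Idx G.Idx ℝ :=
  (2 / P.θ) • (G.posMatrixᵀ * G.posForm P * G.posMatrix)
    + (G.posMatrixᵀ * G.branchMatrix - G.branchMatrixᵀ * G.posMatrix)

theorem posForm_transpose : (G.posForm P)ᵀ = -G.posForm P := by
  rw [posForm, transpose_sub, transpose_smul, vertexForm_transpose, lineForm_transpose, smul_neg,
    neg_sub, sub_neg_eq_add, neg_add_eq_sub]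

theorem phaseMatrix_transpose : (G.phaseMatrix P)ᵀ = -G.phaseMatrix P := by
  rw [phaseMatrix, transpose_add, transpose_smul, transpose_sub, transpose_mul, transpose_mul,
    transpose_mul, transpose_mul, transpose_transpose, transpose_transpose, posForm_transpose,
    Matrix.neg_mul, Matrix.mul_neg, smul_neg, neg_add, neg_sub, Matrix.mul_assoc]

theorem posMatrix_apply (x : G.External ⊕ (G.Line ⊕ G.Line)) :
    G.posMatrix (G.posEquiv x) = Sum.elim
      (fun e => Sum.elim (fun _ => if e = G.root then -1 else 0) 0)
      (Sum.elim (fun l => Sum.elim (Pi.single l (1 / 2)) (Sum.elim (Pi.single l (1 / 2)) 0))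
        (fun l => Sum.elim (Pi.single l (1 / 2)) (Sum.elim (Pi.single l (-(1 / 2))) 0))) x := by
  conv_rhs => rw [← G.posEquiv.symm_apply_apply x]
  rfl

theorem posMatrix_ext (e : G.External) :
    G.posMatrix e.1 = Sum.elim (fun _ => if e = G.root then -1 else 0) 0 := by
  exact G.posMatrix_apply (Sum.inl e)

theorem posMatrix_plus (l : G.Line) : G.posMatrix (G.plus l)
    = Sum.elim (Pi.single l (1 / 2)) (Sum.elim (Pi.single l (1 / 2)) 0) := by
  exact G.posMatrix_apply (Sum.inr (Sum.inl l))

theorem posMatrix_minus (l : G.Line) : G.posMatrix (G.minus l)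
    = Sum.elim (Pi.single l (1 / 2)) (Sum.elim (Pi.single l (-(1 / 2))) 0) := by
  exact G.posMatrix_apply (Sum.inr (Sum.inr l))

theorem posMatrix_mulVec_ext (U : G.Idx → ℝ) (e : G.External) :
    (G.posMatrix *ᵥ U) e.1 = if e = G.root then -∑ l, U (Sum.inl l) else 0 := by
  rw [mulVec, posMatrix_ext, dotProduct, Fintype.sum_sum_type]
  by_cases he : e = G.root <;> simp [he]

theorem posMatrix_mulVec_plus (U : G.Idx → ℝ) (l : G.Line) :
    (G.posMatrix *ᵥ U) (G.plus l) = (U (Sum.inl l) + U (Sum.inr (Sum.inl l))) / 2 := by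
  rw [mulVec, posMatrix_plus, dotProduct, Fintype.sum_sum_type, Fintype.sum_sum_type]
  simp [Pi.single_apply]
  ring

theorem posMatrix_mulVec_minus (U : G.Idx → ℝ) (l : G.Line) :
    (G.posMatrix *ᵥ U) (G.minus l) = (U (Sum.inl l) - U (Sum.inr (Sum.inl l))) / 2 := by
  rw [mulVec, posMatrix_minus, dotProduct, Fintype.sum_sum_type, Fintype.sum_sum_type]
  simp [Pi.single_apply]
  ring

/-- The root position carries $-\sum_lu_l$, as the global delta function prescribes, and the two
ends of a line contribute $u_l$. -/
theorem sum_posMatrix_mulVec (U : G.Idx → ℝ) : ∑ h, (G.posMatrix *ᵥ U) h = 0 := by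
  rw [G.sum_pos]
  simp only [posMatrix_mulVec_ext, posMatrix_mulVec_plus, posMatrix_mulVec_minus]
  rw [← Finset.sum_add_distrib, Finset.sum_ite_eq' Finset.univ, if_pos (Finset.mem_univ _),
    neg_add_eq_zero]
  exact Finset.sum_congr rfl fun l _ => by ring

/-- Tree lines. -/
abbrev TreeLine : Type := {l // l ∈ G.tree}

/-- Loop lines. -/
abbrev Loop : Type := {l // l ∉ G.tree}

/-- Indices of the variables, sorted: `u` (tree), `u` (loops), `w`, then `v` (tree), `p`. -/
def idxEquiv : (G.TreeLine ⊕ (G.Loop ⊕ G.Loop)) ⊕ (G.TreeLine ⊕ G.TreeLine) ≃ G.Idx where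
  toFun := Sum.elim
    (Sum.elim (fun t => Sum.inl t.1)
      (Sum.elim (fun o => Sum.inl o.1) (fun o => Sum.inr (Sum.inl o.1))))
    (Sum.elim (fun t => Sum.inr (Sum.inl t.1)) (fun t => Sum.inr (Sum.inr t)))
  invFun := by
    classical
    exact Sum.elim
      (fun l => if h : l ∈ G.tree then Sum.inl (Sum.inl ⟨l, h⟩)
        else Sum.inl (Sum.inr (Sum.inl ⟨l, h⟩)))
      (Sum.elim (fun l => if h : l ∈ G.tree then Sum.inr (Sum.inl ⟨l, h⟩)
        else Sum.inl (Sum.inr (Sum.inr ⟨l, h⟩))) (fun t => Sum.inr (Sum.inr t)))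
  left_inv := by
    rintro ((⟨l, h⟩ | ⟨l, h⟩ | ⟨l, h⟩) | (⟨l, h⟩ | ⟨l, h⟩)) <;> simp [h]
  right_inv := by
    rintro (l | l | t)
    · by_cases h : l ∈ G.tree <;> simp [h]
    · by_cases h : l ∈ G.tree <;> simp [h]
    · rfl

/-- The coefficient of `v_l` in the branch sum of `l`. -/
def branchCoeff (l : G.TreeLine) : ℝ := if (G.plus l.1).1 ∈ G.branch l.1 then 1 / 2 else -(1 / 2)

theorem branchCoeff_sq (l : G.TreeLine) : G.branchCoeff l ^ 2 = 1 / 4 := by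
  rw [branchCoeff]; split_ifs <;> norm_num

theorem branchCoeff_ne_zero (l : G.TreeLine) : G.branchCoeff l ≠ 0 := by
  intro h
  have := G.branchCoeff_sq l
  rw [h] at this
  norm_num at this

/-- Columns of the variables other than `v_l`, `p_l`, `l` in the tree. -/
def colsFree : Matrix (Pos n) (G.TreeLine ⊕ (G.Loop ⊕ G.Loop)) ℝ :=
  G.posMatrix.submatrix id (G.idxEquiv ∘ Sum.inl)

/-- Columns of the variables `v_l`, `l` in the tree. -/
def colsTree : Matrix (Pos n) G.TreeLine ℝ :=
  G.posMatrix.submatrix id fun t => Sum.inr (Sum.inl t.1)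

/-- The signed ends of a line carry $v_l$ with opposite coefficients. They cancel in every branch
sum except that of the line itself, where only one end lies in the branch. -/
theorem transpose_colsTree_mul : G.colsTreeᵀ * G.inBranch = diagonal G.branchCoeff := by
  ext t t'
  have h0 : ∀ h, G.colsTree h t = G.posMatrix h (Sum.inr (Sum.inl t.1)) := fun _ => rfl
  rw [Matrix.mul_apply, G.sum_pos]
  simp only [transpose_apply, h0, posMatrix_ext, posMatrix_plus, posMatrix_minus, Sum.elim_inr,
    Sum.elim_inl, Pi.zero_apply, zero_mul, Finset.sum_const_zero, zero_add, inBranch, of_apply]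
  simp only [Pi.single_apply, ite_mul, zero_mul, Finset.sum_ite_eq, Finset.mem_univ, if_true]
  by_cases h : t = t'
  · subst h
    rw [diagonal_apply_eq, branchCoeff]
    have := G.branch_ends t.2
    split_ifs <;> first | tauto | norm_num
  · rw [diagonal_apply_ne _ h]
    have := G.branch_ends_of_ne (l := t'.1) t.2 (fun e => h (Subtype.ext e))
    split_ifs <;> first | tauto | norm_num

/-- On the hyperplane of vanishing branch sums, the variables `v_l`, `l` in the tree, are linear
functions of the others. -/
def elim : Matrix G.TreeLine (G.TreeLine ⊕ (G.Loop ⊕ G.Loop)) ℝ :=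
  (diagonal fun t => -(G.branchCoeff t)⁻¹) * (G.colsFreeᵀ * G.inBranch)ᵀ

theorem diagonal_mul_elim :
    diagonal G.branchCoeff * G.elim = -(G.colsFreeᵀ * G.inBranch)ᵀ := by
  rw [elim, ← Matrix.mul_assoc, diagonal_mul_diagonal]
  have : (fun i => G.branchCoeff i * -(G.branchCoeff i)⁻¹) = fun _ => (-1 : ℝ) := by
    ext i
    rw [mul_neg, mul_inv_cancel₀ (G.branchCoeff_ne_zero i)]
  rw [this, show (diagonal fun _ : G.TreeLine => (-1 : ℝ)) = -1 by
    rw [← diagonal_one, ← diagonal_neg], Matrix.neg_mul, Matrix.one_mul]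

/-- The positions on the hyperplane of vanishing branch sums. -/
def restr : Matrix (Pos n) (G.TreeLine ⊕ (G.Loop ⊕ G.Loop)) ℝ := G.colsFree + G.colsTree * G.elim

theorem posMatrix_submatrix :
    G.posMatrix.submatrix id G.idxEquiv = fromCols G.colsFree (fromCols G.colsTree 0) := by
  ext h (d | t | t)
  · rfl
  · rfl
  · simp only [submatrix_apply, id, fromCols_apply_inr, Matrix.zero_apply]
    show G.posMatrix h (Sum.inr (Sum.inr t)) = 0
    obtain ⟨x, rfl⟩ := G.posEquiv.surjective h
    rcases x with e | l | l
    · exact congrFun (G.posMatrix_ext e) _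
    · exact congrFun (G.posMatrix_plus l) _
    · exact congrFun (G.posMatrix_minus l) _

theorem restr_mulVec (x : G.TreeLine ⊕ (G.Loop ⊕ G.Loop) → ℝ) :
    G.restr *ᵥ x = G.posMatrix *ᵥ ((Sum.elim x (Sum.elim (G.elim *ᵥ x) 0)) ∘ G.idxEquiv.symm) := by
  have h2 : G.posMatrix *ᵥ ((Sum.elim x (Sum.elim (G.elim *ᵥ x) 0)) ∘ G.idxEquiv.symm)
      = G.posMatrix.submatrix id G.idxEquiv *ᵥ (Sum.elim x (Sum.elim (G.elim *ᵥ x) 0)) := by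
    ext h
    simp only [mulVec, dotProduct, submatrix_apply, id]
    rw [← G.idxEquiv.sum_comp]
    simp
  rw [h2, posMatrix_submatrix, fromCols_mulVec_sumElim, fromCols_mulVec_sumElim, restr, add_mulVec, mulVec_mulVec,
    mulVec_zero, add_zero]

/-- `elim` solves the branch constraints, so all branch sums vanish; the total vanishes by the root
delta function. A function on the vertices with these properties is zero. -/
theorem sum_vertex_restr (x : G.TreeLine ⊕ (G.Loop ⊕ G.Loop) → ℝ) (v : Fin n) :
    ∑ j, (G.restr *ᵥ x) (v, j) = 0 := by
  classical
  have h := eq_zero_of_branch_sums (G := G) (fun v => ∑ j, (G.restr *ᵥ x) (v, j)) (by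
    have := G.sum_posMatrix_mulVec
      ((Sum.elim x (Sum.elim (G.elim *ᵥ x) 0)) ∘ G.idxEquiv.symm)
    rwa [← restr_mulVec, Fintype.sum_prod_type] at this) (by
    intro l hl
    have h1 : (G.inBranchᵀ * G.restr) = 0 := by
      have h2 : G.inBranchᵀ * G.colsTree = diagonal G.branchCoeff := by
        rw [← transpose_transpose G.colsTree, ← transpose_mul, transpose_colsTree_mul,
          diagonal_transpose]
      rw [restr, Matrix.mul_add, ← Matrix.mul_assoc, h2, diagonal_mul_elim, transpose_mul,
        transpose_transpose, add_neg_cancel]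
    have h2 : (G.inBranchᵀ *ᵥ (G.restr *ᵥ x)) ⟨l, hl⟩ = 0 := by
      rw [mulVec_mulVec, h1, zero_mulVec]; rfl
    rw [← h2]
    simp only [mulVec, dotProduct, transpose_apply, inBranch, of_apply]
    rw [Fintype.sum_prod_type, ← Finset.sum_filter_add_sum_filter_not Finset.univ (· ∈ G.branch l),
      Finset.filter_mem_eq_inter, Finset.univ_inter]
    refine (add_eq_left.2 ?_).symm.trans (congrArg₂ (· + ·) ?_ rfl)
    · exact Finset.sum_eq_zero fun v hv => by simp [(Finset.mem_filter.1 hv).2]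
    · exact Finset.sum_congr rfl fun v hv => by simp [hv])
  exact congrFun h v

/-- The form required by `abs_det_fromBlocks_constraint`: the widths sit only on the short
variables, and the tree momenta are paired with the tree long variables by the diagonal
`branchCoeff`. -/
theorem submatrix_phase (β : G.Line → ℝ) :
    (diagonal (Sum.elim β 0) + G.phaseMatrix P).submatrix G.idxEquiv G.idxEquiv
      = fromBlocks
        (diagonal (Sum.elim (fun t => β t.1) (Sum.elim (fun o => β o.1) 0))
          + (2 / P.θ) • (G.colsFreeᵀ * G.posForm P * G.colsFree))
        (fromCols ((2 / P.θ) • (G.colsFreeᵀ * G.posForm P * G.colsTree)) (G.colsFreeᵀ * G.inBranch))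
        (fromRows ((2 / P.θ) • (G.colsTreeᵀ * G.posForm P * G.colsFree))
          (-(G.colsFreeᵀ * G.inBranch)ᵀ))
        (fromBlocks ((2 / P.θ) • (G.colsTreeᵀ * G.posForm P * G.colsTree)) (diagonal G.branchCoeff)
          (-diagonal G.branchCoeff) 0) := by
  have h2 : G.branchMatrix.submatrix id G.idxEquiv
      = fromCols (0 : Matrix _ (G.TreeLine ⊕ (G.Loop ⊕ G.Loop)) ℝ) (fromCols 0 G.inBranch) := by
    ext h ((t | t | t) | t | t) <;> rfl
  have h3 : (G.phaseMatrix P).submatrix G.idxEquiv G.idxEquiv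
      = (2 / P.θ) • ((G.posMatrix.submatrix id G.idxEquiv)ᵀ * G.posForm P
          * (G.posMatrix.submatrix id G.idxEquiv))
        + ((G.posMatrix.submatrix id G.idxEquiv)ᵀ * G.branchMatrix.submatrix id G.idxEquiv
          - (G.branchMatrix.submatrix id G.idxEquiv)ᵀ * G.posMatrix.submatrix id G.idxEquiv) := rfl
  have h4 : (diagonal (Sum.elim β 0) : Matrix G.Idx G.Idx ℝ).submatrix G.idxEquiv G.idxEquiv
      = fromBlocks (diagonal (Sum.elim (fun t => β t.1) (Sum.elim (fun o => β o.1) 0))) 0 0 0 := by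
    ext a b
    rw [submatrix_apply, diagonal_apply]
    simp only [EmbeddingLike.apply_eq_iff_eq]
    rcases a with (a | a | a) | a | a <;> rcases b with (b | b | b) | b | b <;>
      simp [diagonal_apply] <;> first | rfl | exact fun _ => rfl
  have h5 : G.inBranchᵀ * G.colsTree = diagonal G.branchCoeff := by
    rw [← transpose_transpose G.colsTree, ← transpose_mul, transpose_colsTree_mul,
      diagonal_transpose]
  have h6 : (diagonal (Sum.elim β 0) + G.phaseMatrix P).submatrix G.idxEquiv G.idxEquiv
    = (diagonal (Sum.elim β 0) : Matrix G.Idx G.Idx ℝ).submatrix G.idxEquiv G.idxEquiv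
      + (G.phaseMatrix P).submatrix G.idxEquiv G.idxEquiv := rfl
  rw [h6, h4, h3, posMatrix_submatrix, h2]
  simp only [transpose_fromCols, fromRows_mul, mul_fromCols]
  ext (a | a | a) (b | b | b) <;>
    simp [transpose_colsTree_mul, h5, transpose_mul, Matrix.mul_assoc, -diagonal_neg]

end RootedGraph

namespace RootedGraph

open Matrix

variable {n : ℕ} (G : RootedGraph n) (P : Model)

/-! ### The form of the rosette -/

/-- The form of the rosette. -/
def rosetteForm : Matrix (Pos n) (Pos n) ℝ := orderMatrix G.num - P.Ω • G.lineForm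

theorem rosetteForm_transpose : (G.rosetteForm P)ᵀ = -G.rosetteForm P := by
  rw [rosetteForm, transpose_sub, transpose_smul, orderMatrix_transpose, lineForm_transpose,
    smul_neg, neg_sub, sub_neg_eq_add, neg_add_eq_sub]

theorem rosetteForm_apply (h h' : Pos n) : G.rosetteForm P h h'
    = (if G.num h < G.num h' then -1 else if G.num h' < G.num h then 1 else 0)
      - P.Ω * (if h' = G.contr h ∧ G.contr h ≠ h then if G.isPsi h = true then 1 else -1 else 0) :=
  rfl

theorem rosetteForm_self (h : Pos n) : G.rosetteForm P h h = 0 := by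
  rw [rosetteForm_apply, if_neg (lt_irrefl _), if_neg (lt_irrefl _),
    if_neg (fun h' => h'.2 h'.1.symm), mul_zero, sub_zero]

theorem rosetteForm_swap (h h' : Pos n) : G.rosetteForm P h' h = -G.rosetteForm P h h' := by
  have := congrFun (congrFun (G.rosetteForm_transpose P) h) h'
  exact this

/-- The root comes first in the numbering and belongs to no line. -/
theorem rosetteForm_root {h : Pos n} (hh : h ≠ G.root.1) : G.rosetteForm P h G.root.1 = 1 := by
  have h1 : 0 < G.num h := by
    rw [Nat.pos_iff_ne_zero, ← num_root (G := G)]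
    exact fun e => hh (num_injective e)
  rw [rosetteForm_apply, num_root, if_neg (Nat.not_lt_zero _), if_pos h1, if_neg, mul_zero,
    sub_zero]
  rintro ⟨h2, -⟩
  apply hh
  rw [← G.contr_contr h, ← h2, G.root.2]

/-- The two ends of a tree line are consecutive in the numbering, so no other position distinguishes
them. -/
theorem rosetteForm_tree {l : G.Line} (hl : l ∈ G.tree) {h : Pos n} (h1 : h ≠ G.plus l)
    (h2 : h ≠ G.minus l) : G.rosetteForm P h (G.plus l) = G.rosetteForm P h (G.minus l) := by
  obtain ⟨h3, h4⟩ := num_tree_consecutive hl h1 h2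
  rw [rosetteForm_apply, rosetteForm_apply]
  simp only [h3, h4]
  have k1 : ¬(G.plus l = G.contr h ∧ G.contr h ≠ h) := by
    rintro ⟨h5, -⟩
    apply h2
    rw [← G.contr_contr h, ← h5, G.contr_plus]
  have k2 : ¬(G.minus l = G.contr h ∧ G.contr h ≠ h) := by
    rintro ⟨h5, -⟩
    apply h1
    rw [← G.contr_contr h, ← h5, G.contr_minus]
  rw [if_neg k1, if_neg k2]

/-- If the short variable of a tree line vanishes, its signed ends carry opposite values at
consecutive places and cancel against everything else; the two terms inside the line cancel as well.
Only the contribution of the root is left. -/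
theorem rosetteForm_mulVec_tree {X E : Pos n → ℝ}
    (hX : ∀ l ∈ G.tree, X (G.plus l) + X (G.minus l) = 0)
    (hE : ∀ l ∈ G.tree, E (G.plus l) + E (G.minus l) = 0)
    (hloop : ∀ l ∉ G.tree, E (G.plus l) = 0 ∧ E (G.minus l) = 0)
    (hext : ∀ e : G.External, e ≠ G.root → E e.1 = 0) :
    X ⬝ᵥ G.rosetteForm P *ᵥ E = E G.root.1 * (∑ h, X h - X G.root.1) := by
  have h0 : X ⬝ᵥ G.rosetteForm P *ᵥ E = ∑ h', E h' * ∑ h, X h * G.rosetteForm P h h' := by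
    simp only [dotProduct, mulVec, Finset.mul_sum]
    rw [Finset.sum_comm]
    exact Finset.sum_congr rfl fun _ _ => Finset.sum_congr rfl fun _ _ => by ring
  rw [h0, G.sum_pos, ← Finset.sum_add_distrib]
  have h1 : ∑ e : G.External, E e.1 * ∑ h, X h * G.rosetteForm P h e.1
      = E G.root.1 * (∑ h, X h - X G.root.1) := by
    rw [Finset.sum_eq_single G.root (fun e _ he => by rw [hext e he, zero_mul])
      (fun h => absurd (Finset.mem_univ _) h)]
    congr 1
    rw [eq_sub_iff_add_eq, ← Finset.sum_erase_add _ _ (Finset.mem_univ G.root.1), rosetteForm_self,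
      mul_zero, add_zero, ← Finset.sum_erase_add _ X (Finset.mem_univ G.root.1)]
    congr 1
    exact Finset.sum_congr rfl fun h hh => by
      rw [rosetteForm_root _ _ (Finset.ne_of_mem_erase hh), mul_one]
  rw [h1, add_eq_left]
  refine Finset.sum_eq_zero fun l _ => ?_
  by_cases hl : l ∈ G.tree
  · rw [eq_neg_of_add_eq_zero_right (hE l hl), neg_mul, ← sub_eq_add_neg, ← mul_sub,
      ← Finset.sum_sub_distrib]
    apply mul_eq_zero_of_right
    simp only [← mul_sub]
    rw [Finset.sum_eq_add (G.plus l) (G.minus l) (G.plus_ne_minus l l)]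
    · rw [rosetteForm_self, rosetteForm_self, eq_neg_of_add_eq_zero_right (hX l hl),
        G.rosetteForm_swap P (G.plus l) (G.minus l)]
      ring
    · rintro h - ⟨h2, h3⟩
      rw [rosetteForm_tree _ _ hl h2 h3, sub_self, mul_zero]
    · exact fun h => absurd (Finset.mem_univ _) h
    · exact fun h => absurd (Finset.mem_univ _) h
  · rw [(hloop l hl).1, (hloop l hl).2, zero_mul, zero_mul, add_zero]

/-- The last end of a line. -/
def lastEnd (l : G.Line) : Pos n :=
  if G.num (G.minus l) < G.num (G.plus l) then G.plus l else G.minus l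

theorem contr_firstEnd (l : G.Line) : G.contr (G.firstEnd l) = G.lastEnd l := by
  rw [firstEnd, lastEnd]
  split_ifs
  · exact G.contr_minus l
  · exact G.contr_plus l

theorem num_firstEnd_lt (l : G.Line) : G.num (G.firstEnd l) < G.num (G.lastEnd l) := by
  rw [firstEnd, lastEnd]
  split_ifs with h
  · exact h
  · exact lt_of_le_of_ne (not_lt.1 h) fun e => G.plus_ne_minus l l (num_injective e)

/-- Coefficients of the variables of the loop lines: the short variables, and the positions of the
last ends. -/
def loopCols : Matrix (Pos n) (G.Loop ⊕ G.Loop) ℝ :=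
  Matrix.of fun h => Sum.elim (fun o => if h = G.firstEnd o.1 then 1 else 0)
    (fun o => (if h = G.lastEnd o.1 then 1 else 0) - if h = G.firstEnd o.1 then 1 else 0)

/-- The short variables and the last ends in terms of the short and long variables. -/
def loopChange : Matrix (G.Loop ⊕ G.Loop) (G.Loop ⊕ G.Loop) ℝ :=
  fromBlocks 1 0 ((1 / 2 : ℝ) • (1 : Matrix G.Loop G.Loop ℝ)) (diagonal fun o => G.veps o.1 / 2)

theorem line_ext {l l' : G.Line} {h : Pos n} (h1 : h = G.plus l ∨ h = G.minus l)
    (h2 : h = G.plus l' ∨ h = G.minus l') : l = l' := by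
  rcases h1 with rfl | rfl <;> rcases h2 with h2 | h2
  · exact G.plus_injective h2
  · exact absurd h2 (G.plus_ne_minus _ _)
  · exact absurd h2.symm (G.plus_ne_minus _ _)
  · exact G.minus_injective h2

theorem firstEnd_eq (l : G.Line) : G.firstEnd l = G.plus l ∨ G.firstEnd l = G.minus l := by
  rw [firstEnd]; split_ifs <;> simp

theorem lastEnd_eq (l : G.Line) : G.lastEnd l = G.plus l ∨ G.lastEnd l = G.minus l := by
  rw [lastEnd]; split_ifs <;> simp

theorem firstEnd_inj {l l' : G.Line} : G.firstEnd l = G.firstEnd l' ↔ l = l' :=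
  ⟨fun h => G.line_ext (G.firstEnd_eq l) (h ▸ G.firstEnd_eq l'), fun h => h ▸ rfl⟩

theorem lastEnd_inj {l l' : G.Line} : G.lastEnd l = G.lastEnd l' ↔ l = l' :=
  ⟨fun h => G.line_ext (G.lastEnd_eq l) (h ▸ G.lastEnd_eq l'), fun h => h ▸ rfl⟩

theorem firstEnd_ne_lastEnd (l l' : G.Line) : G.firstEnd l ≠ G.lastEnd l' := by
  intro h
  have := G.line_ext (G.firstEnd_eq l) (h ▸ G.lastEnd_eq l')
  subst this
  exact (G.num_firstEnd_lt l).ne (congrArg G.num h)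

theorem loopCols_mulVec (x : G.Loop ⊕ G.Loop → ℝ) (h : Pos n) : (G.loopCols *ᵥ x) h
    = ∑ o : G.Loop, (if h = G.firstEnd o.1 then x (Sum.inl o) - x (Sum.inr o) else 0)
      + ∑ o : G.Loop, if h = G.lastEnd o.1 then x (Sum.inr o) else 0 := by
  rw [mulVec, dotProduct, Fintype.sum_sum_type, ← Finset.sum_add_distrib, ← Finset.sum_add_distrib]
  refine Finset.sum_congr rfl fun o _ => ?_
  simp only [loopCols, of_apply, Sum.elim_inl, Sum.elim_inr]
  split_ifs <;> ring

theorem loopCols_mulVec_first (x : G.Loop ⊕ G.Loop → ℝ) (o : G.Loop) :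
    (G.loopCols *ᵥ x) (G.firstEnd o.1) = x (Sum.inl o) - x (Sum.inr o) := by
  rw [loopCols_mulVec]
  simp only [firstEnd_inj, firstEnd_ne_lastEnd, if_false, Finset.sum_const_zero, add_zero,
    Subtype.coe_inj, Finset.sum_ite_eq, Finset.mem_univ, if_true]

theorem loopCols_mulVec_last (x : G.Loop ⊕ G.Loop → ℝ) (o : G.Loop) :
    (G.loopCols *ᵥ x) (G.lastEnd o.1) = x (Sum.inr o) := by
  rw [loopCols_mulVec]
  simp only [lastEnd_inj, (G.firstEnd_ne_lastEnd _ _).symm, if_false, Finset.sum_const_zero,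
    zero_add, Subtype.coe_inj, Finset.sum_ite_eq, Finset.mem_univ, if_true]

theorem loopCols_mulVec_of_ne (x : G.Loop ⊕ G.Loop → ℝ) {h : Pos n}
    (hh : ∀ o : G.Loop, h ≠ G.plus o.1 ∧ h ≠ G.minus o.1) : (G.loopCols *ᵥ x) h = 0 := by
  rw [loopCols_mulVec, Finset.sum_eq_zero, Finset.sum_eq_zero, add_zero]
  · refine fun o _ => if_neg ?_
    rcases G.lastEnd_eq o.1 with h1 | h1 <;> rw [h1]
    exacts [(hh o).1, (hh o).2]
  · refine fun o _ => if_neg ?_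
    rcases G.firstEnd_eq o.1 with h1 | h1 <;> rw [h1]
    exacts [(hh o).1, (hh o).2]

theorem sum_loopCols_mulVec (x : G.Loop ⊕ G.Loop → ℝ) :
    ∑ h, (G.loopCols *ᵥ x) h = ∑ o, x (Sum.inl o) := by
  simp only [loopCols_mulVec]
  rw [Finset.sum_add_distrib, Finset.sum_comm, Finset.sum_comm (f := fun h (o : G.Loop) =>
    if h = G.lastEnd o.1 then x (Sum.inr o) else 0), ← Finset.sum_add_distrib]
  refine Finset.sum_congr rfl fun o _ => ?_
  simp

/-- Positions when the short variables of the tree lines vanish. -/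
def restrLoop : Matrix (Pos n) (G.Loop ⊕ G.Loop) ℝ := G.restr.submatrix id Sum.inr

theorem restrLoop_mulVec (x : G.Loop ⊕ G.Loop → ℝ) :
    G.restrLoop *ᵥ x = G.restr *ᵥ Sum.elim 0 x := by
  ext h
  rw [mulVec, mulVec, dotProduct, dotProduct, Fintype.sum_sum_type]
  simp [restrLoop]

theorem restrLoop_mulVec_tree (x : G.Loop ⊕ G.Loop → ℝ) {l : G.Line} (hl : l ∈ G.tree) :
    (G.restrLoop *ᵥ x) (G.plus l) + (G.restrLoop *ᵥ x) (G.minus l) = 0 := by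
  rw [restrLoop_mulVec, restr_mulVec, posMatrix_mulVec_plus, posMatrix_mulVec_minus]
  have : G.idxEquiv.symm (Sum.inl l) = Sum.inl (Sum.inl ⟨l, hl⟩) := by
    rw [Equiv.symm_apply_eq]; rfl
  simp only [Function.comp, this, Sum.elim_inl, Pi.zero_apply]
  ring

theorem restrLoop_mulVec_loop (x : G.Loop ⊕ G.Loop → ℝ) (o : G.Loop) :
    (G.restrLoop *ᵥ x) (G.plus o.1) = (x (Sum.inl o) + x (Sum.inr o)) / 2 ∧
      (G.restrLoop *ᵥ x) (G.minus o.1) = (x (Sum.inl o) - x (Sum.inr o)) / 2 := by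
  rw [restrLoop_mulVec, restr_mulVec, posMatrix_mulVec_plus, posMatrix_mulVec_minus]
  have h1 : G.idxEquiv.symm (Sum.inl o.1) = Sum.inl (Sum.inr (Sum.inl o)) := by
    rw [Equiv.symm_apply_eq]; rfl
  have h2 : G.idxEquiv.symm (Sum.inr (Sum.inl o.1)) = Sum.inl (Sum.inr (Sum.inr o)) := by
    rw [Equiv.symm_apply_eq]; rfl
  simp only [Function.comp, h1, h2, Sum.elim_inl, Sum.elim_inr, and_self]

theorem restrLoop_mulVec_ext (x : G.Loop ⊕ G.Loop → ℝ) (e : G.External) :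
    (G.restrLoop *ᵥ x) e.1 = if e = G.root then -∑ o, x (Sum.inl o) else 0 := by
  rw [restrLoop_mulVec, restr_mulVec, posMatrix_mulVec_ext]
  congr 2
  have h0 : ∀ l, ((Sum.elim (Sum.elim (0 : G.TreeLine → ℝ) x)
      (Sum.elim (G.elim *ᵥ Sum.elim 0 x) 0)) ∘ G.idxEquiv.symm) (Sum.inl l)
      = if h : l ∉ G.tree then x (Sum.inl ⟨l, h⟩) else 0 := by
    intro l
    by_cases h : l ∈ G.tree
    · have : G.idxEquiv.symm (Sum.inl l) = Sum.inl (Sum.inl ⟨l, h⟩) := by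
        rw [Equiv.symm_apply_eq]; rfl
      simp [this, h]
    · have : G.idxEquiv.symm (Sum.inl l) = Sum.inl (Sum.inr (Sum.inl ⟨l, h⟩)) := by
        rw [Equiv.symm_apply_eq]; rfl
      simp [this, h]
  simp only [h0]
  rw [← Fintype.sum_subtype_add_sum_subtype (· ∈ G.tree), Finset.sum_eq_zero, zero_add]
  · exact Finset.sum_congr rfl fun o _ => dif_pos o.2
  · exact fun t _ => dif_neg (not_not.2 t.2)

/-- Contraction of the tree: with vanishing short variables the tree lines decouple from the rosette
form, and the root contributes only a term that cancels by antisymmetry. What is left involves the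
ends of the loop lines alone. -/
theorem restrLoop_form (x y : G.Loop ⊕ G.Loop → ℝ) :
    (G.restrLoop *ᵥ x) ⬝ᵥ G.posForm P *ᵥ (G.restrLoop *ᵥ y)
      = (G.loopCols *ᵥ (G.loopChange *ᵥ x)) ⬝ᵥ
        G.rosetteForm P *ᵥ (G.loopCols *ᵥ (G.loopChange *ᵥ y)) := by
  have hv : ∀ x v, ∑ j, (G.restrLoop *ᵥ x) (v, j) = 0 := fun x v => by
    rw [restrLoop_mulVec]
    exact G.sum_vertex_restr _ v
  have hs : ∀ x, ∑ h, (G.restrLoop *ᵥ x) h = 0 := fun x => by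
    rw [Fintype.sum_prod_type]
    exact Finset.sum_eq_zero fun v _ => hv x v
  have hchange : ∀ (x : G.Loop ⊕ G.Loop → ℝ) (o : G.Loop),
      (G.loopChange *ᵥ x) (Sum.inl o) = x (Sum.inl o) ∧ (G.loopChange *ᵥ x) (Sum.inr o)
        = x (Sum.inl o) / 2 + G.veps o.1 / 2 * x (Sum.inr o) := by
    intro x o
    rw [loopChange, fromBlocks_mulVec]
    simp only [Sum.elim_inl, Sum.elim_inr, one_mulVec, zero_mulVec, smul_mulVec, Pi.add_apply,
      Pi.smul_apply, mulVec_diagonal, Function.comp, smul_eq_mul, add_zero, true_and]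
    ring
  have hloop : ∀ x (o : G.Loop), (G.restrLoop *ᵥ x) (G.plus o.1)
        = (G.loopCols *ᵥ (G.loopChange *ᵥ x)) (G.plus o.1)
      ∧ (G.restrLoop *ᵥ x) (G.minus o.1)
        = (G.loopCols *ᵥ (G.loopChange *ᵥ x)) (G.minus o.1) := by
    intro x o
    have h1 := G.loopCols_mulVec_first (G.loopChange *ᵥ x) o
    have h2 := G.loopCols_mulVec_last (G.loopChange *ᵥ x) o
    rw [(hchange x o).1, (hchange x o).2] at h1
    rw [(hchange x o).2] at h2
    rw [(G.restrLoop_mulVec_loop x o).1, (G.restrLoop_mulVec_loop x o).2]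
    rw [firstEnd] at h1
    rw [lastEnd] at h2
    rw [veps] at h1 h2
    split_ifs at h1 h2 <;> rw [h1, h2] <;> constructor <;> ring
  have hne : ∀ x (l : G.Line), l ∈ G.tree → (G.loopCols *ᵥ x) (G.plus l) = 0
      ∧ (G.loopCols *ᵥ x) (G.minus l) = 0 := by
    intro x l hl
    constructor <;> refine G.loopCols_mulVec_of_ne x fun o => ⟨fun h => o.2 ?_, fun h => o.2 ?_⟩
    · rwa [← G.plus_injective h]
    · exact absurd h (G.plus_ne_minus _ _)
    · exact absurd h.symm (G.plus_ne_minus _ _)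
    · rwa [← G.minus_injective h]
  have hex : ∀ x (e : G.External), (G.loopCols *ᵥ x) e.1 = 0 := by
    intro x e
    refine G.loopCols_mulVec_of_ne x fun o => ⟨fun h => ?_, fun h => ?_⟩
    · exact G.contr_plus_ne o.1 (h ▸ e.2)
    · exact G.contr_minus_ne o.1 (h ▸ e.2)
  have key : ∀ (X : Pos n → ℝ) y, (∀ l ∈ G.tree, X (G.plus l) + X (G.minus l) = 0) →
      X ⬝ᵥ G.rosetteForm P *ᵥ (G.restrLoop *ᵥ y)
        = X ⬝ᵥ G.rosetteForm P *ᵥ (G.loopCols *ᵥ (G.loopChange *ᵥ y))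
          + -(∑ o, y (Sum.inl o)) * (∑ h, X h - X G.root.1) := by
    intro X y hX
    have h := G.rosetteForm_mulVec_tree P (X := X)
      (E := G.restrLoop *ᵥ y - G.loopCols *ᵥ (G.loopChange *ᵥ y)) hX
      (fun l hl => by
        have h1 := G.restrLoop_mulVec_tree y hl
        have h2 := hne (G.loopChange *ᵥ y) l hl
        simp only [Pi.sub_apply]
        rw [h2.1, h2.2]; linarith)
      (fun l hl => by
        have h1 := hloop y ⟨l, hl⟩
        simp only [Pi.sub_apply]
        exact ⟨sub_eq_zero.2 h1.1, sub_eq_zero.2 h1.2⟩)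
      (fun e he => by
        rw [Pi.sub_apply, hex, restrLoop_mulVec_ext, if_neg he, sub_zero])
    rw [mulVec_sub, dotProduct_sub, Pi.sub_apply, hex, restrLoop_mulVec_ext, if_pos rfl,
      sub_zero] at h
    linarith
  have hanti : ∀ X Y : Pos n → ℝ, X ⬝ᵥ G.rosetteForm P *ᵥ Y = -(Y ⬝ᵥ G.rosetteForm P *ᵥ X) := by
    intro X Y
    rw [dotProduct_mulVec, ← mulVec_transpose, rosetteForm_transpose, neg_mulVec, neg_dotProduct,
      dotProduct_comm]
  have h0 : (G.restrLoop *ᵥ x) ⬝ᵥ G.posForm P *ᵥ (G.restrLoop *ᵥ y)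
      = (G.restrLoop *ᵥ x) ⬝ᵥ G.rosetteForm P *ᵥ (G.restrLoop *ᵥ y) := by
    rw [posForm, rosetteForm, sub_mulVec, sub_mulVec, dotProduct_sub, dotProduct_sub,
      vertexForm_eq_orderMatrix G (hv x) (hv y)]
  -- The tree parts are removed from one argument, then, after exchange of the arguments, from the
  -- other. The two corrections due to the root are the product of the two sums of loop short
  -- variables, with opposite signs, and cancel.
  rw [h0, key _ _ fun l hl => G.restrLoop_mulVec_tree x hl, hanti,
    key _ _ fun l hl => by rw [(hne _ l hl).1, (hne _ l hl).2, add_zero], hanti, hs, hex,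
    sum_loopCols_mulVec, restrLoop_mulVec_ext, if_pos rfl]
  simp only [(hchange _ _).1]
  ring

theorem _root_.Matrix.transpose_mul_mul_apply {m k : Type*} [Fintype m] (Z : Matrix m k ℝ)
    (W : Matrix m m ℝ) (i j : k) : (Zᵀ * W * Z) i j = Z.col i ⬝ᵥ W *ᵥ Z.col j := by
  rw [Matrix.mul_assoc, mul_apply]
  rfl

theorem restrLoop_form_eq : G.restrLoopᵀ * G.posForm P * G.restrLoop
    = G.loopChangeᵀ * (G.loopColsᵀ * G.rosetteForm P * G.loopCols) * G.loopChange := by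
  have h2 : G.loopChangeᵀ * (G.loopColsᵀ * G.rosetteForm P * G.loopCols) * G.loopChange
      = (G.loopCols * G.loopChange)ᵀ * G.rosetteForm P * (G.loopCols * G.loopChange) := by
    rw [transpose_mul]
    simp only [Matrix.mul_assoc]
  rw [h2]
  ext i j
  rw [transpose_mul_mul_apply, transpose_mul_mul_apply, ← mulVec_single_one, ← mulVec_single_one,
    restrLoop_form, ← mulVec_single_one, ← mulVec_single_one, mulVec_mulVec (Pi.single i 1),
    mulVec_mulVec (Pi.single j 1) G.loopCols]

/-- Coupling of the last ends with the short variables. -/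
def crossForm : Matrix G.Loop G.Loop ℝ :=
  Matrix.of fun o o' => G.rosetteForm P (G.firstEnd o.1) (G.lastEnd o'.1)
    - G.rosetteForm P (G.firstEnd o.1) (G.firstEnd o'.1)

/-- The short variables appear only at first ends, so their block is the sign matrix of the order of
the first ends; propagators pair a first end with a last end and do not enter it. -/
theorem rosette_blocks : G.loopColsᵀ * G.rosetteForm P * G.loopCols
    = fromBlocks (orderMatrix fun o : G.Loop => G.fst o.1) (G.crossForm P) (-(G.crossForm P)ᵀ)
        ((G.loopColsᵀ * G.rosetteForm P * G.loopCols).toBlocks₂₂) := by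
  have c1 : ∀ o, G.loopCols.col (Sum.inl o) = Pi.single (G.firstEnd o.1) 1 := fun o => by
    ext h; rw [Pi.single_apply]; rfl
  have c2 : ∀ o, G.loopCols.col (Sum.inr o)
      = Pi.single (G.lastEnd o.1) 1 - Pi.single (G.firstEnd o.1) 1 := fun o => by
    ext h; rw [Pi.sub_apply, Pi.single_apply, Pi.single_apply]; rfl
  ext (o | o) (o' | o')
  · rw [transpose_mul_mul_apply, c1, c1, mulVec_single_one, single_one_dotProduct,
      fromBlocks_apply₁₁]
    show G.rosetteForm P _ _ = _
    rw [rosetteForm_apply, if_neg (c := _ ∧ _), mul_zero, sub_zero, ← fst_eq_num, ← fst_eq_num]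
    · rfl
    · rintro ⟨h, -⟩
      rw [contr_firstEnd] at h
      exact G.firstEnd_ne_lastEnd _ _ h
  · rw [transpose_mul_mul_apply, c1, c2, mulVec_sub, mulVec_single_one, mulVec_single_one,
      single_one_dotProduct, fromBlocks_apply₁₂]
    rfl
  · rw [transpose_mul_mul_apply, c1, c2, mulVec_single_one, sub_dotProduct, single_one_dotProduct,
      single_one_dotProduct, fromBlocks_apply₂₁]
    show G.rosetteForm P _ _ - G.rosetteForm P _ _
      = -(G.rosetteForm P _ _ - G.rosetteForm P _ _)
    rw [G.rosetteForm_swap P (G.firstEnd o'.1), G.rosetteForm_swap P (G.firstEnd o'.1)]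
    ring
  · rfl

/-- If `o` starts before `o'`, both ends of `o'` come after the first end of `o` and their
contributions cancel: the matrix is triangular for the order of the first ends. On the diagonal the
order gives −1 and the propagator −Ω with the sign of the field at the first end. -/
theorem det_crossForm : (G.crossForm P).det = ∏ o : G.Loop, -(1 + G.eps o.1 * P.Ω) := by
  have hne : ∀ o o' : G.Loop, o ≠ o' →
      ¬(G.lastEnd o'.1 = G.contr (G.firstEnd o.1) ∧ G.contr (G.firstEnd o.1) ≠ G.firstEnd o.1) := by
    rintro o o' h ⟨h1, -⟩
    rw [contr_firstEnd, lastEnd_inj] at h1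
    exact h (Subtype.ext h1.symm)
  have hne' : ∀ o o' : G.Loop,
      ¬(G.firstEnd o'.1 = G.contr (G.firstEnd o.1) ∧ G.contr (G.firstEnd o.1) ≠ G.firstEnd o.1) := by
    rintro o o' ⟨h, -⟩
    rw [contr_firstEnd] at h
    exact G.firstEnd_ne_lastEnd _ _ h
  rw [Matrix.det_of_injective (b := fun o : G.Loop => G.fst o.1)
    (G.fst_injective.comp Subtype.val_injective)]
  · refine Finset.prod_congr rfl fun o _ => ?_
    rw [crossForm, of_apply, rosetteForm_self, rosetteForm_apply, if_pos (G.num_firstEnd_lt o.1),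
      if_pos, eps]
    · ring
    · rw [contr_firstEnd]
      exact ⟨rfl, (G.firstEnd_ne_lastEnd _ _).symm⟩
  · intro o o' h
    rw [crossForm, of_apply, rosetteForm_apply, rosetteForm_apply,
      if_neg (hne o o' fun e => h.ne (by rw [e])), if_neg (hne' o o')]
    rw [fst_eq_num, fst_eq_num] at h
    rw [if_pos h, if_pos (h.trans (G.num_firstEnd_lt o'.1))]
    ring

set_option synthInstance.maxSize 500 in
set_option maxHeartbeats 1000000 in
/-- Lower bound for the determinant of the Gaussian integral over all internal variables. -/
theorem le_abs_det_phase (hθ : P.θ ≠ 0) (hΩ : P.Ω ∈ Set.Ico (0 : ℝ) 1) {β : G.Line → ℝ}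
    (hβ : ∀ l, 0 < β l) :
    (∏ t : G.TreeLine, (1 / 4 * β t.1)) * ∏ o : G.Loop,
        ((1 - P.Ω) ^ 2 / P.θ ^ 2 * (β o.1 / (β o.1 + 2 / |P.θ|)))
      ≤ |(diagonal (Sum.elim β 0) + G.phaseMatrix P).det| := by
  have hW := G.posForm_transpose P
  rw [← det_submatrix_equiv_self G.idxEquiv, submatrix_phase,
    abs_det_fromBlocks_constraint _ _ _ _ _ G.branchCoeff_ne_zero G.elim G.diagonal_mul_elim]
  -- The constrained form is the form of the positions in which the tree long variables have been
  -- replaced by their solution.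
  have h1 : diagonal (Sum.elim (fun t : G.TreeLine => β t.1)
          (Sum.elim (fun o : G.Loop => β o.1) (0 : G.Loop → ℝ)))
          + (2 / P.θ) • (G.colsFreeᵀ * G.posForm P * G.colsFree)
        + (2 / P.θ) • (G.colsFreeᵀ * G.posForm P * G.colsTree) * G.elim
        + G.elimᵀ * (2 / P.θ) • (G.colsTreeᵀ * G.posForm P * G.colsFree)
        + G.elimᵀ * (2 / P.θ) • (G.colsTreeᵀ * G.posForm P * G.colsTree) * G.elim
      = diagonal (Sum.elim (fun t : G.TreeLine => β t.1)
          (Sum.elim (fun o : G.Loop => β o.1) (0 : G.Loop → ℝ)))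
          + (2 / P.θ) • (G.restrᵀ * G.posForm P * G.restr) := by
    rw [restr, transpose_add, transpose_mul]
    simp only [Matrix.add_mul, Matrix.mul_add, Matrix.smul_mul, Matrix.mul_smul, smul_add,
      Matrix.mul_assoc]
    abel
  have hS : ∀ {k : Type} [Fintype k] (Z : Matrix (Pos n) k ℝ),
      Accretive ((2 / P.θ) • (Zᵀ * G.posForm P * Z)) := fun Z =>
    accretive_of_transpose_eq_neg (by
      rw [transpose_smul, transpose_mul, transpose_mul, transpose_transpose, hW, Matrix.neg_mul,
        Matrix.mul_neg, smul_neg, Matrix.mul_assoc])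
  set ZT : Matrix (Pos n) G.TreeLine ℝ := G.restr.submatrix id Sum.inl with hZT
  have h2 : diagonal (Sum.elim (fun t : G.TreeLine => β t.1)
          (Sum.elim (fun o : G.Loop => β o.1) (0 : G.Loop → ℝ)))
          + (2 / P.θ) • (G.restrᵀ * G.posForm P * G.restr)
      = fromBlocks (diagonal (fun t : G.TreeLine => β t.1)
            + (2 / P.θ) • (ZTᵀ * G.posForm P * ZT))
          ((2 / P.θ) • (ZTᵀ * G.posForm P * G.restrLoop))
          (-((2 / P.θ) • (ZTᵀ * G.posForm P * G.restrLoop))ᵀ)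
          (diagonal (Sum.elim (fun o : G.Loop => β o.1) (0 : G.Loop → ℝ))
            + (2 / P.θ) • (G.restrLoopᵀ * G.posForm P * G.restrLoop)) := by
    have h3 : G.restr = fromCols ZT G.restrLoop := by
      ext h (a | a) <;> rfl
    rw [transpose_smul, transpose_mul, transpose_mul, transpose_transpose, hW]
    conv_lhs => rw [h3]
    rw [← fromBlocks_diagonal, transpose_fromCols, fromRows_mul, fromRows_mul_fromCols,
      fromBlocks_smul, fromBlocks_add, zero_add, zero_add]
    simp only [Matrix.neg_mul, Matrix.mul_neg, smul_neg, neg_neg, Matrix.mul_assoc]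
  have hA : ∀ o : G.Loop, 0 < 1 + G.eps o.1 * P.Ω := fun o => G.one_add_eps_pos P hΩ o.1
  -- The short variables of the tree contribute the product of their widths; the loop block remains,
  -- with no short variable on the tree.
  have h4 := prod_mul_le_abs_det_fromBlocks (fun t : G.TreeLine => hβ t.1) (hS ZT)
    ((2 / P.θ) • (ZTᵀ * G.posForm P * G.restrLoop))
    (A := diagonal (Sum.elim (fun o : G.Loop => β o.1) (0 : G.Loop → ℝ))
            + (2 / P.θ) • (G.restrLoopᵀ * G.posForm P * G.restrLoop))
    ((accretive_diagonal (by
      rintro (o | o)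
      · exact (hβ o.1).le
      · exact le_rfl)).add (hS _))
  rw [h1, h2]
  -- The change to short variables and last ends does not move the short variables, so it preserves
  -- the diagonal widths.
  have h5 : diagonal (Sum.elim (fun o : G.Loop => β o.1) (0 : G.Loop → ℝ))
            + (2 / P.θ) • (G.restrLoopᵀ * G.posForm P * G.restrLoop)
      = G.loopChangeᵀ * (fromBlocks (diagonal (fun o : G.Loop => β o.1)
          + (2 / P.θ) • orderMatrix fun o : G.Loop => G.fst o.1)
          ((2 / P.θ) • G.crossForm P) (-((2 / P.θ) • G.crossForm P)ᵀ)
          ((2 / P.θ) • (G.loopColsᵀ * G.rosetteForm P * G.loopCols).toBlocks₂₂))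
          * G.loopChange := by
    have h6 : fromBlocks (diagonal (fun o : G.Loop => β o.1)
          + (2 / P.θ) • orderMatrix fun o : G.Loop => G.fst o.1)
          ((2 / P.θ) • G.crossForm P) (-((2 / P.θ) • G.crossForm P)ᵀ)
          ((2 / P.θ) • (G.loopColsᵀ * G.rosetteForm P * G.loopCols).toBlocks₂₂)
        = fromBlocks (diagonal (fun o : G.Loop => β o.1)) 0 0 0
          + (2 / P.θ) • (G.loopColsᵀ * G.rosetteForm P * G.loopCols) := by
      conv_rhs => rw [rosette_blocks]
      rw [fromBlocks_smul, fromBlocks_add, zero_add, zero_add, zero_add, transpose_smul, smul_neg]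
    rw [h6, Matrix.mul_add, Matrix.add_mul, restrLoop_form_eq, Matrix.mul_smul, Matrix.smul_mul]
    congr 1
    rw [loopChange, fromBlocks_transpose, fromBlocks_multiply, fromBlocks_multiply,
      ← diagonal_zero', ← fromBlocks_diagonal]
    simp
  have h7 := le_abs_det_fromBlocks (fun o : G.Loop => hβ o.1)
    (J := (2 / P.θ) • orderMatrix fun o : G.Loop => G.fst o.1) (A := (2 / P.θ) • G.crossForm P)
    (K := (2 / P.θ) • (G.loopColsᵀ * G.rosetteForm P * G.loopCols).toBlocks₂₂)
    (by rw [transpose_smul, orderMatrix_transpose, smul_neg])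
    (by
      rw [transpose_smul, ← smul_neg]
      congr 1
      have h8 : (G.loopColsᵀ * G.rosetteForm P * G.loopCols)ᵀ
          = -(G.loopColsᵀ * G.rosetteForm P * G.loopCols) := by
        rw [transpose_mul, transpose_mul, transpose_transpose, rosetteForm_transpose,
          Matrix.neg_mul, Matrix.mul_neg, Matrix.mul_assoc]
      ext o o'
      exact congrFun (congrFun h8 (Sum.inr o)) (Sum.inr o'))
    (by
      rw [det_smul, det_crossForm, isUnit_iff_ne_zero]
      exact mul_ne_zero (pow_ne_zero _ (div_ne_zero two_ne_zero hθ))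
        (Finset.prod_ne_zero_iff.2 fun o _ => neg_ne_zero.2 (hA o).ne'))
  -- The upper bound of the spare factor `det B` is the origin of the denominators
  -- $\beta+2/|\theta|$.
  have h9 := abs_det_diagonal_add_orderMatrix_le (b := fun o : G.Loop => G.fst o.1)
    (G.fst_injective.comp Subtype.val_injective) (fun o : G.Loop => hβ o.1) (2 / P.θ)
  have h10 : |G.loopChange.det| = ∏ _o : G.Loop, (1 / 2 : ℝ) := by
    rw [loopChange, det_fromBlocks_zero₁₂, det_one, one_mul, det_diagonal, Finset.abs_prod]
    refine Finset.prod_congr rfl fun o _ => ?_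
    rw [abs_div, abs_two, veps]
    split_ifs <;> simp
  have hpos : ∀ o : G.Loop, 0 < β o.1 + |2 / P.θ| := fun o =>
    add_pos_of_pos_of_nonneg (hβ o.1) (abs_nonneg _)
  have h11 : ∏ o : G.Loop, ((2 / P.θ) ^ 2 * (1 - P.Ω) ^ 2 * (β o.1 / (β o.1 + |2 / P.θ|)))
      ≤ |(fromBlocks (diagonal (fun o : G.Loop => β o.1)
          + (2 / P.θ) • orderMatrix fun o : G.Loop => G.fst o.1)
          ((2 / P.θ) • G.crossForm P) (-((2 / P.θ) • G.crossForm P)ᵀ)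
          ((2 / P.θ) • (G.loopColsᵀ * G.rosetteForm P * G.loopCols).toBlocks₂₂)).det| := by
    have h12 := h7.trans (mul_le_mul_of_nonneg_left h9 (abs_nonneg _))
    rw [← div_le_iff₀ (Finset.prod_pos fun o _ => hpos o)] at h12
    refine le_trans (le_of_le_of_eq (Finset.prod_le_prod (g := fun o : G.Loop =>
      (2 / P.θ * -(1 + G.eps o.1 * P.Ω)) ^ 2 * (β o.1 / (β o.1 + |2 / P.θ|))) (fun o _ => ?_)
      fun o _ => ?_) ?_) h12
    · have := (hβ o.1).le
      have := (hpos o).le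
      positivity
    · have := (hβ o.1).le
      have := (hpos o).le
      rw [mul_pow, neg_sq]
      gcongr
      · linarith [hΩ.2]
      · have := hΩ.1
        rw [eps]
        split_ifs <;> linarith
    · rw [det_smul, det_crossForm, Finset.prod_mul_distrib, Finset.prod_div_distrib,
        Finset.prod_pow, Finset.prod_mul_distrib, Finset.prod_const, Finset.card_univ, mul_div_assoc]
  rw [h5, det_mul, det_mul, det_transpose, abs_mul, abs_mul, h10] at h4
  -- Tree lines get 1/4 from `branchCoeff` squared. For loop lines the two determinants of
  -- `loopChange` give 1/4, which turns $(2/\theta)^2$ into $1/\theta^2$.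
  rw [← Finset.prod_pow, Finset.prod_congr rfl fun t _ => G.branchCoeff_sq t,
    Finset.prod_mul_distrib, mul_assoc, h5]
  refine mul_le_mul_of_nonneg_left (le_trans ?_ h4) (Finset.prod_nonneg fun _ _ => by norm_num)
  refine mul_le_mul_of_nonneg_left ?_ (Finset.prod_nonneg fun t _ => (hβ t.1).le)
  rw [mul_right_comm, ← Finset.prod_mul_distrib]
  refine le_of_eq_of_le ?_ (mul_le_mul_of_nonneg_left h11 (Finset.prod_nonneg fun _ _ => by norm_num))
  rw [← Finset.prod_mul_distrib]
  refine Finset.prod_congr rfl fun o _ => ?_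
  rw [abs_div, abs_two]
  field_simp

end RootedGraph

section Gaussian

open Matrix

variable {D : Type*} [Fintype D]

/-! ### Oscillating Gaussian integrals -/

/-- The exponent of the Gaussian integrals. -/
def gaussExp (d : D → ℝ) (S : Matrix D D ℝ) (k₀ k₁ : D → ℝ) (z : (D → ℝ) × (D → ℝ)) : ℂ :=
  ((-(∑ i, d i * (z.1 i ^ 2 + z.2 i ^ 2) / 2) : ℝ) : ℂ)
    + Complex.I * ((z.1 ⬝ᵥ S *ᵥ z.2 + k₀ ⬝ᵥ z.1 + k₁ ⬝ᵥ z.2 : ℝ) : ℂ)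

theorem continuous_gaussExp (d : D → ℝ) (S : Matrix D D ℝ) (k₀ k₁ : D → ℝ) :
    Continuous (gaussExp d S k₀ k₁) := by
  unfold gaussExp
  simp only [dotProduct, mulVec]
  fun_prop

theorem norm_exp_gaussExp (d : D → ℝ) (S : Matrix D D ℝ) (k₀ k₁ : D → ℝ)
    (z : (D → ℝ) × (D → ℝ)) : ‖Complex.exp (gaussExp d S k₀ k₁ z)‖
      = (∏ i, Real.exp (-(d i / 2) * z.1 i ^ 2)) * ∏ i, Real.exp (-(d i / 2) * z.2 i ^ 2) := by
  rw [Complex.norm_exp, ← Real.exp_sum, ← Real.exp_sum, ← Real.exp_add, gaussExp]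
  congr 1
  simp only [Complex.add_re, Complex.ofReal_re, Complex.mul_re, Complex.I_re, Complex.I_im,
    Complex.ofReal_im, zero_mul, mul_zero, sub_zero, add_zero]
  rw [← Finset.sum_add_distrib, ← Finset.sum_neg_distrib]
  exact Finset.sum_congr rfl fun i _ => by ring

theorem integrable_gauss {d : D → ℝ} (hd : ∀ i, 0 < d i) :
    Integrable fun v : D → ℝ => ∏ i, Real.exp (-(d i / 2) * v i ^ 2) :=
  Integrable.fintype_prod fun i => integrable_exp_neg_mul_sq (half_pos (hd i))

theorem integral_gauss (d : D → ℝ) :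
    ∫ v : D → ℝ, ∏ i, Real.exp (-(d i / 2) * v i ^ 2) = ∏ i, √(2 * Real.pi / d i) := by
  rw [integral_fintype_prod_volume_eq_prod (fun i (x : ℝ) => Real.exp (-(d i / 2) * x ^ 2))]
  refine Finset.prod_congr rfl fun i _ => ?_
  rw [integral_gaussian]
  congr 1
  field_simp

theorem integrable_exp_gaussExp {d : D → ℝ} (hd : ∀ i, 0 < d i) (S : Matrix D D ℝ)
    (k₀ k₁ : D → ℝ) : Integrable fun z => Complex.exp (gaussExp d S k₀ k₁ z) := by
  refine ((integrable_gauss hd).mul_prod (integrable_gauss hd)).mono'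
    (continuous_gaussExp d S k₀ k₁).cexp.aestronglyMeasurable (Eventually.of_forall fun z => ?_)
  rw [norm_exp_gaussExp]

theorem integral_norm_exp_gaussExp {d : D → ℝ} (hd : ∀ i, 0 < d i) (S : Matrix D D ℝ)
    (k₀ k₁ : D → ℝ) : ∫ z, ‖Complex.exp (gaussExp d S k₀ k₁ z)‖ = ∏ i, (2 * Real.pi / d i) := by
  simp only [norm_exp_gaussExp]
  rw [Measure.volume_eq_prod, integral_prod_mul (μ := (volume : Measure (D → ℝ))) (ν := (volume : Measure (D → ℝ)))
    (fun v : D → ℝ => ∏ i, Real.exp (-(d i / 2) * v i ^ 2))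
    (fun v : D → ℝ => ∏ i, Real.exp (-(d i / 2) * v i ^ 2)), integral_gauss,
    ← Finset.prod_mul_distrib]
  refine Finset.prod_congr rfl fun i _ => Real.mul_self_sqrt ?_
  have := hd i
  have := Real.pi_pos
  positivity

theorem integral_cexp_diag {d : D → ℝ} (hd : ∀ i, 0 < d i) (c : D → ℂ) :
    ∫ v : D → ℝ, Complex.exp (∑ i, (-(d i / 2 : ℝ) * (v i : ℂ) ^ 2 + c i * v i))
      = ((∏ i, √(2 * Real.pi / d i) : ℝ) : ℂ) * Complex.exp (∑ i, c i ^ 2 / (2 * d i)) := by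
  have h := GaussianFourier.integral_cexp_neg_sum_mul_add (b := fun i => ((d i / 2 : ℝ) : ℂ))
    (fun i => by rw [Complex.ofReal_re]; exact half_pos (hd i)) c
  simp only [← Finset.sum_neg_distrib, ← Finset.sum_add_distrib, ← neg_mul] at h
  rw [h, Finset.prod_mul_distrib, Complex.ofReal_prod, Complex.exp_sum]
  congr 1
  · refine Finset.prod_congr rfl fun i _ => ?_
    have h1 : (0 : ℝ) ≤ 2 * Real.pi / d i := by
      have := hd i
      have := Real.pi_pos
      positivity
    rw [Real.sqrt_eq_rpow, Complex.ofReal_cpow h1]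
    congr 1
    · push_cast
      have : (d i : ℂ) ≠ 0 := Complex.ofReal_ne_zero.2 (hd i).ne'
      field_simp
    · push_cast; rfl
  · refine Finset.prod_congr rfl fun i _ => ?_
    congr 1
    push_cast
    have : (d i : ℂ) ≠ 0 := Complex.ofReal_ne_zero.2 (hd i).ne'
    field_simp
    norm_num

variable [DecidableEq D]

theorem integral_comp_mulVec {E : Type*} [NormedAddCommGroup E] [NormedSpace ℝ E]
    {C : Matrix D D ℝ} (hC : C.det ≠ 0) (F : (D → ℝ) → E) :
    ∫ v, F v = |C.det| • ∫ v, F (C *ᵥ v) := by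
  have h := Real.map_matrix_volume_pi_eq_smul_volume_pi hC
  have h1 : MeasurableEmbedding (toLin' C) := by
    have : IsUnit C.det := isUnit_iff_ne_zero.2 hC
    exact ((toLin' C).toContinuousLinearMap.continuous.measurable).measurableEmbedding
      (Matrix.mulVec_injective_iff_isUnit.2 ((Matrix.isUnit_iff_isUnit_det C).2 this))
  have h2 := h1.integral_map (μ := volume) F
  rw [h, integral_smul_measure, ENNReal.toReal_ofReal (abs_nonneg _)] at h2
  simp only [toLin'_apply] at h2
  rw [← h2, smul_smul, abs_inv, mul_inv_cancel₀ (abs_ne_zero.2 hC), one_smul]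

/-- The exponent in the value of the Gaussian integral. -/
def gaussVal (A : Matrix D D ℝ) (k₀ k₁ : D → ℝ) : ℂ :=
  ((-((k₀ ⬝ᵥ A⁻¹ *ᵥ k₀ + k₁ ⬝ᵥ A⁻¹ *ᵥ k₁) / 2) : ℝ) : ℂ)
    + Complex.I * (((k₀ ⬝ᵥ A⁻¹ *ᵥ k₁ - k₁ ⬝ᵥ A⁻¹ *ᵥ k₀) / 2 : ℝ) : ℂ)

/-- The phase couples the two families only to each other. Integrating the first leaves
$-\sum_i(SV+k_0)_i^2/(2d_i)-\sum_id_iV_i^2/2$. As $V\cdot SV=0$, the quadratic part is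
$-\sum_i(AV)_i^2/(2d_i)$ with $A=d+S$, and the substitution $AV=\sqrt d\,\eta$ makes it standard.
The Jacobian gives $1/|\det A|$ to the first power, because the determinant of the form in both
families is $(\det A)^2$. -/
theorem integral_exp_gaussExp {d : D → ℝ} (hd : ∀ i, 0 < d i) {S : Matrix D D ℝ} (hS : Sᵀ = -S)
    (k₀ k₁ : D → ℝ) : ∫ z, Complex.exp (gaussExp d S k₀ k₁ z)
      = (((2 * Real.pi) ^ Fintype.card D / |(diagonal d + S).det| : ℝ) : ℂ)
        * Complex.exp (gaussVal (diagonal d + S) k₀ k₁) := by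
  have hA := isUnit_det_diagonal_add hd (accretive_of_transpose_eq_neg hS)
  set A := diagonal d + S with hAdef
  have hdet : A.det ≠ 0 := isUnit_iff_ne_zero.1 hA
  have hsq : ∀ i, √(d i) * √(d i) = d i := fun i => Real.mul_self_sqrt (hd i).le
  have hsq0 : ∀ i, √(d i) ≠ 0 := fun i => (Real.sqrt_pos.2 (hd i)).ne'
  have hinner : ∀ V : D → ℝ, ∫ U : D → ℝ, Complex.exp (gaussExp d S k₀ k₁ (U, V))
      = ((∏ i, √(2 * Real.pi / d i) : ℝ) : ℂ)
        * Complex.exp (((-(∑ i, ((S *ᵥ V + k₀) i) ^ 2 / (2 * d i)) - ∑ i, d i * V i ^ 2 / 2 : ℝ) : ℂ)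
          + Complex.I * ((k₁ ⬝ᵥ V : ℝ) : ℂ)) := by
    intro V
    have h1 : ∀ U : D → ℝ, Complex.exp (gaussExp d S k₀ k₁ (U, V))
        = Complex.exp (∑ i, (-(d i / 2 : ℝ) * (U i : ℂ) ^ 2
            + (Complex.I * ((S *ᵥ V + k₀) i : ℝ)) * U i))
          * Complex.exp (((-∑ i, d i * V i ^ 2 / 2 : ℝ) : ℂ) + Complex.I * ((k₁ ⬝ᵥ V : ℝ) : ℂ)) := by
      intro U
      rw [← Complex.exp_add, gaussExp]
      congr 1
      have h2 : U ⬝ᵥ S *ᵥ V + k₀ ⬝ᵥ U = ∑ i, (S *ᵥ V + k₀) i * U i := by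
        rw [dotProduct_comm U, ← add_dotProduct]
        rfl
      rw [h2, Finset.sum_add_distrib]
      push_cast
      rw [mul_add, Finset.mul_sum, ← Finset.sum_neg_distrib, ← Finset.sum_neg_distrib]
      have h3 : ∑ i, -((d i : ℂ) * ((U i : ℂ) ^ 2 + (V i : ℂ) ^ 2) / 2)
          = ∑ i, -((d i : ℂ) / 2) * (U i : ℂ) ^ 2 + ∑ i, -((d i : ℂ) * (V i : ℂ) ^ 2 / 2) := by
        rw [← Finset.sum_add_distrib]
        exact Finset.sum_congr rfl fun i _ => by ring
      rw [h3]
      simp only [mul_assoc]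
      ring
    simp only [h1]
    rw [integral_mul_const, integral_cexp_diag hd, mul_assoc, ← Complex.exp_add]
    congr 2
    rw [← add_assoc]
    congr 1
    push_cast
    rw [sub_eq_add_neg, ← Finset.sum_neg_distrib, ← Finset.sum_neg_distrib]
    congr 1
    refine Finset.sum_congr rfl fun i _ => ?_
    rw [mul_pow, Complex.I_sq]
    ring
  set a := A⁻¹ᵀ *ᵥ k₀ with ha
  set b := A⁻¹ᵀ *ᵥ k₁ with hb
  have hAa : Aᵀ *ᵥ a = k₀ := by
    rw [ha, mulVec_mulVec, ← transpose_mul, nonsing_inv_mul _ hA, transpose_one, one_mulVec]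
  have hAb : Aᵀ *ᵥ b = k₁ := by
    rw [hb, mulVec_mulVec, ← transpose_mul, nonsing_inv_mul _ hA, transpose_one, one_mulVec]
  have hAT : Aᵀ = diagonal d - S := by
    rw [hAdef, transpose_add, diagonal_transpose, hS, sub_eq_add_neg]
  have hSS : ∀ x y : D → ℝ, x ⬝ᵥ S *ᵥ y = -(y ⬝ᵥ S *ᵥ x) := by
    intro x y
    rw [dotProduct_mulVec, ← mulVec_transpose, hS, neg_mulVec, neg_dotProduct, dotProduct_comm]
  have hB : ∀ x y : D → ℝ, ∑ i, d i * x i * y i = (x ⬝ᵥ Aᵀ *ᵥ y + y ⬝ᵥ Aᵀ *ᵥ x) / 2 := by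
    intro x y
    rw [hAT, sub_mulVec, sub_mulVec, dotProduct_sub, dotProduct_sub, hSS y x]
    have h1 : ∀ x y : D → ℝ, x ⬝ᵥ diagonal d *ᵥ y = ∑ i, d i * x i * y i := by
      intro x y
      simp only [dotProduct, mulVec_diagonal]
      exact Finset.sum_congr rfl fun i _ => by ring
    rw [h1, h1, Finset.sum_congr rfl fun i _ => (by ring : d i * y i * x i = d i * x i * y i)]
    ring
  -- The substitution after which the remaining quadratic form is the identity.
  set C := A⁻¹ * diagonal (fun i => √(d i)) with hC
  have hCdet : C.det = (∏ i, √(d i)) / A.det := by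
    rw [hC, det_mul, det_diagonal, det_nonsing_inv, Ring.inverse_eq_inv']
    field_simp
  have hC0 : C.det ≠ 0 := by
    rw [hCdet]
    exact div_ne_zero (Finset.prod_ne_zero_iff.2 fun i _ => hsq0 i) hdet
  have hAC : ∀ η, A *ᵥ (C *ᵥ η) = fun i => √(d i) * η i := by
    intro η
    rw [mulVec_mulVec, hC, ← Matrix.mul_assoc, mul_nonsing_inv _ hA, Matrix.one_mul]
    ext i
    rw [mulVec_diagonal]
  have hkC : ∀ k η : D → ℝ, k ⬝ᵥ C *ᵥ η = ∑ i, √(d i) * (A⁻¹ᵀ *ᵥ k) i * η i := by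
    intro k η
    rw [hC, ← mulVec_mulVec, dotProduct_mulVec, ← mulVec_transpose, dotProduct]
    refine Finset.sum_congr rfl fun i _ => ?_
    rw [mulVec_diagonal]
    ring
  have hexp : ∀ η : D → ℝ, ((-(∑ i, ((S *ᵥ (C *ᵥ η) + k₀) i) ^ 2 / (2 * d i))
        - ∑ i, d i * (C *ᵥ η) i ^ 2 / 2 : ℝ) : ℂ) + Complex.I * ((k₁ ⬝ᵥ (C *ᵥ η) : ℝ) : ℂ)
      = ∑ i, (-((1 : ℝ) / 2 : ℝ) * (η i : ℂ) ^ 2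
          + ((√(d i) * a i - k₀ i / √(d i) : ℝ) + Complex.I * (√(d i) * b i : ℝ)) * η i)
        + ((-∑ i, k₀ i ^ 2 / (2 * d i) : ℝ) : ℂ) := by
    intro η
    -- Completion of the square: the mixed term $\sum_iV_i(SV)_i$ that it needs is zero by
    -- antisymmetry.
    have h1 : -(∑ i, ((S *ᵥ (C *ᵥ η) + k₀) i) ^ 2 / (2 * d i)) - ∑ i, d i * (C *ᵥ η) i ^ 2 / 2
        = -(∑ i, (√(d i) * η i + k₀ i) ^ 2 / (2 * d i)) + k₀ ⬝ᵥ C *ᵥ η := by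
      have h2 : ∀ i, √(d i) * η i = d i * (C *ᵥ η) i + (S *ᵥ (C *ᵥ η)) i := by
        intro i
        have := congrFun (hAC η) i
        rw [← this, hAdef, add_mulVec, Pi.add_apply, mulVec_diagonal]
      have h3 : ∑ i, (C *ᵥ η) i * (S *ᵥ (C *ᵥ η)) i = 0 := by
        have := hSS (C *ᵥ η) (C *ᵥ η)
        rw [dotProduct] at this
        linarith
      simp only [h2]
      rw [dotProduct, ← sub_eq_zero, ← h3, ← Finset.sum_neg_distrib,
        ← Finset.sum_neg_distrib, ← Finset.sum_add_distrib,
        ← Finset.sum_sub_distrib, ← Finset.sum_sub_distrib]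
      refine Finset.sum_congr rfl fun i _ => ?_
      have := (hd i).ne'
      rw [Pi.add_apply]
      field_simp
      ring
    rw [h1, hkC, hkC, ← ha, ← hb]
    push_cast
    rw [Finset.mul_sum, ← Finset.sum_neg_distrib, ← Finset.sum_neg_distrib,
      ← Finset.sum_add_distrib, ← Finset.sum_add_distrib, ← Finset.sum_add_distrib]
    refine Finset.sum_congr rfl fun i _ => ?_
    have h4 : (√(d i) : ℂ) ≠ 0 := Complex.ofReal_ne_zero.2 (hsq0 i)
    have h5 : (d i : ℂ) = (√(d i) : ℂ) * √(d i) := by rw [← Complex.ofReal_mul, hsq]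
    rw [h5]
    field_simp
    ring
  rw [Measure.volume_eq_prod, integral_prod_symm _ (integrable_exp_gaussExp hd S k₀ k₁)]
  simp only [hinner]
  rw [integral_const_mul, integral_comp_mulVec hC0]
  simp only [hexp, Complex.exp_add _ ((-∑ i, k₀ i ^ 2 / (2 * d i) : ℝ) : ℂ)]
  have h6 := integral_cexp_diag (d := fun _ : D => 1) (fun _ => one_pos)
    (fun i => ((√(d i) * a i - k₀ i / √(d i) : ℝ) + Complex.I * (√(d i) * b i : ℝ) : ℂ))
  rw [integral_mul_const, h6, hCdet]
  have h7 : (∏ i, √(2 * Real.pi / d i)) * (|(∏ i, √(d i)) / A.det| * ∏ _i : D, √(2 * Real.pi / 1))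
      = (2 * Real.pi) ^ Fintype.card D / |A.det| := by
    rw [abs_div, abs_of_pos (Finset.prod_pos fun i _ => Real.sqrt_pos.2 (hd i)), div_mul_eq_mul_div,
      ← mul_div_assoc, ← mul_assoc, ← Finset.prod_mul_distrib, ← Finset.prod_mul_distrib]
    congr 1
    rw [← Finset.card_univ, ← Finset.prod_const]
    refine Finset.prod_congr rfl fun i _ => ?_
    rw [Real.sqrt_div (by positivity), div_mul_cancel₀ _ (hsq0 i), div_one,
      Real.mul_self_sqrt (by positivity)]
  rw [← h7, Complex.real_smul, mul_assoc, ← Complex.exp_add]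
  push_cast
  simp only [mul_assoc]
  congr 4
  have h8 : gaussVal A k₀ k₁ = ∑ i, ((d i * (a i + Complex.I * b i) ^ 2 / 2
      - (a i + Complex.I * b i) * k₀ i : ℂ)) := by
    have e1 := hB a a
    have e2 := hB b b
    have e3 := hB a b
    rw [hAa] at e1 e3
    rw [hAb] at e2 e3
    have e4 : ∑ i, ((d i * (a i + Complex.I * b i) ^ 2 / 2 - (a i + Complex.I * b i) * k₀ i : ℂ))
        = ((∑ i, d i * a i * a i) / 2 - (∑ i, d i * b i * b i) / 2 - a ⬝ᵥ k₀ : ℝ)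
          + Complex.I * ((∑ i, d i * a i * b i) - b ⬝ᵥ k₀ : ℝ) := by
      push_cast [dotProduct]
      rw [Finset.sum_div, Finset.sum_div, ← Finset.sum_sub_distrib, ← Finset.sum_sub_distrib,
        ← Finset.sum_sub_distrib, Finset.mul_sum, ← Finset.sum_add_distrib]
      refine Finset.sum_congr rfl fun i _ => ?_
      linear_combination ((d i : ℂ) * b i ^ 2 / 2) * Complex.I_sq
    have e5 : ∀ x y : D → ℝ, x ⬝ᵥ A⁻¹ *ᵥ y = (A⁻¹ᵀ *ᵥ x) ⬝ᵥ y := by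
      intro x y
      rw [dotProduct_mulVec, ← mulVec_transpose]
    rw [e4, e1, e2, e3, gaussVal, e5, e5, e5, e5, ← ha, ← hb]
    push_cast
    ring
  rw [h8, ← Finset.sum_neg_distrib, ← Finset.sum_add_distrib]
  refine Finset.sum_congr rfl fun i _ => ?_
  have h4 : (√(d i) : ℂ) ≠ 0 := Complex.ofReal_ne_zero.2 (hsq0 i)
  have h5 : (d i : ℂ) = (√(d i) : ℂ) * √(d i) := by rw [← Complex.ofReal_mul, hsq]
  rw [h5]
  field_simp
  ring

/-- The inverse of an accretive matrix is accretive. So the linear phases, which contain the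
external positions and the plane waves, never increase the modulus. -/
theorem norm_exp_gaussVal_le {A : Matrix D D ℝ} (hA : Accretive A) (hdet : IsUnit A.det)
    (k₀ k₁ : D → ℝ) : ‖Complex.exp (gaussVal A k₀ k₁)‖ ≤ 1 := by
  rw [Complex.norm_exp, gaussVal, Real.exp_le_one_iff]
  simp only [Complex.add_re, Complex.ofReal_re, Complex.mul_re, Complex.I_re, Complex.I_im,
    Complex.ofReal_im, zero_mul, mul_zero, sub_zero, add_zero]
  have h0 := (hA.inv hdet) k₀
  have h1 := (hA.inv hdet) k₁
  linarith

end Gaussian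

section Oscillating

open Matrix

variable {X T D : Type*} [MeasureSpace X] [MeasureSpace T]
  [SFinite (volume : Measure X)] [SFinite (volume : Measure T)] [Fintype D]

/-! ### Superpositions of oscillating Gaussians -/

theorem measurable_gaussExp {Y : Type*} [MeasurableSpace Y] {d k₀ k₁ : Y → D → ℝ}
    (S : Matrix D D ℝ) (hd : Measurable d) (h₀ : Measurable k₀) (h₁ : Measurable k₁) :
    Measurable fun y : Y × ((D → ℝ) × (D → ℝ)) => gaussExp (d y.1) S (k₀ y.1) (k₁ y.1) y.2 := by
  unfold gaussExp
  simp only [dotProduct, mulVec]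
  have hd' := fun i => measurable_pi_iff.1 hd i
  have h₀' := fun i => measurable_pi_iff.1 h₀ i
  have h₁' := fun i => measurable_pi_iff.1 h₁ i
  fun_prop

/-- Exchange of the last two factors of a product of measure spaces. -/
theorem measurePreserving_prodRightComm {X Y Z : Type*} [MeasureSpace X] [MeasureSpace Y]
    [MeasureSpace Z] [SFinite (volume : Measure X)] [SFinite (volume : Measure Y)]
    [SFinite (volume : Measure Z)] :
    MeasurePreserving (fun p : (X × Y) × Z => ((p.1.1, p.2), p.1.2)) := by
  have h1 := measurePreserving_prodAssoc (volume : Measure X) (volume : Measure Y)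
    (volume : Measure Z)
  have h2 := (MeasurePreserving.id (volume : Measure X)).prod
    (Measure.measurePreserving_swap (μ := (volume : Measure Y)) (ν := (volume : Measure Z)))
  have h3 := (measurePreserving_prodAssoc (volume : Measure X) (volume : Measure Z)
    (volume : Measure Y)).symm
  exact h3.comp (h2.comp h1)

/-- For positive r everything is absolutely integrable and the inner Gaussian integral can be done
first. It is at most $(2\pi)^d/|\det|$, and the determinant at r = 0 is the smallest in modulus; it
provides the majorant for dominated convergence. `hint` serves Fubini at fixed r, where absolute
values cost the full product of the widths; `hlim` is the true bound, with the oscillations taken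
into account. -/
theorem exists_oscillating_limit [DecidableEq D] {W : X × T → ℂ} (hW : Measurable W) {β : T → D → ℝ}
    (hβ : Measurable β) {e : D → ℝ} (hpos : ∀ τ i, ∀ r > 0, 0 < β τ i + r * e i)
    (hβ0 : ∀ τ i, 0 ≤ β τ i) (he : ∀ i, 0 ≤ e i) {S : Matrix D D ℝ} (hS : Sᵀ = -S)
    (hdet : ∀ τ, (diagonal (β τ) + S).det ≠ 0) {k₀ k₁ : X × T → D → ℝ}
    (h₀ : Measurable k₀) (h₁ : Measurable k₁)
    (hint : ∀ r > 0, Integrable fun z : X × T => ‖W z‖ * ∏ i, (β z.2 i + r * e i)⁻¹)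
    (hlim : Integrable fun z : X × T => ‖W z‖ * |(diagonal (β z.2) + S).det|⁻¹) :
    (∀ r > 0, Integrable fun y : X × ((D → ℝ) × (D → ℝ)) => ∫ τ, W (y.1, τ)
      * Complex.exp (gaussExp (fun i => β τ i + r * e i) S (k₀ (y.1, τ)) (k₁ (y.1, τ)) y.2)) ∧
    ∃ A : ℂ, Tendsto (fun r : ℝ => ∫ y : X × ((D → ℝ) × (D → ℝ)), ∫ τ, W (y.1, τ)
      * Complex.exp (gaussExp (fun i => β τ i + r * e i) S (k₀ (y.1, τ)) (k₁ (y.1, τ)) y.2))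
        (𝓝[>] 0) (𝓝 A) ∧
      ‖A‖ ≤ (2 * Real.pi) ^ Fintype.card D
        * ∫ z : X × T, ‖W z‖ * |(diagonal (β z.2) + S).det|⁻¹ := by
  set J : ℝ → (X × T) × ((D → ℝ) × (D → ℝ)) → ℂ := fun r p => W p.1
    * Complex.exp (gaussExp (fun i => β p.1.2 i + r * e i) S (k₀ p.1) (k₁ p.1) p.2) with hJ
  have hJm : ∀ r, Measurable (J r) := by
    intro r
    refine (hW.comp measurable_fst).mul (Complex.measurable_exp.comp
      (measurable_gaussExp (d := fun z : X × T => fun i => β z.2 i + r * e i) S ?_ h₀ h₁))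
    have := fun i => measurable_pi_iff.1 hβ i
    fun_prop
  have hJi : ∀ r > 0, Integrable (J r) := by
    intro r hr
    rw [Measure.volume_eq_prod, integrable_prod_iff (hJm r).aestronglyMeasurable]
    refine ⟨Eventually.of_forall fun z => (integrable_exp_gaussExp (fun i => hpos z.2 i r hr) S
      (k₀ z) (k₁ z)).const_mul (W z), ?_⟩
    have h1 : ∀ z : X × T, ∫ U, ‖J r (z, U)‖
        = (2 * Real.pi) ^ Fintype.card D * (‖W z‖ * ∏ i, (β z.2 i + r * e i)⁻¹) := by
      intro z
      simp only [hJ, norm_mul]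
      rw [integral_const_mul, integral_norm_exp_gaussExp (fun i => hpos z.2 i r hr)]
      simp only [div_eq_mul_inv]
      rw [Finset.prod_mul_distrib, Finset.prod_const, Finset.card_univ]
      ring
    simp only [h1]
    exact (hint r hr).const_mul _
  have hmp := measurePreserving_prodRightComm (X := X) (Y := (D → ℝ) × (D → ℝ)) (Z := T)
  have hJi' : ∀ r > 0, Integrable fun p : (X × ((D → ℝ) × (D → ℝ))) × T =>
      J r ((p.1.1, p.2), p.1.2) := fun r hr => hmp.integrable_comp_of_integrable (hJi r hr)
  refine ⟨fun r hr => ?_, ∫ z : X × T, W z * ((((2 * Real.pi) ^ Fintype.card D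
    / |(diagonal (β z.2) + S).det| : ℝ) : ℂ)
      * Complex.exp (gaussVal (diagonal (β z.2) + S) (k₀ z) (k₁ z))), ?_, ?_⟩
  · have := hJi' r hr
    rw [Measure.volume_eq_prod] at this
    exact this.integral_prod_left
  · have hval : ∀ r > 0, ∀ z : X × T, ∫ U, J r (z, U) = W z * ((((2 * Real.pi) ^ Fintype.card D
        / |(diagonal (fun i => β z.2 i + r * e i) + S).det| : ℝ) : ℂ)
        * Complex.exp (gaussVal (diagonal (fun i => β z.2 i + r * e i) + S) (k₀ z) (k₁ z))) := by
      intro r hr z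
      simp only [hJ]
      rw [integral_const_mul, integral_exp_gaussExp (fun i => hpos z.2 i r hr) hS]
    have hswap : ∀ r > 0, ∫ y : X × ((D → ℝ) × (D → ℝ)), ∫ τ, W (y.1, τ)
        * Complex.exp (gaussExp (fun i => β τ i + r * e i) S (k₀ (y.1, τ)) (k₁ (y.1, τ)) y.2)
        = ∫ z, ∫ U, J r (z, U) := by
      intro r hr
      have h1 := hJi' r hr
      have h2 := hJi r hr
      have h3 := integral_map (μ := volume) hmp.measurable.aemeasurable (f := J r)
        (hJm r).aestronglyMeasurable
      rw [hmp.map_eq] at h3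
      rw [Measure.volume_eq_prod] at h1 h2
      rw [← integral_prod _ h2, ← Measure.volume_eq_prod, h3]
      exact (integral_prod _ h1).symm
    refine Tendsto.congr' (f₁ := fun r => ∫ z, ∫ U, J r (z, U)) ?_ ?_
    · filter_upwards [self_mem_nhdsWithin] with r hr using (hswap r hr).symm
    refine tendsto_integral_filter_of_dominated_convergence
      (fun z => (2 * Real.pi) ^ Fintype.card D * (‖W z‖ * |(diagonal (β z.2) + S).det|⁻¹)) ?_ ?_
      (hlim.const_mul _) ?_
    · filter_upwards [self_mem_nhdsWithin] with r hr
      have h2 := hJi r hr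
      rw [Measure.volume_eq_prod] at h2
      exact h2.integral_prod_left.aestronglyMeasurable
    · filter_upwards [self_mem_nhdsWithin] with r hr
      refine Eventually.of_forall fun z => ?_
      rw [hval r hr z, norm_mul, norm_mul, Complex.norm_real, Real.norm_eq_abs, abs_div, abs_abs,
        abs_of_pos (by positivity), mul_left_comm]
      have h4 := norm_exp_gaussVal_le ((accretive_diagonal fun i => (hpos z.2 i r hr).le).add
        (accretive_of_transpose_eq_neg hS)) (isUnit_det_diagonal_add (fun i => hpos z.2 i r hr)
        (accretive_of_transpose_eq_neg hS)) (k₀ z) (k₁ z)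
      -- Monotonicity in the cut-off: one majorant serves all r.
      have h5 : |(diagonal (β z.2) + S).det| ≤ |(diagonal (fun i => β z.2 i + r * e i) + S).det| := by
        have h6 : diagonal (fun i => β z.2 i + r * e i) + S
            = diagonal (β z.2) + S + diagonal fun i => r * e i := by
          rw [add_right_comm, diagonal_add]
        rw [h6]
        exact abs_det_le_abs_det_add_diagonal ((accretive_diagonal (hβ0 z.2)).add
          (accretive_of_transpose_eq_neg hS)) fun i => mul_nonneg (le_of_lt hr) (he i)
      have h7 := abs_pos.2 (hdet z.2)
      calc (2 * Real.pi) ^ Fintype.card D / |(diagonal (fun i => β z.2 i + r * e i) + S).det|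
            * (‖W z‖ * ‖Complex.exp (gaussVal (diagonal (fun i => β z.2 i + r * e i) + S)
              (k₀ z) (k₁ z))‖)
          ≤ (2 * Real.pi) ^ Fintype.card D / |(diagonal (β z.2) + S).det| * (‖W z‖ * 1) := by
            gcongr
        _ = _ := by rw [mul_one, div_eq_mul_inv]; ring
    · refine Eventually.of_forall fun z => ?_
      have hd : Continuous fun (r : ℝ) i => β z.2 i + r * e i := by fun_prop
      have hA : Continuous fun r : ℝ => diagonal (fun i => β z.2 i + r * e i) + S :=
        hd.matrix_diagonal.add continuous_const
      have hA0 : diagonal (fun i => β z.2 i + 0 * e i) + S = diagonal (β z.2) + S := by simp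
      have hdA : ContinuousAt (fun r : ℝ => (diagonal (fun i => β z.2 i + r * e i) + S).det) 0 :=
        hA.matrix_det.continuousAt
      have hinv : ContinuousAt (fun r : ℝ => (diagonal (fun i => β z.2 i + r * e i) + S)⁻¹) 0 := by
        simp only [Matrix.inv_def, Ring.inverse_eq_inv']
        refine (hdA.inv₀ ?_).smul hA.matrix_adjugate.continuousAt
        rw [hA0]
        exact hdet z.2
      have hg : Continuous fun B : Matrix D D ℝ => Complex.exp
          (((-((k₀ z ⬝ᵥ B *ᵥ k₀ z + k₁ z ⬝ᵥ B *ᵥ k₁ z) / 2) : ℝ) : ℂ)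
            + Complex.I * (((k₀ z ⬝ᵥ B *ᵥ k₁ z - k₁ z ⬝ᵥ B *ᵥ k₀ z) / 2 : ℝ) : ℂ)) := by
        simp only [dotProduct, mulVec]
        fun_prop
      have hc : ContinuousAt (fun r : ℝ => W z * ((((2 * Real.pi) ^ Fintype.card D
          / |(diagonal (fun i => β z.2 i + r * e i) + S).det| : ℝ) : ℂ)
          * Complex.exp (gaussVal (diagonal (fun i => β z.2 i + r * e i) + S) (k₀ z) (k₁ z)))) 0 := by
        refine continuousAt_const.mul (ContinuousAt.mul ?_ (hg.continuousAt.comp hinv))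
        refine Complex.continuous_ofReal.continuousAt.comp (continuousAt_const.div hdA.abs ?_)
        rw [hA0]
        exact abs_ne_zero.2 (hdet z.2)
      have h8 := hc.tendsto.mono_left (nhdsWithin_le_nhds (s := Set.Ioi 0))
      simp only [hA0] at h8
      refine h8.congr' ?_
      filter_upwards [self_mem_nhdsWithin] with r hr using (hval r hr z).symm
  · rw [← integral_const_mul]
    refine norm_integral_le_of_norm_le (hlim.const_mul _) (Eventually.of_forall fun z => ?_)
    rw [norm_mul, norm_mul, Complex.norm_real, Real.norm_eq_abs, abs_div, abs_abs,
        abs_of_pos (by positivity), mul_left_comm]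
    have h4 := norm_exp_gaussVal_le ((accretive_diagonal (hβ0 z.2)).add
        (accretive_of_transpose_eq_neg hS)) (isUnit_iff_ne_zero.2 (hdet z.2)) (k₀ z) (k₁ z)
    have h7 := abs_pos.2 (hdet z.2)
    calc (2 * Real.pi) ^ Fintype.card D / |(diagonal (β z.2) + S).det|
          * (‖W z‖ * ‖Complex.exp (gaussVal (diagonal (β z.2) + S) (k₀ z) (k₁ z))‖)
        ≤ (2 * Real.pi) ^ Fintype.card D / |(diagonal (β z.2) + S).det| * (‖W z‖ * 1) := by
          gcongr
      _ = _ := by rw [mul_one, div_eq_mul_inv]; ring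

end Oscillating

namespace Model

open Matrix

variable (P : Model)

/-! ### The kernel of the propagator -/

theorem Theta_inv (hθ : P.θ ≠ 0) : P.Theta⁻¹ = !![0, 1 / P.θ; -(1 / P.θ), 0] := by
  refine Matrix.inv_eq_right_inv ?_
  rw [Theta, mul_fin_two, one_fin_two]
  simp [hθ]

theorem wedge_eq (hθ : P.θ ≠ 0) (x y : Plane) :
    P.wedge x y = 2 / P.θ * (x 0 * y 1 - x 1 * y 0) := by
  rw [wedge, P.Theta_inv hθ]
  simp only [dotProduct, mulVec, Fin.sum_univ_two, of_apply, cons_val', cons_val_zero, cons_val_one,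
    cons_val_fin_one]
  ring

theorem slash_eq (x : Plane) : P.slash x = ((x 0 : ℝ) : ℂ) • P.γ 0 + ((x 1 : ℝ) : ℂ) • P.γ 1 := by
  rw [slash, Fin.sum_univ_two]

/-- Expressing $\Omega\not\!\tilde x$ through $\not\! x\,\gamma^0\gamma^1$ brings it to the algebra
generated by $\gamma^0\gamma^1$, in which the spin factor lives. -/
theorem slash_tilde (hθ : P.θ ≠ 0) (hγ : P.Clifford) (x : Plane) :
    ((P.Ω : ℝ) : ℂ) • P.slash (P.tilde x) = -((P.Om : ℝ) : ℂ) • (P.slash x * (P.γ 0 * P.γ 1)) := by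
  have h0 : P.tilde x 0 = -(2 / P.θ * x 1) := by
    rw [tilde, P.Theta_inv hθ]
    simp [vecHead, vecTail]
    ring
  have h1 : P.tilde x 1 = 2 / P.θ * x 0 := by
    rw [tilde, P.Theta_inv hθ]
    simp [vecHead, vecTail]
    ring
  have g0 : P.γ 0 * P.γ 0 = -1 := by
    have := hγ 0 0
    rw [if_pos rfl, ← two_smul ℂ] at this
    simpa using congrArg (fun A => (1 / 2 : ℂ) • A) this
  have g1 : P.γ 1 * P.γ 1 = -1 := by
    have := hγ 1 1
    rw [if_pos rfl, ← two_smul ℂ] at this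
    simpa using congrArg (fun A => (1 / 2 : ℂ) • A) this
  have g01 : P.γ 1 * P.γ 0 = -(P.γ 0 * P.γ 1) := by
    have := hγ 1 0
    rw [if_neg (by decide)] at this
    exact eq_neg_of_add_eq_zero_left this
  have e0 : P.γ 0 * (P.γ 0 * P.γ 1) = -P.γ 1 := by
    rw [← Matrix.mul_assoc, g0, Matrix.neg_mul, Matrix.one_mul]
  have e1 : P.γ 1 * (P.γ 0 * P.γ 1) = P.γ 0 := by
    rw [← Matrix.mul_assoc, g01, Matrix.neg_mul, Matrix.mul_assoc, g1, Matrix.mul_neg, Matrix.mul_one,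
      neg_neg]
  rw [slash_eq, slash_eq, Matrix.add_mul, Matrix.smul_mul, Matrix.smul_mul, e0, e1, h0, h1, Om]
  push_cast
  module

theorem spinFactor_eq (hθ : P.θ ≠ 0) (hγ : P.Clifford) (t : ℝ) : P.spinFactor t
    = ((Real.cosh (2 * P.Om * t) : ℝ) : ℂ) • 1
      - (Complex.I * ((Real.sinh (2 * P.Om * t) : ℝ) : ℂ)) • (P.γ 0 * P.γ 1) := by
  have g01 : P.γ 1 * P.γ 0 = -(P.γ 0 * P.γ 1) := by
    have := hγ 1 0
    rw [if_neg (by decide)] at this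
    exact eq_neg_of_add_eq_zero_left this
  have h : P.gammaThetaGamma = ((2 / P.θ : ℝ) : ℂ) • (P.γ 0 * P.γ 1) := by
    rw [gammaThetaGamma, P.Theta_inv hθ]
    simp only [Fin.sum_univ_two, of_apply, cons_val', cons_val_zero, cons_val_one, cons_val_fin_one,
      g01]
    push_cast
    module
  rw [spinFactor, h, smul_smul]
  congr 2
  have : (P.θ : ℂ) ≠ 0 := Complex.ofReal_ne_zero.2 hθ
  push_cast
  field_simp

theorem gamma_mul_self (hγ : P.Clifford) : P.γ 0 * P.γ 1 * (P.γ 0 * P.γ 1) = -1 := by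
  have g0 : P.γ 0 * P.γ 0 = -1 := by
    have := hγ 0 0
    rw [if_pos rfl, ← two_smul ℂ] at this
    simpa using congrArg (fun A => (1 / 2 : ℂ) • A) this
  have g1 : P.γ 1 * P.γ 1 = -1 := by
    have := hγ 1 1
    rw [if_pos rfl, ← two_smul ℂ] at this
    simpa using congrArg (fun A => (1 / 2 : ℂ) • A) this
  have g01 : P.γ 1 * P.γ 0 = -(P.γ 0 * P.γ 1) := by
    have := hγ 1 0
    rw [if_neg (by decide)] at this
    exact eq_neg_of_add_eq_zero_left this
  rw [Matrix.mul_assoc, ← Matrix.mul_assoc (P.γ 1), g01, Matrix.neg_mul, Matrix.mul_neg,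
    Matrix.mul_assoc (P.γ 0) (P.γ 1), g1, ← Matrix.mul_assoc, g0]
  simp

theorem Om_eq {t : ℝ} (hS : P.sinhOver t ≠ 0) :
    P.Om = Real.sinh (2 * P.Om * t) / (2 * P.sinhOver t) := by
  by_cases hΩ : P.Ω = 0
  · simp [Om, hΩ]
  · rw [sinhOver, if_neg hΩ] at hS ⊢
    have h1 : P.Om ≠ 0 := by
      intro h; apply hS; simp [h]
    have h2 : Real.sinh (2 * P.Om * t) ≠ 0 := by
      intro h; apply hS; simp [h]
    generalize Real.sinh (2 * P.Om * t) = s at *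
    field_simp

/-- $\gamma^0\gamma^1$ squares to −1, so the product of the brackets is governed by
$\cosh^2-\sinh^2=1$: the hyperbolic growth cancels in the $\not\! x$ term and survives only in the
mass term. -/
theorem kernel_matrix (hθ : P.θ ≠ 0) (hγ : P.Clifford) {t : ℝ} (hS : P.sinhOver t ≠ 0) (x : Plane) :
    ((Complex.I * ((P.omCoth t : ℝ) : ℂ)) • P.slash x + ((P.Ω : ℝ) : ℂ) • P.slash (P.tilde x)
      - ((P.m : ℝ) : ℂ) • 1) * P.spinFactor t
    = (Complex.I / (2 * P.sinhOver t)) • P.slash x - ((P.m : ℝ) : ℂ) • P.spinFactor t := by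
  rw [Matrix.sub_mul, Matrix.smul_mul, Matrix.one_mul, P.slash_tilde hθ hγ]
  congr 1
  have hS' : (P.sinhOver t : ℂ) ≠ 0 := Complex.ofReal_ne_zero.2 hS
  have hO : (P.Om : ℂ) = Real.sinh (2 * P.Om * t) / (2 * P.sinhOver t) := by
    exact_mod_cast congrArg (fun r : ℝ => (r : ℂ)) (P.Om_eq hS)
  have hc : ((Real.cosh (2 * P.Om * t) : ℝ) : ℂ) ^ 2 - ((Real.sinh (2 * P.Om * t) : ℝ) : ℂ) ^ 2 = 1 := by
    exact_mod_cast Real.cosh_sq_sub_sinh_sq (2 * P.Om * t)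
  rw [P.spinFactor_eq hθ hγ, omCoth]
  generalize Real.cosh (2 * P.Om * t) = c at *
  generalize Real.sinh (2 * P.Om * t) = s at *
  rw [hO]
  rw [Matrix.add_mul, Matrix.mul_sub, Matrix.mul_sub]
  simp only [Matrix.smul_mul, Matrix.mul_smul, Matrix.mul_one, Matrix.mul_assoc]
  rw [← Matrix.mul_assoc (P.γ 0) (P.γ 1), P.gamma_mul_self hγ]
  simp only [smul_smul, Matrix.mul_neg, Matrix.mul_one, smul_neg]
  push_cast
  have e1 : Complex.I / (2 * (P.sinhOver t : ℂ))
      = (c : ℂ) * (Complex.I * (c / (2 * P.sinhOver t)))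
        - (Complex.I * s) * (s / (2 * P.sinhOver t)) := by
    field_simp
    linear_combination -hc
  rw [e1]
  linear_combination (norm := module) (-((s : ℂ) * c / (2 * P.sinhOver t)) * Complex.I_sq) •
    (P.slash x * (P.γ 0 * P.γ 1))

end Model

/-! ### Gaussians as superpositions of plane waves -/

/-- The weight of `exp (i κ u)` in `exp (-α u² / 4 + s u)`. -/
def planeWeight (α s κ : ℝ) : ℂ :=
  (((√(Real.pi * α))⁻¹ : ℝ) : ℂ) * Complex.exp (((s : ℂ) - Complex.I * κ) ^ 2 / α)

/-- The weight of `exp (i κ u)` in `u exp (-α u² / 4 + s u)`. -/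
def planeWeight' (α s κ : ℝ) : ℂ := (2 / α * ((s : ℂ) - Complex.I * κ)) * planeWeight α s κ

/-- The real exponential of rate s shifts the Fourier variable into the complex plane; the price is
the factor $e^{s^2/\alpha}$. -/
theorem norm_planeWeight {α : ℝ} (s κ : ℝ) : ‖planeWeight α s κ‖
    = (√(Real.pi * α))⁻¹ * Real.exp (s ^ 2 / α) * Real.exp (-(1 / α) * κ ^ 2) := by
  rw [planeWeight, norm_mul, Complex.norm_real, Real.norm_of_nonneg (by positivity),
    Complex.norm_exp, mul_assoc, ← Real.exp_add]
  congr 2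
  have : ((s : ℂ) - Complex.I * κ) ^ 2 / α
      = (((s ^ 2 - κ ^ 2) / α : ℝ) : ℂ) + Complex.I * ((-(2 * s * κ) / α : ℝ) : ℂ) := by
    push_cast
    linear_combination ((κ : ℂ) ^ 2 / α) * Complex.I_sq
  rw [this, Complex.add_re, Complex.ofReal_re, Complex.I_mul_re, Complex.ofReal_im]
  ring

theorem continuous_planeWeight (α s : ℝ) : Continuous (planeWeight α s) := by
  unfold planeWeight
  fun_prop

theorem continuous_planeWeight' (α s : ℝ) : Continuous (planeWeight' α s) := by
  unfold planeWeight'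
  exact (by fun_prop : Continuous fun κ : ℝ => 2 / (α : ℂ) * ((s : ℂ) - Complex.I * κ)).mul
    (continuous_planeWeight α s)

theorem integrable_planeWeight {α : ℝ} (hα : 0 < α) (s : ℝ) : Integrable (planeWeight α s) := by
  refine ((integrable_exp_neg_mul_sq (b := 1 / α) (by positivity)).const_mul
    ((√(Real.pi * α))⁻¹ * Real.exp (s ^ 2 / α))).mono'
    (continuous_planeWeight α s).aestronglyMeasurable (Eventually.of_forall fun κ => ?_)
  rw [norm_planeWeight]

theorem integral_norm_planeWeight {α : ℝ} (hα : 0 < α) (s : ℝ) :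
    ∫ κ, ‖planeWeight α s κ‖ = Real.exp (s ^ 2 / α) := by
  simp only [norm_planeWeight]
  rw [integral_const_mul, integral_gaussian, div_div_eq_mul_div, div_one, mul_right_comm,
    inv_mul_cancel₀ (by positivity), one_mul]

theorem norm_planeWeight'_le {α : ℝ} (hα : 0 < α) (s κ : ℝ) : ‖planeWeight' α s κ‖
    ≤ 2 / α * (√(Real.pi * α))⁻¹ * Real.exp (s ^ 2 / α)
      * (|s| * Real.exp (-(1 / α) * κ ^ 2) + √α * Real.exp (-(1 / (2 * α)) * κ ^ 2)) := by
  rw [planeWeight', norm_mul, norm_mul, norm_planeWeight]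
  have h1 : ‖(2 / α : ℂ)‖ = 2 / α := by
    rw [norm_div, Complex.norm_real, Real.norm_of_nonneg hα.le, Complex.norm_ofNat]
  have h2 : ‖(s : ℂ) - Complex.I * κ‖ ≤ |s| + |κ| := by
    refine (norm_sub_le _ _).trans (le_of_eq ?_)
    rw [norm_mul, Complex.norm_I, one_mul, Complex.norm_real, Complex.norm_real, Real.norm_eq_abs,
      Real.norm_eq_abs]
  -- Half of the Gaussian pays for the factor $|\kappa|$, by $y\le1+y^2/2\le e^{y^2/2}$ with
  -- $y=|\kappa|/\sqrt\alpha$.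
  have h3 : |κ| * Real.exp (-(1 / α) * κ ^ 2) ≤ √α * Real.exp (-(1 / (2 * α)) * κ ^ 2) := by
    have h4 : |κ| / √α ≤ Real.exp ((1 / (2 * α)) * κ ^ 2) := by
      refine le_trans ?_ (Real.add_one_le_exp _)
      have h5 : (|κ| / √α) ^ 2 = κ ^ 2 / α := by
        rw [div_pow, sq_abs, Real.sq_sqrt hα.le]
      have h6 : 1 / (2 * α) * κ ^ 2 = (|κ| / √α) ^ 2 / 2 := by rw [h5]; field_simp
      rw [h6]
      nlinarith [sq_nonneg (|κ| / √α - 1)]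
    rw [div_le_iff₀ (Real.sqrt_pos.2 hα)] at h4
    calc |κ| * Real.exp (-(1 / α) * κ ^ 2)
        ≤ Real.exp ((1 / (2 * α)) * κ ^ 2) * √α * Real.exp (-(1 / α) * κ ^ 2) := by gcongr
      _ = √α * (Real.exp ((1 / (2 * α)) * κ ^ 2) * Real.exp (-(1 / α) * κ ^ 2)) := by ring
      _ = _ := by
        rw [← Real.exp_add]
        congr 2
        field_simp
        ring
  rw [h1]
  calc 2 / α * ‖(s : ℂ) - Complex.I * κ‖
        * ((√(Real.pi * α))⁻¹ * Real.exp (s ^ 2 / α) * Real.exp (-(1 / α) * κ ^ 2))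
      ≤ 2 / α * (|s| + |κ|)
        * ((√(Real.pi * α))⁻¹ * Real.exp (s ^ 2 / α) * Real.exp (-(1 / α) * κ ^ 2)) := by gcongr
    _ = 2 / α * (√(Real.pi * α))⁻¹ * Real.exp (s ^ 2 / α)
      * (|s| * Real.exp (-(1 / α) * κ ^ 2) + |κ| * Real.exp (-(1 / α) * κ ^ 2)) := by ring
    _ ≤ _ := by gcongr

theorem integrable_planeWeight'_bound {α : ℝ} (hα : 0 < α) (s : ℝ) : Integrable fun κ : ℝ =>
    2 / α * (√(Real.pi * α))⁻¹ * Real.exp (s ^ 2 / α)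
      * (|s| * Real.exp (-(1 / α) * κ ^ 2) + √α * Real.exp (-(1 / (2 * α)) * κ ^ 2)) :=
  (((integrable_exp_neg_mul_sq (by positivity)).const_mul _).add
    ((integrable_exp_neg_mul_sq (by positivity)).const_mul _)).const_mul _

theorem integrable_planeWeight' {α : ℝ} (hα : 0 < α) (s : ℝ) : Integrable (planeWeight' α s) :=
  (integrable_planeWeight'_bound hα s).mono' (continuous_planeWeight' α s).aestronglyMeasurable
    (Eventually.of_forall fun κ => norm_planeWeight'_le hα s κ)

theorem integral_norm_planeWeight'_le {α : ℝ} (hα : 0 < α) (s : ℝ) :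
    ∫ κ, ‖planeWeight' α s κ‖ ≤ 2 / α * (|s| + 2 * √α) * Real.exp (s ^ 2 / α) := by
  refine (integral_mono (integrable_planeWeight' hα s).norm (integrable_planeWeight'_bound hα s)
    (norm_planeWeight'_le hα s)).trans ?_
  rw [integral_const_mul, integral_add ((integrable_exp_neg_mul_sq (by positivity)).const_mul _)
    ((integrable_exp_neg_mul_sq (by positivity)).const_mul _), integral_const_mul,
    integral_const_mul, integral_gaussian, integral_gaussian]
  have h1 : Real.pi / (1 / α) = Real.pi * α := by rw [div_div_eq_mul_div, div_one]
  have h2 : √(Real.pi / (1 / (2 * α))) = √2 * √(Real.pi * α) := by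
    rw [div_div_eq_mul_div, div_one, ← Real.sqrt_mul (by norm_num)]
    congr 1; ring
  have h3 : √(Real.pi * α) ≠ 0 := by positivity
  have h4 : √2 ≤ 2 := Real.sqrt_le_iff.2 ⟨by norm_num, by norm_num⟩
  rw [h1, h2]
  calc 2 / α * (√(Real.pi * α))⁻¹ * Real.exp (s ^ 2 / α)
        * (|s| * √(Real.pi * α) + √α * (√2 * √(Real.pi * α)))
      = 2 / α * (|s| + √2 * √α) * Real.exp (s ^ 2 / α) := by field_simp
    _ ≤ _ := by gcongr

/-- Fourier inversion of a shifted Gaussian. The exponent $-\alpha u^2/4$ is half of that of the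
propagator; the other half is not expanded and provides the widths β. -/
theorem integral_planeWeight {α : ℝ} (hα : 0 < α) (s u : ℝ) :
    ∫ κ, planeWeight α s κ * Complex.exp (Complex.I * ((κ * u : ℝ) : ℂ))
      = ((Real.exp (-(α / 4) * u ^ 2 + s * u) : ℝ) : ℂ) := by
  have hα' : (α : ℂ) ≠ 0 := Complex.ofReal_ne_zero.2 hα.ne'
  have h := integral_cexp_quadratic (b := -(1 / α : ℂ)) (by
    rw [← Complex.ofReal_one, ← Complex.ofReal_div, ← Complex.ofReal_neg, Complex.ofReal_re]
    have : 0 < 1 / α := by positivity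
    linarith) (Complex.I * (u - 2 * s / α)) (s ^ 2 / α)
  have h1 : ∀ κ : ℝ, planeWeight α s κ * Complex.exp (Complex.I * ((κ * u : ℝ) : ℂ))
      = (((√(Real.pi * α))⁻¹ : ℝ) : ℂ)
        * Complex.exp (-(1 / α : ℂ) * κ ^ 2 + Complex.I * (u - 2 * s / α) * κ + s ^ 2 / α) := by
    intro κ
    rw [planeWeight, mul_assoc, ← Complex.exp_add]
    congr 2
    push_cast
    field_simp
    linear_combination ((κ : ℂ) ^ 2) * Complex.I_sq
  simp only [h1]
  rw [integral_const_mul, h]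
  have h2 : ((Real.pi : ℂ) / - -(1 / α : ℂ)) ^ (1 / 2 : ℂ) = ((√(Real.pi * α) : ℝ) : ℂ) := by
    rw [neg_neg, div_div_eq_mul_div, div_one, Real.sqrt_eq_rpow, ← Complex.ofReal_mul,
      Complex.ofReal_cpow (by positivity)]
    push_cast; rfl
  rw [h2, ← mul_assoc, ← Complex.ofReal_mul, inv_mul_cancel₀ (by positivity), Complex.ofReal_one,
    one_mul, Complex.ofReal_exp]
  congr 1
  push_cast
  field_simp
  linear_combination ((α * u - 2 * s : ℂ) ^ 2) * Complex.I_sq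

theorem integrable_mul_wave {F : ℝ → ℂ} (hF : Integrable F) (u : ℝ) :
    Integrable fun κ => F κ * Complex.exp (Complex.I * ((κ * u : ℝ) : ℂ)) := by
  refine hF.mul_bdd (c := 1) (by fun_prop : Continuous fun κ : ℝ =>
    Complex.exp (Complex.I * ((κ * u : ℝ) : ℂ))).aestronglyMeasurable (Eventually.of_forall fun κ => ?_)
  rw [mul_comm, Complex.norm_exp_ofReal_mul_I]

/-- `planeWeight'` is, up to a factor i, the derivative of `planeWeight` in κ. The integral of the
derivative of weight times wave vanishes, which trades the derivative for a factor u. -/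
theorem integral_planeWeight' {α : ℝ} (hα : 0 < α) (s u : ℝ) :
    ∫ κ, planeWeight' α s κ * Complex.exp (Complex.I * ((κ * u : ℝ) : ℂ))
      = (u : ℂ) * ((Real.exp (-(α / 4) * u ^ 2 + s * u) : ℝ) : ℂ) := by
  have h1 : ∀ κ : ℝ, HasDerivAt
      (fun κ : ℝ => planeWeight α s κ * Complex.exp (Complex.I * ((κ * u : ℝ) : ℂ)))
      (-Complex.I * (planeWeight' α s κ * Complex.exp (Complex.I * ((κ * u : ℝ) : ℂ)))
        + Complex.I * u * (planeWeight α s κ * Complex.exp (Complex.I * ((κ * u : ℝ) : ℂ)))) κ := by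
    intro κ
    have d0 : HasDerivAt (fun κ : ℝ => (κ : ℂ)) 1 κ := Complex.ofRealCLM.hasDerivAt
    have d1 : HasDerivAt (planeWeight α s) (-Complex.I * planeWeight' α s κ) κ := by
      have := (((((d0.const_mul Complex.I).const_sub (s : ℂ)).pow 2).div_const (α : ℂ)).cexp).const_mul
        (((√(Real.pi * α))⁻¹ : ℝ) : ℂ)
      refine this.congr_deriv ?_
      simp only [planeWeight', planeWeight, Pi.pow_apply]
      push_cast
      ring
    have d2 : HasDerivAt (fun κ : ℝ => Complex.exp (Complex.I * ((κ * u : ℝ) : ℂ)))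
        (Complex.exp (Complex.I * ((κ * u : ℝ) : ℂ)) * (Complex.I * u)) κ := by
      have := ((d0.mul_const (u : ℂ)).const_mul Complex.I).cexp
      simp only [← Complex.ofReal_mul, one_mul] at this
      exact this
    exact (d1.mul d2).congr_deriv (by ring)
  have i1 := integrable_mul_wave (integrable_planeWeight hα s) u
  have i2 := integrable_mul_wave (integrable_planeWeight' hα s) u
  have h2 := integral_eq_zero_of_hasDerivAt_of_integrable h1
    ((i2.const_mul _).add (i1.const_mul _)) i1
  rw [integral_add (i2.const_mul _) (i1.const_mul _), integral_const_mul, integral_const_mul,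
    integral_planeWeight hα] at h2
  have h3 : Complex.I ≠ 0 := Complex.I_ne_zero
  have h4 : Complex.I * (∫ κ, planeWeight' α s κ * Complex.exp (Complex.I * ((κ * u : ℝ) : ℂ)))
      = Complex.I * ((u : ℂ) * ((Real.exp (-(α / 4) * u ^ 2 + s * u) : ℝ) : ℂ)) := by
    linear_combination -h2
  exact mul_left_cancel₀ h3 h4

namespace Model

variable (P : Model)

/-! ### Estimates on the parametric representation of the propagator -/

theorem Om_ne_zero (hθ : P.θ ≠ 0) (hΩ : P.Ω ≠ 0) : P.Om ≠ 0 :=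
  div_ne_zero (mul_ne_zero two_ne_zero hΩ) hθ

theorem le_sinhOver (hθ : P.θ ≠ 0) {t : ℝ} (ht : 0 < t) : t ≤ P.sinhOver t := by
  rw [sinhOver]
  split_ifs with h
  · exact le_rfl
  · rcases (P.Om_ne_zero hθ h).lt_or_gt with h1 | h1
    · rw [le_div_iff_of_neg (by linarith), mul_comm]
      exact Real.sinh_le_self_iff.2 (by nlinarith)
    · rw [le_div_iff₀ (by linarith), mul_comm]
      exact Real.self_le_sinh_iff.2 (by positivity)

theorem sinhOver_pos (hθ : P.θ ≠ 0) {t : ℝ} (ht : 0 < t) : 0 < P.sinhOver t :=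
  ht.trans_le (P.le_sinhOver hθ ht)

theorem omCoth_pos (hθ : P.θ ≠ 0) {t : ℝ} (ht : 0 < t) : 0 < P.omCoth t :=
  div_pos (Real.cosh_pos _) (mul_pos two_pos (P.sinhOver_pos hθ ht))

theorem _root_.Real.sinh_le_mul_cosh {x : ℝ} (hx : 0 ≤ x) : Real.sinh x ≤ x * Real.cosh x := by
  rcases hx.eq_or_lt with rfl | hx
  · simp
  obtain ⟨c, hc, h⟩ := exists_hasDerivAt_eq_slope Real.sinh Real.cosh hx
    Real.continuous_sinh.continuousOn fun y _ => Real.hasDerivAt_sinh y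
  rw [Real.sinh_zero, sub_zero, sub_zero, eq_div_iff hx.ne'] at h
  rw [← h, mul_comm]
  refine mul_le_mul_of_nonneg_left (Real.cosh_le_cosh.2 ?_) hx.le
  rw [abs_of_pos hc.1, abs_of_pos hx]
  exact hc.2.le

theorem sinhOver_le (hθ : P.θ ≠ 0) {t : ℝ} (ht : 0 < t) :
    P.sinhOver t ≤ t * Real.cosh (2 * P.Om * t) := by
  rw [sinhOver]
  split_ifs with h
  · exact le_mul_of_one_le_right ht.le (Real.one_le_cosh _)
  · rcases (P.Om_ne_zero hθ h).lt_or_gt with h1 | h1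
    · rw [div_le_iff_of_neg (by linarith), ← neg_le_neg_iff, ← Real.sinh_neg,
        ← Real.cosh_neg (2 * P.Om * t)]
      refine (Real.sinh_le_mul_cosh (x := -(2 * P.Om * t)) (by nlinarith)).trans (le_of_eq (by ring))
    · rw [div_le_iff₀ (by linarith)]
      exact (Real.sinh_le_mul_cosh (by positivity)).trans (le_of_eq (by ring))

theorem inv_omCoth_le (hθ : P.θ ≠ 0) {t : ℝ} (ht : 0 < t) : (P.omCoth t)⁻¹ ≤ 2 * t := by
  rw [omCoth, inv_div, div_le_iff₀ (Real.cosh_pos _)]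
  linarith [P.sinhOver_le hθ ht]

theorem abs_sinh_eq (hθ : P.θ ≠ 0) {t : ℝ} (ht : 0 < t) :
    |Real.sinh (2 * P.Om * t)| = 2 * |P.Om| * P.sinhOver t := by
  have h := P.sinhOver_pos hθ ht
  have h1 := P.Om_eq h.ne'
  rw [eq_div_iff (by positivity)] at h1
  rw [← h1, abs_mul, abs_of_pos (by positivity : 0 < 2 * P.sinhOver t)]
  ring

theorem abs_Om_le_omCoth (hθ : P.θ ≠ 0) {t : ℝ} (ht : 0 < t) : |P.Om| ≤ P.omCoth t := by
  have h := P.sinhOver_pos hθ ht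
  rw [omCoth, le_div_iff₀ (by positivity)]
  refine le_trans (le_of_eq ?_) (abs_le_of_sq_le_sq
    (b := Real.cosh (2 * P.Om * t)) (a := Real.sinh (2 * P.Om * t))
    (by linarith [Real.cosh_sq_sub_sinh_sq (2 * P.Om * t)]) (Real.cosh_pos _).le)
  rw [P.abs_sinh_eq hθ ht]
  ring

theorem omCoth_le (hθ : P.θ ≠ 0) {t : ℝ} (ht : 0 < t) : P.omCoth t ≤ 1 / (2 * t) + |P.Om| := by
  have h := P.sinhOver_pos hθ ht
  have h1 : Real.cosh (2 * P.Om * t) ≤ 1 + |Real.sinh (2 * P.Om * t)| := by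
    have h2 := Real.cosh_sq_sub_sinh_sq (2 * P.Om * t)
    have h3 := abs_nonneg (Real.sinh (2 * P.Om * t))
    rw [← sq_abs (Real.sinh _)] at h2
    nlinarith [Real.cosh_pos (2 * P.Om * t)]
  rw [P.abs_sinh_eq hθ ht] at h1
  calc P.omCoth t ≤ (1 + 2 * |P.Om| * P.sinhOver t) / (2 * P.sinhOver t) := by
        rw [omCoth]; gcongr
    _ = 1 / (2 * P.sinhOver t) + |P.Om| := by field_simp
    _ ≤ _ := by
        have := P.le_sinhOver hθ ht
        gcongr

/-- The rate of an exponential decay that the propagators can absorb. -/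
def rate : ℝ := if P.m = 0 then 1 else |P.m| / 4

theorem rate_pos : 0 < P.rate := by
  rw [rate]
  split_ifs with h
  · exact one_pos
  · have := abs_pos.2 h
    positivity

/-- A bound on the matrices of the model. -/
def gammaBound : ℝ := 1 + ∑ a, ∑ b, (‖P.γ 0 a b‖ + ‖P.γ 1 a b‖ + ‖(P.γ 0 * P.γ 1) a b‖)

theorem le_gammaBound (a b : Fin 2) :
    1 + (‖P.γ 0 a b‖ + ‖P.γ 1 a b‖ + ‖(P.γ 0 * P.γ 1) a b‖) ≤ P.gammaBound := by
  rw [gammaBound]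
  gcongr
  have h0 : ∀ a b, 0 ≤ ‖P.γ 0 a b‖ + ‖P.γ 1 a b‖ + ‖(P.γ 0 * P.γ 1) a b‖ := fun a b => by positivity
  exact (Finset.single_le_sum (f := fun b => ‖P.γ 0 a b‖ + ‖P.γ 1 a b‖ + ‖(P.γ 0 * P.γ 1) a b‖)
    (fun b _ => h0 a b) (Finset.mem_univ b)).trans
    (Finset.single_le_sum (f := fun a => ∑ b, (‖P.γ 0 a b‖ + ‖P.γ 1 a b‖ + ‖(P.γ 0 * P.γ 1) a b‖))
      (fun a _ => Finset.sum_nonneg fun b _ => h0 a b) (Finset.mem_univ a))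

theorem gammaBound_pos : 0 < P.gammaBound :=
  lt_of_lt_of_le (by positivity) (P.le_gammaBound 0 0)

/-- The bound on the weight of the parameter `t`. -/
def mass (t : ℝ) : ℝ :=
  P.gammaBound * Real.exp (-t * P.m ^ 2) * Real.exp (2 * P.rate ^ 2 * (P.omCoth t)⁻¹)
    * ((t ^ 2)⁻¹ * (P.rate * (P.omCoth t)⁻¹ + 2 * √((P.omCoth t)⁻¹)) + |P.m| * P.omCoth t)

theorem slice_pos (hM : 1 < P.M) {i : ℕ} {t : ℝ} (ht : t ∈ P.slice i) : 0 < t := by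
  have h0 : (0 : ℝ) < P.M := by linarith
  rw [slice] at ht
  split_ifs at ht with h
  · exact one_pos.trans ht
  · exact (zpow_pos h0 _).trans ht.1

theorem measurableSet_slice (i : ℕ) : MeasurableSet (P.slice i) := by
  rw [slice]
  split_ifs
  · exact measurableSet_Ioi
  · exact measurableSet_Ioc

theorem mem_slice_succ (hM : 1 < P.M) {i : ℕ} {t : ℝ} (ht : t ∈ P.slice (i + 1)) :
    (P.M ^ (i + 1))⁻¹ ^ 2 ≤ t ∧ t ≤ (P.M * (P.M ^ (i + 1))⁻¹) ^ 2 ∧ t ≤ 1 := by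
  have h0 : (0 : ℝ) < P.M := by linarith
  rw [slice, if_neg (Nat.succ_ne_zero i)] at ht
  have e1 : P.M ^ (-2 * ((i + 1 : ℕ) : ℤ)) = (P.M ^ (i + 1))⁻¹ ^ 2 := by
    rw [mul_comm, zpow_mul, zpow_natCast, zpow_neg, inv_pow]
    norm_cast
  have e2 : P.M ^ (-2 * (((i + 1 : ℕ) : ℤ) - 1)) = (P.M * (P.M ^ (i + 1))⁻¹) ^ 2 := by
    rw [mul_sub, mul_one, sub_neg_eq_add, zpow_add₀ h0.ne', e1, mul_pow, mul_comm]
    norm_cast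
  rw [e1, e2] at ht
  refine ⟨ht.1.le, ht.2, ht.2.trans ?_⟩
  have e3 : P.M * (P.M ^ (i + 1))⁻¹ = (P.M ^ i)⁻¹ := by
    rw [pow_succ]; field_simp
  rw [e3]
  exact pow_le_one₀ (by positivity) (inv_le_one_of_one_le₀ (one_le_pow₀ hM.le))

/-- Scaling with $t\sim M^{-2i}$ and $\alpha^{-1}\lesssim t$: the dominant term
$t^{-2}\alpha^{-1/2}$ is of order $M^{3i}$, and the mass term of order at most $M^{2i}$. -/
theorem exists_mass_bound_succ (hθ : P.θ ≠ 0) (hM : 1 < P.M) : ∃ C : ℝ, 0 ≤ C ∧ ∀ i : ℕ,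
    ∀ t ∈ P.slice (i + 1), P.mass t ≤ C * (P.M ^ (i + 1)) ^ 3 ∧
      (P.omCoth t)⁻¹ ≤ C * (P.M ^ (i + 1))⁻¹ ^ 2 := by
  have h0 : (0 : ℝ) < P.M := by linarith
  have hΓ := P.gammaBound_pos
  have hδ := P.rate_pos
  refine ⟨max (P.gammaBound * Real.exp (4 * P.rate ^ 2) * (2 * P.M * (P.rate + 2) + |P.m| * (1 + |P.Om|)))
    (2 * P.M ^ 2), le_max_of_le_right (by positivity), fun i t ht => ?_⟩
  obtain ⟨h1, h2, h3⟩ := P.mem_slice_succ hM ht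
  have htp := P.slice_pos hM ht
  set a := P.M ^ (i + 1) with ha
  have ha1 : 1 ≤ a := one_le_pow₀ hM.le
  have hinv := P.inv_omCoth_le hθ htp
  have hα := P.omCoth_pos hθ htp
  have hti : t⁻¹ ≤ a ^ 2 := by
    rw [inv_pow] at h1
    exact inv_le_of_inv_le₀ (by positivity) h1
  constructor
  · refine le_trans ?_ (mul_le_mul_of_nonneg_right (le_max_left _ _) (by positivity))
    have e1 : Real.exp (-t * P.m ^ 2) ≤ 1 := Real.exp_le_one_iff.2 (by nlinarith [sq_nonneg P.m])
    have e2 : Real.exp (2 * P.rate ^ 2 * (P.omCoth t)⁻¹) ≤ Real.exp (4 * P.rate ^ 2) := by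
      apply Real.exp_le_exp.2
      nlinarith [sq_nonneg P.rate]
    have hs : √t ≤ P.M * a⁻¹ := Real.sqrt_le_iff.2 ⟨by positivity, h2⟩
    have e3 : √((P.omCoth t)⁻¹) ≤ 2 * (P.M * a⁻¹) := by
      refine (Real.sqrt_le_sqrt hinv).trans ?_
      rw [Real.sqrt_mul (by norm_num)]
      exact mul_le_mul (Real.sqrt_le_iff.2 ⟨by norm_num, by norm_num⟩) hs (Real.sqrt_nonneg _)
        (by norm_num)
    have e4 : (P.omCoth t)⁻¹ ≤ 2 * (P.M * a⁻¹) := by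
      have : t ≤ √t := by
        apply Real.le_sqrt_of_sq_le; nlinarith
      linarith
    have e5 : (t ^ 2)⁻¹ ≤ a ^ 4 := by
      rw [← inv_pow, show a ^ 4 = (a ^ 2) ^ 2 by ring]
      gcongr
    have e6 : P.omCoth t ≤ (1 + |P.Om|) * a ^ 3 := by
      have h5 := P.omCoth_le hθ htp
      have h6 : 1 / (2 * t) ≤ a ^ 2 := by
        rw [one_div, mul_inv]
        have : 0 ≤ t⁻¹ := by positivity
        linarith
      have h7 : a ^ 2 ≤ a ^ 3 := pow_le_pow_right₀ ha1 (by norm_num)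
      have h8 : 1 ≤ a ^ 3 := one_le_pow₀ ha1
      nlinarith [abs_nonneg P.Om]
    calc P.mass t ≤ P.gammaBound * 1 * Real.exp (4 * P.rate ^ 2) * (a ^ 4 * (P.rate * (2 * (P.M * a⁻¹))
          + 2 * (2 * (P.M * a⁻¹))) + |P.m| * ((1 + |P.Om|) * a ^ 3)) := by
          rw [mass]
          gcongr
      _ = _ := by field_simp
  · refine le_trans ?_ (mul_le_mul_of_nonneg_right (le_max_right _ _) (by positivity))
    refine hinv.trans ?_
    rw [mul_pow] at h2
    linarith

/-- If Ω ≠ 0, α stays between positive constants and $t^{-2}$ is integrable even for m = 0. If Ω =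
0, $\alpha^{-1}$ grows like t and m ≠ 0 is needed: the factor $e^{-tm^2}$ must beat the growth due
to the tilt. -/
theorem exists_mass_bound_zero (hθ : P.θ ≠ 0) (hm : P.m ≠ 0 ∨ P.Ω ≠ 0) : ∃ C : ℝ, 0 ≤ C ∧
    ∀ t : ℝ, 1 < t → P.mass t * (1 + (P.omCoth t)⁻¹)
      ≤ C * (t ^ (-2 : ℝ) + |P.m| * Real.exp (-(P.m ^ 2 / 2) * t)) := by
  have hΓ := P.gammaBound_pos
  have hδ := P.rate_pos
  by_cases hΩ : P.Ω = 0
  · have hm0 : P.m ≠ 0 := hm.resolve_right (not_not.2 hΩ)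
    have hOm : P.Om = 0 := by simp [Om, hΩ]
    have hmp : 0 < |P.m| := abs_pos.2 hm0
    have hm2 : 0 < P.m ^ 2 := by positivity
    -- With rate $|m|/4$ the tilt costs at most $e^{tm^2/4}$. Another $e^{-tm^2/4}$ pays for the
    -- powers of t, and $e^{-tm^2/2}$ is left for the integration.
    have hr : P.rate ^ 2 = P.m ^ 2 / 16 := by
      rw [rate, if_neg hm0, div_pow, sq_abs]; norm_num
    refine ⟨P.gammaBound * (2 * P.rate + 4 + |P.m|) * (3 * (4 / P.m ^ 2)) / |P.m|, by positivity,
      fun t ht => ?_⟩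
    have htp : 0 < t := by linarith
    have hinv := P.inv_omCoth_le hθ htp
    have hα := P.omCoth_pos hθ htp
    have hαle := P.omCoth_le hθ htp
    rw [hOm, abs_zero, add_zero] at hαle
    have e2 : Real.exp (2 * P.rate ^ 2 * (P.omCoth t)⁻¹) ≤ Real.exp (P.m ^ 2 / 4 * t) := by
      apply Real.exp_le_exp.2
      rw [hr]
      nlinarith
    have e3 : √((P.omCoth t)⁻¹) ≤ 2 * t := by
      refine (Real.sqrt_le_sqrt hinv).trans (Real.sqrt_le_iff.2 ⟨by positivity, by nlinarith⟩)
    have e4 : P.omCoth t ≤ 1 := by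
      refine hαle.trans ?_
      rw [div_le_one (by positivity)]
      linarith
    have e5 : (t ^ 2)⁻¹ * t ≤ 1 := by
      rw [inv_mul_le_iff₀ (by positivity)]; nlinarith
    have e6 : t * Real.exp (-(P.m ^ 2 / 4) * t) ≤ 4 / P.m ^ 2 := by
      have := Real.add_one_le_exp (P.m ^ 2 / 4 * t)
      rw [neg_mul, Real.exp_neg, ← div_eq_mul_inv, div_le_iff₀ (Real.exp_pos _),
        div_mul_eq_mul_div, le_div_iff₀ hm2]
      linarith
    have e7 : (0 : ℝ) ≤ t ^ (-2 : ℝ) := by positivity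
    calc P.mass t * (1 + (P.omCoth t)⁻¹)
        ≤ P.gammaBound * Real.exp (-t * P.m ^ 2) * Real.exp (P.m ^ 2 / 4 * t)
          * ((t ^ 2)⁻¹ * (P.rate * (2 * t) + 2 * (2 * t)) + |P.m| * 1) * (t + 2 * t) := by
          rw [mass]
          gcongr
      _ = P.gammaBound * (((t ^ 2)⁻¹ * t) * (2 * P.rate + 4) + |P.m|) * (3 * (t *
          (Real.exp (-t * P.m ^ 2) * Real.exp (P.m ^ 2 / 4 * t)))) := by ring
      _ = P.gammaBound * (((t ^ 2)⁻¹ * t) * (2 * P.rate + 4) + |P.m|) * (3 * (t *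
          Real.exp (-(P.m ^ 2 / 4) * t))) * Real.exp (-(P.m ^ 2 / 2) * t) := by
          have e9 : Real.exp (-t * P.m ^ 2) * Real.exp (P.m ^ 2 / 4 * t)
              = Real.exp (-(P.m ^ 2 / 4) * t) * Real.exp (-(P.m ^ 2 / 2) * t) := by
            rw [← Real.exp_add, ← Real.exp_add]
            congr 1
            ring
          rw [e9]
          ring
      _ ≤ P.gammaBound * (1 * (2 * P.rate + 4) + |P.m|) * (3 * (4 / P.m ^ 2))
          * Real.exp (-(P.m ^ 2 / 2) * t) := by gcongr
      _ = P.gammaBound * (2 * P.rate + 4 + |P.m|) * (3 * (4 / P.m ^ 2)) / |P.m|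
          * (|P.m| * Real.exp (-(P.m ^ 2 / 2) * t)) := by field_simp
      _ ≤ _ := by
          gcongr
          linarith
  · have hOm := abs_pos.2 (P.Om_ne_zero hθ hΩ)
    refine ⟨P.gammaBound * Real.exp (2 * P.rate ^ 2 * |P.Om|⁻¹)
      * ((P.rate * |P.Om|⁻¹ + 2 * √(|P.Om|⁻¹)) + (1 + |P.Om|)) * (1 + |P.Om|⁻¹), by positivity,
      fun t ht => ?_⟩
    have htp : 0 < t := by linarith
    have hα := P.omCoth_pos hθ htp
    have hinv : (P.omCoth t)⁻¹ ≤ |P.Om|⁻¹ := inv_anti₀ hOm (P.abs_Om_le_omCoth hθ htp)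
    have e4 : P.omCoth t ≤ 1 + |P.Om| := by
      refine (P.omCoth_le hθ htp).trans ?_
      gcongr
      rw [div_le_one (by positivity)]
      linarith
    have e5 : (t ^ 2)⁻¹ = t ^ (-2 : ℝ) := by
      rw [Real.rpow_neg htp.le]; norm_cast
    have e6 : Real.exp (-t * P.m ^ 2) ≤ Real.exp (-(P.m ^ 2 / 2) * t) := by
      apply Real.exp_le_exp.2
      nlinarith [sq_nonneg P.m]
    have e7 : Real.exp (-(P.m ^ 2 / 2) * t) ≤ 1 := by
      apply Real.exp_le_one_iff.2
      nlinarith [sq_nonneg P.m]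
    have e8 : (0 : ℝ) ≤ t ^ (-2 : ℝ) := by positivity
    calc P.mass t * (1 + (P.omCoth t)⁻¹)
        ≤ P.gammaBound * Real.exp (-(P.m ^ 2 / 2) * t) * Real.exp (2 * P.rate ^ 2 * |P.Om|⁻¹)
          * (t ^ (-2 : ℝ) * (P.rate * |P.Om|⁻¹ + 2 * √(|P.Om|⁻¹)) + |P.m| * (1 + |P.Om|))
          * (1 + |P.Om|⁻¹) := by
          rw [mass, e5]
          gcongr
      _ = P.gammaBound * Real.exp (2 * P.rate ^ 2 * |P.Om|⁻¹) * ((P.rate * |P.Om|⁻¹ + 2 * √(|P.Om|⁻¹))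
          * (t ^ (-2 : ℝ) * Real.exp (-(P.m ^ 2 / 2) * t))
          + (1 + |P.Om|) * (|P.m| * Real.exp (-(P.m ^ 2 / 2) * t))) * (1 + |P.Om|⁻¹) := by ring
      _ ≤ P.gammaBound * Real.exp (2 * P.rate ^ 2 * |P.Om|⁻¹) * ((P.rate * |P.Om|⁻¹ + 2 * √(|P.Om|⁻¹))
          * (t ^ (-2 : ℝ) + |P.m| * Real.exp (-(P.m ^ 2 / 2) * t))
          + (1 + |P.Om|) * (t ^ (-2 : ℝ) + |P.m| * Real.exp (-(P.m ^ 2 / 2) * t)))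
          * (1 + |P.Om|⁻¹) := by
          have h9 : t ^ (-2 : ℝ) * Real.exp (-(P.m ^ 2 / 2) * t)
              ≤ t ^ (-2 : ℝ) + |P.m| * Real.exp (-(P.m ^ 2 / 2) * t) := by
            have := mul_le_of_le_one_right e8 e7
            have : 0 ≤ |P.m| * Real.exp (-(P.m ^ 2 / 2) * t) := by positivity
            linarith
          have h10 : |P.m| * Real.exp (-(P.m ^ 2 / 2) * t)
              ≤ t ^ (-2 : ℝ) + |P.m| * Real.exp (-(P.m ^ 2 / 2) * t) := by linarith
          gcongr
      _ = _ := by ring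

end Model

theorem integral_linear_combination {α 𝕜 : Type*} [MeasurableSpace α] [RCLike 𝕜] {μ : Measure α}
    {f₁ f₂ f₃ : α → 𝕜} (h₁ : Integrable f₁ μ) (h₂ : Integrable f₂ μ) (h₃ : Integrable f₃ μ)
    (c a₁ a₂ d : 𝕜) : ∫ x, (c * (a₁ * f₁ x + a₂ * f₂ x) + d * f₃ x) ∂μ
      = c * (a₁ * ∫ x, f₁ x ∂μ + a₂ * ∫ x, f₂ x ∂μ) + d * ∫ x, f₃ x ∂μ := by
  have h₁₂ : Integrable (fun x => a₁ * f₁ x + a₂ * f₂ x) μ :=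
    (h₁.const_mul a₁).add (h₂.const_mul a₂)
  rw [integral_add (h₁₂.const_mul c) (h₃.const_mul d), integral_const_mul,
    integral_add (h₁.const_mul a₁) (h₂.const_mul a₂), integral_const_mul,
    integral_const_mul, integral_const_mul]

namespace Model

variable (P : Model)

/-! ### The propagator as a superposition of Gaussians and plane waves -/

/-- The width of the Gaussians. -/
def beta (t : ℝ) : ℝ := if 0 < t then P.omCoth t / 2 else 1

/-- The factors of the weight that depend on `κ`. -/
def spinWeight (ς : ℝ × ℝ) (a b : Fin 2) (t : ℝ) (κ : ℝ × ℝ) : ℂ :=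
  Complex.I / (2 * P.sinhOver t)
      * (P.γ 0 a b * (planeWeight' (P.omCoth t) ς.1 κ.1 * planeWeight (P.omCoth t) ς.2 κ.2)
        + P.γ 1 a b * (planeWeight (P.omCoth t) ς.1 κ.1 * planeWeight' (P.omCoth t) ς.2 κ.2))
    - P.m * P.spinFactor t a b
      * (planeWeight (P.omCoth t) ς.1 κ.1 * planeWeight (P.omCoth t) ς.2 κ.2)

/-- The weight of the superposition. -/
def lineWeight (i : ℕ) (ς : ℝ × ℝ) (a b : Fin 2) (τ : ℝ × (ℝ × ℝ)) : ℂ :=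
  (P.slice i).indicator
    (fun t => -((Real.exp (-t * P.m ^ 2) / (4 * Real.pi * P.sinhOver t) : ℝ) : ℂ)) τ.1
    * P.spinWeight ς a b τ.1 τ.2

theorem measurable_sinhOver : Measurable P.sinhOver := by
  unfold sinhOver
  by_cases h : P.Ω = 0
  · simp only [h, if_true]; exact measurable_id
  · simp only [h, if_false]; fun_prop

theorem measurable_omCoth : Measurable P.omCoth := by
  unfold omCoth
  have := P.measurable_sinhOver
  fun_prop

theorem measurable_beta : Measurable P.beta := by
  unfold beta
  have := P.measurable_omCoth
  exact Measurable.ite measurableSet_Ioi (by fun_prop) measurable_const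

/-- The default 1 for nonpositive t is never felt, as the weights vanish there; it keeps the
Gaussian integrals nondegenerate for every parameter. -/
theorem beta_pos (hθ : P.θ ≠ 0) (t : ℝ) : 0 < P.beta t := by
  rw [beta]
  split_ifs with h
  · exact half_pos (P.omCoth_pos hθ h)
  · exact one_pos

theorem measurable_planeWeight (s : ℝ) : Measurable fun p : ℝ × ℝ => planeWeight p.1 s p.2 := by
  unfold planeWeight
  fun_prop

theorem measurable_planeWeight' (s : ℝ) : Measurable fun p : ℝ × ℝ => planeWeight' p.1 s p.2 := by
  unfold planeWeight'
  have := measurable_planeWeight s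
  fun_prop

theorem measurable_spinFactor (a b : Fin 2) : Measurable fun t => P.spinFactor t a b := by
  have : (fun t => P.spinFactor t a b) = fun t =>
      ((Real.cosh (2 * P.Om * t) : ℝ) : ℂ) * (1 : Matrix (Fin 2) (Fin 2) ℂ) a b
        - Complex.I * ((P.θ / 2 * Real.sinh (2 * P.Om * t) : ℝ) : ℂ) * P.gammaThetaGamma a b := by
    ext t
    rw [spinFactor, Matrix.sub_apply, Matrix.smul_apply, Matrix.smul_apply, smul_eq_mul,
      smul_eq_mul]
  rw [this]
  generalize P.gammaThetaGamma a b = c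
  generalize (1 : Matrix (Fin 2) (Fin 2) ℂ) a b = d
  fun_prop

theorem measurable_spinWeight (ς : ℝ × ℝ) (a b : Fin 2) :
    Measurable fun τ : ℝ × (ℝ × ℝ) => P.spinWeight ς a b τ.1 τ.2 := by
  have h1 := P.measurable_sinhOver.comp (measurable_fst : Measurable (Prod.fst : ℝ × (ℝ × ℝ) → ℝ))
  have h2 := P.measurable_omCoth.comp (measurable_fst : Measurable (Prod.fst : ℝ × (ℝ × ℝ) → ℝ))
  have hs := (P.measurable_spinFactor a b).comp (measurable_fst : Measurable (Prod.fst : ℝ × (ℝ × ℝ) → ℝ))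
  have f1 : Measurable fun τ : ℝ × (ℝ × ℝ) => (P.omCoth τ.1, τ.2.1) := h2.prodMk (by fun_prop)
  have f2 : Measurable fun τ : ℝ × (ℝ × ℝ) => (P.omCoth τ.1, τ.2.2) := h2.prodMk (by fun_prop)
  have hp := (measurable_planeWeight ς.1).comp f1
  have hq := (measurable_planeWeight ς.2).comp f2
  have hp' := (measurable_planeWeight' ς.1).comp f1
  have hq' := (measurable_planeWeight' ς.2).comp f2
  have hS := (Complex.measurable_ofReal.comp h1)
  have hS2 := (hS.const_mul 2).const_div Complex.I
  have := (hS2.mul (((hp'.mul hq).const_mul (P.γ 0 a b)).add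
    ((hp.mul hq').const_mul (P.γ 1 a b)))).sub ((hs.const_mul (P.m : ℂ)).mul (hp.mul hq))
  exact this

theorem measurable_lineWeight (i : ℕ) (ς : ℝ × ℝ) (a b : Fin 2) :
    Measurable (P.lineWeight i ς a b) := by
  have hf : Measurable fun t : ℝ =>
      -((Real.exp (-t * P.m ^ 2) / (4 * Real.pi * P.sinhOver t) : ℝ) : ℂ) := by
    have h1 := P.measurable_sinhOver
    fun_prop
  have hi := (hf.indicator (P.measurableSet_slice i)).comp (measurable_fst : Measurable (Prod.fst : ℝ × (ℝ × ℝ) → ℝ))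
  exact hi.mul (P.measurable_spinWeight ς a b)

theorem norm_spinFactor_le (hθ : P.θ ≠ 0) (hγ : P.Clifford) (t : ℝ) (a b : Fin 2) :
    ‖P.spinFactor t a b‖ ≤ Real.cosh (2 * P.Om * t) * (1 + ‖(P.γ 0 * P.γ 1) a b‖) := by
  rw [P.spinFactor_eq hθ hγ, Matrix.sub_apply, Matrix.smul_apply, Matrix.smul_apply, smul_eq_mul,
    smul_eq_mul, mul_add]
  refine (norm_sub_le _ _).trans (add_le_add ?_ ?_)
  · rw [norm_mul, Complex.norm_real, Real.norm_of_nonneg (Real.cosh_pos _).le]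
    refine mul_le_mul_of_nonneg_left ?_ (Real.cosh_pos _).le
    rw [Matrix.one_apply]
    split_ifs <;> simp
  · rw [norm_mul, norm_mul, Complex.norm_I, one_mul, Complex.norm_real, Real.norm_eq_abs]
    refine mul_le_mul_of_nonneg_right ?_ (norm_nonneg _)
    exact abs_le_of_sq_le_sq (by linarith [Real.cosh_sq_sub_sinh_sq (2 * P.Om * t)])
      (Real.cosh_pos _).le

theorem integrable_spinWeight (hθ : P.θ ≠ 0) (ς : ℝ × ℝ) (a b : Fin 2) {t : ℝ} (ht : 0 < t) :
    Integrable (P.spinWeight ς a b t) := by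
  have hα := P.omCoth_pos hθ ht
  have i1 := integrable_planeWeight hα
  have i2 := integrable_planeWeight' hα
  exact (((((i2 ς.1).mul_prod (i1 ς.2)).const_mul _).add
    (((i1 ς.1).mul_prod (i2 ς.2)).const_mul _)).const_mul _).sub
    (((i1 ς.1).mul_prod (i1 ς.2)).const_mul _)

/-- The $\not\! x$ term carries two factors $1/\sinh$, bounded by $t^{-2}$. In the mass term the
cosh of the spin factor combines with the one $1/\sinh$ of the prefactor into α. Each of the two
coordinates pays $e^{\mathrm{rate}^2/\alpha}$ for the tilt. -/
theorem integral_norm_spinWeight_le (hθ : P.θ ≠ 0) (hγ : P.Clifford) {ς : ℝ × ℝ}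
    (h1 : |ς.1| ≤ P.rate) (h2 : |ς.2| ≤ P.rate) (a b : Fin 2) {t : ℝ} (ht : 0 < t) :
    Real.exp (-t * P.m ^ 2) / (4 * Real.pi * P.sinhOver t) * ∫ κ, ‖P.spinWeight ς a b t κ‖
      ≤ P.mass t := by
  have hα := P.omCoth_pos hθ ht
  have hS := P.sinhOver_pos hθ ht
  have hSt := P.le_sinhOver hθ ht
  have i1 := integrable_planeWeight hα
  have i2 := integrable_planeWeight' hα
  have hδ := P.rate_pos
  have e0 : ∀ s, |s| ≤ P.rate → Real.exp (s ^ 2 / P.omCoth t) ≤ Real.exp (P.rate ^ 2 / P.omCoth t) := by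
    intro s hs
    apply Real.exp_le_exp.2
    have : s ^ 2 ≤ P.rate ^ 2 := sq_le_sq' (by linarith [neg_abs_le s]) ((le_abs_self s).trans hs)
    gcongr
  have N0 : ∀ s, |s| ≤ P.rate → ∫ κ, ‖planeWeight (P.omCoth t) s κ‖
      ≤ Real.exp (P.rate ^ 2 / P.omCoth t) := by
    intro s hs
    rw [integral_norm_planeWeight hα]
    exact e0 s hs
  have N1 : ∀ s, |s| ≤ P.rate → ∫ κ, ‖planeWeight' (P.omCoth t) s κ‖
      ≤ 2 / P.omCoth t * (P.rate + 2 * √(P.omCoth t)) * Real.exp (P.rate ^ 2 / P.omCoth t) := by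
    intro s hs
    refine (integral_norm_planeWeight'_le hα s).trans ?_
    have := e0 s hs
    gcongr
  have hprod : ∀ {F G : ℝ → ℂ} (A B : ℝ), Integrable F → Integrable G → (∫ κ, ‖F κ‖ ≤ A) →
      (∫ κ, ‖G κ‖ ≤ B) → Integrable (fun κ : ℝ × ℝ => ‖F κ.1 * G κ.2‖) ∧
        ∫ κ : ℝ × ℝ, ‖F κ.1 * G κ.2‖ ≤ A * B := by
    intro F G A B hF hG hA hB
    refine ⟨(hF.mul_prod hG).norm, ?_⟩
    simp only [norm_mul]
    rw [Measure.volume_eq_prod, integral_prod_mul (fun κ => ‖F κ‖) (fun κ => ‖G κ‖)]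
    exact mul_le_mul hA hB (integral_nonneg fun _ => norm_nonneg _)
      ((integral_nonneg fun _ => norm_nonneg _).trans hA)
  obtain ⟨j1, k1⟩ := hprod _ _ (i2 ς.1) (i1 ς.2) (N1 _ h1) (N0 _ h2)
  obtain ⟨j2, k2⟩ := hprod _ _ (i1 ς.1) (i2 ς.2) (N0 _ h1) (N1 _ h2)
  obtain ⟨j3, k3⟩ := hprod _ _ (i1 ς.1) (i1 ς.2) (N0 _ h1) (N0 _ h2)
  have hle : ∫ κ, ‖P.spinWeight ς a b t κ‖ ≤ ∫ κ : ℝ × ℝ, (1 / (2 * P.sinhOver t)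
      * (‖P.γ 0 a b‖ * ‖planeWeight' (P.omCoth t) ς.1 κ.1 * planeWeight (P.omCoth t) ς.2 κ.2‖
        + ‖P.γ 1 a b‖ * ‖planeWeight (P.omCoth t) ς.1 κ.1 * planeWeight' (P.omCoth t) ς.2 κ.2‖)
      + |P.m| * ‖P.spinFactor t a b‖
        * ‖planeWeight (P.omCoth t) ς.1 κ.1 * planeWeight (P.omCoth t) ς.2 κ.2‖) := by
    refine integral_mono (P.integrable_spinWeight hθ ς a b ht).norm
      ((((j1.const_mul _).add (j2.const_mul _)).const_mul _).add (j3.const_mul _)) fun κ => ?_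
    have hn1 : ‖Complex.I / (2 * (P.sinhOver t : ℂ))‖ = 1 / (2 * P.sinhOver t) := by
      rw [norm_div, Complex.norm_I, norm_mul, Complex.norm_real, Real.norm_of_nonneg hS.le,
        Complex.norm_ofNat]
    refine (norm_sub_le _ _).trans (add_le_add ?_ (le_of_eq ?_))
    · rw [norm_mul, hn1]
      refine mul_le_mul_of_nonneg_left ((norm_add_le _ _).trans (le_of_eq ?_)) (by positivity)
      rw [norm_mul (P.γ 0 a b), norm_mul (P.γ 1 a b)]
    · rw [norm_mul (P.m * P.spinFactor t a b), norm_mul, Complex.norm_real, Real.norm_eq_abs]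
  rw [integral_linear_combination j1 j2 j3] at hle
  set E := Real.exp (P.rate ^ 2 / P.omCoth t) with hE
  have hEE : E * E = Real.exp (2 * P.rate ^ 2 * (P.omCoth t)⁻¹) := by
    rw [hE, ← Real.exp_add]
    congr 1
    rw [div_eq_mul_inv]
    ring
  have hspin := P.norm_spinFactor_le hθ hγ t a b
  have hcS : Real.cosh (2 * P.Om * t) = 2 * P.omCoth t * P.sinhOver t := by
    rw [omCoth]; field_simp
  have hsα : √(P.omCoth t) / P.omCoth t = √((P.omCoth t)⁻¹) := by
    rw [Real.sqrt_inv, Real.sqrt_div_self']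
    rw [one_div]
  have hΓ := P.le_gammaBound a b
  have hc := Real.cosh_pos (2 * P.Om * t)
  have hpi : 1 ≤ Real.pi := by linarith [Real.pi_gt_three]
  set X := P.rate * (P.omCoth t)⁻¹ + 2 * √((P.omCoth t)⁻¹) with hX
  have hX0 : 0 ≤ X := by positivity
  have hXe : 2 / P.omCoth t * (P.rate + 2 * √(P.omCoth t)) = 2 * X := by
    rw [hX, ← hsα]
    field_simp
  rw [hXe] at k1 k2
  have hpref : Real.exp (-t * P.m ^ 2) / (4 * Real.pi * P.sinhOver t)
      ≤ Real.exp (-t * P.m ^ 2) * (1 / (2 * P.sinhOver t)) := by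
    rw [mul_one_div]
    gcongr
    linarith
  calc Real.exp (-t * P.m ^ 2) / (4 * Real.pi * P.sinhOver t) * ∫ κ, ‖P.spinWeight ς a b t κ‖
      ≤ Real.exp (-t * P.m ^ 2) * (1 / (2 * P.sinhOver t)) * (1 / (2 * P.sinhOver t)
        * (‖P.γ 0 a b‖ * (2 * X * E * E) + ‖P.γ 1 a b‖ * (E * (2 * X * E)))
        + |P.m| * (2 * P.omCoth t * P.sinhOver t * (1 + ‖(P.γ 0 * P.γ 1) a b‖)) * (E * E)) := by
        refine mul_le_mul hpref (hle.trans ?_) (integral_nonneg fun _ => norm_nonneg _)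
          (by positivity)
        rw [hcS] at hspin
        gcongr
    _ = Real.exp (-t * P.m ^ 2) * (E * E) * ((‖P.γ 0 a b‖ + ‖P.γ 1 a b‖) / 2
          * ((P.sinhOver t ^ 2)⁻¹ * X)
          + (1 + ‖(P.γ 0 * P.γ 1) a b‖) * (|P.m| * P.omCoth t)) := by
        field_simp
    _ ≤ Real.exp (-t * P.m ^ 2) * (E * E) * (P.gammaBound * ((t ^ 2)⁻¹ * X)
          + P.gammaBound * (|P.m| * P.omCoth t)) := by
        have n0 := norm_nonneg (P.γ 0 a b)
        have n1 := norm_nonneg (P.γ 1 a b)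
        have n2 := norm_nonneg ((P.γ 0 * P.γ 1) a b)
        have b1 : (‖P.γ 0 a b‖ + ‖P.γ 1 a b‖) / 2 ≤ P.gammaBound := by linarith
        have b2 : 1 + ‖(P.γ 0 * P.γ 1) a b‖ ≤ P.gammaBound := by linarith
        have b3 : (P.sinhOver t ^ 2)⁻¹ ≤ (t ^ 2)⁻¹ := by gcongr
        refine mul_le_mul_of_nonneg_left (add_le_add ?_ ?_) (by positivity)
        · exact mul_le_mul b1 (mul_le_mul_of_nonneg_right b3 hX0) (by positivity)
            P.gammaBound_pos.le
        · exact mul_le_mul_of_nonneg_right b2 (by positivity)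
    _ = P.mass t := by
        rw [mass, hEE]
        ring

end Model

/-- Integration over the plane waves first, at fixed t, then over the slice outside of which the
weight vanishes. -/
theorem integrable_norm_mul_fst {w : ℝ × (ℝ × ℝ) → ℂ} (hw : Measurable w) {φ : ℝ → ℝ}
    (hφ : Measurable φ) (hφ0 : ∀ t, 0 ≤ φ t) {s : Set ℝ} (hs : MeasurableSet s)
    (hz : ∀ t ∉ s, ∀ κ, w (t, κ) = 0) (hi : ∀ t ∈ s, Integrable fun κ => w (t, κ)) {B : ℝ → ℝ}
    (hB : IntegrableOn B s) (hle : ∀ t ∈ s, (∫ κ, ‖w (t, κ)‖) * φ t ≤ B t) :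
    Integrable (fun τ => ‖w τ‖ * φ τ.1) ∧ ∫ τ, ‖w τ‖ * φ τ.1 ≤ ∫ t in s, B t := by
  have hm : Measurable fun τ : ℝ × (ℝ × ℝ) => ‖w τ‖ * φ τ.1 :=
    hw.norm.mul (hφ.comp measurable_fst)
  have hi' : ∀ t, Integrable fun κ => ‖w (t, κ)‖ * φ t := by
    intro t
    by_cases ht : t ∈ s
    · exact (hi t ht).norm.mul_const _
    · simp [hz t ht]
  have hin : ∀ t, ∫ κ, ‖‖w (t, κ)‖ * φ t‖ = (∫ κ, ‖w (t, κ)‖) * φ t := by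
    intro t
    rw [← integral_mul_const]
    refine integral_congr_ae (.of_forall fun κ => ?_)
    exact Real.norm_of_nonneg (mul_nonneg (norm_nonneg _) (hφ0 t))
  have hdom : ∀ t, ∫ κ, ‖‖w (t, κ)‖ * φ t‖ ≤ s.indicator B t := by
    intro t
    rw [hin]
    by_cases ht : t ∈ s
    · rw [Set.indicator_of_mem ht]
      exact hle t ht
    · simp [hz t ht, Set.indicator_of_notMem ht]
  have h2 : Integrable fun t => ∫ κ, ‖‖w (t, κ)‖ * φ t‖ := by
    refine Integrable.mono' ((integrable_indicator_iff hs).2 hB)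
      (hm.aestronglyMeasurable (μ := (volume : Measure ℝ).prod volume)).norm.integral_prod_right'
      (.of_forall fun t => ?_)
    rw [Real.norm_of_nonneg (integral_nonneg fun _ => norm_nonneg _)]
    exact hdom t
  have h1 : Integrable (fun τ => ‖w τ‖ * φ τ.1) := by
    rw [Measure.volume_eq_prod]
    exact (integrable_prod_iff hm.aestronglyMeasurable).2 ⟨.of_forall hi', h2⟩
  refine ⟨h1, ?_⟩
  rw [Measure.volume_eq_prod, integral_prod _ (by rwa [← Measure.volume_eq_prod]),
    ← integral_indicator hs]
  refine integral_mono_ae ?_ ((integrable_indicator_iff hs).2 hB) (.of_forall fun t => ?_)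
  · refine h2.congr (.of_forall fun t => integral_congr_ae (.of_forall fun κ => ?_))
    exact Real.norm_of_nonneg (mul_nonneg (norm_nonneg _) (hφ0 t))
  · refine le_trans (le_of_eq (integral_congr_ae (.of_forall fun κ => ?_))) (hdom t)
    exact (Real.norm_of_nonneg (mul_nonneg (norm_nonneg _) (hφ0 t))).symm

namespace Model

variable (P : Model)

theorem integral_norm_lineWeight_le (hθ : P.θ ≠ 0) (hM : 1 < P.M) (hγ : P.Clifford) (i : ℕ)
    {ς : ℝ × ℝ} (h1 : |ς.1| ≤ P.rate) (h2 : |ς.2| ≤ P.rate) (a b : Fin 2) {t : ℝ}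
    (ht : t ∈ P.slice i) : Integrable (fun κ => P.lineWeight i ς a b (t, κ)) ∧
      ∫ κ, ‖P.lineWeight i ς a b (t, κ)‖ ≤ P.mass t := by
  have ht0 := P.slice_pos hM ht
  have hS := P.sinhOver_pos hθ ht0
  have e : ∀ κ, P.lineWeight i ς a b (t, κ)
      = -((Real.exp (-t * P.m ^ 2) / (4 * Real.pi * P.sinhOver t) : ℝ) : ℂ)
        * P.spinWeight ς a b t κ := fun κ => by
    rw [lineWeight, Set.indicator_of_mem ht]
  simp only [e]
  refine ⟨(P.integrable_spinWeight hθ ς a b ht0).const_mul _, ?_⟩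
  simp only [norm_mul, norm_neg, Complex.norm_real]
  rw [integral_const_mul, Real.norm_of_nonneg (by positivity)]
  exact P.integral_norm_spinWeight_le hθ hγ h1 h2 a b ht0

theorem integral_norm_lineWeight_mul_le (hθ : P.θ ≠ 0) (hM : 1 < P.M) (hγ : P.Clifford) (i : ℕ)
    {ς : ℝ × ℝ} (h1 : |ς.1| ≤ P.rate) (h2 : |ς.2| ≤ P.rate) (a b : Fin 2) {φ : ℝ → ℝ}
    (hφ : Measurable φ) (hφ0 : ∀ t, 0 ≤ φ t) {B : ℝ → ℝ} (hB : IntegrableOn B (P.slice i))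
    (hle : ∀ t ∈ P.slice i, P.mass t * φ t ≤ B t) :
    Integrable (fun τ => ‖P.lineWeight i ς a b τ‖ * φ τ.1) ∧
      ∫ τ, ‖P.lineWeight i ς a b τ‖ * φ τ.1 ≤ ∫ t in P.slice i, B t := by
  refine integrable_norm_mul_fst (P.measurable_lineWeight i ς a b) hφ hφ0 (P.measurableSet_slice i)
    (fun t ht κ => ?_)
    (fun t ht => (P.integral_norm_lineWeight_le hθ hM hγ i h1 h2 a b ht).1) hB fun t ht => ?_
  · rw [lineWeight, Set.indicator_of_notMem ht, zero_mul]
  · exact (mul_le_mul_of_nonneg_right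
      (P.integral_norm_lineWeight_le hθ hM hγ i h1 h2 a b ht).2 (hφ0 t)).trans (hle t ht)

/-- A uniform bound on the slice times its length, at most $M^{-2(i-1)}$ for the slice of scale i,
here i + 1. -/
theorem integral_norm_lineWeight_succ_le (hθ : P.θ ≠ 0) (hM : 1 < P.M) (hγ : P.Clifford) (i : ℕ)
    {ς : ℝ × ℝ} (h1 : |ς.1| ≤ P.rate) (h2 : |ς.2| ≤ P.rate) (a b : Fin 2) {φ : ℝ → ℝ}
    (hφ : Measurable φ) (hφ0 : ∀ t, 0 ≤ φ t) {B : ℝ} (hB : 0 ≤ B)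
    (hle : ∀ t ∈ P.slice (i + 1), P.mass t * φ t ≤ B) :
    Integrable (fun τ => ‖P.lineWeight (i + 1) ς a b τ‖ * φ τ.1) ∧
      ∫ τ, ‖P.lineWeight (i + 1) ς a b τ‖ * φ τ.1 ≤ B * (P.M * (P.M ^ (i + 1))⁻¹) ^ 2 := by
  set L := (P.M * (P.M ^ (i + 1))⁻¹) ^ 2 with hL
  have hsub : P.slice (i + 1) ⊆ Set.Ioc 0 L := fun t ht =>
    ⟨P.slice_pos hM ht, (P.mem_slice_succ hM ht).2.1⟩
  have hint : IntegrableOn (fun _ : ℝ => B) (Set.Ioc 0 L) :=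
    integrableOn_const (measure_Ioc_lt_top.ne)
  obtain ⟨r1, r2⟩ := P.integral_norm_lineWeight_mul_le hθ hM hγ (i + 1) h1 h2 a b hφ hφ0
    (hint.mono_set hsub) hle
  refine ⟨r1, r2.trans ?_⟩
  refine (setIntegral_mono_set hint (.of_forall fun _ => hB) hsub.eventuallyLE).trans ?_
  rw [setIntegral_const, smul_eq_mul, Measure.real, Real.volume_Ioc, sub_zero,
    ENNReal.toReal_ofReal (sq_nonneg _), mul_comm]

theorem exists_integral_norm_lineWeight_zero_le (hθ : P.θ ≠ 0) (hM : 1 < P.M) (hγ : P.Clifford)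
    (hm : P.m ≠ 0 ∨ P.Ω ≠ 0) : ∃ C : ℝ, 0 ≤ C ∧ ∀ (ς : ℝ × ℝ), |ς.1| ≤ P.rate → |ς.2| ≤ P.rate →
      ∀ (a b : Fin 2) (φ : ℝ → ℝ) (κ : ℝ), Measurable φ → (∀ t, 0 ≤ φ t) → 0 ≤ κ →
      (∀ t, 1 < t → φ t ≤ κ * (1 + (P.omCoth t)⁻¹)) →
      Integrable (fun τ => ‖P.lineWeight 0 ς a b τ‖ * φ τ.1) ∧
        ∫ τ, ‖P.lineWeight 0 ς a b τ‖ * φ τ.1 ≤ C * κ := by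
  obtain ⟨C, hC, hb⟩ := P.exists_mass_bound_zero hθ hm
  have hint : IntegrableOn (fun t : ℝ => t ^ (-2 : ℝ) + |P.m| * Real.exp (-(P.m ^ 2 / 2) * t))
      (P.slice 0) := by
    rw [slice, if_pos rfl]
    refine (integrableOn_Ioi_rpow_of_lt (by norm_num) one_pos).add ?_
    by_cases h : P.m = 0
    · simp [h]
    · have : 0 < P.m ^ 2 / 2 := by positivity
      exact ((exp_neg_integrableOn_Ioi 1 this).const_mul _)
  set J := ∫ t in P.slice 0, (t ^ (-2 : ℝ) + |P.m| * Real.exp (-(P.m ^ 2 / 2) * t)) with hJ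
  have hpos : ∀ t ∈ P.slice 0, 0 ≤ t ^ (-2 : ℝ) + |P.m| * Real.exp (-(P.m ^ 2 / 2) * t) :=
    fun t ht => by have := P.slice_pos hM ht; positivity
  have hJ0 : 0 ≤ J := setIntegral_nonneg (P.measurableSet_slice 0) hpos
  refine ⟨C * J, by positivity, fun ς h1 h2 a b φ κ hφ hφ0 hκ hle => ?_⟩
  have hle' : ∀ t ∈ P.slice 0, P.mass t * φ t
      ≤ C * κ * (t ^ (-2 : ℝ) + |P.m| * Real.exp (-(P.m ^ 2 / 2) * t)) := by
    intro t ht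
    have ht1 : 1 < t := by simpa [slice] using ht
    have hm0 : 0 ≤ P.mass t := (integral_nonneg fun _ => norm_nonneg _).trans
      (P.integral_norm_lineWeight_le hθ hM hγ 0 h1 h2 a b ht).2
    calc P.mass t * φ t ≤ P.mass t * (κ * (1 + (P.omCoth t)⁻¹)) :=
          mul_le_mul_of_nonneg_left (hle t ht1) hm0
      _ = κ * (P.mass t * (1 + (P.omCoth t)⁻¹)) := by ring
      _ ≤ κ * (C * (t ^ (-2 : ℝ) + |P.m| * Real.exp (-(P.m ^ 2 / 2) * t))) :=
          mul_le_mul_of_nonneg_left (hb t ht1) hκ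
      _ = _ := by ring
  obtain ⟨r1, r2⟩ := P.integral_norm_lineWeight_mul_le hθ hM hγ 0 h1 h2 a b hφ hφ0
    (hint.const_mul (C * κ)) hle'
  refine ⟨r1, r2.trans (le_of_eq ?_)⟩
  rw [integral_const_mul, ← hJ, mul_right_comm]

theorem inv_beta {t : ℝ} (ht : 0 < t) : (P.beta t)⁻¹ = 2 * (P.omCoth t)⁻¹ := by
  rw [beta, if_pos ht, inv_div, div_eq_mul_inv]

/-- Bounds on the weights of a line: the first one is used for lines in the tree, the second one
for loop lines. -/
theorem exists_lineWeight_bound (hθ : P.θ ≠ 0) (hM : 1 < P.M) (hγ : P.Clifford)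
    (hm : P.m ≠ 0 ∨ P.Ω ≠ 0) {c : ℝ} (hc : 0 ≤ c) :
    ∃ C : ℝ, 0 ≤ C ∧ ∀ (i : ℕ) (ς : ℝ × ℝ), |ς.1| ≤ P.rate → |ς.2| ≤ P.rate → ∀ a b : Fin 2,
      (Integrable (fun τ => ‖P.lineWeight i ς a b τ‖ * (P.beta τ.1)⁻¹) ∧
        ∫ τ, ‖P.lineWeight i ς a b τ‖ * (P.beta τ.1)⁻¹ ≤ C * (P.M ^ i)⁻¹) ∧
      (Integrable (fun τ => ‖P.lineWeight i ς a b τ‖ * (1 + c * (P.beta τ.1)⁻¹)) ∧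
        ∫ τ, ‖P.lineWeight i ς a b τ‖ * (1 + c * (P.beta τ.1)⁻¹) ≤ C * P.M ^ i) := by
  have h0 : (0 : ℝ) < P.M := by linarith
  obtain ⟨C₁, hC₁, hb₁⟩ := P.exists_mass_bound_succ hθ hM
  obtain ⟨C₀, hC₀, hb₀⟩ := P.exists_integral_norm_lineWeight_zero_le hθ hM hγ hm
  have hm1 : Measurable fun t => (P.beta t)⁻¹ := P.measurable_beta.inv
  have hm2 : Measurable fun t => 1 + c * (P.beta t)⁻¹ := (hm1.const_mul c).const_add 1
  have hp1 : ∀ t, 0 ≤ (P.beta t)⁻¹ := fun t => (inv_pos.2 (P.beta_pos hθ t)).le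
  have hp2 : ∀ t, 0 ≤ 1 + c * (P.beta t)⁻¹ := fun t => by have := hp1 t; positivity
  -- The three entries come from scale 0, from the weight against $\beta^{-1}$ (order
  -- $M^{3i}M^{-2i}M^{-2i}$) and from the weight against $1+c\beta^{-1}$ (order $M^{3i}M^{-2i}$).
  set C := max (C₀ * (2 + 2 * c)) (max (2 * C₁ ^ 2 * P.M ^ 2) (C₁ * (1 + 2 * c * C₁) * P.M ^ 2))
    with hC
  refine ⟨C, le_max_of_le_left (by positivity), fun i ς h1 h2 a b => ?_⟩
  rcases i with _ | i
  · rw [pow_zero, inv_one, mul_one]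
    have hoc : ∀ t : ℝ, 1 < t → 0 ≤ (P.omCoth t)⁻¹ := fun t ht =>
      (inv_pos.2 (P.omCoth_pos hθ (one_pos.trans ht))).le
    obtain ⟨r1, r2⟩ := hb₀ ς h1 h2 a b _ 2 hm1 hp1 zero_le_two fun t ht => by
      rw [P.inv_beta (one_pos.trans ht)]; linarith
    obtain ⟨r3, r4⟩ := hb₀ ς h1 h2 a b _ (1 + 2 * c) hm2 hp2 (by positivity) fun t ht => by
      rw [P.inv_beta (one_pos.trans ht)]
      nlinarith [hoc t ht, mul_nonneg hc (hoc t ht)]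
    refine ⟨⟨r1, r2.trans (le_trans ?_ (le_max_left _ _))⟩,
      r3, r4.trans (le_trans ?_ (le_max_left _ _))⟩
    · gcongr; linarith
    · gcongr; linarith
  · set A := P.M ^ (i + 1) with hA
    have hA0 : 0 < A := by positivity
    have hA1 : 1 ≤ A := one_le_pow₀ hM.le
    have hmn : ∀ t ∈ P.slice (i + 1), 0 ≤ P.mass t := fun t ht =>
      (integral_nonneg fun _ => norm_nonneg _).trans
      (P.integral_norm_lineWeight_le hθ hM hγ (i + 1) h1 h2 a b ht).2
    have hb : ∀ t ∈ P.slice (i + 1), (P.beta t)⁻¹ ≤ 2 * (C₁ * A⁻¹ ^ 2) := fun t ht => by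
      rw [P.inv_beta (P.slice_pos hM ht)]
      exact mul_le_mul_of_nonneg_left (hb₁ i t ht).2 zero_le_two
    obtain ⟨r1, r2⟩ := P.integral_norm_lineWeight_succ_le hθ hM hγ i h1 h2 a b hm1 hp1
      (B := C₁ * A ^ 3 * (2 * (C₁ * A⁻¹ ^ 2))) (by positivity) fun t ht =>
        mul_le_mul (hb₁ i t ht).1 (hb t ht) (hp1 t) (by positivity)
    obtain ⟨r3, r4⟩ := P.integral_norm_lineWeight_succ_le hθ hM hγ i h1 h2 a b hm2 hp2
      (B := C₁ * A ^ 3 * (1 + c * (2 * C₁))) (by positivity) fun t ht => by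
        refine mul_le_mul (hb₁ i t ht).1 ?_ (hp2 t) (by positivity)
        have : C₁ * A⁻¹ ^ 2 ≤ C₁ * 1 :=
          mul_le_mul_of_nonneg_left (pow_le_one₀ (by positivity) (inv_le_one_of_one_le₀ hA1)) hC₁
        have := mul_le_mul_of_nonneg_left (hb t ht) hc
        nlinarith
    refine ⟨⟨r1, r2.trans ?_⟩, r3, r4.trans ?_⟩
    · calc C₁ * A ^ 3 * (2 * (C₁ * A⁻¹ ^ 2)) * (P.M * A⁻¹) ^ 2
          = 2 * C₁ ^ 2 * P.M ^ 2 * A⁻¹ := by field_simp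
        _ ≤ C * A⁻¹ := by
            gcongr
            exact le_max_of_le_right (le_max_left _ _)
    · calc C₁ * A ^ 3 * (1 + c * (2 * C₁)) * (P.M * A⁻¹) ^ 2
          = C₁ * (1 + 2 * c * C₁) * P.M ^ 2 * A := by field_simp
        _ ≤ C * A := by
            gcongr
            exact le_max_of_le_right (le_max_right _ _)

theorem integrable_lineWeight (hθ : P.θ ≠ 0) (hM : 1 < P.M) (hγ : P.Clifford)
    (hm : P.m ≠ 0 ∨ P.Ω ≠ 0) (i : ℕ) {ς : ℝ × ℝ} (h1 : |ς.1| ≤ P.rate) (h2 : |ς.2| ≤ P.rate)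
    (a b : Fin 2) : Integrable (P.lineWeight i ς a b) := by
  obtain ⟨C, -, h⟩ := P.exists_lineWeight_bound hθ hM hγ hm (le_refl 0)
  have := (h i ς h1 h2 a b).2.1
  simp only [zero_mul, add_zero, mul_one] at this
  exact (integrable_norm_iff (P.measurable_lineWeight i ς a b).aestronglyMeasurable).1 this

theorem kernel_apply (hθ : P.θ ≠ 0) (hγ : P.Clifford) (hS : ∀ t, 0 < t → 0 < P.sinhOver t)
    {t : ℝ} (ht : 0 < t) (x y : Plane) (a b : Fin 2) : P.kernel t x y a b
      = Complex.exp (Complex.I * ((P.Ω * P.wedge x y : ℝ) : ℂ))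
        * (-((Real.exp (-t * P.m ^ 2) / (4 * Real.pi * P.sinhOver t) : ℝ) : ℂ)
          * ((Real.exp (-(P.omCoth t / 2) * ‖x - y‖ ^ 2) : ℝ) : ℂ)
          * (Complex.I / (2 * P.sinhOver t)
              * (P.γ 0 a b * ((x - y) 0 : ℝ) + P.γ 1 a b * ((x - y) 1 : ℝ))
            - P.m * P.spinFactor t a b)) := by
  rw [kernel, Matrix.smul_apply, P.kernel_matrix hθ hγ (hS t ht).ne', Matrix.sub_apply,
    Matrix.smul_apply, Matrix.smul_apply, slash, Matrix.sum_apply, Fin.sum_univ_two,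
    Matrix.smul_apply, Matrix.smul_apply, Complex.exp_add]
  simp only [smul_eq_mul]
  push_cast
  ring

theorem integral_spinWeight_mul (hθ : P.θ ≠ 0) (ς : ℝ × ℝ) (a b : Fin 2) {t : ℝ} (ht : 0 < t)
    (u₀ u₁ : ℝ) : ∫ κ : ℝ × ℝ, P.spinWeight ς a b t κ
        * Complex.exp (Complex.I * ((κ.1 * u₀ + κ.2 * u₁ : ℝ) : ℂ))
      = ((Real.exp (-(P.omCoth t / 4) * (u₀ ^ 2 + u₁ ^ 2) + (ς.1 * u₀ + ς.2 * u₁)) : ℝ) : ℂ)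
        * (Complex.I / (2 * P.sinhOver t) * (P.γ 0 a b * u₀ + P.γ 1 a b * u₁)
          - P.m * P.spinFactor t a b) := by
  have hα := P.omCoth_pos hθ ht
  set α := P.omCoth t
  have w1 := fun s u => integrable_mul_wave (integrable_planeWeight hα s) u
  have w2 := fun s u => integrable_mul_wave (integrable_planeWeight' hα s) u
  have hprod : ∀ F G : ℝ → ℂ, ∫ κ : ℝ × ℝ, F κ.1 * G κ.2 = (∫ x, F x) * ∫ x, G x := fun F G => by
    rw [Measure.volume_eq_prod, integral_prod_mul]
  have e : ∀ κ : ℝ × ℝ, P.spinWeight ς a b t κ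
        * Complex.exp (Complex.I * ((κ.1 * u₀ + κ.2 * u₁ : ℝ) : ℂ))
      = Complex.I / (2 * P.sinhOver t)
        * (P.γ 0 a b * ((planeWeight' α ς.1 κ.1 * Complex.exp (Complex.I * ((κ.1 * u₀ : ℝ) : ℂ)))
            * (planeWeight α ς.2 κ.2 * Complex.exp (Complex.I * ((κ.2 * u₁ : ℝ) : ℂ))))
          + P.γ 1 a b * ((planeWeight α ς.1 κ.1 * Complex.exp (Complex.I * ((κ.1 * u₀ : ℝ) : ℂ)))
            * (planeWeight' α ς.2 κ.2 * Complex.exp (Complex.I * ((κ.2 * u₁ : ℝ) : ℂ)))))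
      + (-(P.m * P.spinFactor t a b))
        * ((planeWeight α ς.1 κ.1 * Complex.exp (Complex.I * ((κ.1 * u₀ : ℝ) : ℂ)))
            * (planeWeight α ς.2 κ.2 * Complex.exp (Complex.I * ((κ.2 * u₁ : ℝ) : ℂ)))) := by
    intro κ
    rw [spinWeight, Complex.ofReal_add, mul_add Complex.I, Complex.exp_add]
    ring
  simp only [e]
  have hj : ∀ {F G : ℝ → ℂ}, Integrable F → Integrable G →
      Integrable (fun κ : ℝ × ℝ => F κ.1 * G κ.2) := fun hF hG => hF.mul_prod hG
  rw [integral_linear_combination (hj (w2 ς.1 u₀) (w1 ς.2 u₁)) (hj (w1 ς.1 u₀) (w2 ς.2 u₁))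
    (hj (w1 ς.1 u₀) (w1 ς.2 u₁)),
    hprod (fun κ => planeWeight' α ς.1 κ * Complex.exp (Complex.I * ((κ * u₀ : ℝ) : ℂ)))
      (fun κ => planeWeight α ς.2 κ * Complex.exp (Complex.I * ((κ * u₁ : ℝ) : ℂ))),
    hprod (fun κ => planeWeight α ς.1 κ * Complex.exp (Complex.I * ((κ * u₀ : ℝ) : ℂ)))
      (fun κ => planeWeight' α ς.2 κ * Complex.exp (Complex.I * ((κ * u₁ : ℝ) : ℂ))),
    hprod (fun κ => planeWeight α ς.1 κ * Complex.exp (Complex.I * ((κ * u₀ : ℝ) : ℂ)))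
      (fun κ => planeWeight α ς.2 κ * Complex.exp (Complex.I * ((κ * u₁ : ℝ) : ℂ))),
    integral_planeWeight hα, integral_planeWeight hα, integral_planeWeight' hα,
    integral_planeWeight' hα]
  have hE : -(α / 4) * (u₀ ^ 2 + u₁ ^ 2) + (ς.1 * u₀ + ς.2 * u₁)
      = (-(α / 4) * u₀ ^ 2 + ς.1 * u₀) + (-(α / 4) * u₁ ^ 2 + ς.2 * u₁) := by ring
  rw [hE, Real.exp_add (-(α / 4) * u₀ ^ 2 + ς.1 * u₀), Complex.ofReal_mul]
  ring

/-- The propagator is a superposition of products of a Gaussian, of plane waves and of a real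
exponential in the short variable. -/
theorem prop_mul_exp (hθ : P.θ ≠ 0) (hM : 1 < P.M) (hγ : P.Clifford)
    (hm : P.m ≠ 0 ∨ P.Ω ≠ 0) (i : ℕ) {ς : ℝ × ℝ} (h1 : |ς.1| ≤ P.rate) (h2 : |ς.2| ≤ P.rate)
    (a b : Fin 2) (x y : Plane) :
    P.prop i x y a b * ((Real.exp (ς.1 * (x - y) 0 + ς.2 * (x - y) 1) : ℝ) : ℂ)
      = Complex.exp (Complex.I * ((P.Ω * P.wedge x y : ℝ) : ℂ))
        * ∫ τ, P.lineWeight i ς a b τ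
          * (((Real.exp (-(P.beta τ.1 / 2) * ‖x - y‖ ^ 2) : ℝ) : ℂ)
            * Complex.exp (Complex.I * ((τ.2.1 * (x - y) 0 + τ.2.2 * (x - y) 1 : ℝ) : ℂ))) := by
  have hint : Integrable (fun τ => P.lineWeight i ς a b τ
          * (((Real.exp (-(P.beta τ.1 / 2) * ‖x - y‖ ^ 2) : ℝ) : ℂ)
            * Complex.exp (Complex.I * ((τ.2.1 * (x - y) 0 + τ.2.2 * (x - y) 1 : ℝ) : ℂ)))) := by
    have hb := P.measurable_beta.comp (measurable_fst : Measurable (Prod.fst : ℝ × (ℝ × ℝ) → ℝ))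
    refine (P.integrable_lineWeight hθ hM hγ hm i h1 h2 a b).mul_bdd (c := 1) ?_ ?_
    · refine (Measurable.mul ?_ ?_).aestronglyMeasurable
      · exact Complex.measurable_ofReal.comp
          (Real.measurable_exp.comp (((hb.div_const 2).neg).mul_const _))
      · generalize (x - y) 0 = u₀
        generalize (x - y) 1 = u₁
        fun_prop
    · refine .of_forall fun τ => ?_
      rw [norm_mul, Complex.norm_exp_I_mul_ofReal, mul_one, Complex.norm_real,
        Real.norm_of_nonneg (Real.exp_pos _).le, Real.exp_le_one_iff]
      have := P.beta_pos hθ τ.1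
      have := mul_nonneg (half_pos this).le (sq_nonneg ‖x - y‖)
      linarith
  rw [Measure.volume_eq_prod, integral_prod _ (by rwa [← Measure.volume_eq_prod])]
  rw [prop, Matrix.of_apply, ← integral_indicator (P.measurableSet_slice i), ← integral_mul_const,
    ← integral_const_mul]
  refine integral_congr_ae (.of_forall fun t => ?_)
  dsimp only
  by_cases ht : t ∈ P.slice i
  · have ht0 := P.slice_pos hM ht
    simp only [lineWeight, Set.indicator_of_mem ht]
    have e : ∀ κ : ℝ × ℝ, -((Real.exp (-t * P.m ^ 2) / (4 * Real.pi * P.sinhOver t) : ℝ) : ℂ)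
        * P.spinWeight ς a b t κ * (((Real.exp (-(P.beta t / 2) * ‖x - y‖ ^ 2) : ℝ) : ℂ)
            * Complex.exp (Complex.I * ((κ.1 * (x - y) 0 + κ.2 * (x - y) 1 : ℝ) : ℂ)))
        = (-((Real.exp (-t * P.m ^ 2) / (4 * Real.pi * P.sinhOver t) : ℝ) : ℂ)
          * ((Real.exp (-(P.beta t / 2) * ‖x - y‖ ^ 2) : ℝ) : ℂ)) * (P.spinWeight ς a b t κ
            * Complex.exp (Complex.I * ((κ.1 * (x - y) 0 + κ.2 * (x - y) 1 : ℝ) : ℂ))) :=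
      fun κ => by ring
    simp only [e]
    rw [integral_const_mul, P.integral_spinWeight_mul hθ ς a b ht0,
      P.kernel_apply hθ hγ (fun t ht => P.sinhOver_pos hθ ht) ht0]
    have hn : ‖x - y‖ ^ 2 = (x - y) 0 ^ 2 + (x - y) 1 ^ 2 := by
      rw [EuclideanSpace.norm_sq_eq, Fin.sum_univ_two, Real.norm_eq_abs, Real.norm_eq_abs, sq_abs,
        sq_abs]
    -- The Gaussian is split in two equal halves: one stays as the width `beta`, the other is the
    -- one rebuilt from plane waves together with the tilt.
    have hE : Real.exp (-(P.omCoth t / 2) * ‖x - y‖ ^ 2)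
          * Real.exp (ς.1 * (x - y) 0 + ς.2 * (x - y) 1)
        = Real.exp (-(P.beta t / 2) * ‖x - y‖ ^ 2) * Real.exp (-(P.omCoth t / 4)
          * ((x - y) 0 ^ 2 + (x - y) 1 ^ 2) + (ς.1 * (x - y) 0 + ς.2 * (x - y) 1)) := by
      rw [← Real.exp_add, ← Real.exp_add, ← hn, beta, if_pos ht0]
      congr 1
      ring
    have hE' := congrArg (fun r : ℝ => (r : ℂ)) hE
    simp only [Complex.ofReal_mul] at hE'
    linear_combination (Complex.exp (Complex.I * ((P.Ω * P.wedge x y : ℝ) : ℂ))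
        * (-((Real.exp (-t * P.m ^ 2) / (4 * Real.pi * P.sinhOver t) : ℝ) : ℂ))
          * (Complex.I / (2 * P.sinhOver t)
              * (P.γ 0 a b * ((x - y) 0 : ℝ) + P.γ 1 a b * ((x - y) 1 : ℝ))
            - P.m * P.spinFactor t a b)) * hE'
  · simp only [lineWeight, Set.indicator_of_notMem ht, zero_mul, integral_zero, mul_zero]

end Model

/-! ### A slowly varying cut-off -/

theorem hasDerivAt_inv_cosh (t : ℝ) :
    HasDerivAt (fun t => (Real.cosh t)⁻¹) (-(Real.tanh t * (Real.cosh t)⁻¹)) t := by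
  have h := (Real.hasDerivAt_cosh t).inv (Real.cosh_pos t).ne'
  refine h.congr_deriv ?_
  rw [Real.tanh_eq_sinh_div_cosh]
  field_simp

theorem hasDerivAt_tanh (t : ℝ) : HasDerivAt Real.tanh (1 - Real.tanh t ^ 2) t := by
  have h := (Real.hasDerivAt_sinh t).div (Real.hasDerivAt_cosh t) (Real.cosh_pos t).ne'
  have e : Real.tanh = Real.sinh / Real.cosh := by
    ext t; rw [Real.tanh_eq_sinh_div_cosh]; rfl
  have hc := (Real.cosh_pos t).ne'
  rw [Real.tanh_eq_sinh_div_cosh t, e]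
  refine h.congr_deriv ?_
  field_simp

open Polynomial in
-- Differentiation sends $q(\tanh)/\cosh$ to an expression of the same kind. As tanh is bounded, all
-- derivatives of 1/cosh are controlled by 1/cosh itself.
theorem exists_iteratedDeriv_inv_cosh (n : ℕ) : ∃ q : ℝ[X], ∀ t,
    iteratedDeriv n (fun t => (Real.cosh t)⁻¹) t = q.eval (Real.tanh t) * (Real.cosh t)⁻¹ := by
  induction n with
  | zero => exact ⟨1, fun t => by simp⟩
  | succ n ih =>
    obtain ⟨q, hq⟩ := ih
    refine ⟨derivative q * (1 - X ^ 2) - q * X, fun t => ?_⟩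
    rw [iteratedDeriv_succ, funext hq]
    have h := ((q.hasDerivAt (Real.tanh t)).comp t (hasDerivAt_tanh t)).mul (hasDerivAt_inv_cosh t)
    refine (h.deriv).trans ?_
    simp
    ring

theorem exists_norm_iteratedDeriv_inv_cosh_le (n : ℕ) : ∃ C : ℝ, 0 ≤ C ∧ ∀ t,
    ‖iteratedDeriv n (fun t => (Real.cosh t)⁻¹) t‖ ≤ C * (Real.cosh t)⁻¹ := by
  obtain ⟨q, hq⟩ := exists_iteratedDeriv_inv_cosh n
  obtain ⟨C, hC⟩ := (isCompact_Icc (a := (-1 : ℝ)) (b := 1)).exists_bound_of_continuousOn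
    q.continuous.continuousOn
  refine ⟨C, (norm_nonneg _).trans (hC 0 (by simp)), fun t => ?_⟩
  rw [hq, norm_mul, Real.norm_of_nonneg (inv_pos.2 (Real.cosh_pos t)).le]
  exact mul_le_mul_of_nonneg_right (hC _ ⟨(Real.neg_one_lt_tanh t).le, (Real.tanh_lt_one t).le⟩)
    (inv_pos.2 (Real.cosh_pos t)).le

theorem contDiff_inv_cosh {n : WithTop ℕ∞} : ContDiff ℝ n fun t => (Real.cosh t)⁻¹ :=
  Real.contDiff_cosh.inv fun t => (Real.cosh_pos t).ne'

/-- The cut-off `1 / (4 cosh (δ x₀) cosh (δ x₁))`. -/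
def cutoff (δ : ℝ) (x : Plane) : ℝ :=
  1 / 4 * ((Real.cosh (δ * x 0))⁻¹ * (Real.cosh (δ * x 1))⁻¹)

theorem cutoff_neg (δ : ℝ) (x : Plane) : cutoff δ (-x) = cutoff δ x := by
  simp [cutoff]

theorem contDiff_inv_cosh_coord (δ : ℝ) (μ : Fin 2) {n : WithTop ℕ∞} :
    ContDiff ℝ n fun x : Plane => (Real.cosh (δ * x μ))⁻¹ :=
  contDiff_inv_cosh.comp
    ((δ • (EuclideanSpace.proj μ : Plane →L[ℝ] ℝ)).contDiff)

theorem contDiff_cutoff (δ : ℝ) {n : WithTop ℕ∞} : ContDiff ℝ n (cutoff δ) :=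
  contDiff_const.mul ((contDiff_inv_cosh_coord δ 0).mul (contDiff_inv_cosh_coord δ 1))

theorem exists_norm_iteratedFDeriv_inv_cosh_coord_le (δ : ℝ) (μ : Fin 2) (n : ℕ) :
    ∃ C : ℝ, 0 ≤ C ∧ ∀ x : Plane, ‖iteratedFDeriv ℝ n (fun x : Plane => (Real.cosh (δ * x μ))⁻¹) x‖
      ≤ C * (Real.cosh (δ * x μ))⁻¹ := by
  obtain ⟨C, hC, h⟩ := exists_norm_iteratedDeriv_inv_cosh_le n
  set A : Plane →L[ℝ] ℝ := δ • (EuclideanSpace.proj μ : Plane →L[ℝ] ℝ) with hA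
  refine ⟨C * ‖A‖ ^ n, by positivity, fun x => ?_⟩
  have e : (fun x : Plane => (Real.cosh (δ * x μ))⁻¹) = (fun t => (Real.cosh t)⁻¹) ∘ A := rfl
  have h1 := A.iteratedFDeriv_comp_right (contDiff_inv_cosh (n := n)) x le_rfl
  rw [e, h1]
  refine (ContinuousMultilinearMap.norm_compContinuousLinearMap_le _ _).trans ?_
  rw [Finset.prod_const, Finset.card_univ, Fintype.card_fin, norm_iteratedFDeriv_eq_norm_iteratedDeriv,
    mul_right_comm]
  exact mul_le_mul_of_nonneg_right (h _) (by positivity)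

/-- The derivatives keep the full exponential decay of the cut-off. The hyperbolic cosine is chosen
because in addition the inverse of the cut-off is a finite sum of exponentials, which factor over
the lines. -/
theorem exists_norm_iteratedFDeriv_cutoff_le (δ : ℝ) (n : ℕ) : ∃ C : ℝ, 0 ≤ C ∧ ∀ x,
    ‖iteratedFDeriv ℝ n (cutoff δ) x‖ ≤ C * cutoff δ x := by
  choose C₀ h₀ b₀ using exists_norm_iteratedFDeriv_inv_cosh_coord_le δ 0
  choose C₁ h₁ b₁ using exists_norm_iteratedFDeriv_inv_cosh_coord_le δ 1
  refine ⟨∑ i ∈ Finset.range (n + 1), (n.choose i : ℝ) * C₀ i * C₁ (n - i),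
    Finset.sum_nonneg fun i _ => by have := h₀ i; have := h₁ (n - i); positivity, fun x => ?_⟩
  have e : cutoff δ = (1 / 4 : ℝ) • fun x : Plane =>
      (Real.cosh (δ * x 0))⁻¹ * (Real.cosh (δ * x 1))⁻¹ := rfl
  have c0 := contDiff_inv_cosh_coord δ 0 (n := n)
  have c1 := contDiff_inv_cosh_coord δ 1 (n := n)
  rw [e, iteratedFDeriv_const_smul_apply (c0.mul c1).contDiffAt, norm_smul]
  have hm := norm_iteratedFDeriv_mul_le c0 c1 x le_rfl
  have p0 := (inv_pos.2 (Real.cosh_pos (δ * x 0))).le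
  have p1 := (inv_pos.2 (Real.cosh_pos (δ * x 1))).le
  calc _ ≤ ‖(1 / 4 : ℝ)‖ * ∑ i ∈ Finset.range (n + 1), (n.choose i : ℝ)
          * (C₀ i * (Real.cosh (δ * x 0))⁻¹) * (C₁ (n - i) * (Real.cosh (δ * x 1))⁻¹) := by
        refine mul_le_mul_of_nonneg_left (hm.trans (Finset.sum_le_sum fun i _ => ?_)) (norm_nonneg _)
        have := h₀ i
        gcongr
        · exact b₀ i x
        · exact b₁ (n - i) x
    _ = _ := by
        rw [Finset.mul_sum, Finset.sum_mul]
        refine Finset.sum_congr rfl fun i _ => ?_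
        simp only [Pi.smul_apply, smul_eq_mul]
        norm_num
        ring

theorem inv_cosh_le (t : ℝ) : (Real.cosh t)⁻¹ ≤ 2 * Real.exp (-|t|) := by
  rw [inv_le_iff_one_le_mul₀ (Real.cosh_pos t), ← Real.cosh_abs t, Real.cosh_eq]
  have : Real.exp (-|t|) * Real.exp |t| = 1 := by rw [← Real.exp_add]; simp
  have := sq_nonneg (Real.exp (-|t|))
  nlinarith

theorem norm_le_abs_add_abs (x : Plane) : ‖x‖ ≤ |x 0| + |x 1| := by
  rw [EuclideanSpace.norm_eq, Fin.sum_univ_two]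
  refine Real.sqrt_le_iff.2 ⟨by positivity, ?_⟩
  simp only [Real.norm_eq_abs]
  nlinarith [abs_nonneg (x 0), abs_nonneg (x 1)]

theorem cutoff_le {δ : ℝ} (hδ : 0 ≤ δ) (x : Plane) : cutoff δ x ≤ Real.exp (-(δ * ‖x‖)) := by
  calc cutoff δ x ≤ 1 / 4 * ((2 * Real.exp (-|δ * x 0|)) * (2 * Real.exp (-|δ * x 1|))) := by
        unfold cutoff
        gcongr
        · exact inv_cosh_le _
        · exact inv_cosh_le _
    _ = Real.exp (-(δ * (|x 0| + |x 1|))) := by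
        rw [abs_mul, abs_mul, abs_of_nonneg hδ, mul_add, neg_add, Real.exp_add]
        ring
    _ ≤ _ := by
        apply Real.exp_le_exp.2
        have := mul_le_mul_of_nonneg_left (norm_le_abs_add_abs x) hδ
        linarith

theorem hasTemperateGrowth_cutoff {δ : ℝ} (hδ : 0 ≤ δ) : (cutoff δ).HasTemperateGrowth := by
  refine ⟨contDiff_cutoff δ, fun n => ?_⟩
  obtain ⟨C, hC, h⟩ := exists_norm_iteratedFDeriv_cutoff_le δ n
  refine ⟨0, C, fun x => (h x).trans ?_⟩
  rw [pow_zero]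
  refine mul_le_mul_of_nonneg_left ((cutoff_le hδ x).trans ?_) hC
  rw [Real.exp_le_one_iff]
  have := mul_nonneg hδ (norm_nonneg x)
  linarith

theorem integrable_exp_neg_norm {δ : ℝ} (hδ : 0 < δ) :
    Integrable fun x : Plane => Real.exp (-(δ * ‖x‖)) := by
  have h := integrable_one_add_norm (E := Plane) (μ := volume) (r := 3) (by simp; norm_num)
  obtain ⟨C, hC⟩ : ∃ C : ℝ, ∀ s : ℝ, 0 ≤ s → Real.exp (-(δ * s)) ≤ C * (1 + s) ^ (-3 : ℝ) := by
    refine ⟨Real.exp δ * (6 / δ ^ 3), fun s hs => ?_⟩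
    have h1 : (1 + s) ^ (-3 : ℝ) = ((1 + s) ^ 3)⁻¹ := by
      rw [Real.rpow_neg (by positivity)]; norm_cast
    have h2 := Real.pow_div_factorial_le_exp (δ * (1 + s)) (by positivity) 3
    rw [h1, ← div_eq_mul_inv, le_div_iff₀ (by positivity)]
    have h3 : Real.exp (-(δ * s)) = Real.exp δ * (Real.exp (δ * (1 + s)))⁻¹ := by
      rw [← Real.exp_neg, ← Real.exp_add]; congr 1; ring
    rw [h3, mul_assoc]
    refine mul_le_mul_of_nonneg_left ?_ (Real.exp_pos _).le
    rw [inv_mul_le_iff₀ (Real.exp_pos _), ← div_le_iff₀ (by positivity)]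
    refine le_trans (le_of_eq ?_) h2
    norm_num [Nat.factorial]
    field_simp
  refine (h.const_mul C).mono' (by fun_prop : Continuous fun x : Plane =>
    Real.exp (-(δ * ‖x‖))).aestronglyMeasurable (.of_forall fun x => ?_)
  rw [Real.norm_of_nonneg (Real.exp_pos _).le]
  exact hC _ (norm_nonneg _)

/-! ### Slowly varying envelopes of Schwartz functions -/

section Envelope

variable (f : 𝓢(Plane, ℂ)) (η : ℝ)

/-- The size of a function and of its first two derivatives. -/
def jet (z : Plane) : ℝ := ∑ p ∈ Finset.range 3, ‖iteratedFDeriv ℝ p f z‖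

theorem jet_nonneg (z : Plane) : 0 ≤ jet f z := Finset.sum_nonneg fun _ _ => norm_nonneg _

theorem norm_iteratedFDeriv_le_jet {p : ℕ} (hp : p ≤ 2) (z : Plane) :
    ‖iteratedFDeriv ℝ p f z‖ ≤ jet f z :=
  Finset.single_le_sum (f := fun p => ‖iteratedFDeriv ℝ p f z‖) (fun _ _ => norm_nonneg _)
    (Finset.mem_range.2 (by omega))

theorem norm_le_jet (z : Plane) : ‖f z‖ ≤ jet f z := by
  have := norm_iteratedFDeriv_le_jet f (Nat.zero_le _) z
  rwa [norm_iteratedFDeriv_zero] at this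

theorem seminorm_le_weightedNorm {F : Type*} [NormedAddCommGroup F] [NormedSpace ℝ F]
    (f : 𝓢(Plane, F)) {j k p q : ℕ} (hj : j ≤ k) (hp : p ≤ q) :
    SchwartzMap.seminorm ℝ j p f ≤ weightedNorm k q f :=
  Seminorm.le_def.1 (Finset.le_sup (f := schwartzSeminormFamily ℝ Plane F) (b := (j, p))
    (Finset.mem_Iic.2 (Prod.mk_le_mk.2 ⟨hj, hp⟩))) f

theorem weightedNorm_nonneg {F : Type*} [NormedAddCommGroup F] [NormedSpace ℝ F]
    (f : 𝓢(Plane, F)) (k p : ℕ) : 0 ≤ weightedNorm k p f := apply_nonneg _ _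

theorem pow_mul_jet_le {j k : ℕ} (hj : j ≤ k) (z : Plane) :
    ‖z‖ ^ j * jet f z ≤ 3 * weightedNorm k 2 f := by
  rw [jet, Finset.mul_sum]
  refine (Finset.sum_le_card_nsmul _ _ (weightedNorm k 2 f) fun p hp => ?_).trans (by simp)
  exact (f.le_seminorm ℝ j p z).trans (seminorm_le_weightedNorm f hj
    (by have := Finset.mem_range.1 hp; omega))

theorem jet_le (z : Plane) : jet f z ≤ 3 * weightedNorm 0 2 f := by
  simpa using pow_mul_jet_le f (le_refl 0) z

/-- The envelope of a function and of its first two derivatives. -/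
def envelope (x : Plane) : ℝ := ⨆ z, jet f z * Real.exp (-(η * ‖x - z‖))

variable {η}

theorem bddAbove_envelope (hη : 0 ≤ η) (x : Plane) :
    BddAbove (Set.range fun z => jet f z * Real.exp (-(η * ‖x - z‖))) := by
  refine ⟨3 * weightedNorm 0 2 f, ?_⟩
  rintro _ ⟨z, rfl⟩
  refine (mul_le_of_le_one_right (jet_nonneg f z) ?_).trans (jet_le f z)
  rw [Real.exp_le_one_iff]
  have := mul_nonneg hη (norm_nonneg (x - z))
  linarith

theorem le_envelope (hη : 0 ≤ η) (x z : Plane) :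
    jet f z * Real.exp (-(η * ‖x - z‖)) ≤ envelope f η x :=
  le_ciSup (bddAbove_envelope f hη x) z

theorem jet_le_envelope (hη : 0 ≤ η) (x : Plane) : jet f x ≤ envelope f η x := by
  simpa using le_envelope f hη x x

theorem envelope_nonneg (hη : 0 ≤ η) (x : Plane) : 0 ≤ envelope f η x :=
  (jet_nonneg f x).trans (jet_le_envelope f hη x)

/-- Slow variation, by the triangle inequality in the exponent; convolution with a positive kernel
preserves it. -/
theorem envelope_le (hη : 0 ≤ η) (x y : Plane) :
    envelope f η x ≤ Real.exp (η * ‖x - y‖) * envelope f η y := by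
  refine ciSup_le fun z => ?_
  refine le_trans ?_ (mul_le_mul_of_nonneg_left (le_envelope f hη y z) (Real.exp_pos _).le)
  rw [mul_left_comm, ← Real.exp_add]
  refine mul_le_mul_of_nonneg_left (Real.exp_le_exp.2 ?_) (jet_nonneg f z)
  have h : ‖y - z‖ ≤ ‖x - y‖ + ‖x - z‖ := by
    have := norm_sub_le_norm_sub_add_norm_sub y x z
    rwa [norm_sub_rev y x] at this
  have := mul_le_mul_of_nonneg_left h hη
  linarith

theorem measurable_envelope (hη : 0 ≤ η) : Measurable (envelope f η) := by
  refine LowerSemicontinuous.measurable ?_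
  exact lowerSemicontinuous_ciSup (fun x => bddAbove_envelope f hη x) fun z =>
    Continuous.lowerSemicontinuous (by fun_prop)

theorem envelope_le_const (hη : 0 ≤ η) (x : Plane) : envelope f η x ≤ 3 * weightedNorm 0 2 f := by
  refine ciSup_le fun z => ?_
  refine (mul_le_of_le_one_right (jet_nonneg f z) ?_).trans (jet_le f z)
  rw [Real.exp_le_one_iff]
  have := mul_nonneg hη (norm_nonneg (x - z))
  linarith

theorem pow_mul_exp_neg_le (hη : 0 < η) (j : ℕ) {s : ℝ} (hs : 0 ≤ s) :
    s ^ j * Real.exp (-(η * s)) ≤ j.factorial / η ^ j := by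
  have h := Real.pow_div_factorial_le_exp (η * s) (by positivity) j
  rw [Real.exp_neg, ← div_eq_mul_inv, div_le_div_iff₀ (Real.exp_pos _) (by positivity)]
  rw [div_le_iff₀ (by positivity)] at h
  rw [← mul_pow, mul_comm s η, mul_comm (j.factorial : ℝ)]
  exact h

/-- The constant in the polynomial decay of the envelope. -/
def envelopeConst (η : ℝ) (j : ℕ) : ℝ := 3 * (2 ^ (j - 1) * (j.factorial / η ^ j + 1))

theorem envelopeConst_pos (hη : 0 < η) (j : ℕ) : 0 < envelopeConst η j := by
  unfold envelopeConst; positivity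

/-- Powers of x are split between z, where the decay of f and its derivatives pays for them, and x −
z, where the exponential does. -/
theorem pow_mul_envelope_le (hη : 0 < η) {j k : ℕ} (hj : j ≤ k) (x : Plane) :
    ‖x‖ ^ j * envelope f η x ≤ envelopeConst η j * weightedNorm k 2 f := by
  rw [envelope, Real.mul_iSup_of_nonneg (by positivity)]
  refine ciSup_le fun z => ?_
  set s := ‖x - z‖ with hs
  have hs0 : 0 ≤ s := norm_nonneg _
  have h1 : ‖x‖ ^ j ≤ 2 ^ (j - 1) * (s ^ j + ‖z‖ ^ j) := by
    refine (pow_le_pow_left₀ (norm_nonneg _) ?_ j).trans (add_pow_le hs0 (norm_nonneg z) j)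
    simpa using norm_add_le (x - z) z
  have hJ := jet_nonneg f z
  have h2 := pow_mul_exp_neg_le hη j hs0
  have h3 : jet f z ≤ 3 * weightedNorm k 2 f := by simpa using pow_mul_jet_le f (Nat.zero_le k) z
  have h4 := pow_mul_jet_le f hj z
  have hN := weightedNorm_nonneg f k 2
  have h5 : Real.exp (-(η * s)) ≤ 1 := by
    rw [Real.exp_le_one_iff]
    have := mul_nonneg hη.le hs0
    linarith
  calc ‖x‖ ^ j * (jet f z * Real.exp (-(η * s)))
      ≤ 2 ^ (j - 1) * (s ^ j + ‖z‖ ^ j) * (jet f z * Real.exp (-(η * s))) := by gcongr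
    _ = 2 ^ (j - 1) * ((s ^ j * Real.exp (-(η * s))) * jet f z
          + (‖z‖ ^ j * jet f z) * Real.exp (-(η * s))) := by ring
    _ ≤ 2 ^ (j - 1) * ((j.factorial / η ^ j) * (3 * weightedNorm k 2 f)
          + (3 * weightedNorm k 2 f) * 1) := by gcongr
    _ = _ := by rw [envelopeConst]; ring

end Envelope

/-! ### Mollification -/

open scoped Convolution ContDiff

/-- On the support of φ, a slowly varying H is comparable to its value at the centre, with a
constant that does not depend on H. -/
theorem exists_norm_convolution_le {η : ℝ} {E F : Type} [NormedAddCommGroup E] [NormedSpace ℝ E]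
    [NormedAddCommGroup F] [NormedSpace ℝ F] (L : E →L[ℝ] ℝ →L[ℝ] F)
    {φ : Plane → E} (hφ : Continuous φ) (hc : HasCompactSupport φ) : ∃ C : ℝ, ∀ H : Plane → ℝ,
    (∀ x, 0 ≤ H x) → (∀ x y, H x ≤ Real.exp (η * ‖x - y‖) * H y) →
    ∀ x, ‖(φ ⋆[L] H) x‖ ≤ C * H x := by
  refine ⟨∫ t, ‖L‖ * ‖φ t‖ * Real.exp (η * ‖t‖), fun H hH hs x => ?_⟩
  rw [convolution, ← integral_mul_const]
  refine norm_integral_le_of_norm_le (Integrable.mul_const ?_ _) (.of_forall fun t => ?_)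
  · refine Continuous.integrable_of_hasCompactSupport (by fun_prop) ?_
    exact (hc.norm.mul_left (f := fun _ => ‖L‖)).mul_right
  · refine (L.le_opNorm₂ _ _).trans ?_
    rw [Real.norm_of_nonneg (hH _), mul_assoc _ (Real.exp _)]
    refine mul_le_mul_of_nonneg_left ?_ (by positivity)
    have := hs (x - t) x
    rwa [sub_sub_cancel_left, norm_neg] at this

/-- All derivatives fall on φ, so the mollification of the envelope is smooth with derivatives
controlled by the envelope, which itself is only semicontinuous. The target spaces vary in the
statement because each derivative changes them. -/
theorem exists_norm_iteratedFDeriv_convolution_le {η : ℝ} (n : ℕ) : ∀ {E F : Type}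
    [NormedAddCommGroup E] [NormedSpace ℝ E] [NormedAddCommGroup F] [NormedSpace ℝ F]
    (L : E →L[ℝ] ℝ →L[ℝ] F) {φ : Plane → E}, ContDiff ℝ ∞ φ → HasCompactSupport φ →
    ∃ C : ℝ, ∀ H : Plane → ℝ, LocallyIntegrable H → (∀ x, 0 ≤ H x) →
      (∀ x y, H x ≤ Real.exp (η * ‖x - y‖) * H y) →
      ∀ x, ‖iteratedFDeriv ℝ n (φ ⋆[L] H) x‖ ≤ C * H x := by
  induction n with
  | zero =>
    intro E F _ _ _ _ L φ hφ hc
    obtain ⟨C, h⟩ := exists_norm_convolution_le (η := η) L hφ.continuous hc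
    refine ⟨C, fun H _ hH hs x => ?_⟩
    rw [norm_iteratedFDeriv_zero]
    exact h H hH hs x
  | succ n ih =>
    intro E F _ _ _ _ L φ hφ hc
    have hφ1 : ContDiff ℝ 1 φ := hφ.of_le (by exact_mod_cast le_top)
    obtain ⟨C, h⟩ := ih (L.precompL Plane)
      (hφ.fderiv_right (m := ∞) (by norm_num)) (hc.fderiv ℝ)
    refine ⟨C, fun H hl hH hs x => ?_⟩
    rw [← norm_iteratedFDeriv_fderiv]
    have e : fderiv ℝ (φ ⋆[L] H) = (fderiv ℝ φ) ⋆[L.precompL Plane] H :=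
      funext fun x => (hc.hasFDerivAt_convolution_left L hφ1 hl x).fderiv
    rw [e]
    exact h H hl hH hs x

/-- A Schwartz function has a slowly varying Schwartz majorant with comparable norms. -/
theorem exists_schwartz_envelope {η : ℝ} (hη : 0 < η) (k : ℕ) : ∃ c : ℝ, 0 < c ∧
    ∀ f : 𝓢(Plane, ℂ), ∃ g : 𝓢(Plane, ℝ), (∀ x, 0 ≤ g x) ∧
      weightedNorm k 0 g ≤ weightedNorm k 2 f ∧
      (∀ x u, Real.exp (-(η * ‖u‖)) * g x ≤ g (x - u)) ∧ ∀ x, envelope f η x ≤ c * g x := by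
  let b : ContDiffBump (0 : Plane) := ⟨1, 2, one_pos, one_lt_two⟩
  set ψ : Plane → ℝ := fun x => b x with hψ
  have hψc : HasCompactSupport ψ := b.hasCompactSupport
  have hψs : ContDiff ℝ ∞ ψ := b.contDiff
  have hψ0 : ∀ x, 0 ≤ ψ x := fun x => b.nonneg
  set L := ContinuousLinearMap.lsmul ℝ ℝ (E := ℝ)
  choose C hC using fun n => exists_norm_iteratedFDeriv_convolution_le (η := η) n L hψs hψc
  set I := ∫ t, ψ t * Real.exp (-(η * ‖t‖)) with hI
  have hIint : Integrable fun t => ψ t * Real.exp (-(η * ‖t‖)) :=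
    Continuous.integrable_of_hasCompactSupport (hψs.continuous.mul (by fun_prop)) hψc.mul_right
  have hI0 : 0 < I := by
    refine (integral_pos_iff_support_of_nonneg
      (fun t => mul_nonneg (hψ0 t) (Real.exp_pos _).le) hIint).2 ?_
    have : Function.support (fun t => ψ t * Real.exp (-(η * ‖t‖))) = Metric.ball 0 2 := by
      rw [← b.support_eq]
      ext t
      simp [Real.exp_ne_zero, hψ]
    rw [this]
    exact Metric.measure_ball_pos _ _ two_pos
  have hLI : ∀ f : 𝓢(Plane, ℂ), LocallyIntegrable (envelope f η) := fun f => by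
    refine (locallyIntegrable_const (3 * weightedNorm 0 2 f)).mono
      (measurable_envelope f hη.le).aestronglyMeasurable (.of_forall fun x => ?_)
    rw [Real.norm_of_nonneg (envelope_nonneg f hη.le x)]
    exact (envelope_le_const f hη.le x).trans (le_abs_self _)
  have hint : ∀ (f : 𝓢(Plane, ℂ)) (x : Plane), Integrable fun t => ψ t * envelope f η (x - t) :=
    fun f x => (hψc.convolutionExists_left L hψs.continuous (hLI f)) x
  -- The normalization that makes the constant in the comparison of norms exactly 1; it is paid for
  -- in the constant of the majorization.
  set D := max (C 0) 1 * (∑ j ∈ Finset.range (k + 1), envelopeConst η j) with hD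
  have hsum : 0 < ∑ j ∈ Finset.range (k + 1), envelopeConst η j :=
    Finset.sum_pos (fun j _ => envelopeConst_pos hη j) ⟨0, by simp⟩
  have hD0 : 0 < D := mul_pos (lt_max_of_lt_right one_pos) hsum
  refine ⟨D / I, by positivity, fun f => ?_⟩
  set H := envelope f η with hH
  have hH0 : ∀ x, 0 ≤ H x := envelope_nonneg f hη.le
  have hCH := fun n => hC n H (hLI f) hH0 (envelope_le f hη.le)
  have hconv : ∀ x, (ψ ⋆[L] H) x = ∫ t, ψ t * H (x - t) := fun x => rfl
  let g₀ : 𝓢(Plane, ℝ) :=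
    { toFun := ψ ⋆[L] H
      smooth' := hψc.contDiff_convolution_left L hψs (hLI f)
      decay' := fun j n => ⟨max (C n) 0 * (envelopeConst η j * weightedNorm j 2 f), fun x => by
        calc ‖x‖ ^ j * ‖iteratedFDeriv ℝ n (ψ ⋆[L] H) x‖ ≤ ‖x‖ ^ j * (max (C n) 0 * H x) := by
              gcongr
              exact (hCH n x).trans (mul_le_mul_of_nonneg_right (le_max_left _ _) (hH0 x))
          _ = max (C n) 0 * (‖x‖ ^ j * H x) := by ring
          _ ≤ _ := mul_le_mul_of_nonneg_left (pow_mul_envelope_le f hη le_rfl x)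
                (le_max_right _ _)⟩ }
  have hg₀ : ∀ x, g₀ x = ∫ t, ψ t * H (x - t) := hconv
  have hg₀0 : ∀ x, 0 ≤ g₀ x := fun x => by
    rw [hg₀]; exact integral_nonneg fun t => mul_nonneg (hψ0 t) (hH0 _)
  refine ⟨D⁻¹ • g₀, fun x => mul_nonneg (inv_nonneg.2 hD0.le) (hg₀0 x), ?_, fun x u => ?_,
    fun x => ?_⟩
  · refine Seminorm.finset_sup_apply_le (weightedNorm_nonneg f k 2) fun i hi => ?_
    obtain ⟨hi1, hi2⟩ := Finset.mem_Iic.1 hi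
    have hi2' : i.2 = 0 := Nat.le_zero.1 hi2
    refine SchwartzMap.seminorm_le_bound ℝ i.1 i.2 _ (weightedNorm_nonneg f k 2) fun x => ?_
    rw [hi2', norm_iteratedFDeriv_zero, smul_apply, norm_smul,
      Real.norm_of_nonneg (inv_nonneg.2 hD0.le), mul_left_comm, inv_mul_le_iff₀ hD0]
    have h0 := hCH 0 x
    rw [norm_iteratedFDeriv_zero] at h0
    have h0' : ‖g₀ x‖ ≤ max (C 0) 1 * H x :=
      h0.trans (mul_le_mul_of_nonneg_right (le_max_left _ _) (hH0 x))
    calc ‖x‖ ^ i.1 * ‖g₀ x‖ ≤ ‖x‖ ^ i.1 * (max (C 0) 1 * H x) := by gcongr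
      _ = max (C 0) 1 * (‖x‖ ^ i.1 * H x) := by ring
      _ ≤ max (C 0) 1 * (envelopeConst η i.1 * weightedNorm k 2 f) := by
          exact mul_le_mul_of_nonneg_left (pow_mul_envelope_le f hη hi1 x)
            (le_max_of_le_right zero_le_one)
      _ ≤ D * weightedNorm k 2 f := by
          rw [hD, mul_assoc]
          have := Finset.single_le_sum (f := envelopeConst η)
            (fun j _ => (envelopeConst_pos hη j).le) (Finset.mem_range.2 (Nat.lt_succ_of_le hi1))
          have hN := weightedNorm_nonneg f k 2
          gcongr
  · rw [smul_apply, smul_apply, smul_eq_mul, smul_eq_mul, mul_left_comm]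
    refine mul_le_mul_of_nonneg_left ?_ (inv_nonneg.2 hD0.le)
    rw [hg₀, hg₀, ← integral_const_mul]
    refine integral_mono ((hint f x).const_mul _) (hint f (x - u)) fun t => ?_
    dsimp only
    rw [mul_left_comm]
    refine mul_le_mul_of_nonneg_left ?_ (hψ0 t)
    rw [Real.exp_neg, inv_mul_le_iff₀ (Real.exp_pos _)]
    have := envelope_le f hη.le (x - t) (x - u - t)
    rwa [show x - t - (x - u - t) = u by abel] at this
  · rw [smul_apply, smul_eq_mul, div_mul_eq_mul_div, mul_inv_cancel_left₀ hD0.ne',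
      le_div_iff₀ hI0, hg₀, hI, ← integral_const_mul]
    refine integral_mono (hIint.const_mul _) (hint f x) fun t => ?_
    dsimp only
    rw [mul_left_comm]
    refine mul_le_mul_of_nonneg_left ?_ (hψ0 t)
    rw [mul_comm, Real.exp_neg, inv_mul_le_iff₀ (Real.exp_pos _)]
    have := envelope_le f hη.le x (x - t)
    rwa [sub_sub_cancel] at this

/-! ### Fourier representation of the root function -/

section RootWave

open FourierTransform Laplacian LineDeriv

variable {δ : ℝ} (hδ : 0 < δ) (f : 𝓢(Plane, ℂ)) (y : Plane)

/-- The translate `U ↦ f (U + y)`, cut off. -/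
def cutTranslate (δ : ℝ) : 𝓢(Plane, ℂ) :=
  SchwartzMap.smulLeftCLM ℂ (cutoff δ) (SchwartzMap.compSubConstCLM ℝ (-y) f)

theorem cutTranslate_apply (hδ : 0 < δ) (U : Plane) :
    cutTranslate f y δ U = cutoff δ U • f (U + y) := by
  rw [cutTranslate, SchwartzMap.smulLeftCLM_apply_apply (hasTemperateGrowth_cutoff hδ.le),
    SchwartzMap.compSubConstCLM_apply, sub_neg_eq_add]

/-- The cut-off decays at rate δ. Half of it pays for moving from $f(U+y)$ to the envelope at y,
whose rate is δ/2, and half remains. -/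
theorem exists_norm_iteratedFDeriv_cutTranslate_le (hδ : 0 < δ) {n : ℕ} (hn : n ≤ 2) :
    ∃ C : ℝ, 0 ≤ C ∧ ∀ (f : 𝓢(Plane, ℂ)) (y U : Plane),
    ‖iteratedFDeriv ℝ n (cutTranslate f y δ) U‖
      ≤ C * envelope f (δ / 2) y * Real.exp (-(δ / 2 * ‖U‖)) := by
  choose C hC hb using exists_norm_iteratedFDeriv_cutoff_le δ
  refine ⟨∑ i ∈ Finset.range (n + 1), (n.choose i : ℝ) * C i,
    Finset.sum_nonneg fun i _ => by have := hC i; positivity, fun f y U => ?_⟩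
  have e : (cutTranslate f y δ : Plane → ℂ) = fun U => cutoff δ U • f (U + y) :=
    funext fun U => cutTranslate_apply f y hδ U
  have hf : ContDiff ℝ n fun U => f (U + y) := (f.smooth n).comp (contDiff_id.add contDiff_const)
  rw [e, Finset.sum_mul, Finset.sum_mul]
  refine (norm_iteratedFDeriv_smul_le (contDiff_cutoff δ) hf U le_rfl).trans
    (Finset.sum_le_sum fun i hi => ?_)
  have h1 : ‖iteratedFDeriv ℝ (n - i) (fun U => f (U + y)) U‖
      ≤ Real.exp (δ / 2 * ‖U‖) * envelope f (δ / 2) y := by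
    rw [iteratedFDeriv_comp_add_right]
    refine (norm_iteratedFDeriv_le_jet f (by omega) _).trans ?_
    have := le_envelope f (half_pos hδ).le y (U + y)
    rw [sub_add_cancel_right, norm_neg, Real.exp_neg, ← div_eq_mul_inv,
      div_le_iff₀ (Real.exp_pos _)] at this
    rwa [mul_comm]
  have h2 : ‖iteratedFDeriv ℝ i (cutoff δ) U‖
      ≤ C i * (Real.exp (-(δ / 2 * ‖U‖)) * Real.exp (-(δ / 2 * ‖U‖))) := by
    refine (hb i U).trans (mul_le_mul_of_nonneg_left ((cutoff_le hδ.le U).trans (le_of_eq ?_)) (hC i))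
    rw [← Real.exp_add]
    congr 1
    ring
  calc _ ≤ (n.choose i : ℝ) * (C i * (Real.exp (-(δ / 2 * ‖U‖)) * Real.exp (-(δ / 2 * ‖U‖))))
        * (Real.exp (δ / 2 * ‖U‖) * envelope f (δ / 2) y) := by
        have := hC i
        gcongr
    _ = (n.choose i : ℝ) * C i * envelope f (δ / 2) y * Real.exp (-(δ / 2 * ‖U‖))
        * (Real.exp (-(δ / 2 * ‖U‖)) * Real.exp (δ / 2 * ‖U‖)) := by ring
    _ = _ := by rw [← Real.exp_add, neg_add_cancel, Real.exp_zero, mul_one]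

theorem norm_one_sub_laplacian_le (f : 𝓢(Plane, ℂ)) (x : Plane) :
    ‖(f - Δ f) x‖ ≤ ‖f x‖ + 2 * ‖iteratedFDeriv ℝ 2 f x‖ := by
  have hs : ∀ i, ‖(∂_{EuclideanSpace.basisFun (Fin 2) ℝ i}
      (∂_{EuclideanSpace.basisFun (Fin 2) ℝ i} f) : 𝓢(Plane, ℂ)) x‖ ≤ ‖iteratedFDeriv ℝ 2 f x‖ := by
    intro i
    set e := EuclideanSpace.basisFun (Fin 2) ℝ i
    have h : (∂_{e} (∂_{e} f) : 𝓢(Plane, ℂ)) = ∂^{![e, e]} f := by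
      simp [iteratedLineDerivOp_succ_left]
    rw [h, SchwartzMap.iteratedLineDerivOp_eq_iteratedFDeriv]
    refine (ContinuousMultilinearMap.le_opNorm _ _).trans ?_
    have he : ‖e‖ = 1 := (EuclideanSpace.basisFun (Fin 2) ℝ).norm_eq_one i
    simp [he]
  rw [sub_apply, SchwartzMap.laplacian_eq_sum (EuclideanSpace.basisFun (Fin 2) ℝ), Fin.sum_univ_two,
    add_apply]
  refine (norm_sub_le _ _).trans (add_le_add le_rfl ((norm_add_le _ _).trans ?_))
  rw [two_mul]
  exact add_le_add (hs 0) (hs 1)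

theorem fourier_one_sub_laplacian (f : 𝓢(Plane, ℂ)) (q : Plane) :
    𝓕 (f - Δ f) q = ((1 + (2 * Real.pi) ^ 2 * ‖q‖ ^ 2 : ℝ) : ℂ) * 𝓕 f q := by
  have hg : (fun x : Plane => ‖x‖ ^ 2).HasTemperateGrowth := by fun_prop
  have h : 𝓕 (Δ f) = -(2 * Real.pi) ^ 2 • SchwartzMap.smulLeftCLM ℂ (fun x : Plane => ‖x‖ ^ 2) (𝓕 f) := by
    rw [SchwartzMap.laplacian_eq_fourierMultiplierCLM, SchwartzMap.fourierMultiplierCLM_apply,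
      ← FourierTransform.fourierInv_smul, FourierTransform.fourier_fourierInv_eq]
  rw [sub_eq_add_neg, FourierTransform.fourier_add, add_apply, ← neg_one_smul ℝ,
    FourierTransform.fourier_smul, h, smul_apply, smul_apply,
    SchwartzMap.smulLeftCLM_apply_apply hg]
  simp only [Complex.real_smul]
  push_cast
  ring

/-- $\hat G=(1+4\pi^2|q|^2)^{-1}\widehat{(1-\Delta)G}$, where the first factor is square integrable
in dimension two and the second is controlled by Plancherel. So the $L^1$ norm costs exactly two
derivatives. -/
theorem exists_integral_norm_fourier_cutTranslate_le (hδ : 0 < δ) : ∃ C : ℝ, 0 ≤ C ∧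
    ∀ (f : 𝓢(Plane, ℂ)) (y : Plane),
    ∫ q, ‖𝓕 (cutTranslate f y δ) q‖ ≤ C * envelope f (δ / 2) y := by
  obtain ⟨C₀, hC₀, h₀⟩ := exists_norm_iteratedFDeriv_cutTranslate_le hδ (Nat.zero_le 2)
  obtain ⟨C₂, hC₂, h₂⟩ := exists_norm_iteratedFDeriv_cutTranslate_le hδ (le_refl 2)
  set J := ∫ U : Plane, Real.exp (-(δ * ‖U‖)) with hJ
  have hJint : Integrable fun U : Plane => Real.exp (-(δ * ‖U‖)) := integrable_exp_neg_norm hδ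
  have hIint : Integrable fun q : Plane => ((1 + ‖q‖ ^ 2) ^ 2)⁻¹ := by
    have h := integrable_rpow_neg_one_add_norm_sq (E := Plane) (μ := volume) (r := 4)
      (by simp; norm_num)
    refine h.congr (.of_forall fun q => ?_)
    have : (-(4 : ℝ) / 2) = -((2 : ℕ) : ℝ) := by norm_num
    dsimp only
    rw [this, Real.rpow_neg (by positivity), Real.rpow_natCast]
  set I := ∫ q : Plane, ((1 + ‖q‖ ^ 2) ^ 2)⁻¹ with hI
  have hJ0 : 0 ≤ J := integral_nonneg fun _ => (Real.exp_pos _).le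
  have hI0 : 0 ≤ I := integral_nonneg fun _ => by positivity
  refine ⟨1 / 2 * (I + (C₀ + 2 * C₂) ^ 2 * J), by positivity, fun f y => ?_⟩
  set H := envelope f (δ / 2) y with hH
  set G := cutTranslate f y δ with hG
  have hH0 : 0 ≤ H := envelope_nonneg f (half_pos hδ).le y
  -- The degenerate case is separated because the inequality below divides by the value H of the
  -- envelope.
  rcases hH0.eq_or_lt with hz | hpos
  · have : G = 0 := by
      ext U
      have := h₀ f y U
      rw [norm_iteratedFDeriv_zero, ← hH, ← hz, mul_zero, zero_mul] at this
      simpa using this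
    rw [this, ← hz]
    simp
  set L := G - Δ G with hL
  have hLb : ∀ U, ‖L U‖ ^ 2 ≤ ((C₀ + 2 * C₂) * H) ^ 2 * Real.exp (-(δ * ‖U‖)) := by
    intro U
    have e : Real.exp (-(δ * ‖U‖)) = Real.exp (-(δ / 2 * ‖U‖)) ^ 2 := by
      rw [← Real.exp_nat_mul]; congr 1; push_cast; ring
    rw [e, ← mul_pow]
    refine pow_le_pow_left₀ (norm_nonneg _) ((norm_one_sub_laplacian_le G U).trans ?_) 2
    have a0 := h₀ f y U
    have a2 := h₂ f y U
    rw [norm_iteratedFDeriv_zero] at a0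
    calc ‖G U‖ + 2 * ‖iteratedFDeriv ℝ 2 G U‖
        ≤ C₀ * H * Real.exp (-(δ / 2 * ‖U‖)) + 2 * (C₂ * H * Real.exp (-(δ / 2 * ‖U‖))) := by gcongr
      _ = _ := by ring
  have hL2 : ∫ q, ‖𝓕 L q‖ ^ 2 ≤ ((C₀ + 2 * C₂) * H) ^ 2 * J := by
    rw [SchwartzMap.integral_norm_sq_fourier, hJ, ← integral_const_mul]
    refine integral_mono_of_nonneg (.of_forall fun _ => by positivity) (hJint.const_mul _)
      (.of_forall hLb)
  have hL2i : Integrable fun q => ‖𝓕 L q‖ ^ 2 := ((𝓕 L).memLp 2).integrable_norm_pow two_ne_zero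
  -- Cauchy–Schwarz in its pointwise form; the weights H and $H^{-1}$ make the result linear in H.
  have hpt : ∀ q, ‖𝓕 G q‖ ≤ 1 / 2 * (H * ((1 + ‖q‖ ^ 2) ^ 2)⁻¹ + H⁻¹ * ‖𝓕 L q‖ ^ 2) := by
    intro q
    have h1 : (1 + ‖q‖ ^ 2) * ‖𝓕 G q‖ ≤ ‖𝓕 L q‖ := by
      rw [hL, fourier_one_sub_laplacian, norm_mul, Complex.norm_real,
        Real.norm_of_nonneg (by positivity)]
      refine mul_le_mul_of_nonneg_right ?_ (norm_nonneg _)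
      have : 1 ≤ (2 * Real.pi) ^ 2 := one_le_pow₀ (by linarith [Real.pi_gt_three])
      nlinarith [sq_nonneg ‖q‖]
    have hw : 0 < 1 + ‖q‖ ^ 2 := by positivity
    set w := 1 + ‖q‖ ^ 2
    set A := ‖𝓕 G q‖
    set B := ‖𝓕 L q‖
    have h2 : A ≤ w⁻¹ * B := by rw [inv_mul_eq_div, le_div_iff₀ hw]; linarith
    refine h2.trans ?_
    have h3 := sq_nonneg (H * w⁻¹ - B)
    have h4 : 1 / 2 * (H * (w ^ 2)⁻¹ + H⁻¹ * B ^ 2) - w⁻¹ * B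
        = 1 / 2 * H⁻¹ * (H * w⁻¹ - B) ^ 2 := by field_simp; ring
    have h5 : 0 ≤ 1 / 2 * H⁻¹ * (H * w⁻¹ - B) ^ 2 := by positivity
    linarith
  calc ∫ q, ‖𝓕 G q‖ ≤ ∫ q, 1 / 2 * (H * ((1 + ‖q‖ ^ 2) ^ 2)⁻¹ + H⁻¹ * ‖𝓕 L q‖ ^ 2) :=
        integral_mono (𝓕 G).integrable.norm
          (((hIint.const_mul _).add (hL2i.const_mul _)).const_mul _) hpt
    _ = 1 / 2 * (H * I + H⁻¹ * ∫ q, ‖𝓕 L q‖ ^ 2) := by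
        rw [integral_const_mul, integral_add (hIint.const_mul _) (hL2i.const_mul _),
          integral_const_mul, integral_const_mul]
    _ ≤ 1 / 2 * (H * I + H⁻¹ * (((C₀ + 2 * C₂) * H) ^ 2 * J)) := by gcongr
    _ = _ := by field_simp

theorem measurable_fourier_cutTranslate (hδ : 0 < δ) :
    Measurable fun z : Plane × Plane => 𝓕 (cutTranslate f z.1 δ) z.2 := by
  have e : (fun z : Plane × Plane => 𝓕 (cutTranslate f z.1 δ) z.2) = fun z => ∫ v : Plane,
      Complex.exp ((-2 * Real.pi * inner ℝ v z.2 : ℝ) * Complex.I) • (cutoff δ v • f (v + z.1)) := by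
    ext z
    rw [SchwartzMap.fourier_coe, Real.fourier_eq']
    simp only [cutTranslate_apply _ _ hδ]
  rw [e]
  have hc : Continuous fun w : (Plane × Plane) × Plane =>
      Complex.exp ((-2 * Real.pi * inner ℝ w.2 w.1.2 : ℝ) * Complex.I)
        • (cutoff δ w.2 • f (w.2 + w.1.1)) := by
    have h1 : Continuous (cutoff δ) := (contDiff_cutoff δ (n := 0)).continuous
    have h2 := f.continuous
    fun_prop
  exact (hc.stronglyMeasurable.integral_prod_right' (ν := volume)).measurable

/-- Fourier inversion for the cut-off translate; the even cut-off is then divided out. The last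
factor is the growth that the propagators absorb. -/
theorem eq_integral_fourier_cutTranslate (hδ : 0 < δ) (U : Plane) :
    f (y - U) = (∫ q, 𝓕 (cutTranslate f y δ) q
        * Complex.exp (Complex.I * ((-(2 * Real.pi) * inner ℝ q U : ℝ) : ℂ)))
      * ((4 * (Real.cosh (δ * U 0) * Real.cosh (δ * U 1)) : ℝ) : ℂ) := by
  set G := cutTranslate f y δ with hG
  have h1 : 𝓕⁻ (𝓕 G) (-U) = G (-U) := by rw [FourierTransform.fourierInv_fourier_eq]
  rw [SchwartzMap.fourierInv_coe, Real.fourierInv_eq'] at h1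
  have h2 : (∫ q, 𝓕 G q * Complex.exp (Complex.I * ((-(2 * Real.pi) * inner ℝ q U : ℝ) : ℂ)))
      = G (-U) := by
    rw [← h1]
    refine integral_congr_ae (.of_forall fun q => ?_)
    dsimp only
    rw [smul_eq_mul, mul_comm, inner_neg_right, mul_comm Complex.I]
    congr 4
    ring
  rw [h2, hG, cutTranslate_apply f y hδ, cutoff_neg, neg_add_eq_sub, Complex.real_smul, mul_right_comm,
    ← Complex.ofReal_mul]
  have : cutoff δ U * (4 * (Real.cosh (δ * U 0) * Real.cosh (δ * U 1))) = 1 := by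
    have := (Real.cosh_pos (δ * U 0)).ne'
    have := (Real.cosh_pos (δ * U 1)).ne'
    unfold cutoff
    field_simp
  rw [this, Complex.ofReal_one, one_mul]

end RootWave

/-! ### Coordinates, linear substitutions and separable integrals -/

open Matrix in
theorem integrable_comp_mulVec {D : Type*} [Fintype D] [DecidableEq D] {E : Type*}
    [NormedAddCommGroup E] {C : Matrix D D ℝ} (hC : C.det ≠ 0) {F : (D → ℝ) → E}
    (hF : Integrable F) : Integrable fun v => F (C *ᵥ v) := by
  have h := Real.map_matrix_volume_pi_eq_smul_volume_pi hC
  have h1 : MeasurableEmbedding (toLin' C) := by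
    have : IsUnit C.det := isUnit_iff_ne_zero.2 hC
    exact ((toLin' C).toContinuousLinearMap.continuous.measurable).measurableEmbedding
      (Matrix.mulVec_injective_iff_isUnit.2 ((Matrix.isUnit_iff_isUnit_det C).2 this))
  refine (h1.integrable_map_iff (μ := volume)).1 ?_
  rw [h]
  exact hF.smul_measure ENNReal.ofReal_ne_top

/-- Families of vectors in the plane as pairs of families of coordinates. -/
def planeSplit (ι : Type*) : (ι → Plane) ≃ᵐ (ι → ℝ) × (ι → ℝ) :=
  (MeasurableEquiv.piCongrRight fun _ =>
    (MeasurableEquiv.toLp 2 (Fin 2 → ℝ)).symm.trans MeasurableEquiv.finTwoArrow).trans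
    (MeasurableEquiv.arrowProdEquivProdArrow ℝ ℝ ι)

theorem planeSplit_apply {ι : Type*} (v : ι → Plane) :
    planeSplit ι v = (fun l => v l 0, fun l => v l 1) := rfl

theorem measurePreserving_planeSplit (ι : Type*) [Fintype ι] :
    MeasurePreserving (planeSplit ι) := by
  refine MeasurePreserving.trans (β := ι → ℝ × ℝ) ?_
    (volume_measurePreserving_arrowProdEquivProdArrow ℝ ℝ ι)
  exact volume_preserving_pi fun _ =>
    (PiLp.volume_preserving_ofLp (Fin 2)).trans (volume_preserving_finTwoArrow ℝ)

section Separable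

variable {α β γ δ : Type*} [NormedAddCommGroup β] [MeasureSpace α] [MeasureSpace β]
  [MeasureSpace γ] [MeasureSpace δ] [SFinite (volume : Measure α)] [SFinite (volume : Measure β)]
  [SFinite (volume : Measure γ)] [SFinite (volume : Measure δ)]
  [MeasurableAdd β] [MeasurableSub₂ β] [(volume : Measure β).IsAddRightInvariant]

/-- By translation invariance the shift of u by a function of a is invisible after integration over
u. -/
theorem integrable_and_integral_sheared {A : α → ℝ} {X : γ → ℝ} {E : β → ℝ} {S : δ → ℝ} {τ : α → β}
    (mA : Measurable A) (mX : Measurable X) (mE : Measurable E) (mS : Measurable S)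
    (mτ : Measurable τ)
    (hA : Integrable A) (hX : Integrable X) (hE : Integrable E) (hS : Integrable S) :
    Integrable (fun z : α × (γ × (β × δ)) => A z.1 * (X z.2.1 * (E (z.2.2.1 - τ z.1) * S z.2.2.2))) ∧
    ∫ z : α × (γ × (β × δ)), A z.1 * (X z.2.1 * (E (z.2.2.1 - τ z.1) * S z.2.2.2))
      = (∫ a, A a) * ((∫ x, X x) * ((∫ u, E u) * ∫ y, S y)) := by
  have hin : ∀ (E : β → ℝ) (X : γ → ℝ) (S : δ → ℝ) (t : β),
      ∫ w : γ × (β × δ), X w.1 * (E (w.2.1 - t) * S w.2.2)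
        = (∫ x, X x) * ((∫ u, E u) * ∫ y, S y) := by
    intro E X S t
    rw [Measure.volume_eq_prod, integral_prod_mul X (fun w : β × δ => E (w.1 - t) * S w.2),
      Measure.volume_eq_prod, integral_prod_mul (fun u => E (u - t)) S,
      integral_sub_right_eq_self]
  have hi : Integrable
      (fun z : α × (γ × (β × δ)) => A z.1 * (X z.2.1 * (E (z.2.2.1 - τ z.1) * S z.2.2.2))) := by
    have hm : AEStronglyMeasurable (fun z : α × (γ × (β × δ)) => A z.1
        * (X z.2.1 * (E (z.2.2.1 - τ z.1) * S z.2.2.2))) ((volume : Measure α).prod volume) :=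
      Measurable.aestronglyMeasurable (by fun_prop)
    rw [Measure.volume_eq_prod]
    refine (integrable_prod_iff hm).2 ⟨.of_forall fun a => ?_, ?_⟩
    · have h : Integrable fun w : γ × (β × δ) => X w.1 * (E (w.2.1 - τ a) * S w.2.2) :=
        hX.mul_prod ((hE.comp_sub_right (τ a)).mul_prod hS)
      exact h.const_mul (A a)
    · refine (hA.norm.mul_const ((∫ x, |X x|) * ((∫ u, |E u|) * ∫ y, |S y|))).congr
        (.of_forall fun a => ?_)
      dsimp only
      rw [← hin (fun u => |E u|) (fun x => |X x|) (fun y => |S y|) (τ a), ← integral_const_mul]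
      simp only [Real.norm_eq_abs, abs_mul]
  refine ⟨hi, ?_⟩
  rw [Measure.volume_eq_prod, integral_prod _ (by rwa [← Measure.volume_eq_prod]),
    ← integral_mul_const]
  refine integral_congr_ae (.of_forall fun a => ?_)
  dsimp only
  rw [integral_const_mul, hin]

end Separable

theorem integral_inv_one_add_sq_scaled {c : ℝ} (hc : 0 < c) :
    Integrable (fun x : ℝ => 1 / (1 + (c ^ 2)⁻¹ * x ^ 2)) ∧
      ∫ x : ℝ, 1 / (1 + (c ^ 2)⁻¹ * x ^ 2) = c * Real.pi := by
  have e : (fun x : ℝ => 1 / (1 + (c ^ 2)⁻¹ * x ^ 2)) = fun x => (1 + (c⁻¹ * x) ^ 2)⁻¹ := by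
    ext x
    rw [one_div, mul_pow, inv_pow]
  rw [e]
  refine ⟨integrable_inv_one_add_sq.comp_mul_left' (inv_ne_zero hc.ne'), ?_⟩
  rw [Measure.integral_comp_mul_left (fun x : ℝ => (1 + x ^ 2)⁻¹), integral_univ_inv_one_add_sq,
    inv_inv, abs_of_pos hc, smul_eq_mul]

/-! ### Power counting for the bounding integral -/

namespace RootedGraph

variable {n : ℕ} (G : RootedGraph n) (P : Model)

/-- The linear part of the change of long variables, acting on one coordinate. -/
def longMatrix : Matrix G.Line G.Line ℝ :=
  Matrix.diagonal G.veps * G.changeMatrix P * Matrix.diagonal G.veps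

theorem det_longMatrix : (G.longMatrix P).det = (G.changeMatrix P).det := by
  rw [longMatrix, Matrix.det_mul, Matrix.det_mul, mul_right_comm, ← Matrix.det_mul,
    Matrix.diagonal_mul_diagonal]
  simp [G.veps_mul_self]

open Matrix in
-- The change of long variables acts on the two coordinates separately by one matrix, up to
-- translations by the momenta.
theorem newLong_apply (v : G.Line → Plane) (p : {l // l ∈ G.tree} → Plane) (l : G.Line)
    (μ : Fin 2) : G.newLong P v p l μ
      = (G.longMatrix P *ᵥ fun l' => v l' μ) l + G.newLong P 0 p l μ := by
  have h := congrArg (fun x : Plane => G.veps l * x μ) (G.newLong_sub P v p l)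
  simp only [PiLp.smul_apply, PiLp.sub_apply, smul_eq_mul, WithLp.ofLp_sum, Finset.sum_apply] at h
  rw [← mul_assoc, G.veps_mul_self, one_mul] at h
  rw [sub_eq_iff_eq_add.1 h]
  congr 1
  rw [longMatrix, Matrix.mul_assoc, ← Matrix.mulVec_mulVec, Matrix.mulVec_diagonal,
    ← Matrix.mulVec_mulVec]
  congr 1
  rw [Matrix.mulVec, dotProduct]
  refine Finset.sum_congr rfl fun l' _ => ?_
  rw [Matrix.mulVec_diagonal]

open Matrix in
-- At fixed momenta each coordinate undergoes an affine substitution, and the translations do not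
-- matter. The two Jacobians give the square of the determinant that the bounding integrand
-- compensates.
theorem integral_long_factor (hΩ : P.Ω ∈ Set.Ico (0 : ℝ) 1) {φ : G.Line → ℝ → ℝ}
    (hφ : ∀ l, Integrable (φ l)) (p : {l // l ∈ G.tree} → Plane) :
    Integrable (fun v => ∏ l, ∏ μ : Fin 2, φ l (G.newLong P v p l μ)) ∧
      ∫ v, ∏ l, ∏ μ : Fin 2, φ l (G.newLong P v p l μ)
        = ((G.changeMatrix P).det ^ 2)⁻¹ * ∏ l, (∫ x, φ l x) ^ 2 := by
  have hd := G.det_changeMatrix_ne_zero P hΩ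
  rw [← det_longMatrix] at hd ⊢
  set C := G.longMatrix P
  have hI : ∀ c : G.Line → ℝ, Integrable fun x : G.Line → ℝ => ∏ l, φ l (x l + c l) := fun c =>
    Integrable.fintype_prod fun l => (hφ l).comp_add_right (c l)
  have hv : ∀ c : G.Line → ℝ, ∫ x : G.Line → ℝ, ∏ l, φ l ((C *ᵥ x) l + c l)
      = |C.det|⁻¹ * ∏ l, ∫ x, φ l x := by
    intro c
    have h := integral_comp_mulVec hd fun x : G.Line → ℝ => ∏ l, φ l (x l + c l)
    rw [integral_fintype_prod_volume_eq_prod (fun l x => φ l (x + c l)), smul_eq_mul] at h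
    rw [eq_inv_mul_iff_mul_eq₀ (abs_ne_zero.2 hd), ← h]
    exact Finset.prod_congr rfl fun l _ => integral_add_right_eq_self _ _
  set c : Fin 2 → G.Line → ℝ := fun μ l => G.newLong P 0 p l μ
  have e : (fun v => ∏ l, ∏ μ : Fin 2, φ l (G.newLong P v p l μ))
      = (fun z : (G.Line → ℝ) × (G.Line → ℝ) => (∏ l, φ l ((C *ᵥ z.1) l + c 0 l))
          * ∏ l, φ l ((C *ᵥ z.2) l + c 1 l)) ∘ planeSplit G.Line := by
    ext v
    simp only [Function.comp, planeSplit_apply, Fin.prod_univ_two, Finset.prod_mul_distrib,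
      G.newLong_apply P v p]
    rfl
  have hmp := measurePreserving_planeSplit G.Line
  rw [e]
  constructor
  · refine hmp.integrable_comp_of_integrable ?_
    rw [Measure.volume_eq_prod]
    exact (integrable_comp_mulVec hd (hI (c 0))).mul_prod (integrable_comp_mulVec hd (hI (c 1)))
  · rw [Function.comp_def, hmp.integral_comp' (fun z : (G.Line → ℝ) × (G.Line → ℝ) =>
        (∏ l, φ l ((C *ᵥ z.1) l + c 0 l)) * ∏ l, φ l ((C *ᵥ z.2) l + c 1 l)),
      Measure.volume_eq_prod, integral_prod_mul (fun x : G.Line → ℝ => ∏ l, φ l ((C *ᵥ x) l + c 0 l))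
        (fun x : G.Line → ℝ => ∏ l, φ l ((C *ᵥ x) l + c 1 l)), hv, hv, Finset.prod_pow, ← sq_abs C.det]
    ring

theorem _root_.MoyalGN.Model.continuous_tildeMom : Continuous P.tildeMom := by
  unfold Model.tildeMom
  have h : Continuous fun p : Plane => P.Theta.mulVec p.ofLp :=
    Continuous.matrix_mulVec continuous_const (PiLp.continuous_ofLp 2 _)
  exact (PiLp.continuous_toLp 2 _).comp (h.const_smul (1 / 2 : ℝ))

theorem continuous_newLong : Continuous fun z : (G.Line → Plane) × ({l // l ∈ G.tree} → Plane) =>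
    G.newLong P z.1 z.2 := by
  have h := P.continuous_tildeMom
  refine continuous_pi fun l => ?_
  unfold newLong
  have h1 : Continuous fun z : (G.Line → Plane) × ({l // l ∈ G.tree} → Plane) =>
      ∑ l' : {l' // l' ∈ G.tree},
        if l'.1 ≠ l ∧ l'.1 ∈ G.path (G.upper l) then P.tildeMom (z.2 l') else 0 := by
    refine continuous_finsetSum _ fun l' _ => ?_
    split_ifs <;> fun_prop
  split_ifs <;> fun_prop

theorem integral_momentum_factor {c : ℝ} (hc : 0 < c) :
    Integrable (fun p : Plane => ∏ μ : Fin 2, 1 / (1 + (c ^ 2)⁻¹ * (p μ) ^ 2)) ∧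
      ∫ p : Plane, ∏ μ : Fin 2, 1 / (1 + (c ^ 2)⁻¹ * (p μ) ^ 2) = (c * Real.pi) ^ 2 := by
  have h := integral_inv_one_add_sq_scaled hc
  have hmp := PiLp.volume_preserving_ofLp (Fin 2)
  constructor
  · exact hmp.integrable_comp_of_integrable
      (g := fun x : Fin 2 → ℝ => ∏ μ : Fin 2, 1 / (1 + (c ^ 2)⁻¹ * (x μ) ^ 2))
      (Integrable.fintype_prod fun _ => h.1)
  · rw [hmp.integral_comp (MeasurableEquiv.toLp 2 (Fin 2 → ℝ)).symm.measurableEmbedding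
      (fun x : Fin 2 → ℝ => ∏ μ : Fin 2, 1 / (1 + (c ^ 2)⁻¹ * (x μ) ^ 2)),
      integral_fintype_prod_volume_eq_prod (fun (_ : Fin 2) x => 1 / (1 + (c ^ 2)⁻¹ * x ^ 2)), h.2,
      Fin.prod_univ_two, sq]

end RootedGraph

theorem integrable_exp_neg_norm_sq_sub {η : ℝ} (hη : 0 ≤ η) :
    Integrable fun u : Plane => Real.exp (-‖u‖ ^ 2 - η * ‖u‖) := by
  have h := GaussianFourier.integrable_cexp_neg_mul_sq_norm_add (V := Plane) (b := 1) (by simp) 0 0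
  refine h.norm.mono' (by fun_prop : Continuous fun u : Plane =>
    Real.exp (-‖u‖ ^ 2 - η * ‖u‖)).aestronglyMeasurable (.of_forall fun u => ?_)
  rw [Real.norm_of_nonneg (Real.exp_pos _).le, Complex.norm_exp]
  apply Real.exp_le_exp.2
  have := mul_nonneg hη (norm_nonneg u)
  simp [← Complex.ofReal_pow]
  linarith

theorem integral_comp_smul_plane {F : Plane → ℝ} {c : ℝ} (hc : 0 < c) :
    ∫ x, F (c • x) = (c ^ 2)⁻¹ * ∫ x, F x := by
  rw [Measure.integral_comp_smul, finrank_euclideanSpace_fin, abs_of_pos (by positivity),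
    smul_eq_mul]

theorem continuous_one_div_one_add {X : Type*} [TopologicalSpace X] {F : X → ℝ}
    (hF : Continuous F) {c : ℝ} (hc : 0 ≤ c) : Continuous fun x => 1 / (1 + c * F x ^ 2) :=
  continuous_const.div (by fun_prop) fun x => by positivity

namespace RootedGraph

variable {n : ℕ} (G : RootedGraph n) (P : Model)

/-- The part of the bounding integrand that depends on the long variables and the momenta. -/
def boundLong (i : G.Line → ℕ) (y : (G.Line → Plane) × ({l // l ∈ G.tree} → Plane)) : ℝ :=
  (∏ l, ∏ μ : Fin 2, 1 / (1 + (P.M ^ (2 * i l))⁻¹ * (G.newLong P y.1 y.2 l μ) ^ 2))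
    * (∏ l : {l // l ∈ G.tree}, ∏ μ : Fin 2, 1 / (1 + P.M ^ (2 * i l.1) * (y.2 l μ) ^ 2))
    * (G.changeMatrix P).det ^ 2

theorem boundLong_nonneg (hM : 1 < P.M) (i : G.Line → ℕ)
    (y : (G.Line → Plane) × ({l // l ∈ G.tree} → Plane)) : 0 ≤ G.boundLong P i y := by
  have h0 : (0 : ℝ) < P.M := by linarith
  unfold boundLong
  refine mul_nonneg (mul_nonneg ?_ ?_) (sq_nonneg _) <;>
    exact Finset.prod_nonneg fun l _ => Finset.prod_nonneg fun μ _ => by positivity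

theorem continuous_boundLong (hM : 1 < P.M) (i : G.Line → ℕ) : Continuous (G.boundLong P i) := by
  have h0 : (0 : ℝ) < P.M := by linarith
  have h := G.continuous_newLong P
  unfold boundLong
  refine Continuous.mul (Continuous.mul ?_ ?_) continuous_const
  · exact continuous_finsetProd _ fun l _ => continuous_finsetProd _ fun μ _ =>
      continuous_one_div_one_add ((EuclideanSpace.proj μ : Plane →L[ℝ] ℝ).continuous.comp
        ((continuous_apply l).comp h)) (by positivity)
  · exact continuous_finsetProd _ fun l _ => continuous_finsetProd _ fun μ _ =>
      continuous_one_div_one_add ((EuclideanSpace.proj μ : Plane →L[ℝ] ℝ).continuous.comp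
        ((continuous_apply l).comp continuous_snd)) (by positivity)

/-- The integral over the new long variables does not depend on the momenta, so the two groups
separate: each $\mathcal V$ or $\mathcal W$ gives $(\pi M^i)^2$, each momentum $(\pi M^{-i})^2$. -/
theorem integral_boundLong (hM : 1 < P.M) (hΩ : P.Ω ∈ Set.Ico (0 : ℝ) 1) (i : G.Line → ℕ) :
    Integrable (G.boundLong P i) ∧ ∫ y, G.boundLong P i y
      = (∏ l, (P.M ^ i l * Real.pi) ^ 2) *
        ∏ l : {l // l ∈ G.tree}, ((P.M ^ i l.1)⁻¹ * Real.pi) ^ 2 := by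
  have h0 : (0 : ℝ) < P.M := by linarith
  have hd := G.det_changeMatrix_ne_zero P hΩ
  set φ : G.Line → ℝ → ℝ := fun l x => 1 / (1 + ((P.M ^ i l) ^ 2)⁻¹ * x ^ 2) with hφ
  set ψ : {l // l ∈ G.tree} → Plane → ℝ := fun l q =>
    ∏ μ : Fin 2, 1 / (1 + (((P.M ^ i l.1)⁻¹) ^ 2)⁻¹ * (q μ) ^ 2) with hψ
  have hφi : ∀ l, Integrable (φ l) := fun l => (integral_inv_one_add_sq_scaled (by positivity)).1
  have hφv : ∀ l, ∫ x, φ l x = P.M ^ i l * Real.pi := fun l =>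
    (integral_inv_one_add_sq_scaled (by positivity)).2
  have hψi : ∀ l, Integrable (ψ l) := fun l => (integral_momentum_factor (by positivity)).1
  have hψv : ∀ l, ∫ x, ψ l x = ((P.M ^ i l.1)⁻¹ * Real.pi) ^ 2 := fun l =>
    (integral_momentum_factor (by positivity)).2
  have e : ∀ y, G.boundLong P i y = (G.changeMatrix P).det ^ 2 * (∏ l, ψ l (y.2 l))
      * ∏ l, ∏ μ : Fin 2, φ l (G.newLong P y.1 y.2 l μ) := fun y => by
    simp only [boundLong, hφ, hψ, inv_pow, inv_inv, pow_mul']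
    ring
  have hl := fun p => G.integral_long_factor P hΩ hφi p
  have hm := (G.continuous_boundLong P hM i).aestronglyMeasurable
    (μ := (volume : Measure (G.Line → Plane)).prod volume)
  have hψI : Integrable fun p : {l // l ∈ G.tree} → Plane => ∏ l, ψ l (p l) :=
    Integrable.fintype_prod hψi
  have hin : ∀ p, ∫ v, G.boundLong P i (v, p)
      = (∏ l, ψ l (p l)) * ∏ l, (P.M ^ i l * Real.pi) ^ 2 := fun p => by
    simp only [e]
    rw [integral_const_mul, (hl p).2]
    simp only [hφv]
    generalize (∏ l, (P.M ^ i l * Real.pi) ^ 2) = Z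
    field_simp
  have hi : Integrable (G.boundLong P i) := by
    rw [Measure.volume_eq_prod]
    refine (integrable_prod_iff' hm).2 ⟨.of_forall fun p => ?_, ?_⟩
    · simp only [e]
      exact (hl p).1.const_mul _
    · simp only [Real.norm_of_nonneg (G.boundLong_nonneg P hM i _), hin]
      exact hψI.mul_const _
  refine ⟨hi, ?_⟩
  rw [Measure.volume_eq_prod, integral_prod_symm _ (by rwa [← Measure.volume_eq_prod])]
  simp only [hin]
  rw [integral_mul_const, integral_fintype_prod_volume_eq_prod ψ, mul_comm]
  simp only [hψv]

/-- The value of the root position when all short variables vanish. -/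
def rootPos (x : G.Ext' → Plane) : Plane := -∑ e', (G.sign e'.1.1 : ℝ) • x e'

theorem ext_root (x : G.Ext' → Plane) (u : G.Line → Plane) :
    G.ext x u G.root = G.rootPos x - ∑ l, u l := by
  rw [ext, dif_pos rfl, rootPos, neg_add, sub_eq_add_neg]

theorem ext_of_ne (x : G.Ext' → Plane) (u : G.Line → Plane) (e : G.Ext') :
    G.ext x u e.1 = x e := by
  rw [ext, dif_neg e.2]

/-- The part of the bounding integrand that depends on the short variables. -/
def boundShort (η : ℝ) (i : G.Line → ℕ) (u : G.Line → Plane) : ℝ :=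
  ∏ l, (P.M ^ i l * Real.exp (-P.M ^ (2 * i l) * ‖u l‖ ^ 2) * Real.exp (-(η * ‖u l‖)))

/-- The extra decay $e^{-\eta|u|}$, the cost of the slow variation of the root function, is harmless
after rescaling by $M^i\ge1$: it only replaces the Gaussian integral by a smaller positive constant
that does not depend on the scale. -/
theorem integral_boundShort (hM : 1 < P.M) {η : ℝ} (hη : 0 ≤ η) (i : G.Line → ℕ) :
    Integrable (G.boundShort P η i) ∧
      ∏ l, ((P.M ^ i l)⁻¹ * ∫ u : Plane, Real.exp (-‖u‖ ^ 2 - η * ‖u‖))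
        ≤ ∫ u, G.boundShort P η i u := by
  have h0 : (0 : ℝ) < P.M := by linarith
  set ψ : G.Line → Plane → ℝ := fun l u =>
    P.M ^ i l * Real.exp (-P.M ^ (2 * i l) * ‖u‖ ^ 2) * Real.exp (-(η * ‖u‖)) with hψ
  have hle : ∀ (c : ℝ), 1 ≤ c → ∀ u : Plane, Real.exp (-‖c • u‖ ^ 2 - η * ‖c • u‖)
      ≤ Real.exp (-c ^ 2 * ‖u‖ ^ 2) * Real.exp (-(η * ‖u‖)) := by
    intro c hc u
    rw [← Real.exp_add, norm_smul, Real.norm_of_nonneg (by linarith)]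
    apply Real.exp_le_exp.2
    have := mul_le_mul_of_nonneg_right hc (mul_nonneg hη (norm_nonneg u))
    nlinarith
  have hI : ∀ l, Integrable (ψ l) := by
    intro l
    have hc : 0 < P.M ^ i l := by positivity
    have h1 := (integrable_exp_neg_norm_sq_sub (le_refl 0)).comp_smul hc.ne'
    refine (h1.const_mul (P.M ^ i l)).mono' (Continuous.aestronglyMeasurable (by fun_prop))
      (.of_forall fun u => ?_)
    rw [Real.norm_of_nonneg (by positivity)]
    simp only [hψ]
    rw [mul_assoc]
    refine mul_le_mul_of_nonneg_left ?_ hc.le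
    rw [← Real.exp_add]
    apply Real.exp_le_exp.2
    have := mul_nonneg hη (norm_nonneg u)
    rw [norm_smul, Real.norm_of_nonneg hc.le, mul_pow, pow_mul']
    linarith
  refine ⟨Integrable.fintype_prod hI, ?_⟩
  unfold boundShort
  rw [integral_fintype_prod_volume_eq_prod ψ]
  refine Finset.prod_le_prod (fun l _ => mul_nonneg (by positivity)
    (integral_nonneg fun _ => (Real.exp_pos _).le)) fun l _ => ?_
  have hc : 0 < P.M ^ i l := by positivity
  have h2 := integral_comp_smul_plane (F := fun u => Real.exp (-‖u‖ ^ 2 - η * ‖u‖)) hc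
  calc (P.M ^ i l)⁻¹ * ∫ u : Plane, Real.exp (-‖u‖ ^ 2 - η * ‖u‖)
      = ∫ u : Plane, P.M ^ i l * Real.exp (-‖P.M ^ i l • u‖ ^ 2 - η * ‖P.M ^ i l • u‖) := by
        rw [integral_const_mul, h2]
        field_simp
    _ ≤ _ := by
        refine integral_mono (((integrable_exp_neg_norm_sq_sub hη).comp_smul hc.ne').const_mul _)
          (hI l) fun u => ?_
        simp only [hψ]
        rw [mul_assoc, pow_mul']
        exact mul_le_mul_of_nonneg_left (hle _ (one_le_pow₀ hM.le) u) hc.le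

/-- The part of the bounding integrand that depends on the auxiliary variables. -/
def boundAux (i : G.Line → ℕ) (Ξ : 𝓢(Plane, ℝ)) (a : G.Line → Plane) : ℝ :=
  ∏ l, P.M ^ (2 * i l) * Ξ (P.M ^ i l • a l)

theorem integral_boundAux (hM : 1 < P.M) (i : G.Line → ℕ) (Ξ : 𝓢(Plane, ℝ)) :
    Integrable (G.boundAux P i Ξ) ∧
      ∫ a, G.boundAux P i Ξ a = (∫ x, Ξ x) ^ Fintype.card G.Line := by
  have h0 : (0 : ℝ) < P.M := by linarith
  have hc : ∀ l, P.M ^ i l ≠ 0 := fun l => by positivity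
  refine ⟨Integrable.fintype_prod fun l => (Ξ.integrable.comp_smul (hc l)).const_mul _, ?_⟩
  unfold boundAux
  rw [integral_fintype_prod_volume_eq_prod (fun l (x : Plane) => P.M ^ (2 * i l) * Ξ (P.M ^ i l • x)),
    ← Finset.card_univ, ← Finset.prod_const]
  refine Finset.prod_congr rfl fun l _ => ?_
  rw [integral_const_mul, integral_comp_smul_plane (F := Ξ) (by positivity), pow_mul']
  have := hc l
  field_simp

/-- The bounding integral converges, and is bounded below by power counting. -/
theorem le_boundIntegral (hM : 1 < P.M) (hΩ : P.Ω ∈ Set.Ico (0 : ℝ) 1) {η : ℝ} (hη : 0 ≤ η)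
    (i : G.Line → ℕ) {Ξ : 𝓢(Plane, ℝ)} (hΞ : ∀ x, 0 ≤ Ξ x) {g : G.External → 𝓢(Plane, ℝ)}
    (hg : ∀ e x, 0 ≤ g e x) (hs : ∀ x u, Real.exp (-(η * ‖u‖)) * g G.root x ≤ g G.root (x - u)) :
    Integrable (G.boundIntegrand P i Ξ g) ∧
      (∫ x, Ξ x) ^ Fintype.card G.Line
        * ((∫ x : G.Ext' → Plane, g G.root (G.rootPos x) * ∏ e : G.Ext', g e.1 (x e))
        * ((∏ l, ((P.M ^ i l)⁻¹ * ∫ u : Plane, Real.exp (-‖u‖ ^ 2 - η * ‖u‖)))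
        * ((∏ l, (P.M ^ i l * Real.pi) ^ 2) *
          ∏ l : {l // l ∈ G.tree}, ((P.M ^ i l.1)⁻¹ * Real.pi) ^ 2)))
      ≤ G.boundIntegral P i Ξ g := by
  have h0 : (0 : ℝ) < P.M := by linarith
  set τ : (G.Line → Plane) → (G.Line → Plane) := fun a l => G.veps l • a l with hτ
  have hτc : Continuous τ := by fun_prop
  have hpos : Continuous G.rootPos := by unfold rootPos; fun_prop
  set X₁ : (G.Ext' → Plane) → ℝ := fun x => ∏ e : G.Ext', g e.1 (x e) with hX₁
  set X₀ : (G.Ext' → Plane) → ℝ := fun x => g G.root (G.rootPos x) * X₁ x with hX₀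
  have cX₁ : Continuous X₁ := continuous_finsetProd _ fun e _ =>
    (g e.1).continuous.comp (continuous_apply e)
  have cX₀ : Continuous X₀ := ((g G.root).continuous.comp hpos).mul cX₁
  have cA : Continuous (G.boundAux P i Ξ) := continuous_finsetProd _ fun l _ =>
    continuous_const.mul (Ξ.continuous.comp (by fun_prop))
  have cE : ∀ η, Continuous (G.boundShort P η i) := fun η => continuous_finsetProd _ fun l _ => by
    fun_prop
  have cS := G.continuous_boundLong P hM i
  have hX₁n : ∀ x, 0 ≤ X₁ x := fun x => Finset.prod_nonneg fun e _ => hg _ _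
  have hAn : ∀ a, 0 ≤ G.boundAux P i Ξ a := fun a => Finset.prod_nonneg fun l _ =>
    mul_nonneg (by positivity) (hΞ _)
  have hEn : ∀ η u, 0 ≤ G.boundShort P η i u := fun η u => Finset.prod_nonneg fun l _ => by
    positivity
  have hSn := G.boundLong_nonneg P hM i
  set c := SchwartzMap.seminorm ℝ 0 0 (g G.root) with hc
  have hgc : ∀ x, g G.root x ≤ c := fun x =>
    (le_abs_self _).trans ((g G.root).norm_le_seminorm ℝ x)
  have hX₁i : Integrable X₁ := Integrable.fintype_prod fun e : G.Ext' => (g e.1).integrable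
  have hX₀i : Integrable X₀ := by
    refine (hX₁i.const_mul c).mono' cX₀.aestronglyMeasurable (.of_forall fun x => ?_)
    rw [Real.norm_of_nonneg (mul_nonneg (hg _ _) (hX₁n x))]
    exact mul_le_mul_of_nonneg_right (hgc _) (hX₁n x)
  obtain ⟨iA, vA⟩ := G.integral_boundAux P hM i Ξ
  obtain ⟨iS, vS⟩ := G.integral_boundLong P hM hΩ i
  -- In terms of $w=u-\varepsilon a$ the root function depends on w only, because its argument is
  -- $x_1+\sum\varepsilon(l)a_l$. The auxiliary variables separate completely.
  have eB : ∀ z : G.BoundVars, G.boundIntegrand P i Ξ g z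
      = G.boundAux P i Ξ z.1 * ((g G.root (G.rootPos z.2.1 - ∑ l, (z.2.2.1 - τ z.1) l) * X₁ z.2.1)
        * (G.boundShort P 0 i (z.2.2.1 - τ z.1) * G.boundLong P i z.2.2.2)) := by
    intro z
    have e1 : G.ext z.2.1 z.2.2.1 G.root + ∑ l, G.veps l • z.1 l
        = G.rootPos z.2.1 - ∑ l, (z.2.2.1 - τ z.1) l := by
      rw [ext_root]
      simp only [Pi.sub_apply, Finset.sum_sub_distrib, hτ]
      abel
    simp only [boundIntegrand, boundAux, boundLong, boundShort, e1, ext_of_ne, hX₁,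
      Finset.prod_mul_distrib, zero_mul, neg_zero, Real.exp_zero, mul_one, Pi.sub_apply, hτ]
    ring
  have mB : Measurable (G.boundIntegrand P i Ξ g) := by
    rw [funext eB]
    have m1 := cA.measurable
    have m2 := cX₁.measurable
    have m3 := (cE 0).measurable
    have m4 := cS.measurable
    have m5 := hτc.measurable
    have m6 := (g G.root).continuous.measurable
    have m7 := hpos.measurable
    have m8 : Measurable fun z : G.BoundVars => z.2.2.1 - τ z.1 := by fun_prop
    refine (m1.comp measurable_fst).mul (((m6.comp ((m7.comp (by fun_prop)).sub ?_)).mul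
      (m2.comp (by fun_prop))).mul ((m3.comp m8).mul (m4.comp (by fun_prop))))
    exact Finset.measurable_fun_sum _ fun l _ => (measurable_pi_apply l).comp m8
  -- Upper comparison, for convergence only: the root function is replaced by its supremum.
  have up := integrable_and_integral_sheared cA.measurable (measurable_const.mul cX₁.measurable)
    (cE 0).measurable cS.measurable hτc.measurable iA (hX₁i.const_mul c)
    (G.integral_boundShort P hM (le_refl 0) i).1 iS
  have iB : Integrable (G.boundIntegrand P i Ξ g) := by
    refine up.1.mono' mB.aestronglyMeasurable (.of_forall fun z => ?_)
    have hn : 0 ≤ G.boundShort P 0 i (z.2.2.1 - τ z.1) * G.boundLong P i z.2.2.2 :=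
      mul_nonneg (hEn _ _) (hSn _)
    rw [eB, Real.norm_of_nonneg (mul_nonneg (hAn _) (mul_nonneg (mul_nonneg (hg _ _) (hX₁n _)) hn))]
    exact mul_le_mul_of_nonneg_left (mul_le_mul_of_nonneg_right
      (mul_le_mul_of_nonneg_right (hgc _) (hX₁n _)) hn) (hAn _)
  refine ⟨iB, ?_⟩
  obtain ⟨iE, vE⟩ := G.integral_boundShort P hM hη i
  -- Lower comparison: the root function is replaced by its value at w = 0, and the loss by slow
  -- variation is included in `boundShort`.
  obtain ⟨iL, vL⟩ := integrable_and_integral_sheared cA.measurable cX₀.measurable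
    (cE η).measurable cS.measurable hτc.measurable iA hX₀i iE iS
  rw [← vA, ← vS]
  refine le_trans ?_ (vL.symm.le.trans (integral_mono iL iB fun z => ?_))
  · refine mul_le_mul_of_nonneg_left (mul_le_mul_of_nonneg_left
      (mul_le_mul_of_nonneg_right vE (integral_nonneg hSn)) ?_) (integral_nonneg hAn)
    exact integral_nonneg fun x => mul_nonneg (hg _ _) (hX₁n x)
  · dsimp only
    rw [eB]
    refine mul_le_mul_of_nonneg_left ?_ (hAn _)
    rw [← mul_assoc, ← mul_assoc]
    refine mul_le_mul_of_nonneg_right ?_ (hSn _)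
    set w := z.2.2.1 - τ z.1
    have h1 : G.boundShort P η i w = Real.exp (-(η * ∑ l, ‖w l‖)) * G.boundShort P 0 i w := by
      simp only [boundShort, zero_mul, neg_zero, Real.exp_zero, mul_one]
      rw [Finset.prod_mul_distrib, ← Real.exp_sum, mul_comm, Finset.sum_neg_distrib, Finset.mul_sum]
    have h2 : Real.exp (-(η * ∑ l, ‖w l‖)) * g G.root (G.rootPos z.2.1)
        ≤ g G.root (G.rootPos z.2.1 - ∑ l, w l) := by
      refine le_trans (mul_le_mul_of_nonneg_right ?_ (hg _ _)) (hs _ _)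
      apply Real.exp_le_exp.2
      have := mul_le_mul_of_nonneg_left (norm_sum_le Finset.univ w) hη
      linarith
    rw [h1]
    have h3 := mul_le_mul_of_nonneg_right h2 (mul_nonneg (hX₁n z.2.1) (hEn 0 w))
    simp only [hX₀]
    linarith

end RootedGraph

/-! ### Real coordinates for the internal variables -/

/-- The rotation by a quarter turn. -/
def quarterTurn : Plane ≃ₗᵢ[ℝ] Plane where
  toFun x := !₂[x 1, -x 0]
  invFun x := !₂[-x 1, x 0]
  map_add' x y := by ext i; fin_cases i <;> simp; ring
  map_smul' c x := by ext i; fin_cases i <;> simp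
  left_inv x := by ext i; fin_cases i <;> simp
  right_inv x := by ext i; fin_cases i <;> simp
  norm_map' x := by
    simp [EuclideanSpace.norm_eq, Fin.sum_univ_two, add_comm]

namespace RootedGraph

variable {n : ℕ} (G : RootedGraph n)

/-- The variables `(u, v, p)` in terms of two families of real coordinates; the momenta are
rotated by a quarter turn. -/
def innerEquiv : (G.Idx → ℝ) × (G.Idx → ℝ) ≃ᵐ
    (G.Line → Plane) × (G.Line → Plane) × ({l // l ∈ G.tree} → Plane) :=
  (planeSplit G.Idx).symm.trans <|
    (MeasurableEquiv.sumPiEquivProdPi fun _ : G.Idx => Plane).trans <|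
    (MeasurableEquiv.refl _).prodCongr <|
    (MeasurableEquiv.sumPiEquivProdPi fun _ : G.Line ⊕ {l // l ∈ G.tree} => Plane).trans <|
    (MeasurableEquiv.refl _).prodCongr <|
    MeasurableEquiv.piCongrRight fun _ => quarterTurn.toMeasurableEquiv

theorem innerEquiv_apply (U : (G.Idx → ℝ) × (G.Idx → ℝ)) : G.innerEquiv U
    = (fun l => !₂[U.1 (Sum.inl l), U.2 (Sum.inl l)],
      fun l => !₂[U.1 (Sum.inr (Sum.inl l)), U.2 (Sum.inr (Sum.inl l))],
      fun t => !₂[U.2 (Sum.inr (Sum.inr t)), -U.1 (Sum.inr (Sum.inr t))]) := rfl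

theorem measurePreserving_innerEquiv : MeasurePreserving G.innerEquiv := by
  refine ((measurePreserving_planeSplit G.Idx).symm).trans ?_
  refine (volume_measurePreserving_sumPiEquivProdPi fun _ : G.Idx => Plane).trans ?_
  refine (MeasurePreserving.id _).prod ?_
  refine (volume_measurePreserving_sumPiEquivProdPi
    fun _ : G.Line ⊕ {l // l ∈ G.tree} => Plane).trans ?_
  refine (MeasurePreserving.id _).prod ?_
  exact volume_preserving_pi fun _ => quarterTurn.measurePreserving

/-- The integration variables of the amplitude in terms of the external positions and of two
families of real coordinates. -/
def varsEquiv : (G.Ext' → Plane) × ((G.Idx → ℝ) × (G.Idx → ℝ)) ≃ᵐ G.Vars :=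
  (MeasurableEquiv.refl _).prodCongr G.innerEquiv

theorem varsEquiv_apply (z : (G.Ext' → Plane) × ((G.Idx → ℝ) × (G.Idx → ℝ))) :
    G.varsEquiv z = (z.1, G.innerEquiv z.2) := rfl

theorem measurePreserving_varsEquiv : MeasurePreserving G.varsEquiv :=
  (MeasurePreserving.id _).prod G.measurePreserving_innerEquiv

end RootedGraph

/-! ### The phase as a bilinear form between the two coordinates -/

namespace RootedGraph

open Matrix

variable {n : ℕ} (G : RootedGraph n) (P : Model)

theorem position_ext (x : G.External → Plane) (u v : G.Line → Plane) (e : G.External) :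
    G.position x u v e.1 = x e := by
  rw [OrientedGraph.position, dif_pos e.2]

theorem position_plus (x : G.External → Plane) (u v : G.Line → Plane) (l : G.Line) :
    G.position x u v (G.plus l) = (1 / 2 : ℝ) • (v l + u l) := by
  have h1 : ¬G.contr (G.plus l) = G.plus l := l.2.1
  have h2 : G.sign (G.plus l) = 1 := l.2.2
  rw [OrientedGraph.position, dif_neg h1, dif_pos h2]
  rfl

theorem position_minus (x : G.External → Plane) (u v : G.Line → Plane) (l : G.Line) :
    G.position x u v (G.minus l) = (1 / 2 : ℝ) • (v l - u l) := by
  have h0 : G.contr (G.minus l) = G.plus l := G.contr_contr _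
  have h1 : ¬G.contr (G.minus l) = G.minus l := by
    rw [h0]; exact fun h => l.2.1 h.symm
  have h2 : ¬G.sign (G.minus l) = 1 := by rw [G.sign_minus]; norm_num
  rw [OrientedGraph.position, dif_neg h1, dif_neg h2]
  have : (⟨G.contr (G.minus l), G.minus_end h1 h2⟩ : G.Line) = l := Subtype.ext h0
  rw [this]

/-- The coordinates of the positions, multiplied by the signs of the positions. -/
def signedPos (y : Pos n → Plane) (μ : Fin 2) (h : Pos n) : ℝ := G.sign h * y h μ

/-- The contribution of the external positions to the signed positions. -/
def extPart (x : G.Ext' → Plane) (μ : Fin 2) (h : Pos n) : ℝ :=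
  if hx : G.contr h = h then
    if he : (⟨h, hx⟩ : G.External) = G.root then G.rootPos x μ else G.sign h * x ⟨⟨h, hx⟩, he⟩ μ
  else 0

/-- The real coordinates of the variables `u`, `v` and `p`. -/
def coords (U : (G.Idx → ℝ) × (G.Idx → ℝ)) (μ : Fin 2) : G.Idx → ℝ := if μ = 0 then U.1 else U.2

/-- Multiplied by their signs, the positions depend linearly on the internal variables through one
matrix for both coordinates. The external positions only add a constant, which ends up in linear
phases. -/
theorem signedPos_position (x : G.Ext' → Plane) (U : (G.Idx → ℝ) × (G.Idx → ℝ)) (μ : Fin 2) :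
    G.signedPos (G.position (G.ext x (G.innerEquiv U).1) (G.innerEquiv U).1 (G.innerEquiv U).2.1) μ
      = G.posMatrix *ᵥ G.coords U μ + G.extPart x μ := by
  have hu : ∀ l, (G.innerEquiv U).1 l μ = G.coords U μ (Sum.inl l) := fun l => by
    rw [innerEquiv_apply]; fin_cases μ <;> rfl
  have hv : ∀ l, (G.innerEquiv U).2.1 l μ = G.coords U μ (Sum.inr (Sum.inl l)) := fun l => by
    rw [innerEquiv_apply]; fin_cases μ <;> rfl
  ext h
  rw [Pi.add_apply]
  obtain ⟨w, rfl⟩ := G.posEquiv.surjective h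
  rcases w with e | l | l
  · change G.signedPos _ μ e.1 = (G.posMatrix *ᵥ G.coords U μ) e.1 + G.extPart x μ e.1
    rw [posMatrix_mulVec_ext, signedPos, position_ext, extPart, dif_pos e.2]
    by_cases he : e = G.root
    · subst he
      rw [if_pos rfl, dif_pos rfl, ext_root, G.root_sign]
      simp only [PiLp.sub_apply, WithLp.ofLp_sum, Finset.sum_apply, hu]
      push_cast
      ring
    · rw [if_neg he, dif_neg he, zero_add, G.ext_of_ne x _ ⟨e, he⟩]
  · change G.signedPos _ μ (G.plus l) = (G.posMatrix *ᵥ G.coords U μ) (G.plus l)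
      + G.extPart x μ (G.plus l)
    rw [posMatrix_mulVec_plus, signedPos, position_plus, extPart,
      dif_neg (show ¬G.contr (G.plus l) = G.plus l from l.2.1), G.sign_plus,
      PiLp.smul_apply, PiLp.add_apply, hu, hv]
    push_cast
    rw [smul_eq_mul]
    ring
  · change G.signedPos _ μ (G.minus l) = (G.posMatrix *ᵥ G.coords U μ) (G.minus l)
      + G.extPart x μ (G.minus l)
    have h1 : ¬G.contr (G.minus l) = G.minus l := by
      rw [show G.contr (G.minus l) = G.plus l from G.contr_contr _]; exact fun h => l.2.1 h.symm
    rw [posMatrix_mulVec_minus, signedPos, position_minus, extPart, dif_neg h1, G.sign_minus,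
      PiLp.smul_apply, PiLp.sub_apply, hu, hv]
    push_cast
    rw [smul_eq_mul]
    ring

theorem sign_mul_sign (v : Fin n) (i j : Fin 4) :
    (G.sign (v, i) : ℝ) * G.sign (v, j) = (-1) ^ ((i : ℕ) + (j : ℕ)) := by
  have hs : (G.sign (v, 0) : ℝ) * G.sign (v, 0) = 1 := by
    rcases G.sign_eq (v, 0) with h | h <;> rw [h] <;> norm_num
  have h1 : G.sign (v, 1) = -G.sign (v, 0) := G.sign_succ v 0
  have h2 : G.sign (v, 2) = G.sign (v, 0) := by
    rw [show (2 : Fin 4) = 1 + 1 from rfl, G.sign_succ, h1, neg_neg]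
  have h3 : G.sign (v, 3) = -G.sign (v, 0) := by
    rw [show (3 : Fin 4) = 2 + 1 from rfl, G.sign_succ, h2]
  fin_cases i <;> fin_cases j <;> simp [h1, h2, h3, hs] <;> norm_num

/-- Signs alternate around a vertex, so $(-1)^{i+j+1}$ is minus the product of the two signs. The
wedge pairs first with second coordinates, with the factor 2/θ. -/
theorem sum_vertexPhase (hθ : P.θ ≠ 0) (y : Pos n → Plane) :
    ∑ v, P.vertexPhase (fun j => y (v, j))
      = 2 / P.θ * (G.signedPos y 0 ⬝ᵥ vertexForm n *ᵥ G.signedPos y 1) := by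
  have hsum : G.signedPos y 0 ⬝ᵥ vertexForm n *ᵥ G.signedPos y 1
      = ∑ v, ∑ i : Fin 4, ∑ j : Fin 4, G.signedPos y 0 (v, i)
        * ((if i < j then -1 else if j < i then 1 else 0) * G.signedPos y 1 (v, j)) := by
    rw [dotProduct, Fintype.sum_prod_type]
    refine Finset.sum_congr rfl fun v _ => Finset.sum_congr rfl fun i _ => ?_
    rw [mulVec, dotProduct, Fintype.sum_prod_type, Finset.mul_sum,
      Finset.sum_eq_single v (fun v' _ hv => ?_) (fun h => absurd (Finset.mem_univ v) h)]
    · rw [Finset.mul_sum]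
      refine Finset.sum_congr rfl fun j _ => ?_
      simp [vertexForm]
    · rw [Finset.sum_eq_zero, mul_zero]
      intro j _
      simp [vertexForm, Ne.symm hv]
  rw [hsum, Finset.mul_sum]
  refine Finset.sum_congr rfl fun v _ => ?_
  have hw : ∀ i j : Fin 4, (-1 : ℝ) ^ ((i : ℕ) + (j : ℕ) + 1) * P.wedge (y (v, i)) (y (v, j))
      = 2 / P.θ * (-(G.signedPos y 0 (v, i) * G.signedPos y 1 (v, j)
        - G.signedPos y 1 (v, i) * G.signedPos y 0 (v, j))) := by
    intro i j
    rw [P.wedge_eq hθ, pow_succ, ← G.sign_mul_sign v i j]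
    simp only [signedPos]
    ring
  simp only [Model.vertexPhase, hw]
  simp only [Fin.sum_univ_four]
  simp
  ring

/-- The sign of `ψ - ψ̄` along a line. -/
def lineSign (l : G.Line) : ℝ := if G.isPsi (G.plus l) = true then 1 else -1

theorem lineSign_mul_self (l : G.Line) : G.lineSign l * G.lineSign l = 1 := by
  rw [lineSign]; split_ifs <;> norm_num

theorem position_psiEnd_sub (x : G.External → Plane) (u v : G.Line → Plane) (l : G.Line) :
    G.position x u v (G.psiEnd l) - G.position x u v (G.contr (G.psiEnd l))
      = G.lineSign l • u l := by
  rw [psiEnd, lineSign]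
  split_ifs with h
  · rw [show G.contr (G.plus l) = G.minus l from rfl, position_plus, position_minus]
    module
  · rw [show G.contr (G.minus l) = G.plus l from G.contr_contr _, position_plus, position_minus]
    module

/-- The wedge is taken from the ψ end to the $\bar\psi$ end. The minus sign is the product of the
opposite signs of the two ends. -/
theorem sum_linePhase (hθ : P.θ ≠ 0) (y : Pos n → Plane) :
    ∑ l, P.wedge (y (G.psiEnd l)) (y (G.contr (G.psiEnd l)))
      = -(2 / P.θ * (G.signedPos y 0 ⬝ᵥ G.lineForm *ᵥ G.signedPos y 1)) := by
  have hm : ∀ h, (G.lineForm *ᵥ G.signedPos y 1) h = if G.contr h ≠ h then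
      (if G.isPsi h = true then 1 else -1) * G.signedPos y 1 (G.contr h) else 0 := by
    intro h
    rw [mulVec, dotProduct]
    simp only [lineForm, of_apply]
    by_cases hc : G.contr h ≠ h
    · rw [Finset.sum_eq_single (G.contr h)]
      · simp [hc]
      · intro b _ hb
        simp [hb]
      · exact fun h' => absurd (Finset.mem_univ _) h'
    · rw [if_neg hc]
      exact Finset.sum_eq_zero fun b _ => by simp [hc]
  rw [dotProduct, G.sum_pos]
  have e0 : ∑ e : G.External, G.signedPos y 0 e.1 * (G.lineForm *ᵥ G.signedPos y 1) e.1 = 0 :=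
    Finset.sum_eq_zero fun e _ => by rw [hm, if_neg (not_not.2 e.2), mul_zero]
  rw [e0, zero_add, ← Finset.sum_add_distrib, Finset.mul_sum, ← Finset.sum_neg_distrib]
  refine Finset.sum_congr rfl fun l _ => ?_
  have h0 : G.contr (G.minus l) = G.plus l := G.contr_contr _
  have h0' : G.contr (G.plus l) = G.minus l := rfl
  have h1 : G.contr (G.minus l) ≠ G.minus l := by
    rw [h0]; exact fun h => l.2.1 h.symm
  have h2 : G.isPsi (G.minus l) = !G.isPsi (G.plus l) := G.isPsi_contr _ l.2.1
  rw [hm, hm, if_pos (show G.contr (G.plus l) ≠ G.plus l from l.2.1), if_pos h1,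
    h0, h0', h2, psiEnd, P.wedge_eq hθ]
  simp only [signedPos, G.sign_plus, G.sign_minus]
  cases hb : G.isPsi (G.plus l)
  · simp [h0]
    ring
  · simp [h0']
    ring

theorem sum_branchPhase (y : Pos n → Plane) (p : {l // l ∈ G.tree} → Plane) :
    ∑ t, inner ℝ (p t) (G.branchSum y t.1)
      = ∑ μ : Fin 2, G.signedPos y μ ⬝ᵥ fun h => ∑ t, G.inBranch h t * p t μ := by
  have h1 : ∀ t, inner ℝ (p t) (G.branchSum y t.1)
      = ∑ h, G.inBranch h t * ∑ μ : Fin 2, G.signedPos y μ h * p t μ := by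
    intro t
    rw [branchSum, inner_sum, Fintype.sum_prod_type]
    rw [← Finset.sum_filter_add_sum_filter_not Finset.univ (· ∈ G.branch t.1) (fun v =>
      ∑ j, G.inBranch (v, j) t * ∑ μ : Fin 2, G.signedPos y μ (v, j) * p t μ)]
    rw [Finset.filter_mem_eq_inter, Finset.univ_inter]
    rw [Finset.sum_eq_zero (s := Finset.univ.filter fun v => ¬v ∈ G.branch t.1), add_zero]
    · refine Finset.sum_congr rfl fun v hv => ?_
      rw [inner_sum]
      refine Finset.sum_congr rfl fun j _ => ?_
      simp only [inBranch, of_apply, if_pos hv, one_mul, inner_smul_right, signedPos,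
        PiLp.inner_apply, Finset.mul_sum]
      refine Finset.sum_congr rfl fun μ _ => ?_
      simp
      ring
    · intro v hv
      have := (Finset.mem_filter.1 hv).2
      exact Finset.sum_eq_zero fun j _ => by simp [inBranch, this]
  simp only [h1, dotProduct, Finset.mul_sum]
  rw [Finset.sum_comm]
  simp only [Fin.sum_univ_two]
  rw [← Finset.sum_add_distrib]
  refine Finset.sum_congr rfl fun h _ => ?_
  rw [← Finset.sum_add_distrib]
  refine Finset.sum_congr rfl fun t _ => ?_
  ring

/-- The quarter turn of the momenta turns the scalar product $p\cdot x$ into an antisymmetric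
pairing of first and second coordinates, of the same kind as the wedge. -/
theorem sum_branchPhase_innerEquiv (y : Pos n → Plane) (U : (G.Idx → ℝ) × (G.Idx → ℝ)) :
    ∑ t, inner ℝ ((G.innerEquiv U).2.2 t) (G.branchSum y t.1)
      = G.signedPos y 0 ⬝ᵥ G.branchMatrix *ᵥ U.2 - G.signedPos y 1 ⬝ᵥ G.branchMatrix *ᵥ U.1 := by
  have hB : ∀ V : G.Idx → ℝ, G.branchMatrix *ᵥ V
      = fun h => ∑ t, G.inBranch h t * V (Sum.inr (Sum.inr t)) := by
    intro V
    ext h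
    rw [mulVec, dotProduct, Fintype.sum_sum_type, Fintype.sum_sum_type]
    simp [branchMatrix]
  rw [sum_branchPhase, Fin.sum_univ_two, hB, hB, sub_eq_add_neg, ← dotProduct_neg, innerEquiv_apply]
  congr 2
  ext h
  simp

/-- The coefficients of the part of the phase that is linear in the first coordinates. -/
def linPhase₀ (x : G.Ext' → Plane) : G.Idx → ℝ :=
  (2 / P.θ) • G.posMatrixᵀ *ᵥ G.posForm P *ᵥ G.extPart x 1 - G.branchMatrixᵀ *ᵥ G.extPart x 1

/-- The coefficients of the part of the phase that is linear in the second coordinates. -/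
def linPhase₁ (x : G.Ext' → Plane) : G.Idx → ℝ :=
  G.branchMatrixᵀ *ᵥ G.extPart x 0 - (2 / P.θ) • G.posMatrixᵀ *ᵥ G.posForm P *ᵥ G.extPart x 0

/-- The part of the phase that only depends on the external positions. -/
def constPhase (x : G.Ext' → Plane) : ℝ :=
  2 / P.θ * (G.extPart x 0 ⬝ᵥ G.posForm P *ᵥ G.extPart x 1)

/-- All oscillations (vertices, propagators, branch constraints) together have the shape to which
`integral_exp_gaussExp` applies: one antisymmetric form between the two coordinate families, linear
terms, and a constant that depends on the external positions. -/
theorem total_phase (hθ : P.θ ≠ 0) (x : G.Ext' → Plane) (U : (G.Idx → ℝ) × (G.Idx → ℝ))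
    {y : Pos n → Plane}
    (hy : y = G.position (G.ext x (G.innerEquiv U).1) (G.innerEquiv U).1 (G.innerEquiv U).2.1) :
    (∑ v, P.vertexPhase (fun j => y (v, j))
        + ∑ t, inner ℝ ((G.innerEquiv U).2.2 t) (G.branchSum y t.1))
      + P.Ω * ∑ l, P.wedge (y (G.psiEnd l)) (y (G.contr (G.psiEnd l)))
    = (U.1 ⬝ᵥ G.phaseMatrix P *ᵥ U.2 + G.linPhase₀ P x ⬝ᵥ U.1 + G.linPhase₁ P x ⬝ᵥ U.2)
      + G.constPhase P x := by
  have hY0 := G.signedPos_position x U 0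
  have hY1 := G.signedPos_position x U 1
  rw [← hy] at hY0 hY1
  rw [G.sum_vertexPhase P hθ, G.sum_linePhase P hθ, G.sum_branchPhase_innerEquiv, hY0, hY1]
  have ht : ∀ {m k : Type} [Fintype m] [Fintype k] (A : Matrix m k ℝ) (a : k → ℝ) (b : m → ℝ),
      (A *ᵥ a) ⬝ᵥ b = a ⬝ᵥ Aᵀ *ᵥ b := fun A a b => by
    rw [dotProduct_comm, dotProduct_mulVec, ← mulVec_transpose, dotProduct_comm]
  have hW : ∀ a b, a ⬝ᵥ vertexForm n *ᵥ b - P.Ω * (a ⬝ᵥ G.lineForm *ᵥ b)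
      = a ⬝ᵥ G.posForm P *ᵥ b := fun a b => by
    rw [posForm, sub_mulVec, smul_mulVec, dotProduct_sub, dotProduct_smul, smul_eq_mul]
  have h1 : ∀ a b : Pos n → ℝ, 2 / P.θ * (a ⬝ᵥ vertexForm n *ᵥ b)
      + P.Ω * -(2 / P.θ * (a ⬝ᵥ G.lineForm *ᵥ b)) = 2 / P.θ * (a ⬝ᵥ G.posForm P *ᵥ b) := fun a b => by
    rw [← hW]; ring
  have c0 : G.coords U 0 = U.1 := rfl
  have c1 : G.coords U 1 = U.2 := rfl
  rw [c0, c1, add_right_comm, h1]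
  simp only [linPhase₀, linPhase₁, constPhase, phaseMatrix, mulVec_add, add_mulVec, sub_mulVec,
    smul_mulVec, dotProduct_add, add_dotProduct, sub_dotProduct, dotProduct_sub, smul_dotProduct,
    dotProduct_smul, ← mulVec_mulVec, smul_eq_mul]
  have s1 : G.posMatrix *ᵥ U.1 ⬝ᵥ G.posForm P *ᵥ G.posMatrix *ᵥ U.2
      = U.1 ⬝ᵥ G.posMatrixᵀ *ᵥ G.posForm P *ᵥ G.posMatrix *ᵥ U.2 := ht _ _ _
  have s2 : G.posMatrix *ᵥ U.1 ⬝ᵥ G.posForm P *ᵥ G.extPart x 1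
      = (G.posMatrixᵀ *ᵥ G.posForm P *ᵥ G.extPart x 1) ⬝ᵥ U.1 := by rw [ht, dotProduct_comm]
  have s3 : G.extPart x 0 ⬝ᵥ G.posForm P *ᵥ G.posMatrix *ᵥ U.2
      = -((G.posMatrixᵀ *ᵥ G.posForm P *ᵥ G.extPart x 0) ⬝ᵥ U.2) := by
    rw [dotProduct_comm, ht, posForm_transpose, neg_mulVec, dotProduct_neg, ht, dotProduct_comm]
  have s4 : G.posMatrix *ᵥ U.1 ⬝ᵥ G.branchMatrix *ᵥ U.2
      = U.1 ⬝ᵥ G.posMatrixᵀ *ᵥ G.branchMatrix *ᵥ U.2 := ht _ _ _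
  have s5 : G.extPart x 0 ⬝ᵥ G.branchMatrix *ᵥ U.2 = (G.branchMatrixᵀ *ᵥ G.extPart x 0) ⬝ᵥ U.2 := by
    rw [dotProduct_comm, ht, dotProduct_comm]
  have s6 : G.posMatrix *ᵥ U.2 ⬝ᵥ G.branchMatrix *ᵥ U.1
      = U.1 ⬝ᵥ G.branchMatrixᵀ *ᵥ G.posMatrix *ᵥ U.2 := by rw [dotProduct_comm, ht]
  have s7 : G.extPart x 1 ⬝ᵥ G.branchMatrix *ᵥ U.1 = (G.branchMatrixᵀ *ᵥ G.extPart x 1) ⬝ᵥ U.1 := by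
    rw [dotProduct_comm, ht, dotProduct_comm]
  rw [s1, s2, s3, s4, s5, s6, s7]
  ring

end RootedGraph

/-- The growth in the representation of the root function is a sum of four exponentials in $\sum
u_l$; each one is a product over the lines. -/
theorem four_mul_cosh_mul_cosh (a b : ℝ) : 4 * (Real.cosh a * Real.cosh b)
    = ∑ s : Bool × Bool, Real.exp ((if s.1 = true then 1 else -1) * a
      + (if s.2 = true then 1 else -1) * b) := by
  rw [Fintype.sum_prod_type]
  simp [Real.cosh_eq, Real.exp_add]
  ring

namespace RootedGraph

open Matrix FourierTransform

variable {n : ℕ} (G : RootedGraph n) (P : Model)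

/-! ### The amplitude as a superposition of oscillating Gaussians -/

/-- The parameters of the superposition: the momentum of the root function, and the parameters of the
propagators. -/
abbrev MixVars : Type := Plane × (G.Line → ℝ × (ℝ × ℝ))

/-- The exponential rates, along the short variables, that shift the weight of a propagator. -/
def lineTilt (ς : ℝ × ℝ) (l : G.Line) : ℝ × ℝ := (G.lineSign l * ς.1, G.lineSign l * ς.2)

/-- The weight of the propagator of a line. -/
def spinLineWeight (i : G.Line → ℕ) (σ : Pos n → Fin 2) (ς : ℝ × ℝ) (l : G.Line) :
    ℝ × (ℝ × ℝ) → ℂ :=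
  P.lineWeight (i l) (G.lineTilt ς l) (σ (G.psiEnd l)) (σ (G.contr (G.psiEnd l)))

/-- A Gaussian times a plane wave in a short variable. -/
def lineWave (u : G.Line → Plane) (l : G.Line) (τ : ℝ × (ℝ × ℝ)) : ℂ :=
  ((-(P.beta τ.1 / 2) * ‖u l‖ ^ 2 : ℝ) : ℂ)
    + Complex.I * ((G.lineSign l * (τ.2.1 * u l 0 + τ.2.2 * u l 1) : ℝ) : ℂ)

theorem abs_lineSign (l : G.Line) : |G.lineSign l| = 1 := by
  rw [lineSign]; split_ifs <;> norm_num

/-- The exponential of $\varsigma\cdot\sum u_l$ is shared out among the lines and each propagator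
absorbs its factor. The propagator sees the difference of its ψ and $\bar\psi$ ends, which is $u_l$
up to the sign `lineSign`; the tilt carries the same sign. -/
theorem prod_prop_mul_exp (hθ : P.θ ≠ 0) (hM : 1 < P.M) (hγ : P.Clifford)
    (hm : P.m ≠ 0 ∨ P.Ω ≠ 0) (i : G.Line → ℕ) (σ : Pos n → Fin 2) {ς : ℝ × ℝ}
    (h1 : |ς.1| ≤ P.rate) (h2 : |ς.2| ≤ P.rate) (x : G.External → Plane) (u v : G.Line → Plane)
    {y : Pos n → Plane} (hy : y = G.position x u v) :
    (∏ l, P.prop (i l) (y (G.psiEnd l)) (y (G.contr (G.psiEnd l)))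
        (σ (G.psiEnd l)) (σ (G.contr (G.psiEnd l))))
      * ((Real.exp (ς.1 * (∑ l, u l) 0 + ς.2 * (∑ l, u l) 1) : ℝ) : ℂ)
    = Complex.exp (Complex.I * ((P.Ω * ∑ l, P.wedge (y (G.psiEnd l)) (y (G.contr (G.psiEnd l))) : ℝ)
        : ℂ)) * ∫ τ : G.Line → ℝ × (ℝ × ℝ), ∏ l, (G.spinLineWeight P i σ ς l (τ l)
          * Complex.exp (G.lineWave P u l (τ l))) := by
  rw [integral_fintype_prod_volume_eq_prod
    (fun l τ => G.spinLineWeight P i σ ς l τ * Complex.exp (G.lineWave P u l τ))]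
  have e1 : ς.1 * (∑ l, u l) 0 + ς.2 * (∑ l, u l) 1 = ∑ l, (ς.1 * u l 0 + ς.2 * u l 1) := by
    rw [Finset.sum_add_distrib, ← Finset.mul_sum, ← Finset.mul_sum]
    simp
  rw [e1, Real.exp_sum, Finset.mul_sum, Complex.ofReal_sum, Finset.mul_sum, Complex.exp_sum,
    Complex.ofReal_prod, ← Finset.prod_mul_distrib, ← Finset.prod_mul_distrib]
  refine Finset.prod_congr rfl fun l _ => ?_
  have hs := G.lineSign_mul_self l
  have ha := G.abs_lineSign l
  have hd : y (G.psiEnd l) - y (G.contr (G.psiEnd l)) = G.lineSign l • u l := by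
    rw [hy, position_psiEnd_sub]
  have := P.prop_mul_exp hθ hM hγ hm (i l) (ς := G.lineTilt ς l)
    (by rw [lineTilt, abs_mul, ha, one_mul]; exact h1)
    (by rw [lineTilt, abs_mul, ha, one_mul]; exact h2)
    (σ (G.psiEnd l)) (σ (G.contr (G.psiEnd l))) (y (G.psiEnd l)) (y (G.contr (G.psiEnd l)))
  rw [hd, norm_smul, Real.norm_eq_abs, ha, one_mul] at this
  have e2 : (G.lineTilt ς l).1 * (G.lineSign l • u l) 0 + (G.lineTilt ς l).2 * (G.lineSign l • u l) 1
      = ς.1 * u l 0 + ς.2 * u l 1 := by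
    simp only [lineTilt, PiLp.smul_apply, smul_eq_mul]
    linear_combination (ς.1 * u l 0 + ς.2 * u l 1) * hs
  rw [e2] at this
  rw [this]
  congr 1
  refine integral_congr_ae (.of_forall fun τ => ?_)
  dsimp only
  rw [lineWave, Complex.exp_add, Complex.ofReal_exp, spinLineWeight]
  congr 5
  simp only [PiLp.smul_apply, smul_eq_mul]
  ring

/-- The weight of the superposition. -/
def mixWeight (δ : ℝ) (i : G.Line → ℕ) (f : G.External → 𝓢(Plane, ℂ)) (σ : Pos n → Fin 2)
    (ς : ℝ × ℝ) (z : (G.Ext' → Plane) × G.MixVars) : ℂ :=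
  (∏ e : G.Ext', f e.1 (z.1 e)) * 𝓕 (cutTranslate (f G.root) (G.rootPos z.1) δ) z.2.1
    * (∏ l, G.spinLineWeight P i σ ς l (z.2.2 l))
    * Complex.exp (Complex.I * (G.constPhase P z.1 : ℂ))

/-- The Gaussian widths of the superposition. -/
def mixWidth (τ : G.MixVars) : G.Idx → ℝ := Sum.elim (fun l => P.beta (τ.2 l).1) 0

/-- The Gaussian widths of the cut-off. -/
def cutWidth : G.Idx → ℝ := Sum.elim 0 fun _ => 2

/-- The linear phase in the first coordinates. -/
def mixShift₀ (z : (G.Ext' → Plane) × G.MixVars) : G.Idx → ℝ :=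
  G.linPhase₀ P z.1
    + Sum.elim (fun l => G.lineSign l * (z.2.2 l).2.1 - 2 * Real.pi * z.2.1 0) 0

/-- The linear phase in the second coordinates. -/
def mixShift₁ (z : (G.Ext' → Plane) × G.MixVars) : G.Idx → ℝ :=
  G.linPhase₁ P z.1
    + Sum.elim (fun l => G.lineSign l * (z.2.2 l).2.2 - 2 * Real.pi * z.2.1 1) 0

/-- The integrand of the superposition, integrated over its parameters. -/
def mixture (δ : ℝ) (i : G.Line → ℕ) (f : G.External → 𝓢(Plane, ℂ)) (σ : Pos n → Fin 2)
    (ς : ℝ × ℝ) (r : ℝ) (z : (G.Ext' → Plane) × ((G.Idx → ℝ) × (G.Idx → ℝ))) : ℂ :=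
  ∫ τ : G.MixVars, G.mixWeight P δ i f σ ς (z.1, τ)
    * Complex.exp (gaussExp (fun j => G.mixWidth P τ j + r * G.cutWidth j) (G.phaseMatrix P)
      (G.mixShift₀ P (z.1, τ)) (G.mixShift₁ P (z.1, τ)) z.2)

/-- The bookkeeping of exponents at fixed parameters. The cut-off $e^{-rv^2}$ corresponds to width
2r, since widths enter `gaussExp` halved. -/
theorem mixture_exponent (hθ : P.θ ≠ 0) (r : ℝ) (x : G.Ext' → Plane)
    (U : (G.Idx → ℝ) × (G.Idx → ℝ)) (τ : G.MixVars)
    {y : Pos n → Plane}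
    (hy : y = G.position (G.ext x (G.innerEquiv U).1) (G.innerEquiv U).1 (G.innerEquiv U).2.1) :
    Complex.I * (G.constPhase P x : ℂ) +
      gaussExp (fun j => G.mixWidth P τ j + r * G.cutWidth j) (G.phaseMatrix P)
        (G.mixShift₀ P (x, τ)) (G.mixShift₁ P (x, τ)) U
    = ((-r * (∑ l, ‖(G.innerEquiv U).2.1 l‖ ^ 2 + ∑ l, ‖(G.innerEquiv U).2.2 l‖ ^ 2) : ℝ) : ℂ)
      + Complex.I * ((∑ v, P.vertexPhase (fun j => y (v, j))
        + ∑ t, inner ℝ ((G.innerEquiv U).2.2 t) (G.branchSum y t.1) : ℝ) : ℂ)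
      + Complex.I * ((P.Ω * ∑ l, P.wedge (y (G.psiEnd l)) (y (G.contr (G.psiEnd l))) : ℝ) : ℂ)
      + Complex.I * ((-(2 * Real.pi) * inner ℝ τ.1 (∑ l, (G.innerEquiv U).1 l) : ℝ) : ℂ)
      + ∑ l, G.lineWave P (G.innerEquiv U).1 l (τ.2 l) := by
  have ht := G.total_phase P hθ x U hy
  have hu : ∀ l, (G.innerEquiv U).1 l = !₂[U.1 (Sum.inl l), U.2 (Sum.inl l)] := fun _ => rfl
  have hv : ∀ l, (G.innerEquiv U).2.1 l = !₂[U.1 (Sum.inr (Sum.inl l)), U.2 (Sum.inr (Sum.inl l))] :=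
    fun _ => rfl
  have hp : ∀ t, (G.innerEquiv U).2.2 t
      = !₂[U.2 (Sum.inr (Sum.inr t)), -U.1 (Sum.inr (Sum.inr t))] := fun _ => rfl
  have hn : ∀ a b : ℝ, ‖(!₂[a, b] : Plane)‖ ^ 2 = a ^ 2 + b ^ 2 := fun a b => by
    rw [EuclideanSpace.norm_sq_eq, Fin.sum_univ_two]; simp
  have hre : -(∑ j, (G.mixWidth P τ j + r * G.cutWidth j) * (U.1 j ^ 2 + U.2 j ^ 2) / 2)
      = -r * (∑ l, ‖(G.innerEquiv U).2.1 l‖ ^ 2 + ∑ l, ‖(G.innerEquiv U).2.2 l‖ ^ 2)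
        + ∑ l, -(P.beta (τ.2 l).1 / 2) * ‖(G.innerEquiv U).1 l‖ ^ 2 := by
    simp only [hu, hv, hp, hn]
    rw [Fintype.sum_sum_type, Fintype.sum_sum_type]
    simp only [mixWidth, cutWidth, Sum.elim_inl, Sum.elim_inr, Pi.zero_apply, mul_zero, add_zero,
      zero_add, mul_add, Finset.mul_sum, ← Finset.sum_neg_distrib, neg_add]
    rw [add_comm]
    congr 1
    · congr 1
      · refine Finset.sum_congr rfl fun l _ => ?_; ring
      · refine Finset.sum_congr rfl fun l _ => ?_; ring
    · refine Finset.sum_congr rfl fun l _ => ?_; ring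
  have him : U.1 ⬝ᵥ G.phaseMatrix P *ᵥ U.2 + G.mixShift₀ P (x, τ) ⬝ᵥ U.1
        + G.mixShift₁ P (x, τ) ⬝ᵥ U.2
      = (U.1 ⬝ᵥ G.phaseMatrix P *ᵥ U.2 + G.linPhase₀ P x ⬝ᵥ U.1 + G.linPhase₁ P x ⬝ᵥ U.2)
        + (-(2 * Real.pi) * inner ℝ τ.1 (∑ l, (G.innerEquiv U).1 l))
        + ∑ l, G.lineSign l * ((τ.2 l).2.1 * (G.innerEquiv U).1 l 0
          + (τ.2 l).2.2 * (G.innerEquiv U).1 l 1) := by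
    have hi : inner ℝ τ.1 (∑ l, (G.innerEquiv U).1 l)
        = ∑ l, (τ.1 0 * U.1 (Sum.inl l) + τ.1 1 * U.2 (Sum.inl l)) := by
      rw [inner_sum]
      refine Finset.sum_congr rfl fun l _ => ?_
      rw [hu, PiLp.inner_apply, Fin.sum_univ_two]
      simp [mul_comm]
    have s0 : ∀ (a : G.Line → ℝ) (V : G.Idx → ℝ), (Sum.elim a 0 : G.Idx → ℝ) ⬝ᵥ V
        = ∑ l, a l * V (Sum.inl l) := fun a V => by
      rw [dotProduct, Fintype.sum_sum_type]
      simp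
    rw [hi, mixShift₀, mixShift₁, add_dotProduct, add_dotProduct, s0, s0]
    simp only [hu, Finset.mul_sum]
    have : ∀ a b c d e : ℝ, b + c = d + e → a + b + c = a + d + e := by intros; linarith
    rw [show ∀ a b c d e : ℝ, a + (b + c) + (d + e) = (a + b + d) + (c + e) by intros; ring,
      add_assoc (_ + _ + _)]
    congr 1
    rw [← Finset.sum_add_distrib, ← Finset.sum_add_distrib]
    refine Finset.sum_congr rfl fun l _ => ?_
    simp
    ring
  rw [gaussExp, hre, him]
  simp only [lineWave]
  rw [Finset.sum_add_distrib, ← Finset.mul_sum, ← Complex.ofReal_sum, ← Complex.ofReal_sum]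
  rw [← sub_eq_iff_eq_add] at ht
  rw [← ht]
  push_cast
  ring

/-- The amplitude becomes a finite sum of Gaussian mixtures, over internal spins and over the four
exponentials of the root function. The integral over the mixture parameters is inside; Fubini is
applied only later, with the cut-off. -/
theorem regIntegrand_varsEquiv (hθ : P.θ ≠ 0) (hM : 1 < P.M) (hγ : P.Clifford)
    (hm : P.m ≠ 0 ∨ P.Ω ≠ 0) (i : G.Line → ℕ) (f : G.External → 𝓢(Plane, ℂ))
    (s : G.External → Fin 2) (r : ℝ) (z : (G.Ext' → Plane) × ((G.Idx → ℝ) × (G.Idx → ℝ))) :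
    G.regIntegrand P i f s r (G.varsEquiv z) = ∑ σ ∈ G.spins s, ∑ b : Bool × Bool,
      G.mixture P P.rate i f σ ((if b.1 = true then 1 else -1) * P.rate,
        (if b.2 = true then 1 else -1) * P.rate) r z := by
  classical
  obtain ⟨x, U⟩ := z
  set u := (G.innerEquiv U).1 with hu
  set y := G.position (G.ext x u) u (G.innerEquiv U).2.1 with hy
  have hδ := P.rate_pos
  have hroot : ∏ e, f e (G.ext x u e) = f G.root (G.rootPos x - ∑ l, u l)
      * ∏ e : G.Ext', f e.1 (x e) := by
    rw [Fintype.prod_eq_mul_prod_subtype_ne _ G.root, ext_root]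
    congr 1
    exact Finset.prod_congr rfl fun e _ => by rw [ext_of_ne]
  rw [regIntegrand, integrand]
  simp only [varsEquiv_apply]
  rw [← hu, ← hy, hroot, eq_integral_fourier_cutTranslate _ _ hδ, four_mul_cosh_mul_cosh,
    Complex.ofReal_sum]
  simp only [Finset.mul_sum, Finset.sum_mul]
  refine Finset.sum_congr rfl fun σ _ => Finset.sum_congr rfl fun b _ => ?_
  have h1 : ∀ b : Bool, |(if b = true then 1 else -1) * P.rate| ≤ P.rate := fun b => by
    cases b <;> simp [abs_of_pos hδ]
  have hprop := G.prod_prop_mul_exp P hθ hM hγ hm i σ (ς := ((if b.1 = true then 1 else -1) * P.rate,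
        (if b.2 = true then 1 else -1) * P.rate)) (h1 _) (h1 _) (G.ext x u) u
          (G.innerEquiv U).2.1 hy
  simp only [mul_assoc] at hprop
  set Q := ∏ l, P.prop (i l) (y (G.psiEnd l)) (y (G.contr (G.psiEnd l)))
        (σ (G.psiEnd l)) (σ (G.contr (G.psiEnd l))) with hQ
  set E : ℂ := ((Real.exp ((if b.1 = true then 1 else -1) * (P.rate * (∑ l, u l) 0)
      + (if b.2 = true then 1 else -1) * (P.rate * (∑ l, u l) 1)) : ℝ) : ℂ) with hE
  set R : ℂ := ((Real.exp (-r * (∑ l, ‖(G.innerEquiv U).2.1 l‖ ^ 2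
    + ∑ l, ‖(G.innerEquiv U).2.2 l‖ ^ 2)) : ℝ) : ℂ) with hR
  set O := Complex.exp (Complex.I * ((∑ v, P.vertexPhase (fun j => y (v, j))
        + ∑ t, inner ℝ ((G.innerEquiv U).2.2 t) (G.branchSum y t.1) : ℝ) : ℂ)) with hO
  rw [mixture]
  dsimp only
  set Fq := ∫ q, 𝓕 (cutTranslate (f G.root) (G.rootPos x) P.rate) q
        * Complex.exp (Complex.I * ((-(2 * Real.pi) * inner ℝ q (∑ l, u l) : ℝ) : ℂ)) with hFq
  set X := ∏ e : G.Ext', f e.1 (x e) with hX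
  -- The real exponential is grouped with the propagators before these are expanded.
  rw [show R * (Fq * E * X * Q * O) = R * X * O * (Fq * (Q * E)) by ring, hprop,
    mul_left_comm Fq, ← mul_assoc, hFq, ← integral_prod_mul, ← integral_const_mul,
    ← Measure.volume_eq_prod]
  refine integral_congr_ae (.of_forall fun τ => ?_)
  dsimp only
  rw [Finset.prod_mul_distrib, ← Complex.exp_sum, hR, hO, mixWeight, Complex.ofReal_exp]
  dsimp only
  rw [mul_assoc (_ * _ * _) (Complex.exp _) (Complex.exp _), ← Complex.exp_add,
    G.mixture_exponent P hθ r x U τ hy, Complex.exp_add, Complex.exp_add, Complex.exp_add,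
    Complex.exp_add, ← hu]
  ring

end RootedGraph

theorem integrable_and_integral_assoc_mul {X Q T : Type*} [MeasureSpace X] [MeasureSpace Q]
    [MeasureSpace T] [SFinite (volume : Measure X)] [SFinite (volume : Measure Q)]
    [SFinite (volume : Measure T)] {F : X × Q → ℝ} {H : T → ℝ} (hF : Integrable F)
    (hH : Integrable H) :
    Integrable (fun z : X × (Q × T) => F (z.1, z.2.1) * H z.2.2) ∧
      ∫ z : X × (Q × T), F (z.1, z.2.1) * H z.2.2 = (∫ w, F w) * ∫ t, H t := by
  have hmp := volume_preserving_prodAssoc (α₁ := X) (β₁ := Q) (γ₁ := T)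
  have he := (MeasurableEquiv.prodAssoc (α := X) (β := Q) (γ := T)).measurableEmbedding
  constructor
  · rw [← hmp.integrable_comp_emb he]
    exact hF.mul_prod hH
  · rw [← hmp.integral_comp he]
    exact integral_prod_mul F H

namespace RootedGraph

open Matrix FourierTransform

variable {n : ℕ} (G : RootedGraph n) (P : Model)

/-! ### Bounds on the superposition -/

/-- The part of the weight that depends on the external positions and on the momentum of the root
function. -/
def rootFactor (δ : ℝ) (f : G.External → 𝓢(Plane, ℂ)) (z : (G.Ext' → Plane) × Plane) : ℝ :=
  (∏ e : G.Ext', ‖f e.1 (z.1 e)‖) * ‖𝓕 (cutTranslate (f G.root) (G.rootPos z.1) δ) z.2‖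

theorem continuous_rootPos : Continuous G.rootPos := by
  unfold rootPos
  fun_prop

theorem measurable_rootWave {δ : ℝ} (hδ : 0 < δ) (f : 𝓢(Plane, ℂ)) :
    Measurable fun z : (G.Ext' → Plane) × Plane =>
      𝓕 (cutTranslate f (G.rootPos z.1) δ) z.2 := by
  have h0 : Measurable G.rootPos := G.continuous_rootPos.measurable
  have h1 : Measurable fun z : (G.Ext' → Plane) × Plane => (G.rootPos z.1, z.2) :=
    (h0.comp measurable_fst).prodMk measurable_snd
  have h2 := measurable_fourier_cutTranslate f hδ
  generalize hF : (fun z : Plane × Plane => 𝓕 (cutTranslate f z.1 δ) z.2) = F at h2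
  have h3 : (fun z : (G.Ext' → Plane) × Plane => 𝓕 (cutTranslate f (G.rootPos z.1) δ) z.2)
      = fun z => F (G.rootPos z.1, z.2) := by rw [← hF]
  rw [h3]
  exact h2.comp h1

theorem continuous_extPart (μ : Fin 2) : Continuous fun x : G.Ext' → Plane => G.extPart x μ := by
  have h1 := G.continuous_rootPos
  refine continuous_pi fun h => ?_
  by_cases hx : G.contr h = h
  · by_cases he : (⟨h, hx⟩ : G.External) = G.root
    · simp only [extPart, dif_pos hx, dif_pos he]
      fun_prop
    · simp only [extPart, dif_pos hx, dif_neg he]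
      fun_prop
  · simp only [extPart, dif_neg hx]
    fun_prop

theorem continuous_constPhase : Continuous (G.constPhase P) := by
  have h0 := G.continuous_extPart 0
  have h1 := G.continuous_extPart 1
  unfold constPhase
  exact continuous_const.mul (h0.dotProduct (continuous_const.matrix_mulVec h1))

theorem continuous_linPhase₀ : Continuous (G.linPhase₀ P) := by
  have h1 := G.continuous_extPart 1
  unfold linPhase₀
  exact ((continuous_const.matrix_mulVec (continuous_const.matrix_mulVec h1)).const_smul
    (2 / P.θ)).sub (continuous_const.matrix_mulVec h1)

theorem continuous_linPhase₁ : Continuous (G.linPhase₁ P) := by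
  have h0 := G.continuous_extPart 0
  unfold linPhase₁
  exact (continuous_const.matrix_mulVec h0).sub
    ((continuous_const.matrix_mulVec (continuous_const.matrix_mulVec h0)).const_smul (2 / P.θ))

theorem measurable_rootFactor {δ : ℝ} (hδ : 0 < δ) (f : G.External → 𝓢(Plane, ℂ)) :
    Measurable (G.rootFactor δ f) := by
  refine Measurable.mul ?_ (G.measurable_rootWave hδ (f G.root)).norm
  have h := fun e => (f e).continuous
  fun_prop

theorem integrable_external (g : G.External → 𝓢(Plane, ℝ)) :
    Integrable fun x : G.Ext' → Plane => g G.root (G.rootPos x) * ∏ e : G.Ext', g e.1 (x e) := by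
  have h1 := G.continuous_rootPos
  have h2 := (g G.root).continuous
  have h3 : Integrable fun x : G.Ext' → Plane => ∏ e : G.Ext', g e.1 (x e) :=
    Integrable.fintype_prod (f := fun (e : G.Ext') x => g e.1 x) fun e => (g e.1).integrable
  exact h3.bdd_mul (c := SchwartzMap.seminorm ℝ 0 0 (g G.root))
    (h2.comp h1).aestronglyMeasurable (.of_forall fun x => SchwartzMap.norm_le_seminorm ℝ _ _)

theorem integrable_rootFactor_section (δ : ℝ) (f : G.External → 𝓢(Plane, ℂ)) (x : G.Ext' → Plane) :
    Integrable fun q => G.rootFactor δ f (x, q) := by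
  have h := (𝓕 (cutTranslate (f G.root) (G.rootPos x) δ)).integrable (μ := volume)
  exact h.norm.const_mul (∏ e : G.Ext', ‖f e.1 (x e)‖)

theorem integral_rootFactor_section (δ : ℝ) (f : G.External → 𝓢(Plane, ℂ)) (x : G.Ext' → Plane) :
    ∫ q, G.rootFactor δ f (x, q) = (∏ e : G.Ext', ‖f e.1 (x e)‖)
      * ∫ q, ‖𝓕 (cutTranslate (f G.root) (G.rootPos x) δ) q‖ := by
  simp only [rootFactor]
  rw [integral_const_mul]

/-- The Fourier norm of the root function is bounded by the envelope at the point where all short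
variables vanish. That is the point at which g is evaluated in the lower bound of the bounding
integral, so the two external integrals coincide. -/
theorem integrable_and_integral_rootFactor_le {δ : ℝ} (hδ : 0 < δ)
    {f : G.External → 𝓢(Plane, ℂ)} {g : G.External → 𝓢(Plane, ℝ)} {c C : ℝ} (hc : 0 ≤ c)
    (hC : 0 ≤ C) (hg : ∀ e x, 0 ≤ g e x) (hfg : ∀ e x, ‖f e x‖ ≤ c * g e x)
    (hroot : ∀ x, envelope (f G.root) (δ / 2) x ≤ c * g G.root x)
    (hwave : ∀ y, ∫ q, ‖𝓕 (cutTranslate (f G.root) y δ) q‖ ≤ C * envelope (f G.root) (δ / 2) y) :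
    Integrable (G.rootFactor δ f) ∧ ∫ z, G.rootFactor δ f z
      ≤ C * c ^ Fintype.card G.External
        * ∫ x : G.Ext' → Plane, g G.root (G.rootPos x) * ∏ e : G.Ext', g e.1 (x e) := by
  classical
  have hm := G.measurable_rootFactor hδ f
  have h0 : ∀ z, 0 ≤ G.rootFactor δ f z := fun z =>
    mul_nonneg (Finset.prod_nonneg fun e _ => norm_nonneg _) (norm_nonneg _)
  have hle : ∀ x, ∫ q, G.rootFactor δ f (x, q) ≤ C * c ^ Fintype.card G.External
      * (g G.root (G.rootPos x) * ∏ e : G.Ext', g e.1 (x e)) := by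
    intro x
    have hcard : c ^ Fintype.card G.External = c * ∏ _e : G.Ext', c := by
      rw [← Fintype.prod_eq_mul_prod_subtype_ne (fun _ => c) G.root, Finset.prod_const,
        Finset.card_univ]
    rw [integral_rootFactor_section, hcard]
    calc _ ≤ (∏ e : G.Ext', c * g e.1 (x e)) * (C * (c * g G.root (G.rootPos x))) := by
          refine mul_le_mul (Finset.prod_le_prod (fun e _ => norm_nonneg _) fun e _ => hfg _ _)
            ((hwave _).trans (mul_le_mul_of_nonneg_left (hroot _) hC))
            (integral_nonneg fun q => norm_nonneg _)
            (Finset.prod_nonneg fun e _ => mul_nonneg hc (hg _ _))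
      _ = _ := by rw [Finset.prod_mul_distrib]; ring
  have hext := (G.integrable_external g).const_mul (C * c ^ Fintype.card G.External)
  have hin : Integrable fun x => ∫ q, G.rootFactor δ f (x, q) := by
    refine hext.mono' hm.stronglyMeasurable.integral_prod_right'.aestronglyMeasurable
      (.of_forall fun x => ?_)
    rw [Real.norm_of_nonneg (integral_nonneg fun q => h0 _)]
    exact hle x
  have hI : Integrable (G.rootFactor δ f) := by
    rw [Measure.volume_eq_prod, integrable_prod_iff hm.aestronglyMeasurable]
    refine ⟨.of_forall (G.integrable_rootFactor_section δ f), ?_⟩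
    simpa only [Real.norm_of_nonneg (h0 _)] using hin
  refine ⟨hI, ?_⟩
  rw [Measure.volume_eq_prod, integral_prod _ (by rwa [← Measure.volume_eq_prod]),
    ← integral_const_mul]
  exact integral_mono hin hext hle

theorem norm_mixWeight (δ : ℝ) (i : G.Line → ℕ) (f : G.External → 𝓢(Plane, ℂ))
    (σ : Pos n → Fin 2) (ς : ℝ × ℝ) (z : (G.Ext' → Plane) × G.MixVars) :
    ‖G.mixWeight P δ i f σ ς z‖
      = G.rootFactor δ f (z.1, z.2.1) * ∏ l, ‖G.spinLineWeight P i σ ς l (z.2.2 l)‖ := by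
  rw [mixWeight, norm_mul, Complex.norm_exp, norm_mul, norm_mul, norm_prod, norm_prod, rootFactor]
  simp

theorem measurable_mixWeight {δ : ℝ} (hδ : 0 < δ) (i : G.Line → ℕ)
    (f : G.External → 𝓢(Plane, ℂ)) (σ : Pos n → Fin 2) (ς : ℝ × ℝ) :
    Measurable (G.mixWeight P δ i f σ ς) := by
  have h1 := fun e => (f e).continuous
  have h2 := (G.measurable_rootWave hδ (f G.root)).comp
    ((measurable_fst.prodMk (measurable_fst.comp measurable_snd)) :
      Measurable fun z : (G.Ext' → Plane) × G.MixVars => (z.1, z.2.1))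
  have h3 : ∀ l, Measurable (G.spinLineWeight P i σ ς l) := fun l => P.measurable_lineWeight _ _ _ _
  have h4 : Measurable (G.constPhase P) := (G.continuous_constPhase P).measurable
  unfold mixWeight
  refine ((Measurable.mul ?_ h2).mul ?_).mul ?_ <;> fun_prop

/-- The bound on the inverse determinant, line by line. -/
def detWeight (l : G.Line) (t : ℝ) : ℝ :=
  if l ∈ G.tree then 4 * (P.beta t)⁻¹
  else P.θ ^ 2 / (1 - P.Ω) ^ 2 * (1 + 2 / |P.θ| * (P.beta t)⁻¹)

/-- The determinant bound, inverted and distributed over the lines. Loop lines pay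
$1+2/(|\theta|\beta)$, which is bounded by a constant inside a slice of positive scale. -/
theorem mixWidth_det_bound (hθ : P.θ ≠ 0) (hΩ : P.Ω ∈ Set.Ico (0 : ℝ) 1) (τ : G.MixVars) :
    (diagonal (G.mixWidth P τ) + G.phaseMatrix P).det ≠ 0 ∧
    |(diagonal (G.mixWidth P τ) + G.phaseMatrix P).det|⁻¹ ≤ ∏ l, G.detWeight P l (τ.2 l).1 := by
  have hβ : ∀ l : G.Line, 0 < P.beta (τ.2 l).1 := fun l => P.beta_pos hθ _
  have h := G.le_abs_det_phase P hθ hΩ hβ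
  have hθ' := abs_pos.2 hθ
  have hΩ' : 0 < 1 - P.Ω := by have := hΩ.2; linarith
  have e : (∏ t : G.TreeLine, (1 / 4 * P.beta (τ.2 t.1).1)) * ∏ o : G.Loop,
        ((1 - P.Ω) ^ 2 / P.θ ^ 2 * (P.beta (τ.2 o.1).1 / (P.beta (τ.2 o.1).1 + 2 / |P.θ|)))
      = (∏ l, G.detWeight P l (τ.2 l).1)⁻¹ := by
    rw [← Fintype.prod_subtype_mul_prod_subtype (· ∈ G.tree), mul_inv, ← Finset.prod_inv_distrib,
      ← Finset.prod_inv_distrib]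
    congr 1
    · refine Finset.prod_congr (Finset.ext fun _ => by simp) fun t _ => ?_
      rw [detWeight, if_pos t.2, mul_inv, inv_inv]
      ring
    · refine Finset.prod_congr (Finset.ext fun _ => by simp) fun o _ => ?_
      have := hβ o.1
      rw [detWeight, if_neg o.2]
      field_simp
  have hpos : 0 < ∏ l, G.detWeight P l (τ.2 l).1 := by
    refine Finset.prod_pos fun l _ => ?_
    have := hβ l
    rw [detWeight]
    split_ifs <;> positivity
  rw [e] at h
  have h' : 0 < |(diagonal (G.mixWidth P τ) + G.phaseMatrix P).det| :=
    (inv_pos.2 hpos).trans_le h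
  refine ⟨abs_pos.1 h', ?_⟩
  rw [inv_le_comm₀ h' hpos]
  exact h

end RootedGraph

namespace RootedGraph

open Matrix

variable {n : ℕ} (G : RootedGraph n) (P : Model)

/-- The bound on the integral of the weight of a line against `detWeight`. -/
def lineBound (C : ℝ) (i : G.Line → ℕ) (l : G.Line) : ℝ :=
  if l ∈ G.tree then 4 * (C * (P.M ^ i l)⁻¹) else P.θ ^ 2 / (1 - P.Ω) ^ 2 * (C * P.M ^ i l)

theorem detWeight_nonneg (hθ : P.θ ≠ 0) (l : G.Line) (t : ℝ) : 0 ≤ G.detWeight P l t := by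
  have := P.beta_pos hθ t
  rw [detWeight]
  split_ifs <;> positivity

theorem lineBound_nonneg (hM : 1 < P.M) {C : ℝ} (hC : 0 ≤ C) (i : G.Line → ℕ) (l : G.Line) :
    0 ≤ G.lineBound P C i l := by
  have : 0 < P.M := by linarith
  rw [lineBound]
  split_ifs <;> positivity

theorem measurable_mixWidth : Measurable (G.mixWidth P) := by
  have := P.measurable_beta
  refine measurable_pi_iff.2 fun j => ?_
  rcases j with l | j
  · simp only [mixWidth, Sum.elim_inl]
    fun_prop
  · simp only [mixWidth, Sum.elim_inr]
    exact measurable_const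

theorem measurable_mixShift₀ : Measurable (G.mixShift₀ P) := by
  have h := (G.continuous_linPhase₀ P).measurable
  refine (h.comp measurable_fst).add (measurable_pi_iff.2 fun j => ?_)
  rcases j with l | j
  · simp only [Sum.elim_inl]
    fun_prop
  · simp only [Sum.elim_inr]
    exact measurable_const

theorem measurable_mixShift₁ : Measurable (G.mixShift₁ P) := by
  have h := (G.continuous_linPhase₁ P).measurable
  refine (h.comp measurable_fst).add (measurable_pi_iff.2 fun j => ?_)
  rcases j with l | j
  · simp only [Sum.elim_inl]
    fun_prop
  · simp only [Sum.elim_inr]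
    exact measurable_const

/-- The constant depends on the model only, not on the graph; the final $K^n$ requires this. -/
theorem exists_spinLineWeight_bound (hθ : P.θ ≠ 0) (hM : 1 < P.M) (hγ : P.Clifford)
    (hm : P.m ≠ 0 ∨ P.Ω ≠ 0) : ∃ C : ℝ, 0 ≤ C ∧ ∀ {n : ℕ} (G : RootedGraph n)
      (i : G.Line → ℕ) (σ : Pos n → Fin 2) (ς : ℝ × ℝ), |ς.1| ≤ P.rate → |ς.2| ≤ P.rate → ∀ l,
      (Integrable fun τ => ‖G.spinLineWeight P i σ ς l τ‖ * (P.beta τ.1)⁻¹) ∧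
      (Integrable fun τ => ‖G.spinLineWeight P i σ ς l τ‖ * G.detWeight P l τ.1) ∧
      ∫ τ, ‖G.spinLineWeight P i σ ς l τ‖ * G.detWeight P l τ.1 ≤ G.lineBound P C i l := by
  obtain ⟨C, hC, h⟩ := P.exists_lineWeight_bound hθ hM hγ hm (c := 2 / |P.θ|) (by positivity)
  refine ⟨C, hC, fun {n} G i σ ς h1 h2 l => ?_⟩
  obtain ⟨⟨b1, b2⟩, b3, b4⟩ := h (i l) (G.lineTilt ς l)
    (by rw [lineTilt, abs_mul, G.abs_lineSign, one_mul]; exact h1)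
    (by rw [lineTilt, abs_mul, G.abs_lineSign, one_mul]; exact h2)
    (σ (G.psiEnd l)) (σ (G.contr (G.psiEnd l)))
  refine ⟨b1, ?_⟩
  by_cases hl : l ∈ G.tree
  · simp only [detWeight, lineBound, if_pos hl, mul_left_comm _ (4 : ℝ)]
    refine ⟨b1.const_mul 4, ?_⟩
    rw [integral_const_mul]
    exact mul_le_mul_of_nonneg_left b2 (by norm_num)
  · simp only [detWeight, lineBound, if_neg hl, mul_left_comm _ (P.θ ^ 2 / (1 - P.Ω) ^ 2)]
    refine ⟨b3.const_mul _, ?_⟩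
    rw [integral_const_mul]
    exact mul_le_mul_of_nonneg_left b4 (by positivity)

/-- The general limit theorem applied to the phase matrix of the graph. After the determinant bound
the majorant factors into the root part and one factor per line. -/
theorem exists_mixture_limit (hθ : P.θ ≠ 0) (hΩ : P.Ω ∈ Set.Ico (0 : ℝ) 1) {δ : ℝ} (hδ : 0 < δ)
    {i : G.Line → ℕ} {f : G.External → 𝓢(Plane, ℂ)} {σ : Pos n → Fin 2} {ς : ℝ × ℝ}
    {B : G.Line → ℝ} {R : ℝ} (hR : Integrable (G.rootFactor δ f))
    (hR' : ∫ z, G.rootFactor δ f z ≤ R)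
    (hline : ∀ l, (Integrable fun τ => ‖G.spinLineWeight P i σ ς l τ‖ * (P.beta τ.1)⁻¹) ∧
      (Integrable fun τ => ‖G.spinLineWeight P i σ ς l τ‖ * G.detWeight P l τ.1) ∧
      ∫ τ, ‖G.spinLineWeight P i σ ς l τ‖ * G.detWeight P l τ.1 ≤ B l) :
    (∀ r > 0, Integrable (G.mixture P δ i f σ ς r)) ∧
    ∃ A : ℂ, Tendsto (fun r => ∫ z, G.mixture P δ i f σ ς r z) (𝓝[>] 0) (𝓝 A) ∧
      ‖A‖ ≤ (2 * Real.pi) ^ Fintype.card G.Idx * (R * ∏ l, B l) := by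
  have hβ : ∀ (τ : G.MixVars) l, 0 < P.beta (τ.2 l).1 := fun τ l => P.beta_pos hθ _
  have hW := G.measurable_mixWeight P hδ i f σ ς
  have hdet := fun τ => G.mixWidth_det_bound P hθ hΩ τ
  have hR0 : ∀ w, 0 ≤ G.rootFactor δ f w := fun w =>
    mul_nonneg (Finset.prod_nonneg fun e _ => norm_nonneg _) (norm_nonneg _)
  have hD0 : ∀ l (τ : ℝ × (ℝ × ℝ)), 0 ≤ ‖G.spinLineWeight P i σ ς l τ‖ * G.detWeight P l τ.1 :=
    fun l τ => mul_nonneg (norm_nonneg _) (G.detWeight_nonneg P hθ l _)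
  have hlim' := integrable_and_integral_assoc_mul hR
    (Integrable.fintype_prod fun l => (hline l).2.1)
  have hle : ∀ z : (G.Ext' → Plane) × G.MixVars, ‖G.mixWeight P δ i f σ ς z‖
        * |(diagonal (G.mixWidth P z.2) + G.phaseMatrix P).det|⁻¹
      ≤ G.rootFactor δ f (z.1, z.2.1)
        * ∏ l, (‖G.spinLineWeight P i σ ς l (z.2.2 l)‖ * G.detWeight P l (z.2.2 l).1) := by
    intro z
    rw [norm_mixWeight, mul_assoc, Finset.prod_mul_distrib]
    exact mul_le_mul_of_nonneg_left (mul_le_mul_of_nonneg_left (hdet z.2).2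
      (Finset.prod_nonneg fun l _ => norm_nonneg _)) (hR0 _)
  have hmd : Measurable fun z : (G.Ext' → Plane) × G.MixVars =>
      |(diagonal (G.mixWidth P z.2) + G.phaseMatrix P).det|⁻¹ := by
    have hc : Continuous fun d : G.Idx → ℝ => (diagonal d + G.phaseMatrix P).det :=
      (continuous_id.matrix_diagonal.add continuous_const).matrix_det
    have h := hc.measurable.comp ((G.measurable_mixWidth P).comp
      (measurable_snd : Measurable (Prod.snd : (G.Ext' → Plane) × G.MixVars → _)))
    exact (measurable_norm.comp h).inv
  have hlim : Integrable fun z : (G.Ext' → Plane) × G.MixVars => ‖G.mixWeight P δ i f σ ς z‖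
      * |(diagonal (G.mixWidth P z.2) + G.phaseMatrix P).det|⁻¹ := by
    refine hlim'.1.mono' (hW.norm.mul hmd).aestronglyMeasurable (.of_forall fun z => ?_)
    rw [Real.norm_of_nonneg (by positivity)]
    exact hle z
  -- With the cut-off the long variables and momenta have width 2r. The short variables of all
  -- lines, loops included, then cost $\beta^{-1}$, and only finiteness matters.
  have hint : ∀ r > 0, Integrable fun z : (G.Ext' → Plane) × G.MixVars =>
      ‖G.mixWeight P δ i f σ ς z‖ * ∏ j, (G.mixWidth P z.2 j + r * G.cutWidth j)⁻¹ := by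
    intro r hr
    have h := (integrable_and_integral_assoc_mul hR ((Integrable.fintype_prod
      fun l => (hline l).1).const_mul
        (∏ _j : G.Line ⊕ {l // l ∈ G.tree}, (r * 2)⁻¹))).1
    refine h.congr (.of_forall fun z => ?_)
    dsimp only
    rw [norm_mixWeight, Fintype.prod_sum_type (fun j => (G.mixWidth P z.2 j + r * G.cutWidth j)⁻¹)]
    simp only [mixWidth, cutWidth, Sum.elim_inl, Sum.elim_inr, Pi.zero_apply, mul_zero, add_zero,
      zero_add]
    rw [Finset.prod_mul_distrib]
    ring
  have hfin : SFinite (volume : Measure (Plane × (G.Line → ℝ × (ℝ × ℝ)))) :=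
    Measure.prod.instSFinite
  have hpos : ∀ τ j, ∀ r > 0, 0 < G.mixWidth P τ j + r * G.cutWidth j := by
    rintro τ (l | j) r hr
    · simpa [mixWidth, cutWidth] using hβ τ l
    · simpa [mixWidth, cutWidth] using hr
  have hpos' : ∀ τ j, 0 ≤ G.mixWidth P τ j := by
    rintro τ (l | j)
    · exact (hβ τ l).le
    · exact le_rfl
  have hcut : ∀ j, 0 ≤ G.cutWidth j := by
    rintro (l | j) <;> simp [cutWidth]
  obtain ⟨h1, A, h2, h3⟩ := exists_oscillating_limit (X := G.Ext' → Plane)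
    (T := Plane × (G.Line → ℝ × (ℝ × ℝ))) (D := G.Idx) hW (G.measurable_mixWidth P)
    (e := G.cutWidth) (S := G.phaseMatrix P) hpos hpos' hcut (G.phaseMatrix_transpose P)
    (fun τ => (hdet τ).1) (G.measurable_mixShift₀ P) (G.measurable_mixShift₁ P) hint hlim
  refine ⟨h1, A, h2, h3.trans (mul_le_mul_of_nonneg_left ?_ (by positivity))⟩
  refine (integral_mono hlim hlim'.1 hle).trans ?_
  rw [hlim'.2, integral_fintype_prod_volume_eq_prod
    (fun l (τ : ℝ × (ℝ × ℝ)) => ‖G.spinLineWeight P i σ ς l τ‖ * G.detWeight P l τ.1)]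
  exact mul_le_mul hR' (Finset.prod_le_prod (fun l _ => integral_nonneg (hD0 l))
    fun l _ => (hline l).2.2) (Finset.prod_nonneg fun l _ => integral_nonneg (hD0 l))
    ((integral_nonneg hR0).trans hR')

end RootedGraph

theorem exists_schwartz_bump : ∃ Ξ : 𝓢(Plane, ℝ), (∀ x, 0 ≤ Ξ x) ∧ 0 < ∫ x, Ξ x := by
  let b : ContDiffBump (0 : Plane) := ⟨1, 2, one_pos, one_lt_two⟩
  exact ⟨b.hasCompactSupport.toSchwartzMap b.contDiff, fun x => b.nonneg, b.integral_pos⟩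

namespace RootedGraph

variable {n : ℕ} (G : RootedGraph n) (P : Model)

/-! ### The bound on the amplitude -/

/-- Summation over at most $2^{4n}$ spin assignments and four exponentials. -/
theorem exists_amplitude_limit {i : G.Line → ℕ} {f : G.External → 𝓢(Plane, ℂ)}
    {s : G.External → Fin 2} (hθ : P.θ ≠ 0) (hM : 1 < P.M) (hγ : P.Clifford)
    (hm : P.m ≠ 0 ∨ P.Ω ≠ 0) {B : ℝ}
    (h : ∀ (σ : Pos n → Fin 2) (ς : ℝ × ℝ), |ς.1| ≤ P.rate → |ς.2| ≤ P.rate →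
      (∀ r > 0, Integrable (G.mixture P P.rate i f σ ς r)) ∧
      ∃ A : ℂ, Tendsto (fun r => ∫ z, G.mixture P P.rate i f σ ς r z) (𝓝[>] 0) (𝓝 A) ∧ ‖A‖ ≤ B) :
    (∀ r > 0, Integrable (G.regIntegrand P i f s r)) ∧
      ∃ A : ℂ, G.IsAmplitude P i f s A ∧ ‖A‖ ≤ 2 ^ (4 * n) * (4 * B) := by
  have hδ := P.rate_pos
  have h1 : ∀ b : Bool, |(if b = true then 1 else -1) * P.rate| ≤ P.rate := fun b => by
    cases b <;> simp [abs_of_pos hδ]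
  set F : (Pos n → Fin 2) → Bool × Bool → ℝ → (G.Ext' → Plane) × ((G.Idx → ℝ) × (G.Idx → ℝ)) → ℂ :=
    fun σ b r z => G.mixture P P.rate i f σ ((if b.1 = true then 1 else -1) * P.rate,
      (if b.2 = true then 1 else -1) * P.rate) r z with hF
  have hB : ∀ σ b, (∀ r > 0, Integrable (F σ b r)) ∧
      ∃ A : ℂ, Tendsto (fun r => ∫ z, F σ b r z) (𝓝[>] 0) (𝓝 A) ∧ ‖A‖ ≤ B :=
    fun σ b => h σ _ (h1 _) (h1 _)
  choose hint A hA hAB using hB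
  have hreg : ∀ r z, G.regIntegrand P i f s r (G.varsEquiv z) = ∑ σ ∈ G.spins s, ∑ b, F σ b r z :=
    fun r z => G.regIntegrand_varsEquiv P hθ hM hγ hm i f s r z
  have hmp := G.measurePreserving_varsEquiv
  refine ⟨fun r hr => ?_, ∑ σ ∈ G.spins s, ∑ b, A σ b, ?_, ?_⟩
  · rw [← hmp.integrable_comp_emb G.varsEquiv.measurableEmbedding]
    refine (integrable_finsetSum (G.spins s) fun σ _ => integrable_finsetSum Finset.univ
      fun b _ => hint σ b r hr).congr (.of_forall fun z => (hreg r z).symm)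
  · refine (tendsto_finsetSum (G.spins s) fun σ _ => tendsto_finsetSum Finset.univ
      fun b _ => hA σ b).congr' ?_
    filter_upwards [self_mem_nhdsWithin] with r hr
    rw [← hmp.integral_comp G.varsEquiv.measurableEmbedding]
    simp only [hreg]
    rw [integral_finsetSum _ fun σ _ => integrable_finsetSum _ fun b _ => hint σ b r hr]
    exact Finset.sum_congr rfl fun σ _ => (integral_finsetSum _ fun b _ => hint σ b r hr).symm
  · have hB0 : 0 ≤ B := (norm_nonneg _).trans (hAB (fun _ => 0) (true, true))
    have hcard : (G.spins s).card ≤ 2 ^ (4 * n) := by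
      refine (Finset.card_le_univ _).trans (le_of_eq ?_)
      rw [Fintype.card_fun, Fintype.card_fin, Fintype.card_prod, Fintype.card_fin, Fintype.card_fin,
        mul_comm]
    calc _ ≤ ∑ _σ ∈ G.spins s, 4 * B := by
          refine (norm_sum_le _ _).trans (Finset.sum_le_sum fun σ _ => ?_)
          refine (norm_sum_le_of_le _ fun b _ => hAB σ b).trans (le_of_eq ?_)
          rw [Finset.sum_const, Finset.card_univ, Fintype.card_prod, Fintype.card_bool, nsmul_eq_mul]
          norm_num
      _ ≤ _ := by
          rw [Finset.sum_const, nsmul_eq_mul]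
          refine mul_le_mul_of_nonneg_right ?_ (by positivity)
          exact_mod_cast hcard

/-- The power counting of both sides agrees line by line. On the right a tree line gives
$M^{-i}M^{2i}M^{-2i}$ and a loop line $M^{-i}M^{2i}$; on the left the bounds are $M^{-i}$ and $M^i$.
-/
theorem prod_lineBound_le (hM : 1 < P.M) {C Q a b : ℝ} (hC : 0 ≤ C) (ha : 0 < a) (hb : 0 < b)
    (hQ : 4 * C + P.θ ^ 2 / (1 - P.Ω) ^ 2 * C ≤ Q * (a * b * Real.pi ^ 2)) (i : G.Line → ℕ) :
    ∏ l, G.lineBound P C i l ≤ Q ^ Fintype.card G.Line * (a ^ Fintype.card G.Line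
      * ((∏ l, ((P.M ^ i l)⁻¹ * b)) * ((∏ l, (P.M ^ i l * Real.pi) ^ 2) *
        ∏ l : {l // l ∈ G.tree}, ((P.M ^ i l.1)⁻¹ * Real.pi) ^ 2))) := by
  have h0 : 0 < P.M := by linarith
  have hp := Real.pi_pos
  set D := P.θ ^ 2 / (1 - P.Ω) ^ 2 with hD
  have hD0 : 0 ≤ D := by positivity
  have e1 : ∏ l : {l // l ∈ G.tree}, ((P.M ^ i l.1)⁻¹ * Real.pi) ^ 2
      = ∏ l, if l ∈ G.tree then ((P.M ^ i l)⁻¹ * Real.pi) ^ 2 else 1 := by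
    rw [Finset.prod_ite, Finset.prod_const_one, mul_one, Finset.filter_mem_eq_inter,
      Finset.univ_inter]
    exact (Finset.prod_subtype G.tree (fun _ => Iff.rfl)
      fun l => ((P.M ^ i l)⁻¹ * Real.pi) ^ 2).symm
  have e2 : ∀ c : ℝ, c ^ Fintype.card G.Line = ∏ _l : G.Line, c := fun c => by
    rw [Finset.prod_const, Finset.card_univ]
  rw [e1, e2, e2, ← Finset.prod_mul_distrib, ← Finset.prod_mul_distrib, ← Finset.prod_mul_distrib,
    ← Finset.prod_mul_distrib]
  refine Finset.prod_le_prod (fun l _ => G.lineBound_nonneg P hM hC i l) fun l _ => ?_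
  have hX : 0 < P.M ^ i l := by positivity
  rw [lineBound]
  split_ifs with hl
  · have e3 : Q * (a * ((P.M ^ i l)⁻¹ * b * ((P.M ^ i l * Real.pi) ^ 2
        * ((P.M ^ i l)⁻¹ * Real.pi) ^ 2)))
        = (Q * (a * b * Real.pi ^ 2)) * Real.pi ^ 2 * (P.M ^ i l)⁻¹ := by
      field_simp
    rw [e3, ← mul_assoc]
    refine mul_le_mul_of_nonneg_right ?_ (by positivity)
    have hDC := mul_nonneg hD0 hC
    have hpi : 1 ≤ Real.pi ^ 2 := by nlinarith [Real.pi_gt_three]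
    have hC4 : 4 * C ≤ Q * (a * b * Real.pi ^ 2) := by linarith
    have := mul_le_mul_of_nonneg_left hpi ((by positivity : (0 : ℝ) ≤ 4 * C).trans hC4)
    linarith
  · have e3 : Q * (a * ((P.M ^ i l)⁻¹ * b * ((P.M ^ i l * Real.pi) ^ 2 * 1)))
        = (Q * (a * b * Real.pi ^ 2)) * P.M ^ i l := by
      field_simp
    rw [e3, ← mul_assoc]
    exact mul_le_mul_of_nonneg_right (by linarith) hX.le

/-- Two variables for each of the at most 2n lines, and one momentum for each of the n − 1 tree
lines. -/
theorem card_idx_le : Fintype.card G.Idx ≤ 5 * n := by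
  have h1 := G.two_mul_card_line
  have h2 := G.tree_card
  simp only [Fintype.card_sum, Fintype.card_coe]
  omega

end RootedGraph

open RootedGraph in
theorem exists_amplitude_bound (P : Model) (hθ : P.θ ≠ 0) (hM : 1 < P.M) (hγ : P.Clifford)
    (hΩ : P.Ω ∈ Set.Ico (0 : ℝ) 1) (hm : P.m ≠ 0 ∨ P.Ω ≠ 0) (k : ℕ) :
    ∃ (K : ℝ) (Ξ : 𝓢(Plane, ℝ)) (g : 𝓢(Plane, ℂ) → 𝓢(Plane, ℝ)),
      (∀ x, 0 ≤ Ξ x) ∧ (∀ f x, 0 ≤ g f x) ∧ (∀ f, weightedNorm k 0 (g f) ≤ weightedNorm k 2 f) ∧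
      ∀ (n : ℕ) (G : RootedGraph n) (i : G.Line → ℕ) (f : G.External → 𝓢(Plane, ℂ))
        (s : G.External → Fin 2),
        (∀ r > 0, Integrable (G.regIntegrand P i f s r)) ∧
        Integrable (G.boundIntegrand P i Ξ fun e => g (f e)) ∧
        ∃ A : ℂ, G.IsAmplitude P i f s A ∧
          ‖A‖ ≤ K ^ n * G.boundIntegral P i Ξ fun e => g (f e) := by
  have hδ := P.rate_pos
  obtain ⟨Ξ, hΞ, hΞ'⟩ := exists_schwartz_bump
  obtain ⟨c₀, hc₀, henv⟩ := exists_schwartz_envelope (half_pos hδ) k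
  choose g hg hgk hgs hge using henv
  obtain ⟨C₁, hC₁, hwave⟩ := exists_integral_norm_fourier_cutTranslate_le hδ
  obtain ⟨C, hC, hline⟩ := exists_spinLineWeight_bound P hθ hM hγ hm
  set a := ∫ x, Ξ x with ha
  set b := ∫ u : Plane, Real.exp (-‖u‖ ^ 2 - P.rate / 2 * ‖u‖) with hb
  have hb0 : 0 < b := integral_exp_pos (integrable_exp_neg_norm_sq_sub (half_pos hδ).le)
  have hp := Real.pi_pos
  -- The ratio of the constants per line; the summand 1 makes $Q\ge1$, so that powers of Q can be
  -- bounded through the number of lines, at most 2n.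
  set Q := 1 + (4 * C + P.θ ^ 2 / (1 - P.Ω) ^ 2 * C) / (a * b * Real.pi ^ 2) with hQ
  have hQ1 : 1 ≤ Q := le_add_of_nonneg_right (by positivity)
  have hQ' : 4 * C + P.θ ^ 2 / (1 - P.Ω) ^ 2 * C ≤ Q * (a * b * Real.pi ^ 2) := by
    rw [hQ, add_mul, div_mul_cancel₀ _ (by positivity)]
    exact le_add_of_nonneg_left (by positivity)
  set c := 1 + c₀ with hc
  have hc1 : 1 ≤ c := le_add_of_nonneg_right hc₀.le
  -- Per vertex: $2^4$ spins, 4 exponentials, up to five Gaussian variables, the root constant, at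
  -- most four external positions, and at most two lines.
  refine ⟨2 ^ 4 * (4 * ((2 * Real.pi) ^ 5 * ((1 + C₁) * c ^ 4 * Q ^ 2))), Ξ, g, hΞ, hg, hgk,
    fun n G i f s => ?_⟩
  have hlow := G.le_boundIntegral P hM hΩ (half_pos hδ).le i hΞ (g := fun e => g (f e))
    (fun e x => hg _ _) (hgs _)
  set J := ∫ x : G.Ext' → Plane, g (f G.root) (G.rootPos x) * ∏ e : G.Ext', g (f e.1) (x e) with hJ
  have hJ0 : 0 ≤ J := integral_nonneg fun x =>
    mul_nonneg (hg _ _) (Finset.prod_nonneg fun e _ => hg _ _)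
  have hcg : ∀ h x, c₀ * g h x ≤ c * g h x := fun h x =>
    mul_le_mul_of_nonneg_right (by linarith) (hg h x)
  have hroot := G.integrable_and_integral_rootFactor_le hδ (f := f) (g := fun e => g (f e))
    (c := c) (C := C₁) (by linarith) hC₁ (fun e x => hg _ _)
    (fun e x => (norm_le_jet _ x).trans ((jet_le_envelope _ (half_pos hδ).le x).trans
      ((hge (f e) x).trans (hcg _ _))))
    (fun x => (hge _ x).trans (hcg _ _)) (hwave _)
  obtain ⟨hint, A, hA, hAB⟩ := G.exists_amplitude_limit P (i := i) (f := f) (s := s) hθ hM hγ hm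
    fun σ ς h1 h2 => G.exists_mixture_limit P hθ hΩ hδ hroot.1 hroot.2 (hline G i σ ς h1 h2)
  refine ⟨hint, hlow.1, A, hA, hAB.trans ?_⟩
  -- The root gives at least one vertex, so constants that occur once are absorbed in a power n.
  have hn : n ≠ 0 := by
    rintro rfl
    exact G.root.1.1.elim0
  have hprod := G.prod_lineBound_le P hM hC hΞ' hb0 hQ' i
  set Y := (∏ l, ((P.M ^ i l)⁻¹ * b)) * ((∏ l, (P.M ^ i l * Real.pi) ^ 2) *
        ∏ l : {l // l ∈ G.tree}, ((P.M ^ i l.1)⁻¹ * Real.pi) ^ 2) with hY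
  have hI := hlow.2
  set L := Fintype.card G.Line with hL
  have hcard := G.two_mul_card_line
  have hLB : 0 ≤ ∏ l, G.lineBound P C i l :=
    Finset.prod_nonneg fun l _ => G.lineBound_nonneg P hM hC i l
  have hM0 : 0 < P.M := by linarith
  have hY0 : 0 ≤ Y := by positivity
  have p1 : (2 * Real.pi) ^ Fintype.card G.Idx ≤ ((2 * Real.pi) ^ 5) ^ n := by
    rw [← pow_mul]
    exact pow_le_pow_right₀ (by linarith [Real.pi_gt_three]) G.card_idx_le
  have p2 : c ^ Fintype.card G.External ≤ (c ^ 4) ^ n := by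
    rw [← pow_mul]
    exact pow_le_pow_right₀ hc1 (by omega)
  have p3 : Q ^ L ≤ (Q ^ 2) ^ n := by
    rw [← pow_mul]
    exact pow_le_pow_right₀ hQ1 (by omega)
  have p4 : C₁ ≤ (1 + C₁) ^ n := by
    refine (by linarith : C₁ ≤ 1 + C₁).trans (le_self_pow₀ (by linarith) hn)
  have p5 : (4 : ℝ) ≤ 4 ^ n := le_self_pow₀ (by norm_num) hn
  have hc0 : 0 ≤ c := by linarith
  have hQ0 : 0 ≤ Q := by linarith
  calc _ ≤ 2 ^ (4 * n) * (4 ^ n * (((2 * Real.pi) ^ 5) ^ n * ((1 + C₁) ^ n * (c ^ 4) ^ n * J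
          * ((Q ^ 2) ^ n * (a ^ L * Y))))) := by
        gcongr
        exact hprod.trans (mul_le_mul_of_nonneg_right p3 (by positivity))
    _ = (2 ^ 4 * (4 * ((2 * Real.pi) ^ 5 * ((1 + C₁) * c ^ 4 * Q ^ 2)))) ^ n
          * (a ^ L * (J * Y)) := by
        simp only [mul_pow, pow_mul]
        ring
    _ ≤ _ := mul_le_mul_of_nonneg_left hI (by positivity)

end MoyalGN

end

theorem mainTheorem3 (P : MoyalGN.Model) (hθ : P.θ ≠ 0) (hM : 1 < P.M) (hγ : P.Clifford)
    (hΩ : P.Ω ∈ Set.Ico (0 : ℝ) 1) (hm : P.m ≠ 0 ∨ P.Ω ≠ 0) (k : ℕ) (hk : 3 ≤ k) :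
    ∃ (K : ℝ) (Ξ : 𝓢(MoyalGN.Plane, ℝ)) (g : 𝓢(MoyalGN.Plane, ℂ) → 𝓢(MoyalGN.Plane, ℝ)),
      (∀ x, 0 ≤ Ξ x) ∧ (∀ f x, 0 ≤ g f x) ∧
      (∀ f, MoyalGN.weightedNorm k 0 (g f) ≤ MoyalGN.weightedNorm k 2 f) ∧
      ∀ (n : ℕ) (G : MoyalGN.RootedGraph n),
        -- the change of long variables: its matrix, triangularity and determinant
        (∀ v p l, G.veps l • (G.newLong P v p l - G.newLong P 0 p l)
            = ∑ l', G.changeMatrix P l l' • G.veps l' • v l') ∧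
        (∀ l l', G.fst l < G.fst l' → G.changeMatrix P l l' = 0) ∧
        (Function.Injective G.fst) ∧
        2 * Fintype.card G.Line + Fintype.card G.External = 4 * n ∧
        (G.changeMatrix P).det
            = (1 / 2 : ℝ) ^ Fintype.card G.Line * ∏ l, (1 + G.eps l * P.Ω) ∧
        (G.changeMatrix P).det ≠ 0 ∧
        (∀ p, Function.Bijective fun v => G.newLong P v p) ∧
        -- the bound on the amplitude
        ∀ (i : G.Line → ℕ) (f : G.External → 𝓢(MoyalGN.Plane, ℂ)) (s : G.External → Fin 2),
          (∀ r > 0, Integrable (G.regIntegrand P i f s r)) ∧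
          Integrable (G.boundIntegrand P i Ξ fun e => g (f e)) ∧
          ∃ A : ℂ, G.IsAmplitude P i f s A ∧
            ‖A‖ ≤ K ^ n * G.boundIntegral P i Ξ fun e => g (f e) := by
  obtain ⟨K, Ξ, g, hΞ, hg, hgk, h⟩ := MoyalGN.exists_amplitude_bound P hθ hM hγ hΩ hm k
  exact ⟨K, Ξ, g, hΞ, hg, hgk, fun n G => ⟨fun v p l => G.newLong_sub P v p l,
    fun l l' hl => G.changeMatrix_eq_zero P hl, G.fst_injective, G.two_mul_card_line,
    G.det_changeMatrix P, G.det_changeMatrix_ne_zero P hΩ, G.newLong_bijective P hΩ,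
    fun i f s => h n G i f s⟩⟩
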